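/- Fix integers $a\ge 2$ and $b\ge 2a$. An $(a,b)$-tree is a nonempty search tree with its values in the leaves, all leaves at the same depth, inner nodes of degree at most $b$, non-root inner nodes of degree at least $a$, and a root that is an inner node of degree at least $\min(2,|T|)$. Its rank $r(T)$ is the number of nodes on a path from the root to a leaf. Logarithms are to base two and are by definition at least one. The \emph{lightweight parallel join} of $(a,b)$-trees $T_1,\dots,T_k$ ($k\ge 1$), where all values in $T_t$ are at most all values in $T_{t+1}$, works in iterations until one tree is left. Let $T^i_1,\dots,T^i_{k_i}$ be the sequence before iteration $i$; each tree $T^i_t$ gets an independent fair random bit $c^i_t$; put $r_t=r(T^i_t)$ and $r_0=r_{k_i+1}=\infty$. Simultaneously, every $T^i_t$ is joined to $T^i_{t-1}$ (to $T^i_2$ if $t=1$) for which one of the following rules holds: \begin{enumerate} \item $r_{t-1}>r_t$ and $r_t<r_{t+1}$; \item $r_{t-1}>r_t$, $r_t=r_{t+1}$ and $c^i_t=1$; \item $r_{t-1}=r_t$, $r_t<r_{t+1}$, $c^i_{t-1}=0$ and $c^i_t=1$; \item $r_{t-1}=r_t$, $r_t=r_{t+1}$, $c^i_{t-1}=0$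 and $c^i_t=1$. \end{enumerate} (If two trees are joined to $T^i_2$ in the same iteration, $T^i_1$ comes second.) To join $V$ to a left neighbour $U$ with $r(U)\ge r(V)$, let $n$ be the node of rank $r(V)$ on the right spine of $U$. If $n$ and the root of $V$ both have degree at least $a$, they stay two nodes; otherwise they are fused, and if the fused node has degree $d>b$ it is split into a node with the first $\lfloor d/2\rfloor$ children and a node with the rest. If $r(U)>r(V)$, the resulting one or two nodes replace $n$ as children of its parent $p(n)$, and $V$ disappears, except when there are two nodes and $p(n)$ has degree $b$: then $n$ is removed from $p(n)$, and $V$ is replaced by the tree of rank $r(V)+1$ whose root has these two nodes as its children (subtree stealing). If $r(U)=r(V)$, the resulting node, or a new root above the two resulting nodes, is the new $U$, and $V$ disappears. Joining $T^i_1$ to $T^i_2$ is the mirror image, on the left spine of $T^i_2$ (a split node still has the first $\lfloor d/2\rfloor$ children on the left). \textbf{Theorem.} There are a constant $C$ and a randomized CREW PRAM program, depending only on $a$ and $b$, such that for all $k\ge 1$ and all such $T_1,\dots,T_k$, with $m=\sum_t|T_t|$: \begin{enumerate} \item[(i)] the expected number of iterations of the lightweight parallel join is at most $C(\log m+\log k)$;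 almost surely a single tree is left after finitely many iterations, and this tree is always an $(a,b)$-tree that stores the values of $T_1,\dots,T_k$ in order; \item[(ii)] started on $k$ processors with the nodes of $T_1,\dots,T_k$ stored in its shared memory as records with child pointers and splitter keys, the program carries out this join: if $c^i_t$ is the $i$-th random bit drawn by the processor in charge of $T^i_t$, it halts with the resulting search tree in memory whenever the join terminates; its expected running time is at most $C(\log m+\log k)$, and its expected work is at most $C\,k\log\frac mk$. \end{enumerate} The PRAM is synchronous, with registers, addition, truncated subtraction, tests for zero, loads and stores in a shared memory addressed by pairs (record, field), and random bits as unit-cost instructions; concurrent reads are allowed, concurrent writes to the same cell are not. Work is the number of instructions executed by non-idle processors, and the barrier at the end of a loop costs $\lceil\log_2 k\rceil$ units of time. -/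

import Mathlib

open MeasureTheory
open scoped ENNReal

namespace LightJoin

/-! ### Search trees whose values are stored in the leaves -/

/-- A rooted ordered tree whose leaves carry keys. -/
inductive LTree where
  | leaf (key : ℕ) : LTree
  | node (children : List LTree) : LTree

namespace LTree

/-- The children of the root, from left to right. -/
def children : LTree → List LTree
  | leaf _ => []
  | node cs => cs

mutual
  /-- The values stored in the tree, from left to right. -/
  def leaves : LTree → List ℕ
    | leaf x => [x]
    | node cs => leavesList cs
  /-- The values stored in a sequence of trees, from left to right. -/
  def leavesList : List LTree → List ℕ
    | [] => []
    | t :: ts => leaves t ++ leavesList ts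
end

/-- The size `|T|`: the number of stored values. -/
def size (t : LTree) : ℕ := t.leaves.length

mutual
  /-- The number of nodes on the path from the root to the left-most leaf.  In an `(a,b)`-tree all
  leaves have the same depth, so this is the number of nodes on the path to any leaf. -/
  def rank : LTree → ℕ
    | leaf _ => 1
    | node cs => 1 + rankHead cs
  /-- The rank of the first tree of a sequence. -/
  def rankHead : List LTree → ℕ
    | [] => 0
    | t :: _ => rank t
end

end LTree

open LTree

/-- `IsSubtree a b r t`: all leaves of `t` have the same depth, namely `r` nodes are on the path from
the root of `t` to any leaf, and all inner nodes of `t`, its root included, have degree between `a`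
and `b`. -/
inductive IsSubtree (a b : ℕ) : ℕ → LTree → Prop
  | leaf (x : ℕ) : IsSubtree a b 1 (LTree.leaf x)
  | node (r : ℕ) (cs : List LTree) (hlo : a ≤ cs.length) (hhi : cs.length ≤ b)
      (hcs : ∀ c ∈ cs, IsSubtree a b r c) : IsSubtree a b (r + 1) (LTree.node cs)

/-- Nonempty `(a,b)`-trees: all leaves have the same depth, all inner nodes have degree at most `b`,
all inner nodes except the root have degree at least `a`, and the root is an inner node of degree at
least `min 2 |T|`. -/
def IsABTree (a b : ℕ) (t : LTree) : Prop :=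
  ∃ (r : ℕ) (cs : List LTree), t = LTree.node cs ∧ 0 < t.size ∧ min 2 t.size ≤ cs.length ∧
    cs.length ≤ b ∧ ∀ c ∈ cs, IsSubtree a b r c

/-! ### The basic join step with subtree stealing -/

/-- Put together two nodes `x`, `y` of equal rank, `x` on the left.  If both have degree at least `a`,
they stay two nodes.  Otherwise they are fused; if the fused node has degree `d > b`, it is split
into a node with the first `⌊d/2⌋` children and a node with the remaining ones. -/
def combine (a b : ℕ) (x y : LTree) : List LTree :=
  if a ≤ x.children.length ∧ a ≤ y.children.length then [x, y]
  else
    let cs := x.children ++ y.children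
    if cs.length ≤ b then [node cs]
    else [node (cs.take (cs.length / 2)), node (cs.drop (cs.length / 2))]

/-- The tree made from the one or two nodes that `combine` returns. -/
def rootOf : List LTree → LTree
  | [t] => t
  | ts => node ts

/-- `attachRight a b d U V`: descend `d` nodes on the right spine of `U`, to the node `q` with
`rank q = rank V + 1`, and let `n` be the last child of `q`.  The node `n` and the root of `V` are
combined and replace `n` below `q`; then nothing remains of `V`.  If this would give `q` more than
`b` children, then `n` is instead removed from `q` (it is stolen), and the combination of `n` and `V`
becomes the tree that remains in place of `V`. -/
def attachRight (a b : ℕ) : ℕ → LTree → LTree → LTree × Option LTree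
  | 0, U, V =>
    match U.children.getLast? with
    | none => (U, some V)
    | some n =>
      let ps := combine a b n V
      let others := U.children.dropLast
      if others.length + ps.length ≤ b then (node (others ++ ps), none)
      else (node others, some (node ps))
  | d + 1, U, V =>
    match U.children.getLast? with
    | none => (U, some V)
    | some c =>
      ((node (U.children.dropLast ++ [(attachRight a b d c V).1])), (attachRight a b d c V).2)

/-- The mirror image of `attachRight`: `V` lies to the left of `U` and is attached to the left
spine of `U`. -/
def attachLeft (a b : ℕ) : ℕ → LTree → LTree → LTree × Option LTree
  | 0, U, V =>
    match U.children with
    | [] => (U, some V)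
    | n :: others =>
      let ps := combine a b V n
      if others.length + ps.length ≤ b then (node (ps ++ others), none)
      else (node others, some (node ps))
  | d + 1, U, V =>
    match U.children with
    | [] => (U, some V)
    | c :: others =>
      ((node ((attachLeft a b d c V).1 :: others)), (attachLeft a b d c V).2)

/-- Join `V` to its left neighbour `U`, where `rank V ≤ rank U`.  The result is the new left
neighbour, and what remains of `V` (nothing, unless `V` has stolen a subtree). -/
def joinToLeft (a b : ℕ) (U V : LTree) : LTree × Option LTree :=
  if U.rank = V.rank then (rootOf (combine a b U V), none)
  else attachRight a b (U.rank - V.rank - 1) U V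

/-- Join `V` to its right neighbour `U`, where `rank V ≤ rank U`. -/
def joinToRight (a b : ℕ) (V U : LTree) : LTree × Option LTree :=
  if U.rank = V.rank then (rootOf (combine a b V U), none)
  else attachLeft a b (U.rank - V.rank - 1) U V

/-! ### The lightweight parallel join -/

/-- A tree together with the number of the processor (PE) in charge of it. -/
abbrev Entry : Type := ℕ × LTree

/-- The rank of the first tree of a sequence; a missing tree has rank `∞`. -/
def headRank : List Entry → ℕ∞
  | [] => ⊤
  | e :: _ => (e.2.rank : ℕ∞)

/-- The four rules by which a tree of rank `r` with random bit `c` is joined in an iteration.  Its left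
neighbour has rank `rl` and random bit `cl`, its right neighbour has rank `rr`. -/
def Joins (rl : ℕ∞) (cl : Bool) (r : ℕ∞) (c : Bool) (rr : ℕ∞) : Prop :=
  (rl > r ∧ r < rr) ∨
  (rl > r ∧ r = rr ∧ c = true) ∨
  (rl = r ∧ r < rr ∧ cl = false ∧ c = true) ∨
  (rl = r ∧ r = rr ∧ cl = false ∧ c = true)

open Classical in
/-- One iteration, for all trees but the first one: every tree to which a rule applies is joined to
its left neighbour; `c p` is the random bit of PE `p`.  By the rules, neither of the two neighbours of
a joining tree joins to its left in the same iteration, so that these joins concern disjoint pairs of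
adjacent trees, and all rules refer to the ranks at the beginning of the iteration. -/
noncomputable def leftJoins (a b : ℕ) (c : ℕ → Bool) : List Entry → List Entry
  | u :: v :: rest =>
    if Joins u.2.rank (c u.1) v.2.rank (c v.1) (headRank rest) then
      (match joinToLeft a b u.2 v.2 with
        | (u', none) => [(u.1, u')]
        | (u', some v') => [(u.1, u'), (v.1, v')]) ++ leftJoins a b c rest
    else u :: leftJoins a b c (v :: rest)
  | l => l

/-- The first tree of the sequence is joined to the second one. -/
def firstJoin (a b : ℕ) : List Entry → List Entry
  | v :: u :: rest =>
    match joinToRight a b v.2 u.2 with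
    | (u', none) => (u.1, u') :: rest
    | (u', some v') => (v.1, v') :: (u.1, u') :: rest
  | l => l

open Classical in
/-- One iteration of the lightweight parallel join with random bits `c`.  The first tree, which has no
left neighbour (rank `∞`), is joined to the second one if a rule applies to it. -/
noncomputable def iteration (a b : ℕ) (c : ℕ → Bool) : List Entry → List Entry
  | u :: v :: rest =>
    if Joins ⊤ false u.2.rank (c u.1) v.2.rank then
      firstJoin a b (leftJoins a b c (u :: v :: rest))
    else leftJoins a b c (u :: v :: rest)
  | l => l

/-- The sequence of trees before iteration `i`; `ω i p` is the random bit that PE `p` generates in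
iteration `i`.  Initially PE `t` is in charge of tree `t`. -/
noncomputable def trees (a b : ℕ) {k : ℕ} (T : Fin k → LTree) (ω : ℕ → ℕ → Bool) : ℕ → List Entry
  | 0 => List.ofFn fun t => ((t : ℕ), T t)
  | i + 1 => iteration a b (ω i) (trees a b T ω i)

/-- The number of iterations until a single tree is left (`∞` if that never happens). -/
noncomputable def numIterations (a b : ℕ) {k : ℕ} (T : Fin k → LTree) (ω : ℕ → ℕ → Bool) : ℕ∞ :=
  ⨅ (i : ℕ) (_ : (trees a b T ω i).length ≤ 1), (i : ℕ∞)

/-- The law of independent fair bits `ω i p`, for `i p : ℕ`. -/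
noncomputable def coins : Measure (ℕ → ℕ → Bool) :=
  Measure.infinitePi fun _ : ℕ =>
    Measure.infinitePi fun _ : ℕ => (PMF.uniformOfFintype Bool).toMeasure

/-! ### A randomized CREW PRAM -/

/-- Arithmetic expressions over the registers of a processor, its number and the number of processors.
There is no multiplication, and subtraction is truncated at `0`. -/
inductive Expr where
  | const (n : ℕ) : Expr
  | reg (x : ℕ) : Expr
  | pid : Expr
  | nprocs : Expr
  | add (e f : Expr) : Expr
  | sub (e f : Expr) : Expr

/-- Programs.  All processors run the same program in lockstep, each on its own registers; `load` and
`store` access the cell `mem[e, f]` of the shared memory, `coin` draws a random bit.  Of the processors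
that reach `ite`, those with a nonzero condition do the first branch while the others are idle, and
then the others do the second branch.  Of those that reach `loop`, each repeats the body as long as its
condition is nonzero and is then idle until all have left the loop. -/
inductive Cmd where
  | skip : Cmd
  | assign (x : ℕ) (e : Expr) : Cmd
  | load (x : ℕ) (e f : Expr) : Cmd
  | store (e f g : Expr) : Cmd
  | coin (x : ℕ) : Cmd
  | seq (c d : Cmd) : Cmd
  | ite (e : Expr) (c d : Cmd) : Cmd
  | loop (e : Expr) (c : Cmd) : Cmd

/-- A state of the machine with `k` processors.  The shared memory consists of records with
numbered fields: `mem v f` is the word in field `f` of record `v`. -/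
@[ext] structure State (k : ℕ) where
  mem : ℕ → ℕ → ℕ
  regs : Fin k → ℕ → ℕ
  draws : Fin k → ℕ

/-- The value of an expression for processor `p`. -/
def Expr.eval {k : ℕ} (σ : State k) (p : Fin k) : Expr → ℕ
  | .const n => n
  | .reg x => σ.regs p x
  | .pid => p
  | .nprocs => k
  | .add e f => e.eval σ p + f.eval σ p
  | .sub e f => e.eval σ p - f.eval σ p

/-- All processors in `A` simultaneously set their register `x`. -/
def State.setReg {k : ℕ} (σ : State k) (A : Finset (Fin k)) (x : ℕ) (v : Fin k → ℕ) : State k :=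
  { σ with regs := fun p y => if p ∈ A ∧ y = x then v p else σ.regs p y }

/-- The cell into which processor `p` writes with the addresses `e`, `f`. -/
def State.cell {k : ℕ} (σ : State k) (e f : Expr) (p : Fin k) : ℕ × ℕ := (e.eval σ p, f.eval σ p)

open Classical in
/-- All processors in `A` simultaneously write into the shared memory. -/
noncomputable def State.write {k : ℕ} (σ : State k) (A : Finset (Fin k)) (e f g : Expr) : State k :=
  { σ with mem := fun v i =>
      if h : ∃ p ∈ A, σ.cell e f p = (v, i) then g.eval σ h.choose else σ.mem v i }

/-- `Exec ω c A σ σ' t w`: with the random bits `ω` (the `i`-th bit drawn by processor `p` is `ω i p`),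
the set `A` of active processors runs the program `c` from state `σ` to state `σ'` in time `t` and with
work `w`.  Every instruction and every evaluation of a condition takes one unit of time, and one unit of
work for every active processor.  Leaving a loop takes `⌈log₂ k⌉` further units of time, for the barrier
at which the processors wait for each other.  Cells may be read concurrently, whereas two processors
must not write into the same cell in the same step: there is no execution in which they do. -/
inductive Exec {k : ℕ} (ω : ℕ → ℕ → Bool) :
    Cmd → Finset (Fin k) → State k → State k → ℕ → ℕ → Prop
  | skip (A : Finset (Fin k)) (σ : State k) : Exec ω .skip A σ σ 1 A.card
  | assign (x : ℕ) (e : Expr) (A : Finset (Fin k)) (σ : State k) :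
      Exec ω (.assign x e) A σ (σ.setReg A x fun p => e.eval σ p) 1 A.card
  | load (x : ℕ) (e f : Expr) (A : Finset (Fin k)) (σ : State k) :
      Exec ω (.load x e f) A σ (σ.setReg A x fun p => σ.mem (e.eval σ p) (f.eval σ p)) 1 A.card
  | store (e f g : Expr) (A : Finset (Fin k)) (σ : State k)
      (exclusive : Set.InjOn (σ.cell e f) (A : Set (Fin k))) :
      Exec ω (.store e f g) A σ (σ.write A e f g) 1 A.card
  | coin (x : ℕ) (A : Finset (Fin k)) (σ : State k) :
      Exec ω (.coin x) A σ
        { σ.setReg A x (fun p => (ω (σ.draws p) p).toNat) with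
          draws := fun p => if p ∈ A then σ.draws p + 1 else σ.draws p } 1 A.card
  | seq (c d : Cmd) (A : Finset (Fin k)) (σ σ₁ σ₂ : State k) (t₁ t₂ w₁ w₂ : ℕ)
      (h₁ : Exec ω c A σ σ₁ t₁ w₁) (h₂ : Exec ω d A σ₁ σ₂ t₂ w₂) :
      Exec ω (.seq c d) A σ σ₂ (t₁ + t₂) (w₁ + w₂)
  | ite (e : Expr) (c d : Cmd) (A : Finset (Fin k)) (σ σ₁ σ₂ : State k) (t₁ t₂ w₁ w₂ : ℕ)
      (h₁ : Exec ω c (A.filter fun p => e.eval σ p ≠ 0) σ σ₁ t₁ w₁)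
      (h₂ : Exec ω d (A.filter fun p => e.eval σ p = 0) σ₁ σ₂ t₂ w₂) :
      Exec ω (.ite e c d) A σ σ₂ (1 + t₁ + t₂) (A.card + w₁ + w₂)
  | loopExit (e : Expr) (c : Cmd) (A : Finset (Fin k)) (σ : State k)
      (h : ∀ p ∈ A, e.eval σ p = 0) :
      Exec ω (.loop e c) A σ σ (1 + Nat.clog 2 k) A.card
  | loopStep (e : Expr) (c : Cmd) (A : Finset (Fin k)) (σ σ₁ σ₂ : State k) (t₁ t₂ w₁ w₂ : ℕ)
      (h : ∃ p ∈ A, e.eval σ p ≠ 0)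
      (h₁ : Exec ω c (A.filter fun p => e.eval σ p ≠ 0) σ σ₁ t₁ w₁)
      (h₂ : Exec ω (.loop e c) (A.filter fun p => e.eval σ p ≠ 0) σ₁ σ₂ t₂ w₂) :
      Exec ω (.loop e c) A σ σ₂ (1 + t₁ + t₂) (A.card + w₁ + w₂)

/-- The state with shared memory `μ` in which a computation on `k` processors starts. -/
def start (k : ℕ) (μ : ℕ → ℕ → ℕ) : State k := ⟨μ, fun _ _ => 0, fun _ => 0⟩

/-- The running time of a program on `k` processors (`∞` if it has no complete execution). -/
noncomputable def runTime (P : Cmd) (k : ℕ) (μ : ℕ → ℕ → ℕ) (ω : ℕ → ℕ → Bool) : ℕ∞ :=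
  ⨅ (t : ℕ) (_ : ∃ σ' w, Exec ω P Finset.univ (start k μ) σ' t w), (t : ℕ∞)

/-- The work of a program on `k` processors (`∞` if it has no complete execution). -/
noncomputable def runWork (P : Cmd) (k : ℕ) (μ : ℕ → ℕ → ℕ) (ω : ℕ → ℕ → Bool) : ℕ∞ :=
  ⨅ (w : ℕ) (_ : ∃ σ' t, Exec ω P Finset.univ (start k μ) σ' t w), (w : ℕ∞)

/-! ### Search trees in memory -/

/-- `Stored μ v t fp`: the memory `μ` holds the search tree `t` with root record `v`, one record for each
node, and `fp` lists these records.  Field `0` of a record is the degree of the node (`0` for a leaf).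
Field `1` of a leaf is its value.  In an inner node, field `2 * j + 1` points to the child number `j`, and
field `2 * j + 2` is a splitter key that separates the child number `j` from the next child. -/
inductive Stored (μ : ℕ → ℕ → ℕ) : ℕ → LTree → List ℕ → Prop
  | leaf (v : ℕ) (hdeg : μ v 0 = 0) : Stored μ v (LTree.leaf (μ v 1)) [v]
  | node (v : ℕ) (cs : List LTree) (fps : Fin cs.length → List ℕ)
      (hpos : 0 < cs.length) (hdeg : μ v 0 = cs.length)
      (hchild : ∀ j : Fin cs.length, Stored μ (μ v (2 * j + 1)) (cs.get j) (fps j))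
      (hkey : ∀ i j : Fin cs.length, (j : ℕ) = i + 1 →
        (∀ x ∈ (cs.get i).leaves, x ≤ μ v (2 * i + 2)) ∧
        (∀ y ∈ (cs.get j).leaves, μ v (2 * i + 2) ≤ y)) :
      Stored μ v (LTree.node cs) (v :: (List.ofFn fps).flatten)

/-- The input format: field `t + 1` of record `0` points to the root of tree number `t`, the nodes of the
trees are stored in different records, and these have positive numbers less than the number in
field `0` of record `0`.  The other cells may contain anything. -/
def IsInput {k : ℕ} (μ : ℕ → ℕ → ℕ) (T : Fin k → LTree) : Prop :=
  ∃ fps : Fin k → List ℕ, (∀ t : Fin k, Stored μ (μ 0 ((t : ℕ) + 1)) (T t) (fps t)) ∧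
    (List.ofFn fps).flatten.Nodup ∧ ∀ v ∈ (List.ofFn fps).flatten, 0 < v ∧ v < μ 0 0

/-- The output format: field `1` of record `0` points to the root of the tree, whose nodes are stored
in different records with positive numbers. -/
def IsOutput (μ : ℕ → ℕ → ℕ) (t : LTree) : Prop :=
  ∃ fp : List ℕ, Stored μ (μ 0 1) t fp ∧ fp.Nodup ∧ ∀ v ∈ fp, 0 < v

/-- The logarithm to base two, but at least one. -/
noncomputable def lg (x : ℝ) : ℝ := max 1 (Real.logb 2 x)

end LightJoin

open LightJoin

namespace LightJoin
-- The join step on (a,b)-trees: shape, rank and order of the values.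
open LTree Cmd

/-! ### Ranks, sizes and leaves of trees -/

-- Probability. Give a tree of rank r the weight 4^(-r), and let the potential of a sequence be its
-- total weight. When V is joined to U, the rank of U does not drop, and V disappears or, if it
-- steals a subtree, comes back with rank exactly one larger, hence with a quarter of its weight
-- (`joinToLeft_spec`, `joinToRight_spec`). So every join lowers the potential by at least three
-- quarters of the weight of the joining tree (`iteration_spec`). A tree with a neighbour of smaller
-- rank weighs at most a quarter of that neighbour, and every tree is charged in this way by at most
-- two others; therefore the trees without a smaller neighbour carry at least half of the potential
-- (`potential_le_lowWeight`). Such a tree joins at least whenever the bit of its left neighbour is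
-- 0 and its own bit is 1, an event of probability at least 1/4. In expectation an iteration on at
-- least two trees thus multiplies the potential by at most 1 - 3/4 * 1/4 * 1/2 = 29/32
-- (`integral_openPotential_iteration`).
--
-- The potential controls the number of trees through their sizes, since a tree of rank r stores at
-- least 2^r / 4 values: at most m / x trees store x values or more, and each of the others weighs
-- at least 1 / (16 x^2) (`openCount_le`). If x grows slowly with the iteration, the expected number
-- of trees before iteration i, counted only while there are two or more, is at most k * min(1, 17
-- (m/k)^2 (31/32)^i). The sum over i is O(k log(m/k)), which bounds the work of the iterations
-- (`lintegral_openWork_le`). The same expectation bounds the probability that the join is still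
-- unfinished, which gives O(log m) iterations (`lintegral_openTime_le`).
--
-- Machine. Each processor owns a block with two arrays of pointers, indexed by rank, to the nodes
-- on the left and the right spine of its tree; so the node that a join needs is found by a single
-- load. The arrays would have to be spliced at every join, were it not that an entry is required to
-- be correct only for ranks not below the rank of the neighbour on that side (`HeldAt`, `Chain`). A
-- joining tree has no neighbour of smaller rank, and the ranks of the neighbours of a tree never
-- decrease, so the entries that become wrong are never used again. A join therefore takes constant
-- time, with a separator of the two trees as the new splitter key.
--
-- The joins to the left in one iteration concern disjoint pairs of trees, hence disjoint sets of
-- records. Processors that write only to records which no other one reads can be verified one at a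
-- time (`exec_of_safe`, `exec_loop`), so each phase of an iteration reduces to a statement about a
-- single processor. A new node gets the record `base + p`, where `base` advances by k in each
-- iteration. Left links are recovered from right links, each tree having one predecessor only
-- (`runs_relinkP`). Active processors are those that still have a tree, so the work of the main
-- loop is proportional to the total number of trees (`exec_mainLoop`).
--
-- Filling the arrays costs every processor the rank of its tree: O(log m) time, and O(k log(m/k))
-- work in total because the logarithm is concave (`sum_rank_le`). The program has three loops in
-- sequence, none inside another, so the barriers cost 3 ⌈log₂ k⌉.

theorem leavesList_eq_flatMap (ts : List LTree) : leavesList ts = ts.flatMap leaves := by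
  induction ts with
  | nil => simp [leavesList]
  | cons t ts ih => simp [leavesList, ih]

theorem leavesList_append (ts us : List LTree) :
    leavesList (ts ++ us) = leavesList ts ++ leavesList us := by
  simp [leavesList_eq_flatMap]

/-- An inner node of degree between `lo` and `b` whose children are subtrees of rank `r`. -/
def Inner (a b lo r : ℕ) (t : LTree) : Prop :=
  ∃ cs, t = node cs ∧ lo ≤ cs.length ∧ cs.length ≤ b ∧ ∀ c ∈ cs, IsSubtree a b r c

variable {a b : ℕ}

theorem Inner.mono {lo lo' r : ℕ} {t : LTree} (h : Inner a b lo r t) (hl : lo' ≤ lo) :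
    Inner a b lo' r t := by
  obtain ⟨cs, h1, h2, h3, h4⟩ := h
  exact ⟨cs, h1, hl.trans h2, h3, h4⟩

theorem Inner.isSubtree {r : ℕ} {t : LTree} (h : Inner a b a r t) : IsSubtree a b (r + 1) t := by
  obtain ⟨cs, rfl, h2, h3, h4⟩ := h
  exact .node r cs h2 h3 h4

theorem IsSubtree.pos {r : ℕ} {t : LTree} (h : IsSubtree a b r t) : 0 < r := by
  cases h <;> omega

theorem IsSubtree.inner {r : ℕ} {t : LTree} (h : IsSubtree a b (r + 1) t) (hr : 0 < r) :
    Inner a b a r t := by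
  cases h with
  | leaf x => omega
  | node r cs h1 h2 h3 => exact ⟨cs, rfl, h1, h2, h3⟩

theorem IsSubtree.rank_eq (ha : 2 ≤ a) {r : ℕ} {t : LTree} (h : IsSubtree a b r t) :
    t.rank = r := by
  induction h with
  | leaf x => rfl
  | node r cs hlo hhi hcs ih =>
    cases cs with
    | nil => simp at hlo; omega
    | cons c cs => simp [rank, rankHead, ih c, add_comm]

theorem Inner.rank_eq (ha : 2 ≤ a) {lo r : ℕ} {t : LTree} (h : Inner a b lo r t) (hlo : 0 < lo) :
    t.rank = r + 1 := by
  obtain ⟨cs, rfl, h2, h3, h4⟩ := h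
  cases cs with
  | nil => simp at h2; omega
  | cons c cs => simp [rank, rankHead, (h4 c (by simp)).rank_eq ha, add_comm]

theorem size_node (cs : List LTree) : (node cs).size = (cs.map size).sum := by
  simp only [size, leaves, leavesList_eq_flatMap, List.length_flatMap]
  rfl

theorem mul_le_sum_of_le {l : List ℕ} {n : ℕ} (h : ∀ x ∈ l, n ≤ x) : l.length * n ≤ l.sum := by
  simpa using List.card_nsmul_le_sum l n h

theorem Inner.size_ge {lo r s : ℕ} {t : LTree} (h : Inner a b lo r t)
    (hs : ∀ c, IsSubtree a b r c → s ≤ c.size) : lo * s ≤ t.size := by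
  obtain ⟨cs, rfl, h2, h3, h4⟩ := h
  rw [size_node]
  refine le_trans (Nat.mul_le_mul_right _ h2) ?_
  have := mul_le_sum_of_le (l := cs.map size) (n := s) (by simpa using fun c hc => hs c (h4 c hc))
  simpa using this

/-- Every inner node has at least a ≥ 2 children, so the number of leaves at least doubles from one
rank to the next; the factor on the right replaces the exponent r - 1. -/
theorem IsSubtree.size_ge (ha : 2 ≤ a) {r : ℕ} {t : LTree} (h : IsSubtree a b r t) :
    2 ^ r ≤ 2 * t.size := by
  induction r generalizing t with
  | zero => exact absurd h.pos (by simp)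
  | succ r ih =>
    rcases Nat.eq_zero_or_pos r with rfl | hr
    · cases h with
      | leaf x => simp [size, leaves]
      | node _ cs h1 h2 h3 =>
        cases cs with
        | nil => simp at h1; omega
        | cons c cs => exact absurd (h3 c (by simp)).pos (by simp)
    · have h' := ((h.inner hr).mono ha).size_ge (s := 2 ^ (r - 1)) (fun c hc => by
        have := ih hc
        obtain ⟨r, rfl⟩ : ∃ s, r = s + 1 := ⟨r - 1, by omega⟩
        rw [pow_succ] at this
        simp only [add_tsub_cancel_right]; omega)
      obtain ⟨r, rfl⟩ : ∃ s, r = s + 1 := ⟨r - 1, by omega⟩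
      simp only [add_tsub_cancel_right] at h'
      rw [pow_succ, pow_succ]; omega

theorem IsSubtree.size_pos (ha : 2 ≤ a) {r : ℕ} {t : LTree} (h : IsSubtree a b r t) :
    0 < t.size := by
  have := h.size_ge ha
  have := Nat.one_le_two_pow (n := r)
  omega

theorem Inner.isABTree (ha : 2 ≤ a) {r : ℕ} {t : LTree} (h : Inner a b 2 r t) :
    IsABTree a b t := by
  have := h.size_ge (s := 1) (fun c hc => hc.size_pos ha)
  obtain ⟨cs, rfl, h2, h3, h4⟩ := h
  exact ⟨r, cs, rfl, by omega, (min_le_left _ _).trans h2, h3, h4⟩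

theorem IsABTree.inner {t : LTree} (h : IsABTree a b t) :
    ∃ r, 0 < r ∧ Inner a b 1 r t ∧ (Inner a b 2 r t ∨ t.size = 1) := by
  obtain ⟨r, cs, rfl, h1, h2, h3, h4⟩ := h
  have hne : 1 ≤ cs.length := by omega
  obtain ⟨c, hc⟩ := List.exists_mem_of_length_pos hne
  refine ⟨r, (h4 c hc).pos, ⟨cs, rfl, hne, h3, h4⟩, ?_⟩
  by_cases h : 2 ≤ cs.length
  · exact .inl ⟨cs, rfl, h, h3, h4⟩
  · right; omega

/-- From rank three on, the children of the root are inner nodes with at least two values each,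
which excludes the exceptional root above a single value. In a join of unequal ranks the larger tree
is always of this kind. -/
theorem IsABTree.inner_two (ha : 2 ≤ a) {t : LTree} (h : IsABTree a b t) {r : ℕ}
    (hr : t.rank = r + 1) (h2 : 1 < r) : Inner a b 2 r t := by
  obtain ⟨s, h0, h1, h3⟩ := h.inner
  have := h1.rank_eq ha (by simp)
  obtain rfl : s = r := by omega
  refine h3.resolve_right fun hs => ?_
  have := h1.size_ge (s := 2) (fun c hc => by
    have := hc.size_ge ha
    have h4 : 2 ^ 2 ≤ 2 ^ s := Nat.pow_le_pow_right (by simp) h2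
    omega)
  omega

theorem IsABTree.inner_one (ha : 2 ≤ a) {t : LTree} (h : IsABTree a b t) {r : ℕ}
    (hr : t.rank = r + 1) : 0 < r ∧ Inner a b 1 r t := by
  obtain ⟨s, h0, h1, h3⟩ := h.inner
  have := h1.rank_eq ha (by simp)
  obtain rfl : s = r := by omega
  exact ⟨h0, h1⟩

theorem IsABTree.two_le_rank (ha : 2 ≤ a) {t : LTree} (h : IsABTree a b t) : 2 ≤ t.rank := by
  obtain ⟨s, h0, h1, h3⟩ := h.inner
  have := h1.rank_eq ha (by simp)
  omega

theorem IsABTree.size_pos {t : LTree} (h : IsABTree a b t) : 0 < t.size := by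
  obtain ⟨r, cs, rfl, h1, -⟩ := h
  exact h1

/-- The root may have degree one, so the doubling starts only below it; this costs another factor of
two. -/
theorem IsABTree.two_pow_rank_le (ha : 2 ≤ a) {t : LTree} (h : IsABTree a b t) :
    2 ^ t.rank ≤ 4 * t.size := by
  obtain ⟨s, h0, h1, h3⟩ := h.inner
  rw [h1.rank_eq ha (by simp)]
  have := h1.size_ge (s := 2 ^ (s - 1)) (fun c hc => by
        have := hc.size_ge ha
        obtain ⟨r, rfl⟩ : ∃ r, s = r + 1 := ⟨s - 1, by omega⟩
        rw [pow_succ] at this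
        simp only [add_tsub_cancel_right]; omega)
  obtain ⟨r, rfl⟩ : ∃ r, s = r + 1 := ⟨s - 1, by omega⟩
  simp only [add_tsub_cancel_right] at this
  rw [pow_succ, pow_succ]; omega

/-! ### Joining two trees -/

theorem combine_node (a b : ℕ) (cx cy : List LTree) :
    combine a b (node cx) (node cy) = if a ≤ cx.length ∧ a ≤ cy.length then [node cx, node cy]
      else if (cx ++ cy).length ≤ b then [node (cx ++ cy)]
      else [node ((cx ++ cy).take ((cx ++ cy).length / 2)),
        node ((cx ++ cy).drop ((cx ++ cy).length / 2))] := rfl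

/-- If the nodes are fused, one of them has degree below a. When the degree d of the fused node
exceeds b ≥ 2a, both halves have at least a children, and at most b since d ≤ 2b. When it does not,
the fused node has at least two children, and at least a as soon as one of the two nodes had; below
a spine node this is always the case. -/
theorem combine_spec (ha : 2 ≤ a) (hab : 2 * a ≤ b) {r : ℕ} {x y : LTree}
    (hx : Inner a b 1 r x) (hy : Inner a b 1 r y) :
    (∃ z, combine a b x y = [z] ∧ z = node (x.children ++ y.children) ∧ Inner a b 2 r z ∧
      (a ≤ x.children.length ∨ a ≤ y.children.length → IsSubtree a b (r + 1) z)) ∨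
    (∃ z w, combine a b x y = [z, w] ∧ IsSubtree a b (r + 1) z ∧ IsSubtree a b (r + 1) w ∧
      z.leaves ++ w.leaves = x.leaves ++ y.leaves) := by
  obtain ⟨cx, rfl, hx1, hx2, hx3⟩ := hx
  obtain ⟨cy, rfl, hy1, hy2, hy3⟩ := hy
  have hall : ∀ c ∈ cx ++ cy, IsSubtree a b r c := by
    intro c hc
    rcases List.mem_append.1 hc with h | h
    exacts [hx3 c h, hy3 c h]
  rw [combine_node]
  simp only [children]
  by_cases h1 : a ≤ cx.length ∧ a ≤ cy.length
  · rw [if_pos h1]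
    exact .inr ⟨_, _, rfl, .node r _ h1.1 hx2 hx3, .node r _ h1.2 hy2 hy3, rfl⟩
  rw [if_neg h1]
  by_cases h2 : (cx ++ cy).length ≤ b
  · rw [if_pos h2]
    refine .inl ⟨_, rfl, rfl, ⟨_, rfl, ?_, h2, hall⟩, fun h => ?_⟩
    · simp; omega
    · refine .node r _ ?_ h2 hall
      simp; omega
  · rw [if_neg h2]
    simp only [List.length_append] at h2 ⊢
    refine .inr ⟨_, _, rfl, .node r _ ?_ ?_ ?_, .node r _ ?_ ?_ ?_, ?_⟩
    · simp; omega
    · simp; omega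
    · exact fun c hc => hall c (List.mem_of_mem_take hc)
    · simp; omega
    · simp; omega
    · exact fun c hc => hall c (List.mem_of_mem_drop hc)
    · simp only [leaves]
      rw [← leavesList_append, List.take_append_drop, leavesList_append]

theorem leaves_children {r lo : ℕ} {t : LTree} (h : Inner a b lo r t) :
    leavesList t.children = t.leaves := by
  obtain ⟨cs, rfl, -⟩ := h
  simp [children, leaves]

/-- The bound `lo` on the degree of the top node is 2 at the root and a below it, and it changes
along the induction. Stealing occurs only at degree b and leaves b - 1 children, whence the
assumption that `lo` is less than b. -/
theorem attachRight_spec (ha : 2 ≤ a) (hab : 2 * a ≤ b) {lo r d : ℕ} {U V : LTree} (hr : 0 < r)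
    (hlo : 1 ≤ lo) (hlb : lo < b)
    (hU : Inner a b lo (d + r + 1) U) (hV : Inner a b 1 r V) :
    Inner a b lo (d + r + 1) (attachRight a b d U V).1 ∧
      (((attachRight a b d U V).2 = none ∧
        (attachRight a b d U V).1.leaves = U.leaves ++ V.leaves) ∨
      ∃ V', (attachRight a b d U V).2 = some V' ∧ Inner a b 2 (r + 1) V' ∧
        (attachRight a b d U V).1.leaves ++ V'.leaves = U.leaves ++ V.leaves) := by
  induction d generalizing lo U with
  | zero =>
    obtain ⟨cs, rfl, h1, h2, h3⟩ := hU
    obtain ⟨cs, n, rfl⟩ : ∃ ds n, cs = ds ++ [n] := by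
      refine ⟨cs.dropLast, cs.getLast (by rintro rfl; simp at h1; omega), ?_⟩
      rw [List.dropLast_append_getLast]
    simp only [zero_add, List.length_append, List.length_singleton] at h1 h2 h3
    have hn : IsSubtree a b (r + 1) n := h3 n (by simp)
    have hnI := hn.inner hr
    have hna : a ≤ n.children.length := by
      obtain ⟨cn, rfl, h, -⟩ := hnI
      exact h
    simp only [attachRight, children, List.getLast?_append, List.getLast?_singleton,
      Option.some_or, List.dropLast_concat, zero_add]
    rcases combine_spec ha hab (hnI.mono (by omega)) hV with
      ⟨z, hz, hz1, -, hz3⟩ | ⟨z, w, hz, hz1, hw1, hl⟩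
    · have hz4 := hz3 (.inl hna)
      rw [hz, if_pos (by simpa using h2)]
      refine ⟨⟨_, rfl, by simpa using h1, by simpa using h2, ?_⟩, .inl ⟨rfl, ?_⟩⟩
      · simp only [List.mem_append, List.mem_singleton]
        rintro c (hc | rfl)
        exacts [h3 c (by simp [hc]), hz4]
      · rw [hz1]
        simp only [leaves, leavesList_append, leaves_children hnI, leaves_children hV, leavesList,
          List.append_nil, List.append_assoc]
    · rw [hz]
      split_ifs with hb
      · refine ⟨⟨_, rfl, ?_, by simpa using hb, ?_⟩, .inl ⟨rfl, ?_⟩⟩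
        · simp; omega
        · simp only [List.mem_append, List.mem_cons, List.not_mem_nil, or_false]
          rintro c (hc | rfl | rfl)
          exacts [h3 c (by simp [hc]), hz1, hw1]
        · simp only [leaves, leavesList_append, leavesList, List.append_nil, List.append_assoc, hl]
      · simp only [List.length_cons, List.length_nil] at hb
        refine ⟨⟨_, rfl, by omega, by omega, fun c hc => h3 c (by simp [hc])⟩,
          .inr ⟨_, rfl, ⟨_, rfl, by simp, by simp; omega, ?_⟩, ?_⟩⟩
        · simp only [List.mem_cons, List.not_mem_nil, or_false]
          rintro c (rfl | rfl)
          exacts [hz1, hw1]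
        · simp only [leaves, leavesList_append, leavesList, List.append_nil, List.append_assoc, hl]
  | succ d ih =>
    obtain ⟨cs, rfl, h1, h2, h3⟩ := hU
    obtain ⟨cs, n, rfl⟩ : ∃ ds n, cs = ds ++ [n] := by
      refine ⟨cs.dropLast, cs.getLast (by rintro rfl; simp at h1; omega), ?_⟩
      rw [List.dropLast_append_getLast]
    have hn : IsSubtree a b (d + r + 1 + 1) n := by
      have := h3 n (by simp); convert this using 1; omega
    obtain ⟨i1, i2⟩ := ih (lo := a) (by omega) (by omega) (hn.inner (by omega))
    simp only [attachRight, children, List.getLast?_append, List.getLast?_singleton,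
      Option.some_or, List.dropLast_concat]
    refine ⟨⟨_, rfl, by simpa using h1, by simpa using h2, ?_⟩, ?_⟩
    · simp only [List.mem_append, List.mem_singleton]
      rintro c (hc | rfl)
      · exact h3 c (by simp [hc])
      · have := i1.isSubtree
        convert this using 1; omega
    · rcases i2 with ⟨j1, j2⟩ | ⟨V', j1, j2, j3⟩
      · refine .inl ⟨j1, ?_⟩
        simp only [leaves, leavesList_append, leavesList, List.append_nil, List.append_assoc, j2]
      · refine .inr ⟨V', j1, j2, ?_⟩
        simp only [leaves, leavesList_append, leavesList, List.append_nil, List.append_assoc, j3]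

theorem attachLeft_spec (ha : 2 ≤ a) (hab : 2 * a ≤ b) {lo r d : ℕ} {U V : LTree} (hr : 0 < r)
    (hlo : 1 ≤ lo) (hlb : lo < b)
    (hU : Inner a b lo (d + r + 1) U) (hV : Inner a b 1 r V) :
    Inner a b lo (d + r + 1) (attachLeft a b d U V).1 ∧
      (((attachLeft a b d U V).2 = none ∧
        (attachLeft a b d U V).1.leaves = V.leaves ++ U.leaves) ∨
      ∃ V', (attachLeft a b d U V).2 = some V' ∧ Inner a b 2 (r + 1) V' ∧
        V'.leaves ++ (attachLeft a b d U V).1.leaves = V.leaves ++ U.leaves) := by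
  induction d generalizing lo U with
  | zero =>
    obtain ⟨cs, rfl, h1, h2, h3⟩ := hU
    obtain ⟨n, cs, rfl⟩ : ∃ n ds, cs = n :: ds := by
      cases cs with
      | nil => simp at h1; omega
      | cons n ds => exact ⟨_, _, rfl⟩
    simp only [zero_add, List.length_cons] at h1 h2 h3
    have hn : IsSubtree a b (r + 1) n := h3 n (by simp)
    have hnI := hn.inner hr
    have hna : a ≤ n.children.length := by
      obtain ⟨cn, rfl, h, -⟩ := hnI
      exact h
    simp only [attachLeft, children, zero_add]
    rcases combine_spec ha hab hV (hnI.mono (by omega)) with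
      ⟨z, hz, hz1, -, hz3⟩ | ⟨z, w, hz, hz1, hw1, hl⟩
    · have hz4 := hz3 (.inr hna)
      rw [hz, if_pos (by simpa using h2)]
      refine ⟨⟨_, rfl, by simpa using h1, by simpa using h2, ?_⟩, .inl ⟨rfl, ?_⟩⟩
      · simp only [List.singleton_append, List.mem_cons]
        rintro c (rfl | hc)
        exacts [hz4, h3 c (by simp [hc])]
      · rw [hz1]
        simp only [leaves, leavesList_append, leaves_children hnI, leaves_children hV, leavesList,
          List.append_assoc, List.cons_append, List.nil_append]
    · rw [hz]
      split_ifs with hb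
      · refine ⟨⟨_, rfl, ?_, by simp at hb ⊢; omega, ?_⟩, .inl ⟨rfl, ?_⟩⟩
        · simp; omega
        · simp only [List.cons_append, List.nil_append, List.mem_cons]
          rintro c (rfl | rfl | hc)
          exacts [hz1, hw1, h3 c (by simp [hc])]
        · simp only [leaves, leavesList, List.cons_append, List.nil_append]
          rw [← List.append_assoc, hl, List.append_assoc]
      · simp only [List.length_cons, List.length_nil] at hb
        refine ⟨⟨_, rfl, by omega, by omega, fun c hc => h3 c (by simp [hc])⟩,
          .inr ⟨_, rfl, ⟨_, rfl, by simp, by simp; omega, ?_⟩, ?_⟩⟩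
        · simp only [List.mem_cons, List.not_mem_nil, or_false]
          rintro c (rfl | rfl)
          exacts [hz1, hw1]
        · simp only [leaves, leavesList, List.append_nil]
          rw [hl, List.append_assoc]
  | succ d ih =>
    obtain ⟨cs, rfl, h1, h2, h3⟩ := hU
    obtain ⟨n, cs, rfl⟩ : ∃ n ds, cs = n :: ds := by
      cases cs with
      | nil => simp at h1; omega
      | cons n ds => exact ⟨_, _, rfl⟩
    have hn : IsSubtree a b (d + r + 1 + 1) n := by
      have := h3 n (by simp); convert this using 1; omega
    obtain ⟨i1, i2⟩ := ih (lo := a) (by omega) (by omega) (hn.inner (by omega))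
    simp only [attachLeft, children]
    refine ⟨⟨_, rfl, by simpa using h1, by simpa using h2, ?_⟩, ?_⟩
    · simp only [List.mem_cons]
      rintro c (rfl | hc)
      · have := i1.isSubtree
        convert this using 1; omega
      · exact h3 c (by simp [hc])
    · rcases i2 with ⟨j1, j2⟩ | ⟨V', j1, j2, j3⟩
      · refine .inl ⟨j1, ?_⟩
        simp only [leaves, leavesList, j2, List.append_assoc]
      · refine .inr ⟨V', j1, j2, ?_⟩
        simp only [leaves, leavesList]
        rw [← List.append_assoc, j3, List.append_assoc]

theorem rootOf_combine_spec (ha : 2 ≤ a) (hab : 2 * a ≤ b) {r : ℕ} {x y : LTree}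
    (hx : Inner a b 1 r x) (hy : Inner a b 1 r y) :
    IsABTree a b (rootOf (combine a b x y)) ∧ r + 1 ≤ (rootOf (combine a b x y)).rank ∧
      (rootOf (combine a b x y)).leaves = x.leaves ++ y.leaves := by
  rcases combine_spec ha hab hx hy with ⟨z, hz, hz1, hz2, -⟩ | ⟨z, w, hz, hz1, hw1, hl⟩
  · rw [hz]
    refine ⟨hz2.isABTree ha, ?_, ?_⟩
    · simp [rootOf, hz2.rank_eq ha]
    · simp only [rootOf, hz1, leaves, leavesList_append, leaves_children hx, leaves_children hy]
  · rw [hz]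
    have : Inner a b 2 (r + 1) (node [z, w]) := by
      refine ⟨_, rfl, by simp, by simp; omega, ?_⟩
      simp only [List.mem_cons, List.not_mem_nil, or_false]
      rintro c (rfl | rfl)
      exacts [hz1, hw1]
    refine ⟨this.isABTree ha, ?_, ?_⟩
    · simp [rootOf, this.rank_eq ha]
    · simp only [rootOf, leaves, leavesList, List.append_nil, hl]

/-- Besides correctness, these are the two facts on which the potential rests: the tree that is
joined to does not lose rank, and a stealing tree gains exactly one. -/
theorem joinToLeft_spec (ha : 2 ≤ a) (hab : 2 * a ≤ b) {U V : LTree} (hU : IsABTree a b U)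
    (hV : IsABTree a b V) (h : V.rank ≤ U.rank) :
    IsABTree a b (joinToLeft a b U V).1 ∧ U.rank ≤ (joinToLeft a b U V).1.rank ∧
      (((joinToLeft a b U V).2 = none ∧ (joinToLeft a b U V).1.leaves = U.leaves ++ V.leaves) ∨
      ∃ V', (joinToLeft a b U V).2 = some V' ∧ IsABTree a b V' ∧ V'.rank = V.rank + 1 ∧
        (joinToLeft a b U V).1.leaves ++ V'.leaves = U.leaves ++ V.leaves) := by
  have hV2 := hV.two_le_rank ha
  obtain ⟨r, hr⟩ : ∃ r, V.rank = r + 1 := ⟨V.rank - 1, by omega⟩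
  obtain ⟨hr0, hVI⟩ := hV.inner_one ha hr
  unfold joinToLeft
  split_ifs with he
  · obtain ⟨h1, h2, h3⟩ := rootOf_combine_spec ha hab (hU.inner_one ha (he.trans hr)).2 hVI
    exact ⟨h1, by dsimp only; omega, .inl ⟨rfl, h3⟩⟩
  · obtain ⟨d, hd⟩ : ∃ d, U.rank = d + r + 1 + 1 := ⟨U.rank - r - 2, by omega⟩
    rw [show U.rank - V.rank - 1 = d by omega]
    obtain ⟨h1, h2⟩ := attachRight_spec ha hab hr0 (by simp) (by omega)
      (hU.inner_two ha hd (by omega)) hVI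
    refine ⟨h1.isABTree ha, by rw [h1.rank_eq ha (by simp)]; omega, h2.imp id ?_⟩
    rintro ⟨V', i1, i2, i3⟩
    exact ⟨V', i1, i2.isABTree ha, by rw [i2.rank_eq ha (by simp)]; omega, i3⟩

theorem joinToRight_spec (ha : 2 ≤ a) (hab : 2 * a ≤ b) {U V : LTree} (hU : IsABTree a b U)
    (hV : IsABTree a b V) (h : V.rank ≤ U.rank) :
    IsABTree a b (joinToRight a b V U).1 ∧ U.rank ≤ (joinToRight a b V U).1.rank ∧
      (((joinToRight a b V U).2 = none ∧ (joinToRight a b V U).1.leaves = V.leaves ++ U.leaves) ∨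
      ∃ V', (joinToRight a b V U).2 = some V' ∧ IsABTree a b V' ∧ V'.rank = V.rank + 1 ∧
        V'.leaves ++ (joinToRight a b V U).1.leaves = V.leaves ++ U.leaves) := by
  have hV2 := hV.two_le_rank ha
  obtain ⟨r, hr⟩ : ∃ r, V.rank = r + 1 := ⟨V.rank - 1, by omega⟩
  obtain ⟨hr0, hVI⟩ := hV.inner_one ha hr
  unfold joinToRight
  split_ifs with he
  · obtain ⟨h1, h2, h3⟩ := rootOf_combine_spec ha hab hVI (hU.inner_one ha (he.trans hr)).2
    exact ⟨h1, by dsimp only; omega, .inl ⟨rfl, h3⟩⟩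
  · obtain ⟨d, hd⟩ : ∃ d, U.rank = d + r + 1 + 1 := ⟨U.rank - r - 2, by omega⟩
    rw [show U.rank - V.rank - 1 = d by omega]
    obtain ⟨h1, h2⟩ := attachLeft_spec ha hab hr0 (by simp) (by omega)
      (hU.inner_two ha hd (by omega)) hVI
    refine ⟨h1.isABTree ha, by rw [h1.rank_eq ha (by simp)]; omega, h2.imp id ?_⟩
    rintro ⟨V', i1, i2, i3⟩
    exact ⟨V', i1, i2.isABTree ha, by rw [i2.rank_eq ha (by simp)]; omega, i3⟩

-- The effect of one iteration on the sequence and on its potential.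

variable {a b : ℕ}

/-! ### The sequence of trees in one iteration -/

/-- The four rules are the four ways in which the comparisons with the two neighbours can be strict
or not. Separated by neighbour, a tie on the left is a condition on both bits and a tie on the right
only on the own bit. -/
theorem joins_iff (rl : ℕ∞) (cl : Bool) (r : ℕ∞) (c : Bool) (rr : ℕ∞) :
    Joins rl cl r c rr ↔ r ≤ rl ∧ r ≤ rr ∧ (rl = r → cl = false ∧ c = true) ∧
      (r = rr → c = true) := by
  unfold Joins
  constructor
  · rintro (⟨h1, h2⟩ | ⟨h1, h2, h3⟩ | ⟨h1, h2, h3, h4⟩ | ⟨h1, h2, h3, h4⟩)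
    · exact ⟨h1.le, h2.le, fun h => absurd h h1.ne', fun h => absurd h h2.ne⟩
    · exact ⟨h1.le, h2.le, fun h => absurd h h1.ne', fun _ => h3⟩
    · exact ⟨h1.ge, h2.le, fun _ => ⟨h3, h4⟩, fun h => absurd h h2.ne⟩
    · exact ⟨h1.ge, h2.le, fun _ => ⟨h3, h4⟩, fun _ => h4⟩
  · rintro ⟨h1, h2, h3, h4⟩
    rcases h1.lt_or_eq with h1 | h1 <;> rcases h2.lt_or_eq with h2 | h2
    · exact .inl ⟨h1, h2⟩
    · exact .inr (.inl ⟨h1, h2, h4 h2⟩)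
    · exact .inr (.inr (.inl ⟨h1.symm, h2, h3 h1.symm⟩))
    · exact .inr (.inr (.inr ⟨h1.symm, h2, h3 h1.symm⟩))

/-- A joining tree keeps its right neighbour from joining it. -/
theorem Joins.not_joins {rl r rr rr' : ℕ∞} {cl c c' : Bool} (h : Joins rl cl r c rr) :
    ¬ Joins r c rr c' rr' := by
  rw [joins_iff] at h ⊢
  rintro ⟨h1, h2, h3, h4⟩
  -- If both trees joined, their ranks would be equal; the left one would then need its bit to be 1,
  -- the right one would need the same bit to be 0.
  have he := le_antisymm h.2.1 h1
  have := h.2.2.2 he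
  have := (h3 he).1
  simp_all

/-- What replaces the two trees `u`, `v` when `v` is joined to `u`. -/
def joinEntries (a b : ℕ) (u v : Entry) : List Entry :=
  match joinToLeft a b u.2 v.2 with
  | (u', none) => [(u.1, u')]
  | (u', some v') => [(u.1, u'), (v.1, v')]

theorem leftJoins_join {c : ℕ → Bool} {u v : Entry} {rest : List Entry}
    (h : Joins u.2.rank (c u.1) v.2.rank (c v.1) (headRank rest)) :
    leftJoins a b c (u :: v :: rest) = joinEntries a b u v ++ leftJoins a b c rest := by
  rw [leftJoins, if_pos h]; rfl

theorem leftJoins_skip {c : ℕ → Bool} {u v : Entry} {rest : List Entry}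
    (h : ¬ Joins u.2.rank (c u.1) v.2.rank (c v.1) (headRank rest)) :
    leftJoins a b c (u :: v :: rest) = u :: leftJoins a b c (v :: rest) := by
  rw [leftJoins, if_neg h]

/-- Induction along the recursion of `leftJoins`. -/
theorem leftJoins_induction (c : ℕ → Bool) {P : List Entry → Prop} (nil : P [])
    (single : ∀ u, P [u])
    (join : ∀ u v rest, Joins u.2.rank (c u.1) v.2.rank (c v.1) (headRank rest) → P rest →
      P (u :: v :: rest))
    (skip : ∀ u v rest, ¬ Joins u.2.rank (c u.1) v.2.rank (c v.1) (headRank rest) →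
      P (v :: rest) → P (u :: v :: rest)) (l : List Entry) : P l := by
  induction h : l.length using Nat.strong_induction_on generalizing l with
  | _ n ih =>
    match l with
    | [] => exact nil
    | [u] => exact single u
    | u :: v :: rest =>
      simp only [List.length_cons] at h
      by_cases hj : Joins u.2.rank (c u.1) v.2.rank (c v.1) (headRank rest)
      · exact join u v rest hj (ih _ (by omega) rest rfl)
      · exact skip u v rest hj (ih (rest.length + 1) (by omega) (v :: rest) rfl)

theorem leftJoins_nil (c : ℕ → Bool) : leftJoins a b c [] = [] := by
  rw [leftJoins]; simp

theorem leftJoins_single (c : ℕ → Bool) (u : Entry) : leftJoins a b c [u] = [u] := by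
  rw [leftJoins]; simp

/-- The values stored in a sequence of trees. -/
def valuesOf (l : List Entry) : List ℕ := l.flatMap fun e => e.2.leaves

theorem valuesOf_append (l l' : List Entry) : valuesOf (l ++ l') = valuesOf l ++ valuesOf l' := by
  simp [valuesOf]

/-- The weight of a tree, exponentially small in its rank. -/
noncomputable def weight (e : Entry) : ℝ := (1 / 4) ^ e.2.rank

theorem weight_pos (e : Entry) : 0 < weight e := by unfold weight; positivity

theorem weight_le {e f : Entry} (h : e.2.rank ≤ f.2.rank) : weight f ≤ weight e :=
  pow_le_pow_of_le_one (by norm_num) (by norm_num) h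

theorem weight_succ {e f : Entry} (h : f.2.rank = e.2.rank + 1) : weight f = weight e / 4 := by
  unfold weight; rw [h, pow_succ]; ring

theorem weight_lt {e f : Entry} (h : e.2.rank < f.2.rank) : weight f ≤ weight e / 4 := by
  have h1 : (1 / 4 : ℝ) ^ f.2.rank ≤ (1 / 4) ^ (e.2.rank + 1) :=
    pow_le_pow_of_le_one (by norm_num) (by norm_num) h
  unfold weight; rw [pow_succ] at h1; linarith

/-- The potential of a sequence of trees. -/
noncomputable def potential (l : List Entry) : ℝ := (l.map weight).sum

@[simp] theorem potential_nil : potential [] = 0 := rfl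

@[simp] theorem potential_cons (e : Entry) (l : List Entry) :
    potential (e :: l) = weight e + potential l := by simp [potential]

theorem potential_append (l l' : List Entry) :
    potential (l ++ l') = potential l + potential l' := by simp [potential]

theorem potential_nonneg (l : List Entry) : 0 ≤ potential l := by
  refine List.sum_nonneg fun x hx => ?_
  obtain ⟨e, -, rfl⟩ := List.mem_map.1 hx
  exact (weight_pos e).le

open Classical in
/-- The total weight of the joining trees of a sequence whose left neighbour has rank `rl` and random
bit `cl`. -/
noncomputable def joinWeight (c : ℕ → Bool) : ℕ∞ → Bool → List Entry → ℝ
  | _, _, [] => 0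
  | rl, cl, v :: rest =>
    (if Joins rl cl v.2.rank (c v.1) (headRank rest) then weight v else 0) +
      joinWeight c v.2.rank (c v.1) rest

/-- The sequence `l` may replace two neighbours `u`, `v` of which `w` joins the other one. -/
structure Replaces (a b : ℕ) (u v w : Entry) (l : List Entry) : Prop where
  tree : ∀ e ∈ l, IsABTree a b e.2
  values : valuesOf l = valuesOf [u, v]
  pids : (l.map Prod.fst).Sublist [u.1, v.1]
  pot : potential l + 3 / 4 * weight w ≤ weight u + weight v

/-- The weight of `u` does not grow because its rank does not drop, and `v` keeps at most a quarter
of its weight, namely if it has stolen. -/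
theorem joinEntries_spec (ha : 2 ≤ a) (hab : 2 * a ≤ b) {u v : Entry} (hu : IsABTree a b u.2)
    (hv : IsABTree a b v.2) (h : v.2.rank ≤ u.2.rank) :
    Replaces a b u v v (joinEntries a b u v) ∧ ∃ u' l, joinEntries a b u v = (u.1, u') :: l ∧
      u.2.rank ≤ u'.rank := by
  obtain ⟨h1, h2, h3⟩ := joinToLeft_spec ha hab hu hv h
  have hw := weight_le (e := u) (f := (u.1, (joinToLeft a b u.2 v.2).1)) h2
  unfold joinEntries
  rcases hj : joinToLeft a b u.2 v.2 with ⟨u', _ | v'⟩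
  · rw [hj] at h1 h2 h3 hw
    simp only [true_and, reduceCtorEq, false_and, exists_false, or_false] at h3
    refine ⟨⟨by simpa using h1, by simpa [valuesOf] using h3, by simp, ?_⟩, _, _, rfl, h2⟩
    have := weight_pos v
    simp only [potential_cons, potential_nil]
    linarith
  · rw [hj] at h1 h2 h3 hw
    simp only [reduceCtorEq, false_and, false_or, Option.some.injEq] at h3
    obtain ⟨_, rfl, h4, h5, h6⟩ := h3
    refine ⟨⟨by simpa using ⟨h1, h4⟩, by simpa [valuesOf] using h6, by simp, ?_⟩, _, _, rfl, h2⟩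
    have := weight_succ (e := v) (f := (v.1, v')) h5
    simp only [potential_cons, potential_nil]
    linarith

/-- One entry of the sequence before an iteration still exists as the first one afterwards. -/
theorem leftJoins_cons (ha : 2 ≤ a) (hab : 2 * a ≤ b) (c : ℕ → Bool) {u : Entry}
    {rest : List Entry} (h : ∀ e ∈ u :: rest, IsABTree a b e.2) :
    ∃ u' l, leftJoins a b c (u :: rest) = (u.1, u') :: l ∧ u.2.rank ≤ u'.rank := by
  match rest with
  | [] => exact ⟨u.2, [], leftJoins_single c u, le_rfl⟩
  | v :: rest =>
    by_cases hj : Joins u.2.rank (c u.1) v.2.rank (c v.1) (headRank rest)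
    · rw [leftJoins_join hj]
      obtain ⟨-, u', l, h1, h2⟩ := joinEntries_spec ha hab (h u (by simp)) (h v (by simp))
        (by exact_mod_cast ((joins_iff _ _ _ _ _).1 hj).1)
      exact ⟨u', l ++ leftJoins a b c rest, by rw [h1]; rfl, h2⟩
    · rw [leftJoins_skip hj]
      exact ⟨u.2, _, rfl, le_rfl⟩

theorem leftJoins_spec (ha : 2 ≤ a) (hab : 2 * a ≤ b) (c : ℕ → Bool) (l : List Entry)
    (h : ∀ e ∈ l, IsABTree a b e.2) :
    (∀ e ∈ leftJoins a b c l, IsABTree a b e.2) ∧ valuesOf (leftJoins a b c l) = valuesOf l ∧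
      ((leftJoins a b c l).map Prod.fst).Sublist (l.map Prod.fst) ∧
      ∀ u rest, l = u :: rest →
        potential (leftJoins a b c l) + 3 / 4 * joinWeight c u.2.rank (c u.1) rest
          ≤ potential l := by
  induction l using leftJoins_induction c with
  | nil => simp [leftJoins_nil]
  | single u =>
    rw [leftJoins_single]
    refine ⟨h, rfl, .refl _, ?_⟩
    rintro u rest ⟨⟩
    simp [joinWeight]
  | join u v rest hj ih =>
    obtain ⟨i1, i2, i3, i4⟩ := ih fun e he => h e (by simp [he])
    obtain ⟨⟨j1, j2, j3, j4⟩, -⟩ := joinEntries_spec ha hab (h u (by simp)) (h v (by simp))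
        (by exact_mod_cast ((joins_iff _ _ _ _ _).1 hj).1)
    rw [leftJoins_join hj]
    refine ⟨fun e he => ?_, ?_, ?_, ?_⟩
    · rcases List.mem_append.1 he with he | he
      exacts [j1 e he, i1 e he]
    · rw [valuesOf_append, j2, i2, ← valuesOf_append]; rfl
    · rw [List.map_append]; exact j3.append i3
    · rintro u rest' ⟨⟩
      rw [potential_append, joinWeight, if_pos hj, potential_cons, potential_cons]
      have : potential (leftJoins a b c rest) + 3 / 4 * joinWeight c v.2.rank (c v.1) rest
          ≤ potential rest := by
        cases rest with
        | nil => simp [leftJoins_nil, joinWeight]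
        | cons w l =>
          simp only [headRank] at hj
          -- The tree to the right of a joining tree does not join, so nothing is lost when the
          -- induction hypothesis starts afresh behind the pair.
          rw [joinWeight, if_neg hj.not_joins, zero_add]
          exact i4 w l rfl
      linarith
  | skip u v rest hj ih =>
    obtain ⟨i1, i2, i3, i4⟩ := ih fun e he => h e (List.mem_cons_of_mem _ he)
    rw [leftJoins_skip hj]
    refine ⟨fun e he => ?_, ?_, ?_, ?_⟩
    · rcases List.mem_cons.1 he with rfl | he
      exacts [h _ (by simp), i1 e he]
    · rw [← List.singleton_append, valuesOf_append, i2, ← valuesOf_append]; rfl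
    · exact i3.cons_cons _
    · rintro u rest' ⟨⟩
      have := i4 v rest rfl
      simp only [joinWeight, if_neg hj, potential_cons] at this ⊢
      linarith

/-- What replaces the first two trees `v`, `u` when `v` is joined to `u`. -/
def firstEntries (a b : ℕ) (v u : Entry) : List Entry :=
  match joinToRight a b v.2 u.2 with
  | (u', none) => [(u.1, u')]
  | (u', some v') => [(v.1, v'), (u.1, u')]

theorem firstJoin_eq (v u : Entry) (rest : List Entry) :
    firstJoin a b (v :: u :: rest) = firstEntries a b v u ++ rest := by
  rw [firstJoin, firstEntries]
  rcases joinToRight a b v.2 u.2 with ⟨u', _ | v'⟩ <;> rfl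

theorem firstEntries_spec (ha : 2 ≤ a) (hab : 2 * a ≤ b) {u v : Entry} (hu : IsABTree a b u.2)
    (hv : IsABTree a b v.2) (h : v.2.rank ≤ u.2.rank) :
    Replaces a b v u v (firstEntries a b v u) := by
  obtain ⟨h1, h2, h3⟩ := joinToRight_spec ha hab hu hv h
  have hw := weight_le (e := u) (f := (u.1, (joinToRight a b v.2 u.2).1)) h2
  unfold firstEntries
  rcases hj : joinToRight a b v.2 u.2 with ⟨u', _ | v'⟩
  · rw [hj] at h1 h2 h3 hw
    simp only [true_and, reduceCtorEq, false_and, exists_false, or_false] at h3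
    refine ⟨by simpa using h1, by simpa [valuesOf] using h3, by simp, ?_⟩
    have := weight_pos v
    simp only [potential_cons, potential_nil]
    linarith
  · rw [hj] at h1 h2 h3 hw
    simp only [reduceCtorEq, false_and, false_or, Option.some.injEq] at h3
    obtain ⟨_, rfl, h4, h5, h6⟩ := h3
    refine ⟨by simpa using ⟨h4, h1⟩, by simpa [valuesOf] using h6, by simp, ?_⟩
    have := weight_succ (e := v) (f := (v.1, v')) h5
    simp only [potential_cons, potential_nil]
    linarith

theorem iteration_pos {c : ℕ → Bool} {u v : Entry} {rest : List Entry}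
    (h : Joins ⊤ false u.2.rank (c u.1) v.2.rank) :
    iteration a b c (u :: v :: rest) = firstJoin a b (u :: leftJoins a b c (v :: rest)) := by
  rw [iteration, if_pos h, leftJoins_skip h.not_joins]

theorem iteration_neg {c : ℕ → Bool} {u v : Entry} {rest : List Entry}
    (h : ¬ Joins ⊤ false u.2.rank (c u.1) v.2.rank) :
    iteration a b c (u :: v :: rest) = leftJoins a b c (u :: v :: rest) := by
  rw [iteration, if_neg h]

theorem iteration_of_length_le {c : ℕ → Bool} {l : List Entry} (h : l.length ≤ 1) :
    iteration a b c l = l := by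
  match l with
  | [] => rw [iteration]; simp
  | [u] => rw [iteration]; simp
  | u :: v :: l => simp at h

theorem iteration_spec (ha : 2 ≤ a) (hab : 2 * a ≤ b) (c : ℕ → Bool) (l : List Entry)
    (h : ∀ e ∈ l, IsABTree a b e.2) :
    (∀ e ∈ iteration a b c l, IsABTree a b e.2) ∧ valuesOf (iteration a b c l) = valuesOf l ∧
      ((iteration a b c l).map Prod.fst).Sublist (l.map Prod.fst) ∧
      (2 ≤ l.length →
        potential (iteration a b c l) + 3 / 4 * joinWeight c ⊤ false l ≤ potential l) := by
  match l with
  | [] => rw [iteration_of_length_le (by simp)]; simp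
  | [u] => rw [iteration_of_length_le (by simp)]; simpa using h
  | u :: v :: rest =>
    by_cases hj : Joins ⊤ false u.2.rank (c u.1) v.2.rank
    · rw [iteration_pos hj]
      have h' : ∀ e ∈ v :: rest, IsABTree a b e.2 := fun e he => h e (List.mem_cons_of_mem _ he)
      obtain ⟨i1, i2, i3, i4⟩ := leftJoins_spec ha hab c (v :: rest) h'
      obtain ⟨v', l, h1, h2⟩ := leftJoins_cons ha hab c h'
      have i4 := i4 v rest rfl
      rw [h1] at i1 i2 i3 i4 ⊢
      -- The second tree does not join to its left, so it is still there when the first tree is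
      -- joined to it; it may have grown meanwhile, which does no harm.
      have hle : u.2.rank ≤ v'.rank :=
        le_trans (by exact_mod_cast ((joins_iff _ _ _ _ _).1 hj).2.1) h2
      obtain ⟨j1, j2, j3, j4⟩ := firstEntries_spec ha hab (u := (v.1, v')) (v := u)
        (i1 _ (by simp)) (h u (by simp)) hle
      rw [firstJoin_eq]
      refine ⟨fun e he => ?_, ?_, ?_, fun _ => ?_⟩
      · rcases List.mem_append.1 he with he | he
        exacts [j1 e he, i1 e (by simp [he])]
      · rw [valuesOf_append, j2, ← valuesOf_append]
        change valuesOf ([u] ++ ((v.1, v') :: l)) = valuesOf ([u] ++ (v :: rest))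
        rw [valuesOf_append, i2, ← valuesOf_append]
      · rw [List.map_append]
        refine (j3.append (List.Sublist.refl _)).trans ?_
        simpa using i3
      · rw [potential_append, joinWeight, if_pos (by simpa [headRank] using hj), potential_cons]
        rw [joinWeight, if_neg hj.not_joins, zero_add]
        simp only [potential_cons] at i4 ⊢
        linarith
    · rw [iteration_neg hj]
      obtain ⟨i1, i2, i3, i4⟩ := leftJoins_spec ha hab c (u :: v :: rest) h
      refine ⟨i1, i2, i3, fun _ => ?_⟩
      rw [joinWeight, if_neg (by simpa [headRank] using hj), zero_add]
      exact i4 u _ rfl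

-- Expectations: geometric decay of the potential and of the number of trees.

variable {a b : ℕ}

/-! ### The expected potential -/

theorem leftJoins_congr {c c' : ℕ → Bool} {l : List Entry} (h : ∀ e ∈ l, c e.1 = c' e.1) :
    leftJoins a b c l = leftJoins a b c' l := by
  induction l using leftJoins_induction c with
  | nil => simp [leftJoins_nil]
  | single u => simp [leftJoins_single]
  | join u v rest hj ih =>
    rw [leftJoins_join hj]
    rw [h u (by simp), h v (by simp)] at hj
    rw [leftJoins_join hj, ih fun e he => h e (by simp [he])]
  | skip u v rest hj ih =>
    rw [leftJoins_skip hj]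
    rw [h u (by simp), h v (by simp)] at hj
    rw [leftJoins_skip hj, ih fun e he => h e (List.mem_cons_of_mem _ he)]

theorem iteration_congr {c c' : ℕ → Bool} {l : List Entry} (h : ∀ e ∈ l, c e.1 = c' e.1) :
    iteration a b c l = iteration a b c' l := by
  match l with
  | [] => rw [iteration_of_length_le (by simp), iteration_of_length_le (by simp)]
  | [u] => rw [iteration_of_length_le (by simp), iteration_of_length_le (by simp)]
  | u :: v :: rest =>
    rw [iteration, iteration, leftJoins_congr h, h u (by simp)]

variable {k : ℕ} {T : Fin k → LTree}

theorem mem_trees_zero {ω : ℕ → ℕ → Bool} {e : Entry} :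
    e ∈ trees a b T ω 0 ↔ ∃ t : Fin k, ((t : ℕ), T t) = e := by
  simp [trees, List.mem_ofFn]

theorem trees_isABTree (ha : 2 ≤ a) (hab : 2 * a ≤ b) (hT : ∀ t, IsABTree a b (T t))
    (ω : ℕ → ℕ → Bool) (i : ℕ) : ∀ e ∈ trees a b T ω i, IsABTree a b e.2 := by
  induction i with
  | zero =>
    intro e he
    obtain ⟨t, rfl⟩ := mem_trees_zero.1 he
    exact hT t
  | succ i ih => exact (iteration_spec ha hab _ _ ih).1

theorem trees_values (ha : 2 ≤ a) (hab : 2 * a ≤ b) (hT : ∀ t, IsABTree a b (T t))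
    (ω : ℕ → ℕ → Bool) (i : ℕ) :
    valuesOf (trees a b T ω i) = leavesList (List.ofFn T) := by
  induction i with
  | zero =>
    rw [trees, leavesList_eq_flatMap, valuesOf, List.flatMap_def, List.flatMap_def,
      List.map_ofFn, List.map_ofFn]; rfl
  | succ i ih => rw [← ih]; exact (iteration_spec ha hab _ _ (trees_isABTree ha hab hT ω i)).2.1

theorem trees_pids (ha : 2 ≤ a) (hab : 2 * a ≤ b) (hT : ∀ t, IsABTree a b (T t))
    (ω : ℕ → ℕ → Bool) (i : ℕ) :
    ((trees a b T ω i).map Prod.fst).Nodup ∧ (∀ e ∈ trees a b T ω i, e.1 < k) ∧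
      (trees a b T ω i).length ≤ k := by
  have : ((trees a b T ω i).map Prod.fst).Sublist ((trees a b T ω 0).map Prod.fst) := by
    induction i with
    | zero => exact .refl _
    | succ i ih => exact (iteration_spec ha hab _ _ (trees_isABTree ha hab hT ω i)).2.2.1.trans ih
  have h0 : (trees a b T ω 0).map Prod.fst = List.ofFn fun t : Fin k => (t : ℕ) := by
    rw [trees, List.map_ofFn]; rfl
  rw [h0] at this
  refine ⟨this.nodup (List.nodup_ofFn.2 Fin.val_injective), fun e he => ?_, ?_⟩
  · have := this.subset (List.mem_map_of_mem (f := Prod.fst) he)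
    obtain ⟨t, ht⟩ := (List.mem_ofFn' _ _).1 this
    rw [← ht]; exact t.2
  · simpa using this.length_le

/-- Only finitely many bits have been used before any given iteration. All questions of
measurability and integrability are reduced to finite types in this way. -/
theorem trees_congr (ha : 2 ≤ a) (hab : 2 * a ≤ b) (hT : ∀ t, IsABTree a b (T t))
    {ω ω' : ℕ → ℕ → Bool} {i : ℕ} (h : ∀ j < i, ∀ p < k, ω j p = ω' j p) :
    trees a b T ω i = trees a b T ω' i := by
  induction i with
  | zero => rfl
  | succ i ih =>
    rw [trees, trees, ← ih fun j hj => h j (by omega)]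
    exact iteration_congr fun e he => h i (by omega) _ ((trees_pids ha hab hT ω i).2.1 e he)

open Classical in
/-- The total weight of the trees that have no smaller neighbour, in a sequence whose left neighbour
has rank `rl`. -/
noncomputable def lowWeight : ℕ∞ → List Entry → ℝ
  | _, [] => 0
  | rl, v :: rest =>
    (if (v.2.rank : ℕ∞) ≤ rl ∧ (v.2.rank : ℕ∞) ≤ headRank rest then weight v else 0) +
      lowWeight v.2.rank rest

/-- The weight of the first tree of a sequence. -/
noncomputable def headWeight : List Entry → ℝ
  | [] => 0
  | e :: _ => weight e

/-- A charging argument. A tree with a smaller neighbour weighs at most a quarter of it, so it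
weighs at most a quarter of both neighbours together, and every tree is charged at most twice. Here
`w` is the weight of the tree to the left of the sequence (0 if there is none), and the subtracted
term is the charge on the first tree that only a tree further left could cause. -/
theorem potential_le_lowWeight_aux (l : List Entry) (rl : ℕ∞) (w : ℝ) (hw : 0 ≤ w)
    (h : ∀ e : Entry, rl < e.2.rank → weight e ≤ w / 4) :
    potential l - lowWeight rl l ≤ w / 4 + potential l / 2 - headWeight l / 4 := by
  induction l generalizing rl w with
  | nil => simp [lowWeight, headWeight]; positivity
  | cons v rest ih =>
    have := ih v.2.rank (weight v) (weight_pos v).le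
      (fun e he => weight_lt (by exact_mod_cast he))
    have hn : 0 ≤ headWeight rest := by
      cases rest with
      | nil => exact le_rfl
      | cons e _ => exact (weight_pos e).le
    simp only [lowWeight, potential_cons, headWeight]
    split_ifs with hc
    · linarith
    · have : weight v ≤ (w + headWeight rest) / 4 := by
        rw [not_and_or, not_le, not_le] at hc
        rcases hc with hc | hc
        · have := h v hc; linarith
        · cases rest with
          | nil => simp [headRank] at hc
          | cons e rest =>
            have := weight_lt (e := e) (f := v) (by simpa [headRank] using hc)
            simp only [headWeight]; linarith
      linarith

theorem potential_le_lowWeight (l : List Entry) : potential l / 2 ≤ lowWeight ⊤ l := by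
  have := potential_le_lowWeight_aux l ⊤ 0 le_rfl (by simp)
  have hn : 0 ≤ headWeight l := by
    cases l with
    | nil => exact le_rfl
    | cons e _ => exact (weight_pos e).le
  linarith

/-- The law of the random bits of one iteration. -/
noncomputable def coinRow : Measure (ℕ → Bool) :=
  Measure.infinitePi fun _ : ℕ => (PMF.uniformOfFintype Bool).toMeasure

instance : IsProbabilityMeasure coinRow := by unfold coinRow; infer_instance

theorem coins_eq : coins = Measure.infinitePi fun _ : ℕ => coinRow := rfl

instance : IsProbabilityMeasure coins := by rw [coins_eq]; infer_instance

theorem coin_apply (x : Bool) : (PMF.uniformOfFintype Bool).toMeasure {x} = 1 / 2 := by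
  rw [PMF.toMeasure_apply_singleton _ _ (measurableSet_singleton x)]
  simp

theorem coinRow_pair {p q : ℕ} (h : p ≠ q) :
    coinRow {c | c p = false ∧ c q = true} = 1 / 4 := by
  have : {c : ℕ → Bool | c p = false ∧ c q = true} =
      Set.pi (({p, q} : Finset ℕ) : Set ℕ) (fun i => if i = p then {false} else {true}) := by
    ext c
    simp [h.symm]
  rw [this, coinRow, Measure.infinitePi_pi _ fun _ _ => by split_ifs <;> exact .of_discrete,
    Finset.prod_pair h, if_pos rfl, if_neg h.symm, coin_apply, coin_apply]
  rw [one_div, one_div, ← ENNReal.mul_inv (by simp) (by simp)]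
  norm_num

theorem coinRow_single (q : ℕ) : coinRow {c | c q = true} = 1 / 2 := by
  have : {c : ℕ → Bool | c q = true} =
      Set.pi (({q} : Finset ℕ) : Set ℕ) (fun _ => {true}) := by
    ext c
    simp
  rw [this, coinRow, Measure.infinitePi_pi _ fun _ _ => .of_discrete, Finset.prod_singleton,
    coin_apply]

/-- The first `k` bits. -/
def firstBits (k : ℕ) (c : ℕ → Bool) (p : Fin k) : Bool := c p

theorem measurable_firstBits (k : ℕ) : Measurable (firstBits k) :=
  measurable_pi_lambda _ fun p => measurable_pi_apply (p : ℕ)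

/-- A sequence of bits that starts with the given ones. -/
def extendBits {k : ℕ} (d : Fin k → Bool) (p : ℕ) : Bool := if h : p < k then d ⟨p, h⟩ else false

theorem extendBits_firstBits {k p : ℕ} (h : p < k) (c : ℕ → Bool) :
    extendBits (firstBits k c) p = c p := by simp [extendBits, firstBits, h]

/-- The law of the random bits of the processors in one iteration. -/
noncomputable def bitsLaw (k : ℕ) : Measure (Fin k → Bool) := coinRow.map (firstBits k)

instance : IsProbabilityMeasure (bitsLaw k) :=
  Measure.isProbabilityMeasure_map (measurable_firstBits k).aemeasurable

theorem bitsLaw_pair {p q : ℕ} (hp : p < k) (hq : q < k) (h : p ≠ q) :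
    (bitsLaw k).real {d | extendBits d p = false ∧ extendBits d q = true} = 1 / 4 := by
  rw [Measure.real, bitsLaw, Measure.map_apply (measurable_firstBits k) .of_discrete,
    Set.preimage_ofPred_eq]
  simp only [extendBits_firstBits hp, extendBits_firstBits hq, coinRow_pair h]
  simp

theorem bitsLaw_single {q : ℕ} (hq : q < k) :
    (bitsLaw k).real {d | extendBits d q = true} = 1 / 2 := by
  rw [Measure.real, bitsLaw, Measure.map_apply (measurable_firstBits k) .of_discrete,
    Set.preimage_ofPred_eq]
  simp only [extendBits_firstBits hq, coinRow_single]
  simp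

/-- A tree without a smaller neighbour joins, whatever ties there are, if the left bit is 0 and its
own bit is 1. The left bit `cl` is a random variable so that the induction can pass from the
constant bit in front of the first tree to the bit of an actual neighbour. -/
theorem lowWeight_le_integral_joinWeight (l : List Entry) (rl : ℕ∞) (cl : (Fin k → Bool) → Bool)
    (hk : ∀ e ∈ l, e.1 < k) (hn : (l.map Prod.fst).Nodup)
    (hcl : ∀ v rest, l = v :: rest →
      1 / 4 ≤ (bitsLaw k).real {d | cl d = false ∧ extendBits d v.1 = true}) :
    lowWeight rl l / 4 ≤ ∫ d, joinWeight (extendBits d) rl (cl d) l ∂bitsLaw k := by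
  classical
  induction l generalizing rl cl with
  | nil => simp [lowWeight, joinWeight]
  | cons v rest ih =>
    simp only [joinWeight]
    rw [integral_add Integrable.of_finite Integrable.of_finite, lowWeight, add_div]
    simp only [List.map_cons, List.nodup_cons] at hn
    refine add_le_add ?_ (ih _ _ (fun e he => hk e (by simp [he])) hn.2 ?_)
    · split_ifs with hlow
      · have h1 := hcl v rest rfl
        calc weight v / 4 ≤ (bitsLaw k).real {d | cl d = false ∧ extendBits d v.1 = true} *
            weight v := by nlinarith [weight_pos v]
          _ = ∫ d, Set.indicator {d | cl d = false ∧ extendBits d v.1 = true}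
              (fun _ => weight v) d ∂bitsLaw k := by
            rw [integral_indicator_const _ .of_discrete, smul_eq_mul]
          _ ≤ _ := by
            refine integral_mono Integrable.of_finite Integrable.of_finite fun d => ?_
            simp only [Set.indicator_apply, Set.mem_ofPred_eq]
            by_cases hd : cl d = false ∧ extendBits d v.1 = true
            · rw [if_pos hd, if_pos ((joins_iff _ _ _ _ _).2
                ⟨hlow.1, hlow.2, fun _ => hd, fun _ => hd.2⟩)]
            · rw [if_neg hd]
              have := weight_pos v
              split_ifs <;> linarith
      · rw [zero_div]
        refine integral_nonneg fun d => ?_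
        have := weight_pos v
        dsimp only [Pi.zero_apply]
        split_ifs <;> linarith
    -- The processors are distinct, so the bits of two neighbours are independent and the event has
    -- probability exactly 1/4.
    · rintro w rest rfl
      refine (bitsLaw_pair (hk v (by simp)) (hk w (by simp)) fun h => hn.1 ?_).ge
      simp [h]

/-- The potential, as long as there are at least two trees. -/
noncomputable def openPotential (l : List Entry) : ℝ := if 2 ≤ l.length then potential l else 0

theorem openPotential_le (l : List Entry) : openPotential l ≤ potential l := by
  unfold openPotential
  split_ifs
  exacts [le_rfl, potential_nonneg l]

/-- In each iteration the expected potential decreases by a constant factor. -/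
theorem integral_openPotential_iteration (ha : 2 ≤ a) (hab : 2 * a ≤ b) {l : List Entry}
    (h : ∀ e ∈ l, IsABTree a b e.2) (hk : ∀ e ∈ l, e.1 < k) (hn : (l.map Prod.fst).Nodup) :
    ∫ d, openPotential (iteration a b (extendBits d) l) ∂bitsLaw k
      ≤ 29 / 32 * openPotential l := by
  by_cases hl : 2 ≤ l.length
  · have h1 := lowWeight_le_integral_joinWeight (k := k) l ⊤ (fun _ => false) hk hn fun v rest hv => by
      simp only [true_and]
      rw [bitsLaw_single (hk v (by simp [hv]))]
      norm_num
    have h2 := potential_le_lowWeight l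
    calc _ ≤ ∫ d, (potential l - 3 / 4 * joinWeight (extendBits d) ⊤ false l) ∂bitsLaw k := by
          refine integral_mono Integrable.of_finite Integrable.of_finite fun d => ?_
          have := (iteration_spec ha hab (extendBits d) l h).2.2.2 hl
          have := openPotential_le (iteration a b (extendBits d) l)
          dsimp only
          linarith
      _ = potential l - 3 / 4 * ∫ d, joinWeight (extendBits d) ⊤ false l ∂bitsLaw k := by
          rw [integral_sub Integrable.of_finite Integrable.of_finite, integral_const_mul]
          simp
      -- At least half of the potential is on trees without a smaller neighbour, these join with
      -- probability at least 1/4, and each of them loses 3/4 of its weight: 1 - 3/32 = 29/32.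
      _ ≤ _ := by rw [openPotential, if_pos hl]; linarith
  · simp only [iteration_of_length_le (show l.length ≤ 1 by omega)]
    simp [openPotential, hl]

/-- The random bits of the processors in the first `i` iterations. -/
def pastBits (k i : ℕ) (ω : ℕ → ℕ → Bool) (j : Fin i) : Fin k → Bool := firstBits k (ω j)

theorem measurable_pastBits (k i : ℕ) : Measurable (pastBits k i) :=
  measurable_pi_lambda _ fun j => (measurable_firstBits k).comp (measurable_pi_apply (j : ℕ))

/-- Random bits that start with the given ones. -/
def extendPast {k i : ℕ} (x : Fin i → Fin k → Bool) (j : ℕ) : ℕ → Bool :=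
  if h : j < i then extendBits (x ⟨j, h⟩) else fun _ => false

theorem trees_extendPast (ha : 2 ≤ a) (hab : 2 * a ≤ b) (hT : ∀ t, IsABTree a b (T t))
    (ω : ℕ → ℕ → Bool) (i : ℕ) :
    trees a b T (extendPast (pastBits k i ω)) i = trees a b T ω i :=
  trees_congr ha hab hT fun j hj p hp => by
    simp [extendPast, hj, pastBits, extendBits_firstBits hp]

theorem indepFun_pastBits (k i : ℕ) :
    ProbabilityTheory.IndepFun (pastBits k i) (fun ω => firstBits k (ω i)) coins := by
  have h : ProbabilityTheory.iIndepFun (fun (i : ℕ) (ω : ℕ → ℕ → Bool) => ω i) coins := by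
    rw [ProbabilityTheory.iIndepFun_iff_map_fun_eq_infinitePi_map
      fun i => measurable_pi_apply i]
    simp only [coins_eq, Measure.infinitePi_map_eval]
    exact Measure.map_id
  have h2 := h.indepFun_finset (Finset.range i) {i} (by simp) fun i => measurable_pi_apply i
  have e1 : Measurable fun (x : Finset.range i → ℕ → Bool) (j : Fin i) =>
      firstBits k (x ⟨j, by simp⟩) :=
    measurable_pi_lambda _ fun j => (measurable_firstBits k).comp
      (measurable_pi_apply (⟨j, by simp⟩ : Finset.range i))
  have e2 : Measurable fun y : ({i} : Finset ℕ) → ℕ → Bool => firstBits k (y ⟨i, by simp⟩) :=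
    (measurable_firstBits k).comp (measurable_pi_apply (⟨i, by simp⟩ : ({i} : Finset ℕ)))
  exact h2.comp e1 e2

theorem map_firstBits (k i : ℕ) : coins.map (fun ω => firstBits k (ω i)) = bitsLaw k := by
  have : (fun ω : ℕ → ℕ → Bool => firstBits k (ω i)) = firstBits k ∘ fun ω => ω i := rfl
  rw [this, ← Measure.map_map (measurable_firstBits k) (measurable_pi_apply i), coins_eq,
    Measure.infinitePi_map_eval, bitsLaw]

/-- Before iteration i the sequence is a function of the i * k bits drawn by then, hence takes
finitely many values; no condition on `F` is needed. -/
theorem integrable_trees (ha : 2 ≤ a) (hab : 2 * a ≤ b) (hT : ∀ t, IsABTree a b (T t)) (i : ℕ)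
    (F : List Entry → ℝ) : Integrable (fun ω => F (trees a b T ω i)) coins := by
  have : Integrable ((fun x => F (trees a b T (extendPast x) i)) ∘ pastBits k i) coins :=
    Integrable.comp_measurable Integrable.of_finite (measurable_pastBits k i)
  refine this.congr (.of_forall fun ω => ?_)
  simp [trees_extendPast ha hab hT]

theorem measurable_trees (ha : 2 ≤ a) (hab : 2 * a ≤ b) (hT : ∀ t, IsABTree a b (T t)) (i : ℕ)
    {β : Type*} [MeasurableSpace β] (F : List Entry → β) :
    Measurable (fun ω => F (trees a b T ω i)) := by
  have : Measurable ((fun x => F (trees a b T (extendPast x) i)) ∘ pastBits k i) :=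
    Measurable.comp .of_discrete (measurable_pastBits k i)
  convert this using 2 with ω
  simp [trees_extendPast ha hab hT]

/-- The bits of an iteration are independent of the past, so by Fubini the one-step estimate may be
applied for each fixed past. It starts from a potential of at most k because no weight exceeds 1. -/
theorem integral_openPotential_trees (ha : 2 ≤ a) (hab : 2 * a ≤ b)
    (hT : ∀ t, IsABTree a b (T t)) (i : ℕ) :
    ∫ ω, openPotential (trees a b T ω i) ∂coins ≤ k * (29 / 32) ^ i := by
  induction i with
  | zero =>
    have : ∀ ω, openPotential (trees a b T ω 0) ≤ k := fun ω => by
      refine (openPotential_le _).trans ?_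
      refine (List.sum_le_card_nsmul _ 1 fun x hx => ?_).trans ?_
      · obtain ⟨e, -, rfl⟩ := List.mem_map.1 hx
        exact pow_le_one₀ (by norm_num) (by norm_num)
      · simp [trees]
    calc _ ≤ ∫ ω, (k : ℝ) ∂coins :=
          integral_mono (integrable_trees ha hab hT 0 _) (integrable_const _) this
      _ = _ := by simp
  | succ i ih =>
    let G : (Fin i → Fin k → Bool) × (Fin k → Bool) → ℝ := fun z =>
      openPotential (iteration a b (extendBits z.2) (trees a b T (extendPast z.1) i))
    have h1 : ∀ ω, openPotential (trees a b T ω (i + 1)) =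
        G (pastBits k i ω, firstBits k (ω i)) := fun ω => by
      simp only [G, trees_extendPast ha hab hT, trees]
      congr 1
      exact iteration_congr fun e he =>
        (extendBits_firstBits ((trees_pids ha hab hT ω i).2.1 e he) _).symm
    have hm : Measurable fun ω : ℕ → ℕ → Bool => firstBits k (ω i) :=
      (measurable_firstBits k).comp (measurable_pi_apply i)
    have hlaw := (ProbabilityTheory.indepFun_iff_map_prod_eq_prod_map_map
      (measurable_pastBits k i).aemeasurable hm.aemeasurable).1 (indepFun_pastBits k i)
    have : IsProbabilityMeasure (coins.map (pastBits k i)) :=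
      Measure.isProbabilityMeasure_map (measurable_pastBits k i).aemeasurable
    calc ∫ ω, openPotential (trees a b T ω (i + 1)) ∂coins
        = ∫ z, G z ∂(coins.map fun ω => (pastBits k i ω, firstBits k (ω i))) := by
          rw [integral_map ((measurable_pastBits k i).prodMk hm).aemeasurable
            (Measurable.of_discrete.aestronglyMeasurable)]
          exact integral_congr_ae (.of_forall h1)
      _ = ∫ x, ∫ d, G (x, d) ∂bitsLaw k ∂(coins.map (pastBits k i)) := by
          rw [hlaw, map_firstBits, integral_prod _ Integrable.of_finite]
      _ ≤ ∫ x, 29 / 32 * openPotential (trees a b T (extendPast x) i)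
            ∂(coins.map (pastBits k i)) := by
          refine integral_mono Integrable.of_finite Integrable.of_finite fun x => ?_
          have := trees_pids ha hab hT (extendPast x) i
          exact integral_openPotential_iteration ha hab (trees_isABTree ha hab hT _ i) this.2.1
            this.1
      _ = 29 / 32 * ∫ ω, openPotential (trees a b T ω i) ∂coins := by
          rw [integral_const_mul, integral_map (measurable_pastBits k i).aemeasurable
            (Measurable.of_discrete.aestronglyMeasurable)]
          simp [trees_extendPast ha hab hT]
      _ ≤ _ := by rw [pow_succ]; linarith

/-! ### The expected number of trees -/

/-- The number of trees, as long as there are at least two. -/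
def openCount (l : List Entry) : ℕ := if 2 ≤ l.length then l.length else 0

theorem openCount_le_length (l : List Entry) : openCount l ≤ l.length := by
  unfold openCount; split_ifs <;> omega

theorem length_valuesOf (l : List Entry) :
    (valuesOf l).length = (l.map fun e => e.2.size).sum := by
  simp only [valuesOf, List.length_flatMap]; rfl

/-- Trees are split at size x. A tree with at least x values contributes at least 1 to the second
term. A smaller one has 2^rank ≤ 4x, so its weight, the inverse square of 2^rank, is at least 1 /
(16 x^2). -/
theorem openCount_le (ha : 2 ≤ a) {l : List Entry} (h : ∀ e ∈ l, IsABTree a b e.2) {x : ℝ}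
    (hx : 0 < x) : (openCount l : ℝ) ≤ 16 * x ^ 2 * openPotential l + (valuesOf l).length / x := by
  unfold openCount openPotential
  split_ifs with hl
  · clear hl
    induction l with
    | nil => simp [valuesOf]
    | cons e l ih =>
      have ih := ih fun f hf => h f (by simp [hf])
      have hv : (valuesOf (e :: l)).length = e.2.size + (valuesOf l).length := by
        simp [length_valuesOf]
      rw [hv, potential_cons]
      push_cast [List.length_cons]
      have hs : (2 : ℝ) ^ e.2.rank ≤ 4 * e.2.size := by
        exact_mod_cast (h e (by simp)).two_pow_rank_le ha
      have hw : weight e * (2 ^ e.2.rank) ^ 2 = 1 := by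
        unfold weight
        rw [← pow_mul, mul_comm e.2.rank 2, pow_mul, ← mul_pow]; norm_num
      have hw0 := weight_pos e
      have : (1 : ℝ) ≤ 16 * x ^ 2 * weight e + e.2.size / x := by
        by_cases hsx : x ≤ e.2.size
        · have : 1 ≤ (e.2.size : ℝ) / x := by rwa [le_div_iff₀ hx, one_mul]
          have : 0 ≤ 16 * x ^ 2 * weight e := by positivity
          linarith
        · have h3 : ((2 : ℝ) ^ e.2.rank) ^ 2 ≤ (4 * x) ^ 2 := by
            gcongr
            linarith
          have : (0 : ℝ) ≤ e.2.size / x := by positivity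
          nlinarith
      rw [add_div]
      linarith
  · simp; positivity

/-- The decay rate is written as a cube: two factors pay for a size threshold that grows like
(32/31)^i and enters squared, and the third one remains as the decay of the number of trees. -/
theorem theta_cube : (29 / 32 : ℝ) ≤ (31 / 32) ^ 3 := by norm_num

theorem integral_openCount_le (ha : 2 ≤ a) (hab : 2 * a ≤ b) (hT : ∀ t, IsABTree a b (T t))
    (hk : 0 < k) {m : ℕ} (hm : m = ∑ t, (T t).size) (i : ℕ) :
    ∫ ω, (openCount (trees a b T ω i) : ℝ) ∂coins ≤ k * (17 * (m / k) ^ 2 * (31 / 32) ^ i) := by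
  have hkm : k ≤ m := by
    rw [hm]
    simpa using Finset.card_nsmul_le_sum Finset.univ (fun t => (T t).size) 1
      fun t _ => (hT t).size_pos
  have hk' : (0 : ℝ) < k := by exact_mod_cast hk
  have hy : (1 : ℝ) ≤ m / k := by
    rw [le_div_iff₀ hk', one_mul]; exact_mod_cast hkm
  set y : ℝ := m / k
  have hmy : (m : ℝ) = y * k := by simp only [y]; field_simp
  set θ : ℝ := (31 / 32) ^ i with hθ
  have hθ0 : 0 < θ := by positivity
  have hlen : ∀ ω, (valuesOf (trees a b T ω i)).length = m := fun ω => by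
    rw [trees_values ha hab hT, leavesList_eq_flatMap, List.length_flatMap, hm, List.map_ofFn,
      List.sum_ofFn]; rfl
  -- With the threshold y / θ, where y = m / k is the mean size, both terms are of order θ: the
  -- large trees number at most kθ, and the small ones contribute 16 (y/θ)^2 * kθ^3.
  calc _ ≤ ∫ ω, (16 * (y / θ) ^ 2 * openPotential (trees a b T ω i) + m / (y / θ)) ∂coins := by
        refine integral_mono (integrable_trees ha hab hT i fun l => (openCount l : ℝ))
          (integrable_trees ha hab hT i fun l => 16 * (y / θ) ^ 2 * openPotential l + m / (y / θ))
          fun ω => ?_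
        have := openCount_le ha (trees_isABTree ha hab hT ω i) (x := y / θ) (by positivity)
        rwa [hlen ω] at this
    _ = 16 * (y / θ) ^ 2 * ∫ ω, openPotential (trees a b T ω i) ∂coins + m / (y / θ) := by
        rw [integral_add (integrable_trees ha hab hT i fun l => 16 * (y / θ) ^ 2 * openPotential l)
          (integrable_const _), integral_const_mul]
        simp
    _ ≤ 16 * (y / θ) ^ 2 * (k * θ ^ 3) + m / (y / θ) := by
        gcongr
        refine (integral_openPotential_trees ha hab hT i).trans ?_
        rw [hθ, ← pow_mul, mul_comm i 3, pow_mul]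
        gcongr
        exact theta_cube
    _ = k * ((16 * y ^ 2 + 1) * θ) := by rw [hmy]; field_simp
    _ ≤ _ := by
        gcongr
        nlinarith

variable {a b : ℕ}

/-! ### Expected number of iterations and expected total number of trees -/

theorem one_le_lg (x : ℝ) : 1 ≤ lg x := le_max_left _ _

theorem lg_le_seven {y : ℝ} (hy : 1 ≤ y) : lg (17 * y ^ 2) ≤ 7 * lg y := by
  have h1 := one_le_lg y
  have h2 : Real.logb 2 y ≤ lg y := le_max_right _ _
  have h3 : Real.logb 2 17 ≤ 5 := by
    rw [Real.logb_le_iff_le_rpow (by norm_num) (by norm_num)]; norm_num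
  have h4 : Real.logb 2 (17 * y ^ 2) = Real.logb 2 17 + 2 * Real.logb 2 y := by
    rw [Real.logb_mul (by norm_num) (by positivity), Real.logb_pow]; norm_num
  exact max_le (by linarith) (by linarith)

/-- Terms are bounded by 1 until the geometric sequence has fallen below 1, and from there on by a
geometric series of sum 32. Since (31/32)^32 ≤ 1/2, this takes 32 ⌈log₂ D⌉ terms, and 32 (log₂ D +
1) + 32 is at most 96 times a logarithm that is at least one. -/
theorem tsum_min_geometric_le {D : ℝ} (hD : 1 ≤ D) :
    ∑' i : ℕ, min 1 (ENNReal.ofReal (D * (31 / 32) ^ i)) ≤ ENNReal.ofReal (96 * lg D) := by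
  set L := 32 * ⌈Real.logb 2 D⌉₊ with hL
  have h0 : 0 ≤ Real.logb 2 D := Real.logb_nonneg (by norm_num) hD
  have hDL : D * (31 / 32) ^ L ≤ 1 := by
    have h1 : D ≤ 2 ^ ⌈Real.logb 2 D⌉₊ := by
      rw [← Real.rpow_natCast, ← Real.logb_le_iff_le_rpow (by norm_num) (by linarith)]
      exact Nat.le_ceil _
    have h2 : ((31 / 32 : ℝ) ^ L) ≤ (1 / 2) ^ ⌈Real.logb 2 D⌉₊ := by
      rw [hL, pow_mul]
      gcongr
      norm_num
    calc D * (31 / 32) ^ L ≤ 2 ^ ⌈Real.logb 2 D⌉₊ * (1 / 2) ^ ⌈Real.logb 2 D⌉₊ := by gcongr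
      _ = 1 := by rw [← mul_pow]; norm_num
  rw [← ENNReal.summable.sum_add_tsum_nat_add' (k := L)]
  have h1 : ∑ i ∈ Finset.range L, min 1 (ENNReal.ofReal (D * (31 / 32) ^ i)) ≤
      ENNReal.ofReal L := by
    rw [ENNReal.ofReal_natCast]
    simpa using Finset.sum_le_card_nsmul (Finset.range L)
      (fun i => min 1 (ENNReal.ofReal (D * (31 / 32) ^ i))) 1 fun i _ => min_le_left _ _
  have h2 : ∑' i : ℕ, min 1 (ENNReal.ofReal (D * (31 / 32) ^ (i + L))) ≤ ENNReal.ofReal 32 := by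
    calc _ ≤ ∑' i : ℕ, ENNReal.ofReal ((31 / 32) ^ i) := by
          refine ENNReal.tsum_le_tsum fun i => (min_le_right _ _).trans ?_
          refine ENNReal.ofReal_le_ofReal ?_
          rw [pow_add, mul_left_comm]
          exact mul_le_of_le_one_right (by positivity) hDL
      _ = ENNReal.ofReal (∑' i : ℕ, (31 / 32) ^ i) :=
          (ENNReal.ofReal_tsum_of_nonneg (fun i => by positivity)
            (summable_geometric_of_lt_one (by norm_num) (by norm_num))).symm
      _ = _ := by rw [tsum_geometric_of_lt_one (by norm_num) (by norm_num)]; norm_num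
  refine (add_le_add h1 h2).trans ?_
  rw [← ENNReal.ofReal_add (by positivity) (by norm_num)]
  refine ENNReal.ofReal_le_ofReal ?_
  have h3 := Nat.ceil_lt_add_one h0
  have h4 : Real.logb 2 D ≤ lg D := le_max_right _ _
  have h5 := one_le_lg D
  rw [hL]
  push_cast
  linarith

variable {k : ℕ} {T : Fin k → LTree}

open Classical in
/-- The number of iterations before which there are at least two trees. -/
noncomputable def openTime (a b : ℕ) {k : ℕ} (T : Fin k → LTree) (ω : ℕ → ℕ → Bool) : ℝ≥0∞ :=
  ∑' i, if 2 ≤ (trees a b T ω i).length then 1 else 0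

/-- The total number of trees in all iterations. -/
noncomputable def openWork (a b : ℕ) {k : ℕ} (T : Fin k → LTree) (ω : ℕ → ℕ → Bool) : ℝ≥0∞ :=
  ∑' i, (openCount (trees a b T ω i) : ℝ≥0∞)

theorem length_trees_eq (ha : 2 ≤ a) (hab : 2 * a ≤ b) (hT : ∀ t, IsABTree a b (T t))
    {m : ℕ} (hm : m = ∑ t, (T t).size) (ω : ℕ → ℕ → Bool) (i : ℕ) :
    (valuesOf (trees a b T ω i)).length = m := by
  rw [trees_values ha hab hT, leavesList_eq_flatMap, List.length_flatMap, hm, List.map_ofFn,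
      List.sum_ofFn]; rfl

theorem card_le_sum_size (hT : ∀ t, IsABTree a b (T t)) {m : ℕ} (hm : m = ∑ t, (T t).size) :
    k ≤ m := by
  rw [hm]
  simpa using Finset.card_nsmul_le_sum Finset.univ (fun t => (T t).size) 1
    fun t _ => (hT t).size_pos

theorem lintegral_openCount_le (ha : 2 ≤ a) (hab : 2 * a ≤ b) (hT : ∀ t, IsABTree a b (T t))
    (hk : 0 < k) {m : ℕ} (hm : m = ∑ t, (T t).size) (i : ℕ) :
    ∫⁻ ω, (openCount (trees a b T ω i) : ℝ≥0∞) ∂coins ≤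
      ENNReal.ofReal (k * (17 * (m / k) ^ 2 * (31 / 32) ^ i)) := by
  refine le_trans (le_of_eq ?_)
    (ENNReal.ofReal_le_ofReal (integral_openCount_le ha hab hT hk hm i))
  rw [ofReal_integral_eq_lintegral_ofReal
    (integrable_trees ha hab hT i fun l => (openCount l : ℝ)) (.of_forall fun ω => by positivity)]
  simp

/-- There are never more than k trees, and their expected number decays geometrically; the smaller
of the two bounds is summed. The constant is 672 = 96 * 7, the 7 coming from the factor 17 and the
square inside the logarithm. -/
theorem lintegral_openWork_le (ha : 2 ≤ a) (hab : 2 * a ≤ b) (hT : ∀ t, IsABTree a b (T t))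
    (hk : 0 < k) {m : ℕ} (hm : m = ∑ t, (T t).size) :
    ∫⁻ ω, openWork a b T ω ∂coins ≤ ENNReal.ofReal (672 * (k * lg (m / k))) := by
  have hkm := card_le_sum_size hT hm
  have hk' : (0 : ℝ) < k := by exact_mod_cast hk
  have hy : (1 : ℝ) ≤ m / k := by
    rw [le_div_iff₀ hk', one_mul]; exact_mod_cast hkm
  unfold openWork
  rw [lintegral_tsum fun i => (measurable_trees ha hab hT i
    fun l => (openCount l : ℝ≥0∞)).aemeasurable]
  calc _ ≤ ∑' i : ℕ, (k : ℝ≥0∞) * min 1 (ENNReal.ofReal (17 * (m / k) ^ 2 * (31 / 32) ^ i)) := by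
        refine ENNReal.tsum_le_tsum fun i => ?_
        rw [mul_min, mul_one]
        refine le_min ?_ ?_
        · calc _ ≤ ∫⁻ _, (k : ℝ≥0∞) ∂coins := by
                refine lintegral_mono fun ω => ?_
                exact Nat.cast_le.2 ((openCount_le_length _).trans (trees_pids ha hab hT ω i).2.2)
            _ = k := by simp
        · refine (lintegral_openCount_le ha hab hT hk hm i).trans ?_
          rw [ENNReal.ofReal_mul (by positivity), ENNReal.ofReal_natCast]
    _ ≤ k * ENNReal.ofReal (96 * lg (17 * (m / k) ^ 2)) := by
        rw [ENNReal.tsum_mul_left]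
        gcongr
        exact tsum_min_geometric_le (by nlinarith)
    _ ≤ _ := by
        rw [← ENNReal.ofReal_natCast, ← ENNReal.ofReal_mul (by positivity)]
        refine ENNReal.ofReal_le_ofReal ?_
        have := lg_le_seven hy
        nlinarith

/-- By Markov's inequality the probability that two trees are left is at most the expected number of
trees, counted while there are at least two. -/
theorem lintegral_openTime_le (ha : 2 ≤ a) (hab : 2 * a ≤ b) (hT : ∀ t, IsABTree a b (T t))
    (hk : 0 < k) {m : ℕ} (hm : m = ∑ t, (T t).size) :
    ∫⁻ ω, openTime a b T ω ∂coins ≤ ENNReal.ofReal (672 * lg m) := by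
  have hkm := card_le_sum_size hT hm
  have hk' : (1 : ℝ) ≤ k := by exact_mod_cast hk
  have hm' : (1 : ℝ) ≤ m := by exact_mod_cast hk.trans_le hkm
  unfold openTime
  rw [lintegral_tsum fun i => (measurable_trees ha hab hT i
    fun l => if 2 ≤ l.length then (1 : ℝ≥0∞) else 0).aemeasurable]
  calc _ ≤ ∑' i : ℕ, min 1 (ENNReal.ofReal (17 * m ^ 2 * (31 / 32) ^ i)) := by
        refine ENNReal.tsum_le_tsum fun i => le_min ?_ ?_
        · calc _ ≤ ∫⁻ _, (1 : ℝ≥0∞) ∂coins := by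
                refine lintegral_mono fun ω => ?_
                split_ifs <;> simp
            _ = 1 := by simp
        · calc _ ≤ ∫⁻ ω, (openCount (trees a b T ω i) : ℝ≥0∞) ∂coins := by
                refine lintegral_mono fun ω => ?_
                dsimp only
                unfold openCount
                split_ifs with h
                · exact_mod_cast le_trans (by norm_num) h
                · simp
            _ ≤ _ := (lintegral_openCount_le ha hab hT hk hm i).trans ?_
          refine ENNReal.ofReal_le_ofReal ?_
          rw [← mul_assoc]
          refine mul_le_mul_of_nonneg_right ?_ (by positivity)
          -- The leading k cancels against one of the two factors k in the denominator; what remains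
          -- is at most 17 m^2.
          rw [div_pow, show (k : ℝ) * (17 * ((m : ℝ) ^ 2 / k ^ 2)) = 17 * m ^ 2 / k by
            field_simp]
          exact div_le_self (by positivity) hk'
    _ ≤ ENNReal.ofReal (96 * lg (17 * m ^ 2)) := tsum_min_geometric_le (by nlinarith)
    _ ≤ _ := by
        refine ENNReal.ofReal_le_ofReal ?_
        have := lg_le_seven hm'
        linarith

theorem openTime_ge {ω : ℕ → ℕ → Bool} {n : ℕ}
    (h : ∀ i < n, 2 ≤ (trees a b T ω i).length) : (n : ℝ≥0∞) ≤ openTime a b T ω := by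
  refine le_trans ?_ (ENNReal.sum_le_tsum (Finset.range n))
  rw [Finset.sum_congr rfl fun i hi => if_pos (h i (Finset.mem_range.1 hi))]
  simp

theorem openTime_eq_top {ω : ℕ → ℕ → Bool} (h : ∀ i, 2 ≤ (trees a b T ω i).length) :
    openTime a b T ω = ⊤ := by
  unfold openTime
  simp only [h, if_true]
  exact ENNReal.tsum_const_eq_top_of_ne_zero one_ne_zero

theorem openTime_le_openWork (ω : ℕ → ℕ → Bool) : openTime a b T ω ≤ openWork a b T ω := by
  refine ENNReal.tsum_le_tsum fun i => ?_
  unfold openCount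
  split_ifs with h
  · exact_mod_cast le_trans (by norm_num) h
  · simp

theorem numIterations_le (ω : ℕ → ℕ → Bool) :
    (numIterations a b T ω : ℝ≥0∞) ≤ openTime a b T ω := by
  classical
  by_cases h : ∃ i, (trees a b T ω i).length ≤ 1
  · have h1 : numIterations a b T ω ≤ (Nat.find h : ℕ∞) :=
      iInf₂_le (f := fun (i : ℕ) (_ : (trees a b T ω i).length ≤ 1) => (i : ℕ∞)) _
        (Nat.find_spec h)
    have h2 : (numIterations a b T ω : ℝ≥0∞) ≤ (Nat.find h : ℕ) := by
      simpa using ENat.toENNReal_le.2 h1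
    refine h2.trans (openTime_ge fun i hi => ?_)
    have := Nat.find_min h hi
    omega
  · push Not at h
    rw [openTime_eq_top fun i => h i]
    exact le_top

/-- The sequence never becomes empty, because it keeps storing all m ≥ k > 0 values. -/
theorem exists_trees_eq_singleton (ha : 2 ≤ a) (hab : 2 * a ≤ b) (hT : ∀ t, IsABTree a b (T t))
    (hk : 0 < k) {ω : ℕ → ℕ → Bool} (h : openTime a b T ω ≠ ⊤) :
    ∃ i e, trees a b T ω i = [e] := by
  by_contra! hc
  refine h (openTime_eq_top fun i => ?_)
  have hm := length_trees_eq ha hab hT rfl ω i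
  have hkm := card_le_sum_size hT rfl
  rcases h : trees a b T ω i with _ | ⟨e, _ | ⟨f, l⟩⟩
  · rw [h] at hm; simp [valuesOf] at hm; omega
  · exact absurd h (hc i e)
  · simp


/-! ### Programs without loops: one processor at a time -/

/-- The value of an expression for processor `p` of `k` with registers `ρ`. -/
def Expr.val (k p : ℕ) (ρ : ℕ → ℕ) : Expr → ℕ
  | .const n => n
  | .reg x => ρ x
  | .pid => p
  | .nprocs => k
  | .add e f => e.val k p ρ + f.val k p ρ
  | .sub e f => e.val k p ρ - f.val k p ρ

/-- The memory `μ` with a new word in one cell. -/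
def put (μ : ℕ → ℕ → ℕ) (v i x : ℕ) : ℕ → ℕ → ℕ :=
  fun v' i' => if v' = v ∧ i' = i then x else μ v' i'

/-- The memory together with the registers of one processor. -/
abbrev Loc : Type := (ℕ → ℕ → ℕ) × (ℕ → ℕ)

namespace Cmd

/-- The result of a program without loops, when it is executed by processor `p` alone. -/
def run (k p : ℕ) : Cmd → Loc → Loc
  | skip, s => s
  | assign x e, s => (s.1, Function.update s.2 x (e.val k p s.2))
  | load x e f, s => (s.1, Function.update s.2 x (s.1 (e.val k p s.2) (f.val k p s.2)))
  | store e f g, s => (put s.1 (e.val k p s.2) (f.val k p s.2) (g.val k p s.2), s.2)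
  | coin _, s => s
  | seq c d, s => run k p d (run k p c s)
  | ite e c d, s => if e.val k p s.2 = 0 then run k p d s else run k p c s
  | loop _ _, s => s

/-- A program without loops and random bits reads, when executed by processor `p` alone, only from
records in `R` and writes only to records in `W`. -/
def Safe (R W : Set ℕ) (k p : ℕ) : Cmd → Loc → Prop
  | skip, _ => True
  | assign _ _, _ => True
  | load _ e _, s => e.val k p s.2 ∈ R
  | store e _ _, s => e.val k p s.2 ∈ W
  | coin _, _ => False
  | seq c d, s => Safe R W k p c s ∧ Safe R W k p d (run k p c s)
  | ite e c d, s => if e.val k p s.2 = 0 then Safe R W k p d s else Safe R W k p c s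
  | loop _ _, _ => False

/-- Programs without loops and random bits. -/
def Simple : Cmd → Prop
  | coin _ => False
  | loop _ _ => False
  | seq c d => Simple c ∧ Simple d
  | ite _ c d => Simple c ∧ Simple d
  | _ => True

/-- The running time of a program without loops. -/
def cost : Cmd → ℕ
  | seq c d => cost c + cost d
  | ite _ c d => 1 + cost c + cost d
  | _ => 1

end Cmd

-- Simultaneous execution as independent executions by single processors.

open Cmd

theorem Expr.eval_eq_val {k : ℕ} (σ : State k) (p : Fin k) (e : Expr) :
    e.eval σ p = e.val k p (σ.regs p) := by
  induction e with
  | const n => rfl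
  | reg x => rfl
  | pid => rfl
  | nprocs => rfl
  | add e f he hf => simp [Expr.eval, Expr.val, he, hf]
  | sub e f he hf => simp [Expr.eval, Expr.val, he, hf]

theorem put_of_ne {μ : ℕ → ℕ → ℕ} {v v' : ℕ} (h : v' ≠ v) (i x : ℕ) : put μ v i x v' = μ v' := by
  funext i'; simp [put, h]

theorem run_frame {R W : Set ℕ} {k p : ℕ} (c : Cmd) {s : Loc} (h : Safe R W k p c s) {v : ℕ}
    (hv : v ∉ W) : (run k p c s).1 v = s.1 v := by
  induction c generalizing s with
  | store e f g =>
    refine put_of_ne ?_ _ _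
    rintro rfl
    exact hv h
  | seq c d hc hd => exact (hd h.2).trans (hc h.1)
  | ite e c d hc hd =>
    simp only [Safe] at h
    simp only [run]
    split_ifs at h ⊢
    exacts [hd h, hc h]
  | _ => rfl

/-- A safe execution depends on the registers and on the records in `R` only. In a simultaneous
execution a processor finds a memory about which nothing else is known. -/
theorem run_congr {R W : Set ℕ} {k p : ℕ} (c : Cmd) {s s' : Loc}
    (h : Safe R W k p c s) (hr : s'.2 = s.2) (hm : ∀ v ∈ R, s'.1 v = s.1 v) :
    Safe R W k p c s' ∧ (run k p c s').2 = (run k p c s).2 ∧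
      ∀ v ∈ R, (run k p c s').1 v = (run k p c s).1 v := by
  induction c generalizing s s' with
  | skip => exact ⟨trivial, hr, hm⟩
  | assign x e => exact ⟨trivial, by simp [run, hr], hm⟩
  | load x e f =>
    simp only [Safe] at h ⊢
    rw [hr]
    refine ⟨h, ?_, hm⟩
    simp only [run, hr, hm _ h]
  | store e f g =>
    simp only [Safe] at h ⊢
    simp only [run]
    rw [hr]
    refine ⟨h, rfl, fun v hv => ?_⟩
    funext i
    simp only [put, hm v hv]
  | coin x => exact h.elim
  | seq c d hc hd =>
    obtain ⟨h1, h2, h3⟩ := hc h.1 hr hm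
    obtain ⟨h4, h5, h6⟩ := hd h.2 h2 h3
    exact ⟨⟨h1, h4⟩, h5, h6⟩
  | ite e c d hc hd =>
    simp only [Safe] at h ⊢
    simp only [run]
    rw [hr]
    split_ifs at h ⊢
    exacts [hd h hr hm, hc h hr hm]
  | loop e c => exact h.elim

/-! ### Simultaneous execution without interference -/

/-- `Apart R W`: processor `p` reads from the records in `R p` and writes to those in `W p`, and none
of the processors writes to a record from which another one reads. -/
structure Apart {k : ℕ} (R W : Fin k → Set ℕ) : Prop where
  sub : ∀ p, W p ⊆ R p
  disj : ∀ p q, p ≠ q → ∀ v, v ∈ R p → v ∉ W q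

/-- From `σ` to `σ'`, every processor in `A` has executed `c` on its own records. -/
structure Outcome {k : ℕ} (R W : Fin k → Set ℕ) (c : Cmd) (A : Finset (Fin k)) (σ σ' : State k) :
    Prop where
  regs : ∀ p ∈ A, σ'.regs p = (run k p c (σ.mem, σ.regs p)).2
  mem : ∀ p ∈ A, ∀ v ∈ R p, σ'.mem v = (run k p c (σ.mem, σ.regs p)).1 v
  regs_of_notMem : ∀ p ∉ A, σ'.regs p = σ.regs p
  mem_of_notMem : ∀ v, (∀ p ∈ A, v ∉ W p) → σ'.mem v = σ.mem v
  draws : σ'.draws = σ.draws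

/-- No processor reads what another one writes, so in lockstep each of them sees on its own records
exactly what it would see alone. This also yields exclusive writing. Both branches of a conditional
are executed one after the other, which is why their costs add up in the time. -/
theorem exec_of_safe {k : ℕ} (ω : ℕ → ℕ → Bool) {R W : Fin k → Set ℕ} (hRW : Apart R W) (c : Cmd)
    (hs : Simple c) (A : Finset (Fin k)) (σ : State k) (h : ∀ p ∈ A, Safe (R p) (W p) k p c (σ.mem, σ.regs p)) :
    ∃ σ' t w, Exec ω c A σ σ' t w ∧ t ≤ cost c ∧ w ≤ cost c * A.card ∧
      Outcome R W c A σ σ' := by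
  induction c generalizing A σ with
  | skip =>
    exact ⟨σ, _, _, .skip A σ, le_rfl, by simp [cost], fun p _ => rfl, fun p _ v _ => rfl,
      fun p _ => rfl, fun v _ => rfl, rfl⟩
  | assign x e =>
    refine ⟨_, _, _, .assign x e A σ, le_rfl, by simp [cost], fun p hp => ?_, fun p _ v _ => rfl,
      fun p hp => ?_, fun v _ => rfl, rfl⟩
    · funext y
      simp [State.setReg, hp, run, Function.update_apply, Expr.eval_eq_val]
    · funext y
      simp [State.setReg, hp]
  | load x e f =>
    refine ⟨_, _, _, .load x e f A σ, le_rfl, by simp [cost], fun p hp => ?_, fun p _ v _ => rfl,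
      fun p hp => ?_, fun v _ => rfl, rfl⟩
    · funext y
      simp [State.setReg, hp, run, Function.update_apply, Expr.eval_eq_val]
    · funext y
      simp [State.setReg, hp]
  | store e f g =>
    have hW : ∀ p ∈ A, e.eval σ p ∈ W p := fun p hp => by
      rw [Expr.eval_eq_val]; exact h p hp
    -- A write into a record that `p` may read can only be the write of `p` itself. Write conflicts
    -- are excluded by the same argument, since records written are among those read.
    have heq : ∀ p q, q ∈ A → e.eval σ q ∈ R p → q = p := fun p q hq hv => by
      by_contra hne
      exact hRW.disj p q (Ne.symm hne) _ hv (hW q hq)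
    refine ⟨_, _, _, .store e f g A σ ?_, le_rfl, by simp [cost], fun p _ => rfl,
      fun p hp v hv => ?_, fun p _ => rfl, fun v hv => ?_, rfl⟩
    · intro p hp q hq hpq
      simp only [State.cell, Prod.mk.injEq] at hpq
      exact heq q p hp (hpq.1 ▸ hRW.sub q (hW q hq))
    · funext i
      simp only [State.write, run, put]
      split_ifs with h1 h2 h2
      · obtain ⟨hq, hc⟩ := h1.choose_spec
        have hv' : e.eval σ h1.choose ∈ R p := Set.mem_of_eq_of_mem (congrArg Prod.fst hc) hv
        rw [heq p _ hq hv', Expr.eval_eq_val]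
      · obtain ⟨q, hq, hc⟩ := h1
        simp only [State.cell, Prod.mk.injEq] at hc
        obtain rfl := heq p _ hq (hc.1 ▸ hv)
        simp only [Expr.eval_eq_val] at hc
        exact absurd ⟨hc.1.symm, hc.2.symm⟩ h2
      · refine absurd ⟨p, hp, ?_⟩ h1
        simp only [State.cell, Prod.mk.injEq, Expr.eval_eq_val]
        exact ⟨h2.1.symm, h2.2.symm⟩
      · rfl
    · funext i
      simp only [State.write]
      rw [dif_neg]
      rintro ⟨p, hp, hc⟩
      simp only [State.cell, Prod.mk.injEq] at hc
      exact hv p hp (hc.1 ▸ hW p hp)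
  | coin x => exact hs.elim
  | seq c d hc hd =>
    obtain ⟨σ₁, t₁, w₁, e₁, ht₁, hw₁, o₁⟩ := hc hs.1 A σ fun p hp => (h p hp).1
    have key := fun p hp => run_congr d (s' := (σ₁.mem, σ₁.regs p)) (h p hp).2
      (o₁.regs p hp) (o₁.mem p hp)
    obtain ⟨σ₂, t₂, w₂, e₂, ht₂, hw₂, o₂⟩ := hd hs.2 A σ₁ fun p hp => (key p hp).1
    refine ⟨σ₂, _, _, .seq c d A σ σ₁ σ₂ _ _ _ _ e₁ e₂, by simp only [cost]; omega,
      by simp only [cost]; rw [add_mul]; omega, fun p hp => ?_, fun p hp v hv => ?_,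
      fun p hp => ?_, fun v hv => ?_, ?_⟩
    · rw [o₂.regs p hp, (key p hp).2.1]; rfl
    · rw [o₂.mem p hp v hv, (key p hp).2.2 v hv]; rfl
    · rw [o₂.regs_of_notMem p hp, o₁.regs_of_notMem p hp]
    · rw [o₂.mem_of_notMem v hv, o₁.mem_of_notMem v hv]
    · rw [o₂.draws, o₁.draws]
  | ite e c d hc hd =>
    simp only [Safe] at h
    obtain ⟨σ₁, t₁, w₁, e₁, ht₁, hw₁, o₁⟩ := hc hs.1 (A.filter fun p => e.eval σ p ≠ 0) σ
      fun p hp => by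
        rw [Finset.mem_filter, Expr.eval_eq_val] at hp
        have := h p hp.1
        rwa [if_neg hp.2] at this
    -- When the second branch starts, the processors of the first branch have already changed the
    -- memory, but not where the waiting processors read.
    have hmem : ∀ p ∈ A.filter fun p => e.eval σ p = 0, ∀ v ∈ R p, σ₁.mem v = σ.mem v :=
      fun p hp v hv => o₁.mem_of_notMem v fun q hq => hRW.disj p q (by
        rintro rfl
        rw [Finset.mem_filter] at hp hq
        exact hq.2 hp.2) v hv
    have key := fun p (hp : p ∈ A.filter fun p => e.eval σ p = 0) =>
      run_congr d (s := (σ.mem, σ.regs p)) (s' := (σ₁.mem, σ₁.regs p)) (by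
        rw [Finset.mem_filter, Expr.eval_eq_val] at hp
        have := h p hp.1
        rwa [if_pos hp.2] at this) (o₁.regs_of_notMem p (by simp_all)) (hmem p hp)
    obtain ⟨σ₂, t₂, w₂, e₂, ht₂, hw₂, o₂⟩ := hd hs.2 (A.filter fun p => e.eval σ p = 0) σ₁
      fun p hp => (key p hp).1
    refine ⟨σ₂, _, _, .ite e c d A σ σ₁ σ₂ _ _ _ _ e₁ e₂, by simp only [cost]; omega, ?_,
      fun p hp => ?_, fun p hp v hv => ?_, fun p hp => ?_, fun v hv => ?_, ?_⟩
    · have h1 := Finset.card_filter_le A fun p => e.eval σ p ≠ 0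
      have h2 := Finset.card_filter_le A fun p => e.eval σ p = 0
      have h3 := hw₁.trans (Nat.mul_le_mul_left _ h1)
      have h4 := hw₂.trans (Nat.mul_le_mul_left _ h2)
      simp only [cost, add_mul]
      omega
    · by_cases h0 : e.val k p (σ.regs p) = 0
      · have hp' : p ∈ A.filter fun p => e.eval σ p = 0 := by simp [hp, Expr.eval_eq_val, h0]
        rw [o₂.regs p hp', (key p hp').2.1]
        simp [run, h0]
      · rw [o₂.regs_of_notMem p (by simp [Expr.eval_eq_val, h0]),
          o₁.regs p (by simp [hp, Expr.eval_eq_val, h0])]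
        simp [run, h0]
    · by_cases h0 : e.val k p (σ.regs p) = 0
      · have hp' : p ∈ A.filter fun p => e.eval σ p = 0 := by simp [hp, Expr.eval_eq_val, h0]
        rw [o₂.mem p hp' v hv, (key p hp').2.2 v hv]
        simp [run, h0]
      · rw [o₂.mem_of_notMem v fun q hq => hRW.disj p q (by
            rintro rfl
            simp [Expr.eval_eq_val, h0] at hq) v hv,
          o₁.mem p (by simp [hp, Expr.eval_eq_val, h0]) v hv]
        simp [run, h0]
    · rw [o₂.regs_of_notMem p (by simp [hp]), o₁.regs_of_notMem p (by simp [hp])]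
    · rw [o₂.mem_of_notMem v fun p hp => hv p (Finset.mem_filter.1 hp).1,
        o₁.mem_of_notMem v fun p hp => hv p (Finset.mem_filter.1 hp).1]
    · rw [o₂.draws, o₁.draws]
  | loop e c => exact hs.elim

/-! ### Preconditions of programs without loops -/

/-- Processor `p` may execute `c` alone, and afterwards `Q` holds. -/
def wp (R W : Set ℕ) (k p : ℕ) (c : Cmd) (Q : Loc → Prop) (s : Loc) : Prop :=
  Safe R W k p c s ∧ Q (run k p c s)

section wp

variable {R W : Set ℕ} {k p : ℕ} {Q : Loc → Prop}

@[simp] theorem wp_skip {s : Loc} : wp R W k p .skip Q s ↔ Q s := by simp [wp, Safe, run]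

@[simp] theorem wp_assign {x : ℕ} {e : Expr} {s : Loc} :
    wp R W k p (.assign x e) Q s ↔ Q (s.1, Function.update s.2 x (e.val k p s.2)) := by
  simp [wp, Safe, run]

@[simp] theorem wp_load {x : ℕ} {e f : Expr} {s : Loc} :
    wp R W k p (.load x e f) Q s ↔ e.val k p s.2 ∈ R ∧
      Q (s.1, Function.update s.2 x (s.1 (e.val k p s.2) (f.val k p s.2))) := by
  simp [wp, Safe, run]

@[simp] theorem wp_store {e f g : Expr} {s : Loc} :
    wp R W k p (.store e f g) Q s ↔ e.val k p s.2 ∈ W ∧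
      Q (put s.1 (e.val k p s.2) (f.val k p s.2) (g.val k p s.2), s.2) := by
  simp [wp, Safe, run]

@[simp] theorem wp_seq {c d : Cmd} {s : Loc} :
    wp R W k p (.seq c d) Q s ↔ wp R W k p c (wp R W k p d Q) s := by
  simp [wp, Safe, run, and_assoc]

@[simp] theorem wp_ite {e : Expr} {c d : Cmd} {s : Loc} :
    wp R W k p (.ite e c d) Q s ↔
      if e.val k p s.2 = 0 then wp R W k p d Q s else wp R W k p c Q s := by
  simp only [wp, Safe, run]
  split_ifs <;> rfl

theorem wp.mono {c : Cmd} {Q' : Loc → Prop} {s : Loc} (h : wp R W k p c Q s)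
    (hQ : ∀ s, Q s → Q' s) : wp R W k p c Q' s := ⟨h.1, hQ _ h.2⟩

theorem wp.frame {c : Cmd} {s : Loc} (h : wp R W k p c Q s) :
    wp R W k p c (fun s' => Q s' ∧ ∀ v ∉ W, s'.1 v = s.1 v) s :=
  ⟨h.1, h.2, fun _ hv => run_frame c h.1 hv⟩

end wp

/-! ### Loops -/

/-- On its registers and on the records that it reads, processor `p` finds the state `s`. -/
def View {k : ℕ} (R : Fin k → Set ℕ) (p : Fin k) (σ : State k) (s : Loc) : Prop :=
  σ.regs p = s.2 ∧ ∀ v ∈ R p, σ.mem v = s.1 v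

/-- The variant `n p` is the exact number of rounds that processor `p` still has to do, and it
differs between processors: the time is governed by the maximum, the work by the sum. The invariant
speaks of a private state `s`, of which the machine realises only the registers and the records in
`R p`. -/
theorem exec_loop {k : ℕ} (ω : ℕ → ℕ → Bool) {R W : Fin k → Set ℕ} (hRW : Apart R W) (e : Expr)
    (c : Cmd) (hs : Simple c) (I : Fin k → ℕ → Loc → Prop)
    (hstep : ∀ p n s, I p (n + 1) s → e.val k p s.2 ≠ 0 ∧ wp (R p) (W p) k p c (I p n) s)
    (hzero : ∀ p s, I p 0 s → e.val k p s.2 = 0) (N : ℕ) (A : Finset (Fin k)) (n : Fin k → ℕ)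
    (σ : State k) (hN : ∀ p ∈ A, n p ≤ N) (hI : ∀ p ∈ A, ∃ s, View R p σ s ∧ I p (n p) s) :
    ∃ σ' t w, Exec ω (.loop e c) A σ σ' t w ∧ t ≤ N * (cost c + 1) + 1 + Nat.clog 2 k ∧
      w ≤ ∑ p ∈ A, (n p + 1) * (cost c + 1) ∧
      (∀ p ∈ A, ∃ s, View R p σ' s ∧ I p 0 s) ∧ (∀ p ∉ A, σ'.regs p = σ.regs p) ∧
      (∀ v, (∀ p ∈ A, v ∉ W p) → σ'.mem v = σ.mem v) ∧ σ'.draws = σ.draws := by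
  have hcond : ∀ p ∈ A, e.eval σ p = 0 ↔ n p = 0 := fun p hp => by
    obtain ⟨s, hv, hi⟩ := hI p hp
    rw [Expr.eval_eq_val, hv.1]
    rcases h : n p with _ | j
    · rw [h] at hi; simp [hzero p s hi]
    · rw [h] at hi; simp [(hstep p j s hi).1]
  induction N generalizing A n σ with
  | zero =>
    have h0 : ∀ p ∈ A, n p = 0 := fun p hp => Nat.le_zero.1 (hN p hp)
    refine ⟨σ, _, _, .loopExit e c A σ fun p hp => (hcond p hp).2 (h0 p hp), by omega, ?_,
      fun p hp => ?_, fun p _ => rfl, fun v _ => rfl, rfl⟩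
    · simpa using Finset.card_nsmul_le_sum A (fun p => (n p + 1) * (cost c + 1)) 1
        fun p _ => Nat.mul_pos (by omega) (by omega)
    · have := hI p hp
      rwa [h0 p hp] at this
  | succ N ih =>
    by_cases hex : ∃ p ∈ A, e.eval σ p ≠ 0
    · set A' := A.filter fun p => e.eval σ p ≠ 0 with hA'
      have hmem : ∀ p, p ∈ A' ↔ p ∈ A ∧ n p ≠ 0 := fun p => by
        rw [hA', Finset.mem_filter]
        exact and_congr_right fun hp => not_congr (hcond p hp)
      have hwp : ∀ p ∈ A', wp (R p) (W p) k p c (fun s => ∃ s', I p (n p - 1) s' ∧ s.2 = s'.2 ∧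
          ∀ v ∈ R p, s.1 v = s'.1 v) (σ.mem, σ.regs p) := fun p hp => by
        obtain ⟨hpA, hn⟩ := (hmem p).1 hp
        obtain ⟨s, hv, hi⟩ := hI p hpA
        obtain ⟨j, hj⟩ := Nat.exists_eq_succ_of_ne_zero hn
        rw [hj] at hi
        obtain ⟨-, h1, h2⟩ := hstep p j s hi
        -- The invariant is known for the private state; the step of the machine starts from a
        -- memory that agrees with it on `R p` only.
        obtain ⟨h3, h4, h5⟩ := run_congr c (s' := (σ.mem, σ.regs p)) h1 hv.1 hv.2
        exact ⟨h3, _, by rw [hj]; exact h2, h4, h5⟩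
      obtain ⟨σ₁, t₁, w₁, e₁, ht₁, hw₁, o₁⟩ := exec_of_safe ω hRW c hs A' σ fun p hp => (hwp p hp).1
      have hI₁ : ∀ p ∈ A', ∃ s, View R p σ₁ s ∧ I p (n p - 1) s := fun p hp => by
        obtain ⟨-, s', h1, h2, h3⟩ := hwp p hp
        exact ⟨s', ⟨(o₁.regs p hp).trans h2, fun v hv => (o₁.mem p hp v hv).trans (h3 v hv)⟩, h1⟩
      obtain ⟨σ₂, t₂, w₂, e₂, ht₂, hw₂, i₂, r₂, m₂, d₂⟩ := ih A' (fun p => n p - 1) σ₁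
        (fun p hp => by have := hN p ((hmem p).1 hp).1; omega) hI₁ (fun p hp => by
          obtain ⟨s, hv, hi⟩ := hI₁ p hp
          rw [Expr.eval_eq_val, hv.1]
          rcases h : n p - 1 with _ | j
          · rw [h] at hi; simp [hzero p s hi]
          · rw [h] at hi; simp [(hstep p j s hi).1])
      refine ⟨σ₂, _, _, .loopStep e c A σ σ₁ σ₂ _ _ _ _ hex e₁ e₂, ?_, ?_, fun p hp => ?_,
        fun p hp => ?_, fun v hv => ?_, ?_⟩
      · rw [add_mul]; omega
      · have h1 : ∑ p ∈ A', (n p - 1 + 1) * (cost c + 1) ≤ ∑ p ∈ A', n p * (cost c + 1) :=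
          Finset.sum_le_sum fun p hp => by
            have := ((hmem p).1 hp).2
            rw [Nat.sub_add_cancel (by omega)]
        have h2 : ∑ p ∈ A', n p * (cost c + 1) ≤ ∑ p ∈ A, n p * (cost c + 1) :=
          Finset.sum_le_sum_of_subset (Finset.filter_subset _ _)
        have h3 : cost c * A'.card ≤ cost c * A.card :=
          Nat.mul_le_mul_left _ (Finset.card_filter_le _ _)
        simp only [add_mul, one_mul, Finset.sum_add_distrib, Finset.sum_const, smul_eq_mul,
          mul_one, mul_comm A.card] at h1 h2 hw₂ ⊢
        omega
      · by_cases hp' : p ∈ A'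
        · exact i₂ p hp'
        · have hn : n p = 0 := by
            by_contra h
            exact hp' ((hmem p).2 ⟨hp, h⟩)
          obtain ⟨s, hv, hi⟩ := hI p hp
          rw [hn] at hi
          -- A processor that has left the loop keeps its invariant while the others go on, because
          -- they do not write where it reads.
          have hq : ∀ v ∈ R p, ∀ q ∈ A', v ∉ W q := fun v hv q hq =>
            hRW.disj p q (by rintro rfl; exact hp' hq) v hv
          refine ⟨s, ⟨?_, fun v hvR => ?_⟩, hi⟩
          · rw [r₂ p hp', o₁.regs_of_notMem p hp', hv.1]
          · rw [m₂ v (hq v hvR), o₁.mem_of_notMem v (hq v hvR), hv.2 v hvR]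
      · have hp' : p ∉ A' := fun h => hp ((hmem p).1 h).1
        rw [r₂ p hp', o₁.regs_of_notMem p hp']
      · have hq : ∀ q ∈ A', v ∉ W q := fun q hq => hv q ((hmem q).1 hq).1
        rw [m₂ v hq, o₁.mem_of_notMem v hq]
      · rw [d₂, o₁.draws]
    · push Not at hex
      refine ⟨σ, _, _, .loopExit e c A σ hex, by omega, ?_,
        fun p hp => ?_, fun p _ => rfl, fun v _ => rfl, rfl⟩
      · simpa using Finset.card_nsmul_le_sum A (fun p => (n p + 1) * (cost c + 1)) 1
          fun p _ => Nat.mul_pos (by omega) (by omega)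
      · have := hI p hp
        rwa [(hcond p hp).1 (hex p hp)] at this


/-! ### Trees in memory -/

/-- The tree of height `r` whose root is record `v`. -/
def treeAt (μ : ℕ → ℕ → ℕ) : ℕ → ℕ → LTree
  | 0, v => leaf (μ v 1)
  | r + 1, v => node ((List.range (μ v 0)).map fun j => treeAt μ r (μ v (2 * j + 1)))

/-- The records of the tree of height `r` whose root is record `v`. -/
def recsAt (μ : ℕ → ℕ → ℕ) : ℕ → ℕ → Multiset ℕ
  | 0, v => {v}
  | r + 1, v => v ::ₘ ∑ j ∈ Finset.range (μ v 0), recsAt μ r (μ v (2 * j + 1))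

/-- The bounds of the key intervals of `n` children, where `F` lists the fields of a node. -/
def bnd (n : ℕ) (F : ℕ → ℕ) (lo hi j : ℕ) : ℕ :=
  if j = 0 then lo else if j = n then hi else F (2 * j)

/-- The tree of height `r` at record `v` is a search tree with values between `lo` and `hi`. -/
def Ordered (μ : ℕ → ℕ → ℕ) : ℕ → ℕ → ℕ → ℕ → Prop
  | 0, v, lo, hi => μ v 0 = 0 ∧ lo ≤ μ v 1 ∧ μ v 1 ≤ hi
  | r + 1, v, lo, hi => 0 < μ v 0 ∧ ∀ j < μ v 0, Ordered μ r (μ v (2 * j + 1))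
      (bnd (μ v 0) (μ v) lo hi j) (bnd (μ v 0) (μ v) lo hi (j + 1))

/-- The trees below a node of degree `n` with fields `F`. -/
def kids (μ : ℕ → ℕ → ℕ) (r n : ℕ) (F : ℕ → ℕ) : List LTree :=
  (List.range n).map fun j => treeAt μ r (F (2 * j + 1))

/-- The records below a node of degree `n` with fields `F`. -/
def recsKids (μ : ℕ → ℕ → ℕ) (r n : ℕ) (F : ℕ → ℕ) : Multiset ℕ :=
  ∑ j ∈ Finset.range n, recsAt μ r (F (2 * j + 1))

/-- The trees below a node of degree `n` with fields `F` are search trees with values in the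
intervals that the keys of the node define. -/
def OrdKids (μ : ℕ → ℕ → ℕ) (r n : ℕ) (F : ℕ → ℕ) (lo hi : ℕ) : Prop :=
  0 < n ∧ ∀ j < n, Ordered μ r (F (2 * j + 1)) (bnd n F lo hi j) (bnd n F lo hi (j + 1))

-- Locality of trees in memory, and the layout of a node.

section

variable {μ μ' : ℕ → ℕ → ℕ} {r : ℕ}

theorem treeAt_succ (v : ℕ) : treeAt μ (r + 1) v = node (kids μ r (μ v 0) (μ v)) := rfl

theorem recsAt_succ (v : ℕ) : recsAt μ (r + 1) v = v ::ₘ recsKids μ r (μ v 0) (μ v) := rfl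

theorem ordered_succ {v lo hi : ℕ} :
    Ordered μ (r + 1) v lo hi ↔ OrdKids μ r (μ v 0) (μ v) lo hi := Iff.rfl

@[simp] theorem length_kids (n : ℕ) (F : ℕ → ℕ) : (kids μ r n F).length = n := by simp [kids]

theorem self_mem_recsAt (r v : ℕ) : v ∈ recsAt μ r v := by
  cases r <;> simp [recsAt]

theorem mem_recsKids {n : ℕ} {F : ℕ → ℕ} {w : ℕ} :
    w ∈ recsKids μ r n F ↔ ∃ j < n, w ∈ recsAt μ r (F (2 * j + 1)) := by
  simp [recsKids, Multiset.mem_sum]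

/-- A tree in memory is determined by its own records; in particular the records themselves, which
are found by following pointers, do not change. The three parts share one induction. -/
theorem frame_aux (r v : ℕ) (h : ∀ w ∈ recsAt μ r v, μ' w = μ w) :
    treeAt μ' r v = treeAt μ r v ∧ recsAt μ' r v = recsAt μ r v ∧
      ∀ lo hi, Ordered μ' r v lo hi ↔ Ordered μ r v lo hi := by
  induction r generalizing v with
  | zero =>
    have := h v (self_mem_recsAt 0 v)
    simp [treeAt, recsAt, Ordered, this]
  | succ r ih =>
    have hv := h v (self_mem_recsAt _ v)
    have ih : ∀ j < μ v 0, _ := fun j hj => ih (μ v (2 * j + 1)) fun w hw =>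
      h w (Multiset.mem_cons_of_mem (mem_recsKids.2 ⟨j, hj, hw⟩))
    refine ⟨?_, ?_, fun lo hi => ?_⟩
    · simp only [treeAt, hv]
      congr 1
      exact List.map_congr_left fun j hj => (ih j (List.mem_range.1 hj)).1
    · simp only [recsAt, hv]
      congr 1
      exact Finset.sum_congr rfl fun j hj => (ih j (Finset.mem_range.1 hj)).2.1
    · simp only [Ordered, hv]
      exact and_congr_right fun _ => forall₂_congr fun j hj => (ih j hj).2.2 _ _

theorem treeAt_frame {v : ℕ} (h : ∀ w ∈ recsAt μ r v, μ' w = μ w) :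
    treeAt μ' r v = treeAt μ r v := (frame_aux r v h).1

theorem recsAt_frame {v : ℕ} (h : ∀ w ∈ recsAt μ r v, μ' w = μ w) :
    recsAt μ' r v = recsAt μ r v := (frame_aux r v h).2.1

theorem ordered_frame {v lo hi : ℕ} (h : ∀ w ∈ recsAt μ r v, μ' w = μ w) :
    Ordered μ' r v lo hi ↔ Ordered μ r v lo hi := (frame_aux r v h).2.2 lo hi

theorem kids_frame {n : ℕ} {F : ℕ → ℕ} (h : ∀ w ∈ recsKids μ r n F, μ' w = μ w) :
    kids μ' r n F = kids μ r n F :=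
  List.map_congr_left fun j hj => treeAt_frame fun w hw =>
    h w (mem_recsKids.2 ⟨j, List.mem_range.1 hj, hw⟩)

theorem recsKids_frame {n : ℕ} {F : ℕ → ℕ} (h : ∀ w ∈ recsKids μ r n F, μ' w = μ w) :
    recsKids μ' r n F = recsKids μ r n F :=
  Finset.sum_congr rfl fun j hj => recsAt_frame fun w hw =>
    h w (mem_recsKids.2 ⟨j, Finset.mem_range.1 hj, hw⟩)

theorem ordKids_frame {n : ℕ} {F : ℕ → ℕ} {lo hi : ℕ}
    (h : ∀ w ∈ recsKids μ r n F, μ' w = μ w) :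
    OrdKids μ' r n F lo hi ↔ OrdKids μ r n F lo hi :=
  and_congr_right fun _ => forall₂_congr fun j hj => ordered_frame fun w hw =>
    h w (mem_recsKids.2 ⟨j, hj, hw⟩)

/-- For a node of degree n only the fields 1, ..., 2n - 1 count, alternately pointers and keys.
Whatever lies beyond may be garbage, which allows copying a fixed number of fields. -/
theorem kids_congr {n : ℕ} {F F' : ℕ → ℕ} (h : ∀ f, 0 < f → f < 2 * n → F f = F' f) :
    kids μ r n F = kids μ r n F' :=
  List.map_congr_left fun j hj => by
    have := List.mem_range.1 hj
    rw [h (2 * j + 1) (by omega) (by omega)]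

theorem recsKids_congr {n : ℕ} {F F' : ℕ → ℕ} (h : ∀ f, 0 < f → f < 2 * n → F f = F' f) :
    recsKids μ r n F = recsKids μ r n F' :=
  Finset.sum_congr rfl fun j hj => by
    have := Finset.mem_range.1 hj
    rw [h (2 * j + 1) (by omega) (by omega)]

theorem bnd_congr {n : ℕ} {F F' : ℕ → ℕ} (h : ∀ f, 0 < f → f < 2 * n → F f = F' f) (lo hi : ℕ)
    {j : ℕ} (hj : j ≤ n) : bnd n F lo hi j = bnd n F' lo hi j := by
  unfold bnd
  split_ifs
  · rfl
  · rfl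
  · exact h _ (by omega) (by omega)

theorem ordKids_congr {n : ℕ} {F F' : ℕ → ℕ} {lo hi : ℕ}
    (h : ∀ f, 0 < f → f < 2 * n → F f = F' f) :
    OrdKids μ r n F lo hi ↔ OrdKids μ r n F' lo hi :=
  and_congr_right fun _ => forall₂_congr fun j hj => by
    rw [h (2 * j + 1) (by omega) (by omega), bnd_congr h lo hi (by omega),
      bnd_congr h lo hi (by omega)]

theorem kids_add (n₁ n₂ : ℕ) (F : ℕ → ℕ) :
    kids μ r (n₁ + n₂) F = kids μ r n₁ F ++ kids μ r n₂ (fun f => F (2 * n₁ + f)) := by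
  simp only [kids, List.range_add, List.map_append, List.map_map]
  congr 2
  funext j
  simp only [Function.comp_apply]
  congr 2
  ring

theorem recsKids_add (n₁ n₂ : ℕ) (F : ℕ → ℕ) :
    recsKids μ r (n₁ + n₂) F = recsKids μ r n₁ F + recsKids μ r n₂ (fun f => F (2 * n₁ + f)) := by
  simp only [recsKids, Finset.sum_range_add]
  congr 1
  refine Finset.sum_congr rfl fun j _ => ?_
  congr 2
  ring

theorem bnd_left {n₁ n₂ : ℕ} (h₂ : 0 < n₂) (F : ℕ → ℕ) (lo hi : ℕ) {j : ℕ} (hj : j ≤ n₁) :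
    bnd (n₁ + n₂) F lo hi j = bnd n₁ F lo (F (2 * n₁)) j := by
  unfold bnd
  split_ifs <;> first | rfl | omega | congr

theorem bnd_right {n₁ n₂ : ℕ} (h₁ : 0 < n₁) (h₂ : 0 < n₂) (F : ℕ → ℕ) (lo hi : ℕ) {j : ℕ} :
    bnd (n₁ + n₂) F lo hi (n₁ + j) = bnd n₂ (fun f => F (2 * n₁ + f)) (F (2 * n₁)) hi j := by
  unfold bnd
  split_ifs <;> first | rfl | omega | (congr; done) | (congr; omega)

/-- Since pointers and keys alternate, two runs of children are put together by shifting fields, and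
field 2n₁ becomes the key that separates them. Fusing, splitting, appending and removing children
are all instances of this. -/
theorem ordKids_add {n₁ n₂ : ℕ} (h₁ : 0 < n₁) (h₂ : 0 < n₂) (F : ℕ → ℕ) (lo hi : ℕ) :
    OrdKids μ r (n₁ + n₂) F lo hi ↔ OrdKids μ r n₁ F lo (F (2 * n₁)) ∧
      OrdKids μ r n₂ (fun f => F (2 * n₁ + f)) (F (2 * n₁)) hi := by
  constructor
  · rintro ⟨-, h⟩
    refine ⟨⟨h₁, fun j hj => ?_⟩, h₂, fun j hj => ?_⟩
    · have := h j (by omega)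
      rwa [bnd_left h₂ F lo hi (by omega), bnd_left h₂ F lo hi (by omega)] at this
    · have := h (n₁ + j) (by omega)
      rw [add_assoc, bnd_right h₁ h₂, bnd_right h₁ h₂, mul_add, add_assoc] at this
      exact this
  · rintro ⟨⟨-, hl⟩, -, hr⟩
    refine ⟨by omega, fun j hj => ?_⟩
    by_cases hjn : j < n₁
    · rw [bnd_left h₂ F lo hi (by omega), bnd_left h₂ F lo hi (by omega)]
      exact hl j hjn
    · obtain ⟨i, rfl⟩ := Nat.exists_eq_add_of_le (not_lt.1 hjn)
      rw [add_assoc, bnd_right h₁ h₂, bnd_right h₁ h₂, mul_add, add_assoc]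
      exact hr i (by omega)

theorem ordKids_one (F : ℕ → ℕ) (lo hi : ℕ) :
    OrdKids μ r 1 F lo hi ↔ Ordered μ r (F 1) lo hi := by
  simp [OrdKids, bnd]

theorem kids_one (F : ℕ → ℕ) : kids μ r 1 F = [treeAt μ r (F 1)] := rfl

theorem recsKids_one (F : ℕ → ℕ) : recsKids μ r 1 F = recsAt μ r (F 1) := by
  simp [recsKids]

theorem Ordered.rank_eq {v lo hi : ℕ} (h : Ordered μ r v lo hi) : (treeAt μ r v).rank = r + 1 := by
  induction r generalizing v lo hi with
  | zero => rfl
  | succ r ih =>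
    obtain ⟨n, hn⟩ := Nat.exists_eq_succ_of_ne_zero h.1.ne'
    have := ih (h.2 0 h.1)
    simp only [treeAt, hn, Nat.succ_eq_add_one, List.range_succ_eq_map, List.map_cons, rank,
      rankHead]
    rw [this]; omega

/-! ### The right spine and the left spine -/

/-- The last child of a node. -/
def lastKid (μ : ℕ → ℕ → ℕ) (v : ℕ) : ℕ := μ v (2 * μ v 0 - 1)

/-- The node at depth `d` on the right spine of the tree with root `v`. -/
def rsp (μ : ℕ → ℕ → ℕ) (v : ℕ) : ℕ → ℕ
  | 0 => v
  | d + 1 => lastKid μ (rsp μ v d)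

/-- The node at depth `d` on the left spine of the tree with root `v`. -/
def lsp (μ : ℕ → ℕ → ℕ) (v : ℕ) : ℕ → ℕ
  | 0 => v
  | d + 1 => μ (lsp μ v d) 1

theorem rsp_succ' (v d : ℕ) : rsp μ v (d + 1) = rsp μ (lastKid μ v) d := by
  induction d with
  | zero => rfl
  | succ d ih => rw [rsp, ih]; rfl

theorem lsp_succ' (v d : ℕ) : lsp μ v (d + 1) = lsp μ (μ v 1) d := by
  induction d with
  | zero => rfl
  | succ d ih => rw [lsp, ih]; rfl

theorem rsp_mem {v lo hi d : ℕ} (h : Ordered μ r v lo hi) (hd : d ≤ r) :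
    rsp μ v d ∈ recsAt μ r v := by
  induction d generalizing r v lo hi with
  | zero => exact self_mem_recsAt r v
  | succ d ih =>
    obtain ⟨r, rfl⟩ : ∃ s, r = s + 1 := ⟨r - 1, by omega⟩
    have h0 := h.1
    have h1 := h.2 (μ v 0 - 1) (by omega)
    have e : 2 * (μ v 0 - 1) + 1 = 2 * μ v 0 - 1 := by omega
    rw [e] at h1
    rw [rsp_succ', recsAt_succ]
    refine Multiset.mem_cons_of_mem (mem_recsKids.2 ⟨μ v 0 - 1, by omega, ?_⟩)
    rw [e]
    exact ih h1 (by omega)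

theorem lsp_mem {v lo hi d : ℕ} (h : Ordered μ r v lo hi) (hd : d ≤ r) :
    lsp μ v d ∈ recsAt μ r v := by
  induction d generalizing r v lo hi with
  | zero => exact self_mem_recsAt r v
  | succ d ih =>
    obtain ⟨r, rfl⟩ : ∃ s, r = s + 1 := ⟨r - 1, by omega⟩
    have h0 := h.1
    rw [lsp_succ', recsAt_succ]
    exact Multiset.mem_cons_of_mem (mem_recsKids.2 ⟨0, h0, ih (h.2 0 h0) (by omega)⟩)

theorem rsp_congr {v lo hi d : ℕ} (h : Ordered μ r v lo hi) (hd : d ≤ r)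
    (hμ : ∀ w ∈ recsAt μ r v, lastKid μ' w = lastKid μ w) : rsp μ' v d = rsp μ v d := by
  induction d with
  | zero => rfl
  | succ d ih => rw [rsp, rsp, ih (by omega), hμ _ (rsp_mem h (by omega))]

theorem lsp_congr {v lo hi d : ℕ} (h : Ordered μ r v lo hi) (hd : d ≤ r)
    (hμ : ∀ w ∈ recsAt μ r v, μ' w 1 = μ w 1) : lsp μ' v d = lsp μ v d := by
  induction d with
  | zero => rfl
  | succ d ih => rw [lsp, lsp, ih (by omega), hμ _ (lsp_mem h (by omega))]

theorem attachRight_succ (a b d : ℕ) (cs : List LTree) (c V : LTree) :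
    attachRight a b (d + 1) (node (cs ++ [c])) V =
      (node (cs ++ [(attachRight a b d c V).1]), (attachRight a b d c V).2) := by
  simp [attachRight, children]

theorem attachLeft_succ (a b d : ℕ) (cs : List LTree) (c V : LTree) :
    attachLeft a b (d + 1) (node (c :: cs)) V =
      (node ((attachLeft a b d c V).1 :: cs), (attachLeft a b d c V).2) := by
  simp [attachLeft, children]

/-- The memory changes from `μ` to `μ'` only in the subtree of height `r` at record `q`, within the
tree of height `r + d` at record `v`, in which `q` is on the right spine. -/
theorem spine_right (a b : ℕ) {v d lo hi : ℕ} (ho : Ordered μ (r + d) v lo hi)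
    (hn : (recsAt μ (r + d) v).Nodup)
    (hf : ∀ w ∈ recsAt μ (r + d) v, w ∉ recsAt μ r (rsp μ v d) → μ' w = μ w) :
    (∃ rest, recsAt μ (r + d) v = rest + recsAt μ r (rsp μ v d) ∧
      recsAt μ' (r + d) v = rest + recsAt μ' r (rsp μ v d)) ∧
    (∃ lq, Ordered μ r (rsp μ v d) lq hi ∧
      ∀ hi', Ordered μ' r (rsp μ v d) lq hi' → Ordered μ' (r + d) v lo hi') ∧
    (∀ e ≤ d, rsp μ' v e = rsp μ v e) ∧
    (∀ V, (attachRight a b d (treeAt μ (r + d) v) V).2 =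
      (attachRight a b 0 (treeAt μ r (rsp μ v d)) V).2) ∧
    ∀ V, treeAt μ' r (rsp μ v d) = (attachRight a b 0 (treeAt μ r (rsp μ v d)) V).1 →
      treeAt μ' (r + d) v = (attachRight a b d (treeAt μ (r + d) v) V).1 := by
  induction d generalizing v lo with
  | zero =>
    refine ⟨⟨0, by simp [rsp], by simp [rsp]⟩, ⟨lo, ho, fun _ h => h⟩, fun e he => ?_,
      fun V => rfl, fun V h => h⟩
    obtain rfl : e = 0 := by omega
    rfl
  | succ d ih =>
    obtain ⟨n, hdeg⟩ := Nat.exists_eq_succ_of_ne_zero (Nat.ne_of_gt ho.1)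
    rw [Nat.succ_eq_add_one] at hdeg
    have hc : lastKid μ v = μ v (2 * n + 1) := by unfold lastKid; rw [hdeg]; rfl
    have hrecs : recsAt μ (r + d + 1) v =
        v ::ₘ (recsKids μ (r + d) n (μ v) + recsAt μ (r + d) (lastKid μ v)) := by
      rw [recsAt_succ, hdeg, recsKids_add, recsKids_one, hc]
    have hoc := ho.2 n (by omega)
    change Ordered μ (r + d) _ _ _ at hoc
    change (recsAt μ (r + d + 1) v).Nodup at hn
    change ∀ w ∈ recsAt μ (r + d + 1) v, _ at hf
    rw [← hc, hdeg] at hoc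
    have hb : bnd (n + 1) (μ v) lo hi (n + 1) = hi := by simp [bnd]
    rw [hb] at hoc
    rw [rsp_succ'] at hf ⊢
    rw [hrecs] at hn hf
    rw [Multiset.nodup_cons, Multiset.nodup_add] at hn
    obtain ⟨hv, hn1, hn2, hdis⟩ := hn
    rw [Multiset.mem_add, not_or] at hv
    obtain ⟨⟨rest, i1, i1'⟩, ⟨lq, i2, i2'⟩, i3, i4, i5⟩ := ih hoc hn2 fun w hw hq =>
      hf w (by simp [hw]) hq
    have hqc : ∀ w ∈ recsAt μ r (rsp μ (lastKid μ v) d), w ∈ recsAt μ (r + d) (lastKid μ v) :=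
      fun w hw => by rw [i1]; simp [hw]
    -- The root lies outside the subtree of the spine node, so all its fields survive, including the
    -- pointer to its last child.
    have hv' : μ' v = μ v := hf v (by simp) fun h => hv.2 (hqc v h)
    have hc' : lastKid μ' v = lastKid μ v := by simp only [lastKid, hv']
    have hkf : ∀ w ∈ recsKids μ (r + d) n (μ v), μ' w = μ w := fun w hw =>
      hf w (by simp [hw]) fun h => Multiset.disjoint_left.1 hdis hw (hqc w h)
    refine ⟨⟨v ::ₘ (recsKids μ (r + d) n (μ v) + rest), ?_, ?_⟩, ⟨lq, i2, fun hi' h => ?_⟩,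
      fun e he => ?_, fun V => ?_, fun V h => ?_⟩
    · change recsAt μ (r + d + 1) v = _
      rw [hrecs, i1, Multiset.cons_add, add_assoc]
    · change recsAt μ' (r + d + 1) v = _
      rw [recsAt_succ, hv', hdeg, recsKids_add, recsKids_one, recsKids_frame hkf, ← hc, i1',
        Multiset.cons_add, add_assoc]
    · change OrdKids μ' (r + d) (μ' v 0) (μ' v) lo hi'
      rw [hv', hdeg]
      refine ⟨by omega, fun j hj => ?_⟩
      -- The upper bound of the whole tree enters only the interval of the last child; all the other
      -- intervals are unaffected by the new bound.
      by_cases hjn : j = n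
      · subst hjn
        have := i2' hi' h
        rw [← hc]
        have hb' : bnd (j + 1) (μ v) lo hi' (j + 1) = hi' := by simp [bnd]
        have hb2 : bnd (j + 1) (μ v) lo hi' j = bnd (j + 1) (μ v) lo hi j := by
          unfold bnd; split_ifs <;> first | rfl | omega
        rw [hb', hb2]
        exact this
      · have h1 := ho.2 j (by omega)
        change Ordered μ (r + d) _ _ _ at h1
        rw [hdeg] at h1
        have hb1 : ∀ i ≤ n, bnd (n + 1) (μ v) lo hi' i = bnd (n + 1) (μ v) lo hi i := by
          intro i hi
          unfold bnd; split_ifs <;> first | rfl | omega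
        rw [hb1 j (by omega), hb1 (j + 1) (by omega)]
        exact (ordered_frame fun w hw => hkf w (mem_recsKids.2 ⟨j, by omega, hw⟩)).2 h1
    · cases e with
      | zero => rfl
      | succ e => rw [rsp_succ', rsp_succ', hc', i3 e (by omega)]
    · change (attachRight a b (d + 1) (treeAt μ (r + d + 1) v) V).2 = _
      rw [treeAt_succ, hdeg, kids_add, kids_one, ← hc, attachRight_succ, i4]
    · change treeAt μ' (r + d + 1) v = (attachRight a b (d + 1) (treeAt μ (r + d + 1) v) V).1
      rw [treeAt_succ, treeAt_succ, hv', hdeg, kids_add, kids_one, kids_add, kids_one, ← hc,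
        attachRight_succ, kids_frame hkf, i5 V h]

/-- The mirror image of `spine_right`. -/
theorem spine_left (a b : ℕ) {v d lo hi : ℕ} (ho : Ordered μ (r + d) v lo hi)
    (hn : (recsAt μ (r + d) v).Nodup)
    (hf : ∀ w ∈ recsAt μ (r + d) v, w ∉ recsAt μ r (lsp μ v d) → μ' w = μ w) :
    (∃ rest, recsAt μ (r + d) v = rest + recsAt μ r (lsp μ v d) ∧
      recsAt μ' (r + d) v = rest + recsAt μ' r (lsp μ v d)) ∧
    (∃ hq, Ordered μ r (lsp μ v d) lo hq ∧
      ∀ lo', Ordered μ' r (lsp μ v d) lo' hq → Ordered μ' (r + d) v lo' hi) ∧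
    (∀ e ≤ d, lsp μ' v e = lsp μ v e) ∧
    (∀ V, (attachLeft a b d (treeAt μ (r + d) v) V).2 =
      (attachLeft a b 0 (treeAt μ r (lsp μ v d)) V).2) ∧
    ∀ V, treeAt μ' r (lsp μ v d) = (attachLeft a b 0 (treeAt μ r (lsp μ v d)) V).1 →
      treeAt μ' (r + d) v = (attachLeft a b d (treeAt μ (r + d) v) V).1 := by
  induction d generalizing v hi with
  | zero =>
    refine ⟨⟨0, by simp [lsp], by simp [lsp]⟩, ⟨hi, ho, fun _ h => h⟩, fun e he => ?_,
      fun V => rfl, fun V h => h⟩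
    obtain rfl : e = 0 := by omega
    rfl
  | succ d ih =>
    obtain ⟨n, hdeg⟩ := Nat.exists_eq_succ_of_ne_zero (Nat.ne_of_gt ho.1)
    rw [Nat.succ_eq_add_one, add_comm] at hdeg
    have hrecs : recsAt μ (r + d + 1) v =
        v ::ₘ (recsAt μ (r + d) (μ v 1) + recsKids μ (r + d) n (fun f => μ v (2 * 1 + f))) := by
      rw [recsAt_succ, hdeg, recsKids_add, recsKids_one]
    have hoc := ho.2 0 ho.1
    change Ordered μ (r + d) (μ v 1) _ _ at hoc
    change (recsAt μ (r + d + 1) v).Nodup at hn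
    change ∀ w ∈ recsAt μ (r + d + 1) v, _ at hf
    have hb : ∀ lo hi, bnd (1 + n) (μ v) lo hi 0 = lo := fun _ _ => by simp [bnd]
    rw [hdeg, hb] at hoc
    rw [lsp_succ'] at hf ⊢
    rw [hrecs] at hn hf
    rw [Multiset.nodup_cons, Multiset.nodup_add] at hn
    obtain ⟨hv, hn2, hn1, hdis⟩ := hn
    rw [Multiset.mem_add, not_or] at hv
    obtain ⟨⟨rest, i1, i1'⟩, ⟨lq, i2, i2'⟩, i3, i4, i5⟩ := ih hoc hn2 fun w hw hq =>
      hf w (by simp [hw]) hq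
    have hqc : ∀ w ∈ recsAt μ r (lsp μ (μ v 1) d), w ∈ recsAt μ (r + d) (μ v 1) :=
      fun w hw => by rw [i1]; simp [hw]
    have hv' : μ' v = μ v := hf v (by simp) fun h => hv.1 (hqc v h)
    have hkf : ∀ w ∈ recsKids μ (r + d) n (fun f => μ v (2 * 1 + f)), μ' w = μ w := fun w hw =>
      hf w (by simp [hw]) fun h => Multiset.disjoint_left.1 hdis (hqc w h) hw
    refine ⟨⟨v ::ₘ (recsKids μ (r + d) n (fun f => μ v (2 * 1 + f)) + rest), ?_, ?_⟩,
      ⟨lq, i2, fun lo' h => ?_⟩, fun e he => ?_, fun V => ?_, fun V h => ?_⟩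
    · change recsAt μ (r + d + 1) v = _
      rw [hrecs, i1, Multiset.cons_add, add_assoc]
      abel_nf
    · change recsAt μ' (r + d + 1) v = _
      rw [recsAt_succ, hv', hdeg, recsKids_add, recsKids_one, recsKids_frame hkf, i1',
        Multiset.cons_add, add_assoc]
      abel_nf
    · change OrdKids μ' (r + d) (μ' v 0) (μ' v) lo' hi
      rw [hv', hdeg]
      refine ⟨by omega, fun j hj => ?_⟩
      have hb1 : ∀ i, 0 < i → bnd (1 + n) (μ v) lo' hi i = bnd (1 + n) (μ v) lo hi i := by
        intro i hi
        unfold bnd; split_ifs <;> first | rfl | omega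
      by_cases hjn : j = 0
      · subst hjn
        have := i2' lo' h
        rw [hb, hb1 (0 + 1) (by omega)]
        exact this
      · have h1 := ho.2 j (by omega)
        change Ordered μ (r + d) _ _ _ at h1
        rw [hdeg] at h1
        rw [hb1 j (by omega), hb1 (j + 1) (by omega)]
        refine (ordered_frame fun w hw => hkf w (mem_recsKids.2 ⟨j - 1, by omega, ?_⟩)).2 h1
        have : 2 * 1 + (2 * (j - 1) + 1) = 2 * j + 1 := by omega
        rwa [this]
    · cases e with
      | zero => rfl
      | succ e => rw [lsp_succ', lsp_succ', hv', i3 e (by omega)]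
    · change (attachLeft a b (d + 1) (treeAt μ (r + d + 1) v) V).2 = _
      rw [treeAt_succ, hdeg, kids_add, kids_one, List.singleton_append, attachLeft_succ, i4]
    · change treeAt μ' (r + d + 1) v = (attachLeft a b (d + 1) (treeAt μ (r + d + 1) v) V).1
      rw [treeAt_succ, treeAt_succ, hv', hdeg, kids_add, kids_one, kids_add, kids_one,
        List.singleton_append, List.singleton_append,
        attachLeft_succ, kids_frame hkf, i5 V h]

end


/-! ### Copying the fields of a node -/

instance : Add Expr := ⟨Expr.add⟩
instance : Sub Expr := ⟨Expr.sub⟩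

/-- The content of a register. -/
abbrev rg (x : ℕ) : Expr := Expr.reg x

@[simp] theorem val_add (k p : ℕ) (ρ : ℕ → ℕ) (e f : Expr) :
    (e + f).val k p ρ = e.val k p ρ + f.val k p ρ := rfl

@[simp] theorem val_sub (k p : ℕ) (ρ : ℕ → ℕ) (e f : Expr) :
    (e - f).val k p ρ = e.val k p ρ - f.val k p ρ := rfl

@[simp] theorem val_const (k p : ℕ) (ρ : ℕ → ℕ) (n : ℕ) : (Expr.const n).val k p ρ = n := rfl

@[simp] theorem val_reg (k p : ℕ) (ρ : ℕ → ℕ) (n : ℕ) : (Expr.reg n).val k p ρ = ρ n := rfl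

@[simp] theorem val_pid (k p : ℕ) (ρ : ℕ → ℕ) : Expr.pid.val k p ρ = p := rfl

@[simp] theorem val_nprocs (k p : ℕ) (ρ : ℕ → ℕ) : Expr.nprocs.val k p ρ = k := rfl

/-- The expression only depends on the first hundred registers; the others are used for copying. -/
def Expr.Low (e : Expr) : Prop :=
  ∀ (k p : ℕ) (ρ ρ' : ℕ → ℕ), (∀ x < 100, ρ' x = ρ x) → e.val k p ρ' = e.val k p ρ

theorem low_reg {x : ℕ} (h : x < 100) : (rg x).Low := fun _ _ _ _ hρ => hρ x h

theorem low_const (n : ℕ) : (Expr.const n).Low := fun _ _ _ _ _ => rfl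

theorem Expr.Low.add {e f : Expr} (he : e.Low) (hf : f.Low) : (e + f).Low :=
  fun k p ρ ρ' h => by simp [he k p ρ ρ' h, hf k p ρ ρ' h]

/-- Load `n` fields of a record, from field `so` on, into registers. -/
def loads (src so : Expr) : ℕ → Cmd
  | 0 => skip
  | n + 1 => seq (loads src so n) (load (100 + n) src (so + .const n))

/-- Store `n` registers into a record, from field `dof` on. -/
def stores (dst dof : Expr) : ℕ → Cmd
  | 0 => skip
  | n + 1 => seq (stores dst dof n) (store dst (dof + .const n) (.reg (100 + n)))

/-- Copy `n` fields. -/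
def move (n : ℕ) (src so dst dof : Expr) : Cmd := seq (loads src so n) (stores dst dof n)

theorem simple_loads (src so : Expr) (n : ℕ) : Simple (loads src so n) := by
  induction n with
  | zero => trivial
  | succ n ih => exact ⟨ih, trivial⟩

theorem simple_stores (dst dof : Expr) (n : ℕ) : Simple (stores dst dof n) := by
  induction n with
  | zero => trivial
  | succ n ih => exact ⟨ih, trivial⟩

theorem simple_move (n : ℕ) (src so dst dof : Expr) : Simple (move n src so dst dof) :=
  ⟨simple_loads _ _ _, simple_stores _ _ _⟩

/-- The memory after copying `n` fields. -/
def moved (μ : ℕ → ℕ → ℕ) (n src so dst dof : ℕ) : ℕ → ℕ → ℕ := fun v f =>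
  if v = dst ∧ dof ≤ f ∧ f < dof + n then μ src (so + (f - dof)) else μ v f

section wp

variable {R W : Set ℕ} {k p : ℕ} {Q : Loc → Prop} {μ : ℕ → ℕ → ℕ} {ρ : ℕ → ℕ}

theorem wp_loads {src so : Expr} {n : ℕ} (hsrc : src.Low) (hso : so.Low)
    (hR : src.val k p ρ ∈ R)
    (hQ : ∀ ρ', (∀ x < 100, ρ' x = ρ x) →
      (∀ j < n, ρ' (100 + j) = μ (src.val k p ρ) (so.val k p ρ + j)) → Q (μ, ρ')) :
    wp R W k p (loads src so n) Q (μ, ρ) := by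
  induction n generalizing Q with
  | zero => exact wp_skip.2 (hQ ρ (fun _ _ => rfl) (by simp))
  | succ n ih =>
    rw [loads, wp_seq]
    refine ih fun ρ' h1 h2 => ?_
    rw [wp_load]
    dsimp only
    rw [hsrc k p ρ ρ' h1, val_add, hso k p ρ ρ' h1, val_const]
    refine ⟨hR, hQ _ (fun x hx => ?_) fun j hj => ?_⟩
    · rw [Function.update_of_ne (by omega), h1 x hx]
    · by_cases hjn : j = n
      · subst hjn; simp
      · rw [Function.update_of_ne (by omega), h2 j (by omega)]

theorem wp_stores {dst dof : Expr} {n : ℕ} (hW : dst.val k p ρ ∈ W)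
    (hQ : Q (fun v f => if v = dst.val k p ρ ∧ dof.val k p ρ ≤ f ∧ f < dof.val k p ρ + n then
      ρ (100 + (f - dof.val k p ρ)) else μ v f, ρ)) :
    wp R W k p (stores dst dof n) Q (μ, ρ) := by
  induction n generalizing Q with
  | zero =>
    refine wp_skip.2 ?_
    convert hQ using 2
    funext v f
    rw [if_neg (by omega)]
  | succ n ih =>
    rw [stores, wp_seq]
    refine ih ?_
    rw [wp_store]
    refine ⟨hW, ?_⟩
    convert hQ using 2
    funext v f
    simp only [put, val_add, val_const, val_reg]
    have e : dof.val k p ρ + n - dof.val k p ρ = n := by omega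
    by_cases hv : v = dst.val k p ρ
    · by_cases hf : f = dof.val k p ρ + n
      · simp only [hv, hf, true_and, e, if_true]
        rw [if_pos (by omega)]
      · simp only [hv, hf, true_and, if_false]
        refine if_congr ?_ rfl rfl
        omega
    · simp only [hv, false_and, if_false]

/-- All loads precede all stores, so the copy is correct even if source and target overlap in one
record, as when the children of a node are shifted. -/
theorem wp_move {n : ℕ} {src so dst dof : Expr} (h1 : src.Low) (h2 : so.Low) (h3 : dst.Low)
    (h4 : dof.Low) (hR : src.val k p ρ ∈ R) (hW : dst.val k p ρ ∈ W)
    (hQ : ∀ ρ', (∀ x < 100, ρ' x = ρ x) → Q (moved μ n (src.val k p ρ) (so.val k p ρ)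
      (dst.val k p ρ) (dof.val k p ρ), ρ')) :
    wp R W k p (move n src so dst dof) Q (μ, ρ) := by
  rw [move, wp_seq]
  refine wp_loads h1 h2 hR fun ρ' hρ hl => ?_
  refine wp_stores (by rwa [h3 k p ρ ρ' hρ]) ?_
  rw [h3 k p ρ ρ' hρ, h4 k p ρ ρ' hρ]
  convert hQ ρ' hρ using 2
  funext v f
  unfold moved
  split_ifs with h
  · exact hl _ (by omega)
  · rfl

end wp

/-- Half of the value of an expression, as far as it is at most `n`. -/
def halfE (e : Expr) : ℕ → Expr
  | 0 => .const 0
  | n + 1 => halfE e n + (.const 1 - (.const (2 * n + 2) - e))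

/-- The machine cannot halve. The i-th summand is 1 exactly if the value is at least 2i + 2, so the
sum counts the integers up to half of the value; degrees are bounded, hence a fixed number of
summands suffices. -/
theorem val_halfE (k p : ℕ) (ρ : ℕ → ℕ) (e : Expr) (n : ℕ) :
    (halfE e n).val k p ρ = min n (e.val k p ρ / 2) := by
  induction n with
  | zero => simp [halfE]
  | succ n ih =>
    rw [halfE, val_add, ih]
    simp only [val_sub, val_const]
    omega

/-! ### Combining two nodes -/

/-- Combine the nodes in registers 14 and 15, of which the key in register 16 separates the values.
Afterwards register 19 is zero if they have been fused; otherwise register 16 separates the new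
nodes. -/
def combineP (a b : ℕ) : Cmd :=
  seq (load 17 (rg 14) (.const 0)) <| seq (load 18 (rg 15) (.const 0)) <|
  ite ((.const a - rg 17) + (.const a - rg 18))
    (seq (store (rg 14) (rg 17 + rg 17) (rg 16)) <|
     seq (move (2 * b) (rg 15) (.const 1) (rg 14) (rg 17 + rg 17 + .const 1)) <|
     ite ((rg 17 + rg 18) - .const b)
      (seq (assign 20 (halfE (rg 17 + rg 18) b)) <|
       seq (load 16 (rg 14) (rg 20 + rg 20)) <|
       seq (move (2 * b) (rg 14) (rg 20 + rg 20 + .const 1) (rg 15) (.const 1)) <|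
       seq (store (rg 15) (.const 0) ((rg 17 + rg 18) - rg 20)) <|
       seq (store (rg 14) (.const 0) (rg 20)) (assign 19 (.const 1)))
      (seq (store (rg 14) (.const 0) (rg 17 + rg 18)) (assign 19 (.const 0))))
    (assign 19 (.const 1))

theorem simple_combineP (a b : ℕ) : Simple (combineP a b) := by
  simp [combineP, Simple, simple_move]

/-- The nodes `x` and `y` of height `r + 1` have been combined; `two` is zero if only `x` is left, and
otherwise `s` separates the two nodes. -/
structure Combined (a b : ℕ) (μ μ' : ℕ → ℕ → ℕ) (r x y lo hi two s : ℕ) : Prop where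
  frame : ∀ v, v ≠ x → v ≠ y → μ' v = μ v
  first : μ' x 1 = μ x 1
  last : lastKid μ' y = lastKid μ y
  res : (two = 0 ∧ combine a b (treeAt μ (r + 1) x) (treeAt μ (r + 1) y) = [treeAt μ' (r + 1) x] ∧
      Ordered μ' (r + 1) x lo hi ∧
      recsAt μ' (r + 1) x + {y} = recsAt μ (r + 1) x + recsAt μ (r + 1) y ∧
      lastKid μ' x = lastKid μ y) ∨
    (two ≠ 0 ∧ combine a b (treeAt μ (r + 1) x) (treeAt μ (r + 1) y) =
      [treeAt μ' (r + 1) x, treeAt μ' (r + 1) y] ∧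
      Ordered μ' (r + 1) x lo s ∧ Ordered μ' (r + 1) y s hi ∧
      recsAt μ' (r + 1) x + recsAt μ' (r + 1) y = recsAt μ (r + 1) x + recsAt μ (r + 1) y)

/-- The hypotheses under which `x` and `y` may be combined. -/
structure Combinable (b : ℕ) (μ : ℕ → ℕ → ℕ) (r x y lo s hi : ℕ) : Prop where
  ordx : Ordered μ (r + 1) x lo s
  ordy : Ordered μ (r + 1) y s hi
  nodup : (recsAt μ (r + 1) x + recsAt μ (r + 1) y).Nodup
  degx : μ x 0 ≤ b
  degy : μ y 0 ≤ b

-- Fusing and splitting two nodes of equal rank in memory.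

section

variable {a b : ℕ} {μ μ' : ℕ → ℕ → ℕ} {r x y lo s hi : ℕ}

theorem Combinable.facts (h : Combinable b μ r x y lo s hi) :
    x ≠ y ∧ (∀ w ∈ recsKids μ r (μ x 0) (μ x), w ≠ x ∧ w ≠ y) ∧
      (∀ w ∈ recsKids μ r (μ y 0) (μ y), w ≠ x ∧ w ≠ y) := by
  have hn := h.nodup
  rw [recsAt_succ, recsAt_succ, Multiset.nodup_add, Multiset.nodup_cons, Multiset.nodup_cons,
    Multiset.disjoint_left] at hn
  obtain ⟨⟨h1, -⟩, ⟨h2, -⟩, h3⟩ := hn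
  refine ⟨?_, fun w hw => ⟨?_, ?_⟩, fun w hw => ⟨?_, ?_⟩⟩
  · rintro rfl; exact h3 (Multiset.mem_cons_self _ _) (Multiset.mem_cons_self _ _)
  · rintro rfl; exact h1 hw
  · rintro rfl; exact h3 (Multiset.mem_cons_of_mem hw) (Multiset.mem_cons_self _ _)
  · rintro rfl; exact h3 (Multiset.mem_cons_self _ _) (Multiset.mem_cons_of_mem hw)
  · rintro rfl; exact h2 hw

/-- The children of a fused node with fields `F`. -/
theorem Combinable.fused (h : Combinable b μ r x y lo s hi) {F : ℕ → ℕ}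
    (h1 : ∀ f, 0 < f → f < 2 * μ x 0 → F f = μ x f) (h2 : F (2 * μ x 0) = s)
    (h3 : ∀ f, 0 < f → f < 2 * μ y 0 → F (2 * μ x 0 + f) = μ y f)
    (hf : ∀ v, v ≠ x → v ≠ y → μ' v = μ v) :
    kids μ' r (μ x 0 + μ y 0) F = kids μ r (μ x 0) (μ x) ++ kids μ r (μ y 0) (μ y) ∧
    recsKids μ' r (μ x 0 + μ y 0) F =
      recsKids μ r (μ x 0) (μ x) + recsKids μ r (μ y 0) (μ y) ∧
    OrdKids μ' r (μ x 0 + μ y 0) F lo hi := by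
  obtain ⟨-, hx, hy⟩ := h.facts
  have hx' : ∀ w ∈ recsKids μ r (μ x 0) (μ x), μ' w = μ w := fun w hw =>
    hf w (hx w hw).1 (hx w hw).2
  have hy' : ∀ w ∈ recsKids μ r (μ y 0) (μ y), μ' w = μ w := fun w hw =>
    hf w (hy w hw).1 (hy w hw).2
  refine ⟨?_, ?_, ?_⟩
  · rw [kids_add, kids_congr h1, kids_congr h3, kids_frame hx', kids_frame hy']
  · rw [recsKids_add, recsKids_congr h1, recsKids_congr h3, recsKids_frame hx', recsKids_frame hy']
  · rw [ordKids_add h.ordx.1 h.ordy.1, h2, ordKids_congr h1, ordKids_congr h3,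
      ordKids_frame hx', ordKids_frame hy']
    exact ⟨h.ordx, h.ordy⟩

theorem lastKid_eq {n : ℕ} (h : μ x 0 = n) : lastKid μ x = μ x (2 * n - 1) := by
  rw [lastKid, h]

theorem combine_treeAt : combine a b (treeAt μ (r + 1) x) (treeAt μ (r + 1) y) =
    if a ≤ μ x 0 ∧ a ≤ μ y 0 then [treeAt μ (r + 1) x, treeAt μ (r + 1) y]
    else if μ x 0 + μ y 0 ≤ b then
      [node (kids μ r (μ x 0) (μ x) ++ kids μ r (μ y 0) (μ y))]
    else [node ((kids μ r (μ x 0) (μ x) ++ kids μ r (μ y 0) (μ y)).take ((μ x 0 + μ y 0) / 2)),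
      node ((kids μ r (μ x 0) (μ x) ++ kids μ r (μ y 0) (μ y)).drop ((μ x 0 + μ y 0) / 2))] := by
  rw [treeAt_succ, treeAt_succ, combine_node]
  simp only [List.length_append, length_kids]

theorem Combinable.combined_self (h : Combinable b μ r x y lo s hi)
    (hd : a ≤ μ x 0 ∧ a ≤ μ y 0) {two : ℕ} (h2 : two ≠ 0) : Combined a b μ μ r x y lo hi two s :=
  ⟨fun _ _ _ => rfl, rfl, rfl, .inr ⟨h2, by rw [combine_treeAt, if_pos hd], h.ordx, h.ordy, rfl⟩⟩

theorem Combinable.combined_fused (h : Combinable b μ r x y lo s hi)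
    (hd : ¬ (a ≤ μ x 0 ∧ a ≤ μ y 0)) (hb : μ x 0 + μ y 0 ≤ b)
    (h0 : μ' x 0 = μ x 0 + μ y 0)
    (h1 : ∀ f, 0 < f → f < 2 * μ x 0 → μ' x f = μ x f) (h2 : μ' x (2 * μ x 0) = s)
    (h3 : ∀ f, 0 < f → f < 2 * μ y 0 → μ' x (2 * μ x 0 + f) = μ y f)
    (hf : ∀ v, v ≠ x → μ' v = μ v) (s' : ℕ) :
    Combined a b μ μ' r x y lo hi 0 s' := by
  obtain ⟨i1, i2, i3⟩ := h.fused h1 h2 h3 fun v hv _ => hf v hv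
  have hx := h.ordx.1
  have hy := h.ordy.1
  refine ⟨fun v hv _ => hf v hv, h1 1 (by simp) (by omega), ?_, .inl ⟨rfl, ?_, ?_, ?_, ?_⟩⟩
  · simp only [lastKid, hf y h.facts.1.symm]
  · rw [combine_treeAt, if_neg hd, if_pos hb, treeAt_succ, h0, i1]
  · rw [ordered_succ, h0]; exact i3
  · simp only [recsAt_succ, h0, i2]
    simp only [← Multiset.singleton_add]
    abel
  · have e : 2 * (μ x 0 + μ y 0) - 1 = 2 * μ x 0 + (2 * μ y 0 - 1) := by omega
    rw [lastKid_eq h0, e, h3 _ (by omega) (by omega)]; rfl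

/-- `F` is the list of fields of the fused node before it is split. The two new nodes are
consecutive segments of it, and the key between the segments becomes their separator. -/
theorem Combinable.combined_split (ha : 2 ≤ a) (hab : 2 * a ≤ b)
    (h : Combinable b μ r x y lo s hi)
    (hd : ¬ (a ≤ μ x 0 ∧ a ≤ μ y 0)) (hb : ¬ μ x 0 + μ y 0 ≤ b) {F : ℕ → ℕ}
    (h1 : ∀ f, 0 < f → f < 2 * μ x 0 → F f = μ x f) (h2 : F (2 * μ x 0) = s)
    (h3 : ∀ f, 0 < f → f < 2 * μ y 0 → F (2 * μ x 0 + f) = μ y f)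
    (hx0 : μ' x 0 = (μ x 0 + μ y 0) / 2)
    (hy0 : μ' y 0 = μ x 0 + μ y 0 - (μ x 0 + μ y 0) / 2)
    (hx : ∀ f, 0 < f → f < 2 * μ' x 0 → μ' x f = F f)
    (hy : ∀ f, 0 < f → f < 2 * μ' y 0 → μ' y f = F (2 * μ' x 0 + f))
    (hf : ∀ v, v ≠ x → v ≠ y → μ' v = μ v) {two : ℕ} (htwo : two ≠ 0) :
    Combined a b μ μ' r x y lo hi two (F (2 * μ' x 0)) := by
  obtain ⟨i1, i2, i3⟩ := h.fused h1 h2 h3 hf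
  have px := h.ordx.1
  have py := h.ordy.1
  have hsum : μ x 0 + μ y 0 = μ' x 0 + μ' y 0 := by omega
  rw [hsum] at i1 i2 i3
  rw [ordKids_add (by omega) (by omega), ← ordKids_congr hx, ← ordKids_congr hy] at i3
  rw [kids_add, ← kids_congr hx, ← kids_congr hy] at i1
  rw [recsKids_add, ← recsKids_congr hx, ← recsKids_congr hy] at i2
  refine ⟨hf, ?_, ?_, .inr ⟨htwo, ?_, i3.1, i3.2, ?_⟩⟩
  · rw [hx 1 (by simp) (by omega), h1 1 (by simp) (by omega)]
  · unfold lastKid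
    have e : 2 * μ' x 0 + (2 * μ' y 0 - 1) = 2 * μ x 0 + (2 * μ y 0 - 1) := by omega
    rw [hy _ (by omega) (by omega), ← h3 _ (by omega) (by omega), e]
  · rw [combine_treeAt, if_neg hd, if_neg hb, ← i1, ← hx0, List.take_left' (by simp),
      List.drop_left' (by simp), treeAt_succ, treeAt_succ]
  · simp only [recsAt_succ]
    rw [← Multiset.singleton_add, ← Multiset.singleton_add, ← Multiset.singleton_add x,
      ← Multiset.singleton_add y, add_add_add_comm, i2, add_add_add_comm]

end

/-- Two by-products matter for the spines: the first child of `x` and the last child of `y` do not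
change, so a left spine through `x` and a right spine through `y` continue as before below the
combined nodes. -/
theorem wp_combineP {a b : ℕ} (ha : 2 ≤ a) (hab : 2 * a ≤ b) {R W : Set ℕ} {k p : ℕ}
    {Q : Loc → Prop} {μ : ℕ → ℕ → ℕ} {ρ : ℕ → ℕ} {r x y lo s hi : ℕ}
    (h : Combinable b μ r x y lo s hi) (hx : ρ 14 = x) (hy : ρ 15 = y) (hs : ρ 16 = s)
    (hxR : x ∈ R) (hyR : y ∈ R) (hxW : x ∈ W) (hyW : y ∈ W)
    (hQ : ∀ μ' ρ', Combined a b μ μ' r x y lo hi (ρ' 19) (ρ' 16) →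
      (∀ i < 100, i < 16 ∨ 20 < i → ρ' i = ρ i) → Q (μ', ρ')) :
    wp R W k p (combineP a b) Q (μ, ρ) := by
  have hxy := h.facts.1
  have hdx := h.degx
  have hdy := h.degy
  have px := h.ordx.1
  have py := h.ordy.1
  simp only [combineP, wp_seq, wp_load, wp_ite, wp_assign, wp_store, val_add, val_sub, 
    val_const, val_reg, Function.update_apply]
  norm_num [hx, hy, hs, hxR, hyR, hxW, hyW]
  split_ifs with h1
  · refine hQ _ _ ?_ fun i hi hi' => ?_
    · simp only [Function.update_apply]
      norm_num [hs]
      exact h.combined_self (by omega) (by simp)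
    · simp only [Function.update_apply]
      split_ifs <;> first | rfl | omega
  -- Always 2b fields are copied, enough for every degree up to b; the superfluous ones land behind
  -- the last pointer.
  · refine wp_move (low_reg (by norm_num)) (low_const _) (low_reg (by norm_num))
      (((low_reg (by norm_num)).add (low_reg (by norm_num))).add (low_const _)) ?_ ?_ fun ρ₁ hρ₁ => ?_
    · simpa [Function.update_apply, hy] using hyR
    · simpa [Function.update_apply, hx] using hxW
    · have e14 := hρ₁ 14 (by norm_num)
      have e15 := hρ₁ 15 (by norm_num)
      have e16 := hρ₁ 16 (by norm_num)
      have e17 := hρ₁ 17 (by norm_num)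
      have e18 := hρ₁ 18 (by norm_num)
      simp only [Function.update_apply] at e14 e15 e16 e17 e18
      norm_num [hx, hy, hs] at e14 e15 e16 e17 e18
      simp only [Function.update_apply, val_reg, val_add, val_const]
      norm_num [hx, hy]
      simp only [e14, e17, e18, val_halfE, val_add, val_reg]
      norm_num [hx, hy, hs, hxR, hyR, hxW, hyW]
      -- In this memory the fields of the fused node are laid out in `x`, possibly more than b
      -- children for the moment; only the degree is still the old one.
      set μ₁ := moved (put μ x (μ x 0 + μ x 0) s) (2 * b) y 1 x (μ x 0 + μ x 0 + 1) with hμ₁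
      have f1 : ∀ f, 0 < f → f < 2 * μ x 0 → μ₁ x f = μ x f := fun f hf1 hf2 => by
        simp only [hμ₁, moved, put]
        rw [if_neg (by omega), if_neg (by omega)]
      have f2 : μ₁ x (2 * μ x 0) = s := by
        simp only [hμ₁, moved, put, true_and]
        rw [if_neg (by omega), if_pos (by omega)]
      have f3 : ∀ f, 0 < f → f < 2 * μ y 0 → μ₁ x (2 * μ x 0 + f) = μ y f := fun f hf1 hf2 => by
        simp only [hμ₁, moved, put, true_and]
        rw [if_pos (by omega), if_neg (by omega)]
        congr 1; omega
      have f4 : ∀ v, v ≠ x → μ₁ v = μ v := fun v hv => by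
        funext f
        simp only [hμ₁, moved, put]
        rw [if_neg (by tauto), if_neg (by tauto)]
      split_ifs with h2
      · refine hQ _ _ ?_ fun i hi hi' => ?_
        · have e19 : Function.update ρ₁ 19 0 19 = 0 := by simp
          rw [e19]
          refine h.combined_fused (by omega) (by omega) (by simp [put]) (fun f hf1 hf2 => ?_) ?_
            (fun f hf1 hf2 => ?_) (fun v hv => ?_) _
          · rw [← f1 f hf1 hf2]; simp only [put]; rw [if_neg (by omega)]
          · rw [← f2]; simp only [put]; rw [if_neg (by omega)]
          · rw [← f3 f hf1 hf2]; simp only [put]; rw [if_neg (by omega)]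
          · rw [put_of_ne hv, f4 v hv]
        · rw [Function.update_of_ne (by omega), hρ₁ i hi]
          simp only [Function.update_apply]
          split_ifs <;> first | rfl | omega
      · refine wp_move (low_reg (by norm_num))
          (((low_reg (by norm_num)).add (low_reg (by norm_num))).add (low_const _))
          (low_reg (by norm_num)) (low_const _) ?_ ?_ fun ρ₂ hρ₂ => ?_
        · simpa [Function.update_apply, e14] using hxR
        · simpa [Function.update_apply, e15] using hyW
        · have g14 := hρ₂ 14 (by norm_num)
          have g15 := hρ₂ 15 (by norm_num)
          have g16 := hρ₂ 16 (by norm_num)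
          have g17 := hρ₂ 17 (by norm_num)
          have g18 := hρ₂ 18 (by norm_num)
          have g20 := hρ₂ 20 (by norm_num)
          simp only [Function.update_apply] at g14 g15 g16 g17 g18 g20
          norm_num [e14, e15, e17, e18] at g14 g15 g16 g17 g18 g20
          -- Both degrees are at most b, so the cutoff in the halving expression is inactive.
          have hmin : min b ((μ x 0 + μ y 0) / 2) = (μ x 0 + μ y 0) / 2 := by omega
          rw [hmin] at g16 g20 ⊢
          have u14 : Function.update (Function.update ρ₁ 20 ((μ x 0 + μ y 0) / 2)) 16
              (μ₁ x ((μ x 0 + μ y 0) / 2 + (μ x 0 + μ y 0) / 2)) 14 = x := by simpa using e14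
          have u15 : Function.update (Function.update ρ₁ 20 ((μ x 0 + μ y 0) / 2)) 16
              (μ₁ x ((μ x 0 + μ y 0) / 2 + (μ x 0 + μ y 0) / 2)) 15 = y := by simpa using e15
          have u20 : Function.update (Function.update ρ₁ 20 ((μ x 0 + μ y 0) / 2)) 16
              (μ₁ x ((μ x 0 + μ y 0) / 2 + (μ x 0 + μ y 0) / 2)) 20 = (μ x 0 + μ y 0) / 2 := by
            simp
          simp only [val_reg, val_add, val_const]
          rw [u14, u15, u20]
          simp only [wp_seq, wp_store, wp_assign, g14, g15, g17, g18, g20, hxW, hyW, true_and,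
            val_reg, val_add, val_sub, val_const]
          refine hQ _ _ ?_ fun i hi hi' => ?_
          · have v19 : Function.update ρ₂ 19 1 19 ≠ 0 := by simp
            have v16 : Function.update ρ₂ 19 1 16 =
                μ₁ x (2 * put (put (moved μ₁ (2 * b) x ((μ x 0 + μ y 0) / 2 + (μ x 0 + μ y 0) / 2 + 1) y 1)
                  y 0 (μ x 0 + μ y 0 - (μ x 0 + μ y 0) / 2)) x 0 ((μ x 0 + μ y 0) / 2) x 0) := by
              rw [Function.update_of_ne (by norm_num), g16]
              simp [put, two_mul]
            rw [v16]
            refine h.combined_split ha hab (by omega) (by omega) f1 f2 f3 ?_ ?_ (fun f hf1 hf2 => ?_)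
              (fun f hf1 hf2 => ?_) (fun v hvx hvy => ?_) v19
            · simp [put]
            · simp [put, hxy.symm]
            · simp only [put, moved]
              rw [if_neg (by omega), if_neg (by omega), if_neg (by tauto)]
            · simp only [put, moved, and_true, true_and, if_true] at hf2 ⊢
              rw [if_neg (by tauto)] at hf2
              rw [if_neg (by omega), if_neg (by omega), if_pos (by omega)]
              congr 1; omega
            · rw [put_of_ne hvx, put_of_ne hvy, ← f4 v hvx]
              funext f
              simp only [moved]
              rw [if_neg (by tauto)]
          · rw [Function.update_of_ne (by omega), hρ₂ i hi, Function.update_of_ne (by omega),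
              Function.update_of_ne (by omega), hρ₁ i hi, Function.update_of_ne (by omega),
              Function.update_of_ne (by omega)]


/-! ### Attaching a tree to a node on the spine -/

/-- What is known of the nodes `x` and `y` in the memory `μ'` after they have been combined. -/
structure Merged (a b : ℕ) (μ μ' : ℕ → ℕ → ℕ) (r x y lo hi two s : ℕ) : Prop where
  first : μ' x 1 = μ x 1
  last : lastKid μ' y = lastKid μ y
  res : (two = 0 ∧ combine a b (treeAt μ (r + 1) x) (treeAt μ (r + 1) y) = [treeAt μ' (r + 1) x] ∧
      Ordered μ' (r + 1) x lo hi ∧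
      recsAt μ' (r + 1) x + {y} = recsAt μ (r + 1) x + recsAt μ (r + 1) y ∧
      lastKid μ' x = lastKid μ y) ∨
    (two ≠ 0 ∧ combine a b (treeAt μ (r + 1) x) (treeAt μ (r + 1) y) =
      [treeAt μ' (r + 1) x, treeAt μ' (r + 1) y] ∧
      Ordered μ' (r + 1) x lo s ∧ Ordered μ' (r + 1) y s hi ∧
      recsAt μ' (r + 1) x + recsAt μ' (r + 1) y = recsAt μ (r + 1) x + recsAt μ (r + 1) y)

section

variable {a b : ℕ} {μ μ₁ μ' : ℕ → ℕ → ℕ} {r x y lo hi two s : ℕ}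

/-- The second half of a join writes to the parent, to the blocks and to the new record, none of
which is a record of the two combined subtrees; so what is known of these subtrees carries over to
the final memory. -/
theorem Combined.merged (h : Combined a b μ μ₁ r x y lo hi two s)
    (hμ : ∀ w ∈ recsAt μ (r + 1) x + recsAt μ (r + 1) y, μ' w = μ₁ w) :
    Merged a b μ μ' r x y lo hi two s := by
  have hx := hμ x (Multiset.mem_add.2 (.inl (self_mem_recsAt _ _)))
  have hy := hμ y (Multiset.mem_add.2 (.inr (self_mem_recsAt _ _)))
  refine ⟨by rw [hx, h.first], by simpa only [lastKid, hy] using h.last, ?_⟩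
  rcases h.res with ⟨h1, h2, h3, h4, h5⟩ | ⟨h1, h2, h3, h4, h5⟩
  · have hf : ∀ w ∈ recsAt μ₁ (r + 1) x, μ' w = μ₁ w := fun w hw =>
      hμ w (by rw [← h4]; exact Multiset.mem_add.2 (.inl hw))
    exact .inl ⟨h1, by rw [treeAt_frame hf, h2], (ordered_frame hf).2 h3,
      by rw [recsAt_frame hf, h4], by simpa only [lastKid, hx] using h5⟩
  · have hf : ∀ w ∈ recsAt μ₁ (r + 1) x, μ' w = μ₁ w := fun w hw =>
      hμ w (by rw [← h5]; exact Multiset.mem_add.2 (.inl hw))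
    have hg : ∀ w ∈ recsAt μ₁ (r + 1) y, μ' w = μ₁ w := fun w hw =>
      hμ w (by rw [← h5]; exact Multiset.mem_add.2 (.inr hw))
    exact .inr ⟨h1, by rw [treeAt_frame hf, treeAt_frame hg, h2], (ordered_frame hf).2 h3,
      (ordered_frame hg).2 h4, by rw [recsAt_frame hf, recsAt_frame hg, h5]⟩

theorem Merged.of_eq_zero (h : Merged a b μ μ' r x y lo hi two s) (h0 : two = 0) :
    combine a b (treeAt μ (r + 1) x) (treeAt μ (r + 1) y) = [treeAt μ' (r + 1) x] ∧
      Ordered μ' (r + 1) x lo hi ∧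
      recsAt μ' (r + 1) x + {y} = recsAt μ (r + 1) x + recsAt μ (r + 1) y ∧
      lastKid μ' x = lastKid μ y := by
  rcases h.res with ⟨-, h⟩ | ⟨h, -⟩
  exacts [h, absurd h0 h]

theorem Merged.of_ne_zero (h : Merged a b μ μ' r x y lo hi two s) (h0 : two ≠ 0) :
    combine a b (treeAt μ (r + 1) x) (treeAt μ (r + 1) y) =
      [treeAt μ' (r + 1) x, treeAt μ' (r + 1) y] ∧
      Ordered μ' (r + 1) x lo s ∧ Ordered μ' (r + 1) y s hi ∧
      recsAt μ' (r + 1) x + recsAt μ' (r + 1) y = recsAt μ (r + 1) x + recsAt μ (r + 1) y := by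
  rcases h.res with ⟨h, -⟩ | ⟨-, h⟩
  exacts [absurd h h0, h]

/-- A node with two children. -/
structure IsPair (μ : ℕ → ℕ → ℕ) (z x s y : ℕ) : Prop where
  deg : μ z 0 = 2
  fst : μ z 1 = x
  key : μ z 2 = s
  snd : μ z 3 = y

theorem IsPair.kids_eq {z : ℕ} (h : IsPair μ z x s y) :
    treeAt μ (r + 1) z = node [treeAt μ r x, treeAt μ r y] ∧
      recsAt μ (r + 1) z = {z} + (recsAt μ r x + recsAt μ r y) ∧
      (Ordered μ (r + 1) z lo hi ↔ Ordered μ r x lo s ∧ Ordered μ r y s hi) := by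
  refine ⟨?_, ?_, ?_⟩
  · rw [treeAt_succ, h.deg, show 2 = 1 + 1 from rfl, kids_add, kids_one, kids_one]
    simp [h.fst, h.snd]
  · rw [recsAt_succ, h.deg, show 2 = 1 + 1 from rfl, recsKids_add, recsKids_one, recsKids_one]
    simp [h.fst, h.snd]
  · rw [ordered_succ, h.deg, show 2 = 1 + 1 from rfl, ordKids_add (by simp) (by simp), ordKids_one,
      ordKids_one]
    simp [h.fst, h.snd, h.key]

theorem Merged.pair (h : Merged a b μ μ' r x y lo hi two s) (h0 : two ≠ 0) {z : ℕ}
    (hz : IsPair μ' z x s y) :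
    treeAt μ' (r + 2) z = node (combine a b (treeAt μ (r + 1) x) (treeAt μ (r + 1) y)) ∧
      Ordered μ' (r + 2) z lo hi ∧
      recsAt μ' (r + 2) z = {z} + (recsAt μ (r + 1) x + recsAt μ (r + 1) y) := by
  obtain ⟨h1, h2, h3, h4⟩ := h.of_ne_zero h0
  obtain ⟨i1, i2, i3⟩ := hz.kids_eq (r := r + 1) (lo := lo) (hi := hi)
  exact ⟨by rw [i1, h1], i3.2 ⟨h2, h3⟩, by rw [i2, h4]⟩

theorem attachRight_zero (cs : List LTree) (n V : LTree) :
    attachRight a b 0 (node (cs ++ [n])) V =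
      if cs.length + (combine a b n V).length ≤ b then (node (cs ++ combine a b n V), none)
      else (node cs, some (node (combine a b n V))) := by
  simp [attachRight, children]

theorem attachLeft_zero (cs : List LTree) (n V : LTree) :
    attachLeft a b 0 (node (n :: cs)) V =
      if cs.length + (combine a b V n).length ≤ b then (node (combine a b V n ++ cs), none)
      else (node cs, some (node (combine a b V n))) := by
  simp [attachLeft, children]

-- At the parent on the right spine: fused child, additional child, stolen child.

section right

variable {q n lq m : ℕ}

theorem right_parts (hq : μ q 0 = n + 1) (hn : 0 < n) (hoq : Ordered μ (r + 1) q lq m) :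
    treeAt μ (r + 1) q = node (kids μ r n (μ q) ++ [treeAt μ r (μ q (2 * n + 1))]) ∧
    recsAt μ (r + 1) q = {q} + (recsKids μ r n (μ q) + recsAt μ r (μ q (2 * n + 1))) ∧
    OrdKids μ r n (μ q) lq (μ q (2 * n)) ∧ Ordered μ r (μ q (2 * n + 1)) (μ q (2 * n)) m := by
  rw [ordered_succ, hq, ordKids_add hn (by simp), ordKids_one] at hoq
  refine ⟨?_, ?_, hoq⟩
  · rw [treeAt_succ, hq, kids_add, kids_one]
  · rw [recsAt_succ, hq, recsKids_add, recsKids_one, Multiset.singleton_add]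

/-- The fusion takes place in the record of the old last child, so the parent is untouched and the
record `y` becomes garbage. -/
theorem right_fused (hq : μ q 0 = n + 1) (hn : 0 < n) (hb : n + 1 ≤ b)
    (hoq : Ordered μ (r + 2) q lq m)
    (h : Merged a b μ μ' r (μ q (2 * n + 1)) y (μ q (2 * n)) hi two s) (h0 : two = 0)
    (hk : ∀ w ∈ recsKids μ (r + 1) n (μ q), μ' w = μ w) (hqq : μ' q = μ q) :
    attachRight a b 0 (treeAt μ (r + 2) q) (treeAt μ (r + 1) y) = (treeAt μ' (r + 2) q, none) ∧
    Ordered μ' (r + 2) q lq hi ∧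
    recsAt μ' (r + 2) q + {y} = recsAt μ (r + 2) q + recsAt μ (r + 1) y := by
  obtain ⟨h1, h2, h3, -⟩ := h.of_eq_zero h0
  obtain ⟨i1, i2, i3, -⟩ := right_parts hq hn hoq
  refine ⟨?_, ?_, ?_⟩
  · rw [i1, attachRight_zero, h1, if_pos (by simpa using hb), treeAt_succ (μ := μ') (r := r + 1) q, hqq, hq, kids_add,
      kids_one, kids_frame hk]
  · rw [ordered_succ, hqq, hq, ordKids_add hn (by simp), ordKids_one, ordKids_frame hk]
    exact ⟨i3, h2⟩
  · rw [i2, recsAt_succ, hqq, hq, recsKids_add, recsKids_one, recsKids_frame hk,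
      ← Multiset.singleton_add]
    rw [add_assoc, add_assoc, h3, add_assoc, add_assoc]

theorem right_append (hq : μ q 0 = n + 1) (hn : 0 < n) (hb : n + 2 ≤ b)
    (hoq : Ordered μ (r + 2) q lq m)
    (h : Merged a b μ μ' r (μ q (2 * n + 1)) y (μ q (2 * n)) hi two s) (h0 : two ≠ 0)
    (hk : ∀ w ∈ recsKids μ (r + 1) n (μ q), μ' w = μ w) (hqd : μ' q 0 = n + 2)
    (hqf : ∀ f, 0 < f → f < 2 * (n + 1) → μ' q f = μ q f) (hqs : μ' q (2 * (n + 1)) = s)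
    (hqy : μ' q (2 * (n + 1) + 1) = y) :
    attachRight a b 0 (treeAt μ (r + 2) q) (treeAt μ (r + 1) y) = (treeAt μ' (r + 2) q, none) ∧
    Ordered μ' (r + 2) q lq hi ∧
    recsAt μ' (r + 2) q = recsAt μ (r + 2) q + recsAt μ (r + 1) y := by
  obtain ⟨h1, h2, h3, h4⟩ := h.of_ne_zero h0
  obtain ⟨i1, i2, i3, -⟩ := right_parts hq hn hoq
  have e : n + 2 = n + 1 + 1 := rfl
  refine ⟨?_, ?_, ?_⟩
  · rw [i1, attachRight_zero, h1, if_pos (by simpa using hb), treeAt_succ (μ := μ') (r := r + 1) q, hqd, e, kids_add,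
      kids_one, kids_congr hqf, kids_add, kids_one, kids_frame hk, hqy]
    simp
  · rw [ordered_succ, hqd, e, ordKids_add (by simp) (by simp), ordKids_one, hqs, hqy,
      ordKids_congr hqf, ordKids_add hn (by simp), ordKids_one, ordKids_frame hk]
    exact ⟨⟨i3, h2⟩, h3⟩
  · rw [i2, recsAt_succ, hqd, e, recsKids_add, recsKids_one, recsKids_congr hqf, recsKids_add,
      recsKids_one, recsKids_frame hk, hqy, ← Multiset.singleton_add]
    rw [add_assoc, h4]
    simp only [add_assoc]

theorem right_steal (hq : μ q 0 = n + 1) (hn : 0 < n) (hb : ¬ n + 2 ≤ b)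
    (hoq : Ordered μ (r + 2) q lq m)
    (h : Merged a b μ μ' r (μ q (2 * n + 1)) y (μ q (2 * n)) hi two s) (h0 : two ≠ 0)
    (hk : ∀ w ∈ recsKids μ (r + 1) n (μ q), μ' w = μ w) (hqd : μ' q 0 = n)
    (hqf : ∀ f, 0 < f → f < 2 * n → μ' q f = μ q f) {z : ℕ}
    (hz : IsPair μ' z (μ q (2 * n + 1)) s y) :
    attachRight a b 0 (treeAt μ (r + 2) q) (treeAt μ (r + 1) y) =
      (treeAt μ' (r + 2) q, some (treeAt μ' (r + 2) z)) ∧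
    Ordered μ' (r + 2) q lq (μ q (2 * n)) ∧ Ordered μ' (r + 2) z (μ q (2 * n)) hi ∧
    recsAt μ' (r + 2) q + recsAt μ' (r + 2) z =
      recsAt μ (r + 2) q + recsAt μ (r + 1) y + {z} := by
  obtain ⟨h1, -⟩ := h.of_ne_zero h0
  obtain ⟨j1, j2, j3⟩ := h.pair h0 hz
  obtain ⟨i1, i2, i3, -⟩ := right_parts hq hn hoq
  refine ⟨?_, ?_, j2, ?_⟩
  · rw [j1, i1, attachRight_zero, h1, if_neg (by simpa using hb), treeAt_succ (μ := μ') (r := r + 1) q, hqd, kids_congr hqf,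
      kids_frame hk]
  · rw [ordered_succ, hqd, ordKids_congr hqf, ordKids_frame hk]
    exact i3
  · rw [i2, j3, recsAt_succ, hqd, recsKids_congr hqf, recsKids_frame hk, ← Multiset.singleton_add]
    abel

end right

-- At the parent on the left spine: fused child, additional child, stolen child.

section left

variable {q n hq m : ℕ}

theorem left_parts (hqn : μ q 0 = 1 + n) (hn : 0 < n) (hoq : Ordered μ (r + 1) q m hq) :
    treeAt μ (r + 1) q = node (treeAt μ r (μ q 1) :: kids μ r n fun f => μ q (2 * 1 + f)) ∧
    recsAt μ (r + 1) q =
      {q} + (recsAt μ r (μ q 1) + recsKids μ r n fun f => μ q (2 * 1 + f)) ∧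
    Ordered μ r (μ q 1) m (μ q 2) ∧ OrdKids μ r n (fun f => μ q (2 * 1 + f)) (μ q 2) hq := by
  rw [ordered_succ, hqn, ordKids_add (by simp) hn, ordKids_one] at hoq
  refine ⟨?_, ?_, hoq⟩
  · rw [treeAt_succ, hqn, kids_add, kids_one]; rfl
  · rw [recsAt_succ, hqn, recsKids_add, recsKids_one, Multiset.singleton_add]

/-- Fusing always happens in the record of the left node. Here this is the root of the attached
tree, so the parent needs a new first pointer, and the record of its old first child is given up. -/
theorem left_fused (hqn : μ q 0 = 1 + n) (hn : 0 < n) (hb : n + 1 ≤ b)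
    (hoq : Ordered μ (r + 2) q m hq)
    (h : Merged a b μ μ' r x (μ q 1) lo (μ q 2) two s) (h0 : two = 0)
    (hk : ∀ w ∈ recsKids μ (r + 1) n (fun f => μ q (2 * 1 + f)), μ' w = μ w)
    (hqd : μ' q 0 = 1 + n) (hqx : μ' q 1 = x) (hqf : ∀ f, 2 ≤ f → μ' q f = μ q f) :
    attachLeft a b 0 (treeAt μ (r + 2) q) (treeAt μ (r + 1) x) = (treeAt μ' (r + 2) q, none) ∧
    Ordered μ' (r + 2) q lo hq ∧
    recsAt μ' (r + 2) q + {μ q 1} = recsAt μ (r + 2) q + recsAt μ (r + 1) x := by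
  obtain ⟨h1, h2, h3, -⟩ := h.of_eq_zero h0
  obtain ⟨i1, i2, -, i3⟩ := left_parts hqn hn hoq
  have hqf' : (fun f => μ' q (2 * 1 + f)) = fun f => μ q (2 * 1 + f) :=
    funext fun f => hqf _ (by omega)
  refine ⟨?_, ?_, ?_⟩
  · rw [i1, attachLeft_zero, h1, if_pos (by simpa using hb), treeAt_succ (μ := μ') (r := r + 1) q, hqd, kids_add,
      kids_one, hqf', kids_frame hk, hqx]
  · rw [ordered_succ, hqd, ordKids_add (by simp) hn, ordKids_one, hqf', ordKids_frame hk, hqx,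
      hqf _ (by simp)]
    exact ⟨h2, i3⟩
  · rw [i2, recsAt_succ, hqd, recsKids_add, recsKids_one, hqf', recsKids_frame hk, hqx,
      ← Multiset.singleton_add]
    have e : ∀ A B C D E : Multiset ℕ, A + C = D + E →
        {q} + (A + B) + C = {q} + (E + B) + D := fun A B C D E hh => by
      rw [add_assoc, add_right_comm, hh]; abel
    exact e _ _ _ _ _ h3

theorem left_append (hqn : μ q 0 = 1 + n) (hn : 0 < n) (hb : n + 2 ≤ b)
    (hoq : Ordered μ (r + 2) q m hq)
    (h : Merged a b μ μ' r x (μ q 1) lo (μ q 2) two s) (h0 : two ≠ 0)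
    (hk : ∀ w ∈ recsKids μ (r + 1) n (fun f => μ q (2 * 1 + f)), μ' w = μ w)
    (hqd : μ' q 0 = n + 2) (hqx : μ' q 1 = x) (hqs : μ' q 2 = s) (hqy : μ' q 3 = μ q 1)
    (hqf : ∀ f, 2 ≤ f → f < 2 * (n + 1) → μ' q (f + 2) = μ q f) :
    attachLeft a b 0 (treeAt μ (r + 2) q) (treeAt μ (r + 1) x) = (treeAt μ' (r + 2) q, none) ∧
    Ordered μ' (r + 2) q lo hq ∧
    recsAt μ' (r + 2) q = recsAt μ (r + 2) q + recsAt μ (r + 1) x := by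
  obtain ⟨h1, h2, h3, h4⟩ := h.of_ne_zero h0
  obtain ⟨i1, i2, -, i3⟩ := left_parts hqn hn hoq
  have e : n + 2 = 1 + (1 + n) := by omega
  have hqf' : ∀ f, 0 < f → f < 2 * n →
      (fun f => (fun f => μ' q (2 * 1 + f)) (2 * 1 + f)) f = (fun f => μ q (2 * 1 + f)) f :=
    fun f _ hf => by
      dsimp only
      rw [← hqf (2 * 1 + f) (by omega) (by omega), show 2 * 1 + (2 * 1 + f) = 2 * 1 + f + 2 by omega]
  refine ⟨?_, ?_, ?_⟩
  · rw [i1, attachLeft_zero, h1, if_pos (by simpa using hb), treeAt_succ (μ := μ') (r := r + 1) q, hqd, e, kids_add,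
      kids_one, kids_add, kids_one, kids_congr hqf', kids_frame hk, hqx, hqy]
    simp
  · rw [ordered_succ, hqd, e, ordKids_add (by simp) (by simp), ordKids_one,
      ordKids_add (by simp) hn, ordKids_one, ordKids_congr hqf', ordKids_frame hk, hqx, hqs, hqy,
      hqf 2 (by simp) (by omega)]
    exact ⟨h2, h3, i3⟩
  · rw [i2, recsAt_succ, hqd, e, recsKids_add, recsKids_one, recsKids_add, recsKids_one,
      recsKids_congr hqf', recsKids_frame hk, hqx, hqy, ← Multiset.singleton_add]
    have e : ∀ A B C D E : Multiset ℕ, A + C = E + D →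
        {q} + (A + (C + B)) = {q} + (D + B) + E := fun A B C D E hh => by
      rw [← add_assoc A, hh]; abel
    exact e _ _ _ _ _ h4

theorem left_steal (hqn : μ q 0 = 1 + n) (hn : 0 < n) (hb : ¬ n + 2 ≤ b)
    (hoq : Ordered μ (r + 2) q m hq)
    (h : Merged a b μ μ' r x (μ q 1) lo (μ q 2) two s) (h0 : two ≠ 0)
    (hk : ∀ w ∈ recsKids μ (r + 1) n (fun f => μ q (2 * 1 + f)), μ' w = μ w)
    (hqd : μ' q 0 = n) (hqf : ∀ f, 0 < f → f < 2 * n → μ' q f = μ q (2 * 1 + f)) {z : ℕ}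
    (hz : IsPair μ' z x s (μ q 1)) :
    attachLeft a b 0 (treeAt μ (r + 2) q) (treeAt μ (r + 1) x) =
      (treeAt μ' (r + 2) q, some (treeAt μ' (r + 2) z)) ∧
    Ordered μ' (r + 2) q (μ q 2) hq ∧ Ordered μ' (r + 2) z lo (μ q 2) ∧
    recsAt μ' (r + 2) q + recsAt μ' (r + 2) z =
      recsAt μ (r + 2) q + recsAt μ (r + 1) x + {z} := by
  obtain ⟨h1, -⟩ := h.of_ne_zero h0
  obtain ⟨j1, j2, j3⟩ := h.pair h0 hz
  obtain ⟨i1, i2, -, i3⟩ := left_parts hqn hn hoq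
  refine ⟨?_, ?_, j2, ?_⟩
  · rw [j1, i1, attachLeft_zero, h1, if_neg (by simpa using hb), treeAt_succ (μ := μ') (r := r + 1) q, hqd,
      kids_congr (F' := fun f => μ q (2 * 1 + f)) hqf, kids_frame hk]
  · rw [ordered_succ, hqd, ordKids_congr (F' := fun f => μ q (2 * 1 + f)) hqf, ordKids_frame hk]
    exact i3
  · rw [i2, j3, recsAt_succ, hqd, recsKids_congr (F' := fun f => μ q (2 * 1 + f)) hqf,
      recsKids_frame hk, ← Multiset.singleton_add]
    abel

end left

end

/-! ### Degrees -/

section degrees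

variable {a b : ℕ} {μ : ℕ → ℕ → ℕ}

theorem isSubtree_kid {r v lo j : ℕ} (h : Inner a b lo (r + 1) (treeAt μ (r + 1) v))
    (hj : j < μ v 0) : IsSubtree a b (r + 1) (treeAt μ r (μ v (2 * j + 1))) := by
  obtain ⟨cs, h1, -, -, h2⟩ := h
  rw [treeAt_succ] at h1
  obtain rfl := (node.inj h1)
  exact h2 _ (List.mem_map.2 ⟨j, List.mem_range.2 hj, rfl⟩)

theorem Inner.degree {r v lo : ℕ} (h : Inner a b lo (r + 1) (treeAt μ (r + 1) v)) :
    lo ≤ μ v 0 ∧ μ v 0 ≤ b := by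
  obtain ⟨cs, h1, h2, h3, -⟩ := h
  rw [treeAt_succ] at h1
  obtain rfl := (node.inj h1)
  simpa using And.intro h2 h3

/-- The lower bound is that of the root, which may be smaller than a; the upper bound is what
copying a fixed number of fields needs. -/
theorem Inner.degree_rsp {r d v lo : ℕ} (hlo : 0 < lo) (hla : lo ≤ a)
    (h : Inner a b lo (r + d + 1) (treeAt μ (r + d + 1) v)) :
    lo ≤ μ (rsp μ v d) 0 ∧ μ (rsp μ v d) 0 ≤ b := by
  induction d generalizing v with
  | zero => exact h.degree
  | succ d ih =>
    have h1 := h.degree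
    have h2 := isSubtree_kid (j := μ v 0 - 1) h (by omega)
    have e : 2 * (μ v 0 - 1) + 1 = 2 * μ v 0 - 1 := by omega
    rw [e] at h2
    rw [rsp_succ']
    exact ih ((h2.inner (by omega)).mono hla)

theorem Inner.degree_lsp {r d v lo : ℕ} (hlo : 0 < lo) (hla : lo ≤ a)
    (h : Inner a b lo (r + d + 1) (treeAt μ (r + d + 1) v)) :
    lo ≤ μ (lsp μ v d) 0 ∧ μ (lsp μ v d) 0 ≤ b := by
  induction d generalizing v with
  | zero => exact h.degree
  | succ d ih =>
    have h1 := h.degree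
    have h2 := isSubtree_kid (j := 0) h (by omega)
    rw [lsp_succ']
    exact ih ((h2.inner (by omega)).mono hla)

end degrees


/-! ### A tree together with the block of its processor -/

/-- Record `M + p` is the block of processor `p`, which is in charge of the tree of height `h` with root
`v`.  Field `0` of the block contains the rank of the tree and field `3` the link `link` to the right
neighbour.  Fields `2 * j + 5` and `2 * j + 6` point to the nodes of rank `j` on the left and on the right
spine; they are up to date for the ranks that are not less than the rank `pr` of the left neighbour and
the rank `nr` of the right neighbour, respectively. -/
structure HeldAt (μ : ℕ → ℕ → ℕ) (M p h v : ℕ) (pr : ℕ∞) (lo hi : ℕ) (nr : ℕ∞) (link : ℕ) :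
    Prop where
  rank : μ (M + p) 0 = h + 1
  left : μ (M + p) (2 * (h + 1) + 5) = v
  right : μ (M + p) (2 * (h + 1) + 6) = v
  ord : Ordered μ h v lo hi
  link : μ (M + p) 3 = link
  spL : ∀ j : ℕ, 0 < j → pr ≤ j → j ≤ h + 1 → μ (M + p) (2 * j + 5) = lsp μ v (h + 1 - j)
  spR : ∀ j : ℕ, 0 < j → nr ≤ j → j ≤ h + 1 → μ (M + p) (2 * j + 6) = rsp μ v (h + 1 - j)

-- How the arrays of spine pointers survive a join.

section

variable {a b M pu pv p r d h v vu x y z s n link link' lu lo m hi two key : ℕ}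
  {μ μ' : ℕ → ℕ → ℕ} {pr nr pr' nr' nv pv' : ℕ∞}

theorem HeldAt.mono (H : HeldAt μ M p h v pr lo hi nr link) (hp : pr ≤ pr') (hn : nr ≤ nr') :
    HeldAt μ M p h v pr' lo hi nr' link :=
  ⟨H.rank, H.left, H.right, H.ord, H.link, fun j h0 h1 => H.spL j h0 (hp.trans h1),
    fun j h0 h1 => H.spR j h0 (hn.trans h1)⟩

theorem HeldAt.frame (H : HeldAt μ M p h v pr lo hi nr link)
    (hr : ∀ w ∈ recsAt μ h v, μ' w = μ w) (hb : ∀ f, f = 0 ∨ 5 ≤ f → μ' (M + p) f = μ (M + p) f)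
    (hl : μ' (M + p) 3 = link') :
    HeldAt μ' M p h v pr lo hi nr link' := by
  refine ⟨?_, ?_, ?_, (ordered_frame hr).2 H.ord, hl, fun j h0 h1 h2 => ?_,
    fun j h0 h1 h2 => ?_⟩
  · rw [hb _ (by omega), H.rank]
  · rw [hb _ (by omega), H.left]
  · rw [hb _ (by omega), H.right]
  · rw [hb _ (by omega), H.spL j h0 h1 h2,
      lsp_congr (μ' := μ') H.ord (by omega) fun w hw => by rw [hr w hw]]
  · rw [hb _ (by omega), H.spR j h0 h1 h2,
      rsp_congr (μ' := μ') H.ord (by omega) fun w hw => by simp only [lastKid, hr w hw]]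

theorem HeldAt.pair (hz : IsPair μ z x s y) (ho : Ordered μ (h + 1) z lo hi)
    (h0 : μ (M + p) 0 = h + 2) (hL : μ (M + p) (2 * (h + 2) + 5) = z)
    (hR : μ (M + p) (2 * (h + 2) + 6) = z) (hl : μ (M + p) 3 = link)
    (spL : ∀ j : ℕ, 0 < j → pr ≤ j → j ≤ h + 1 → μ (M + p) (2 * j + 5) = lsp μ x (h + 1 - j))
    (spR : ∀ j : ℕ, 0 < j → nr ≤ j → j ≤ h + 1 → μ (M + p) (2 * j + 6) = rsp μ y (h + 1 - j)) :
    HeldAt μ M p (h + 1) z pr lo hi nr link := by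
  refine ⟨h0, hL, hR, ho, hl, fun j h0 h1 h2 => ?_, fun j h0 h1 h2 => ?_⟩
  · by_cases hj : j = h + 2
    · subst hj; simpa [lsp] using hL
    · rw [spL j h0 h1 (by omega), show h + 1 + 1 - j = (h + 1 - j) + 1 by omega, lsp_succ', hz.fst]
  · by_cases hj : j = h + 2
    · subst hj; simpa [rsp] using hR
    · rw [spR j h0 h1 (by omega), show h + 1 + 1 - j = (h + 1 - j) + 1 by omega, rsp_succ']
      congr 1
      simp only [lastKid, hz.deg, hz.snd]

/-! ### Joins to the left -/

/-- The right spine of `vu` down to the node to which the tree of height `r + 1` is attached. -/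
theorem HeldAt.attach_right (hu : HeldAt μ M pu (r + 2 + d) vu pr lo m nv lu)
    (hn : (recsAt μ (r + 2 + d) vu).Nodup)
    (hf : ∀ w ∈ recsAt μ (r + 2 + d) vu, w ∉ recsAt μ (r + 2) (rsp μ vu d) → μ' w = μ w)
    (hfirst : ∀ w ∈ recsAt μ (r + 2 + d) vu, μ' w 1 = μ w 1)
    (hblk : ∀ f, f ≠ 3 → f ≠ 2 * (r + 2) + 6 → μ' (M + pu) f = μ (M + pu) f)
    (hlink : μ' (M + pu) 3 = link) (hnv : nv ≤ (r + 2 : ℕ)) (hnr : (r + 2 : ℕ) ≤ nr)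
    (hR : nr ≤ (r + 2 : ℕ) → μ' (M + pu) (2 * (r + 2) + 6) = lastKid μ' (rsp μ vu d))
    {V : LTree} {o : Option LTree} {X Y : Multiset ℕ}
    (hq : ∀ lq, Ordered μ (r + 2) (rsp μ vu d) lq m →
      attachRight a b 0 (treeAt μ (r + 2) (rsp μ vu d)) V = (treeAt μ' (r + 2) (rsp μ vu d), o) ∧
      Ordered μ' (r + 2) (rsp μ vu d) lq hi ∧
      recsAt μ' (r + 2) (rsp μ vu d) + X = recsAt μ (r + 2) (rsp μ vu d) + Y)
    (hV : V.rank = r + 2) :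
    joinToLeft a b (treeAt μ (r + 2 + d) vu) V = (treeAt μ' (r + 2 + d) vu, o) ∧
    HeldAt μ' M pu (r + 2 + d) vu pr lo hi nr link ∧
    recsAt μ' (r + 2 + d) vu + X = recsAt μ (r + 2 + d) vu + Y := by
  obtain ⟨⟨rest, i1, i1'⟩, ⟨lq, i2, i2'⟩, i3, i4, i5⟩ := spine_right a b hu.ord hn hf
  obtain ⟨j1, j2, j3⟩ := hq lq i2
  refine ⟨?_, ⟨?_, ?_, ?_, i2' _ j2, hlink, fun j h0 h1 h2 => ?_, fun j h0 h1 h2 => ?_⟩,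
    by rw [i1, i1', add_assoc, j3, add_assoc]⟩
  · rw [joinToLeft, hu.ord.rank_eq, hV, if_neg (by omega),
      show r + 2 + d + 1 - (r + 2) - 1 = d by omega]
    exact Prod.ext (i5 V (by rw [j1])).symm (by rw [i4 V, j1])
  · rw [hblk _ (by omega) (by omega), hu.rank]
  · rw [hblk _ (by omega) (by omega), hu.left]
  · rw [hblk _ (by omega) (by omega), hu.right]
  · rw [hblk _ (by omega) (by omega), hu.spL j h0 h1 h2, lsp_congr (μ' := μ') hu.ord (by omega) hfirst]
  -- The next tree on the right has rank at least that of the attached one. Hence only the entries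
  -- from this rank on are claimed, and of these only the lowest may have changed.
  · have hj : r + 2 ≤ j := by exact_mod_cast hnr.trans h1
    by_cases hj' : j = r + 2
    · subst hj'
      rw [hR h1, show r + 2 + d + 1 - (r + 2) = d + 1 by omega, rsp, i3 d le_rfl]
    · rw [hblk _ (by omega) (by omega), hu.spR j h0 (hnv.trans (by exact_mod_cast hj)) h2,
        i3 _ (by omega)]

/-- Equal ranks, the two roots have been fused. -/
theorem HeldAt.fuse_left (hu : HeldAt μ M pu (r + 1) x pr lo m nv lu)
    (hy : Ordered μ (r + 1) y m hi)
    (H : Merged a b μ μ' r x y lo hi two s) (h0 : two = 0)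
    (hf : ∀ w ∈ recsAt μ (r + 1) x, w ≠ x → μ' w = μ w)
    (hblk : ∀ f, f ≠ 3 → μ' (M + pu) f = μ (M + pu) f)
    (hlink : μ' (M + pu) 3 = link) (hnr : (r + 2 : ℕ) ≤ nr) :
    joinToLeft a b (treeAt μ (r + 1) x) (treeAt μ (r + 1) y) = (treeAt μ' (r + 1) x, none) ∧
    HeldAt μ' M pu (r + 1) x pr lo hi nr link ∧
    recsAt μ' (r + 1) x + {y} = recsAt μ (r + 1) x + recsAt μ (r + 1) y := by
  obtain ⟨h1, h2, h3, -⟩ := H.of_eq_zero h0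
  refine ⟨?_, ⟨?_, ?_, ?_, h2, hlink, fun j h0 h1 h2 => ?_, fun j h0 h1 h2 => ?_⟩, h3⟩
  · rw [joinToLeft, hu.ord.rank_eq, hy.rank_eq, if_pos rfl, h1, rootOf]
  · rw [hblk _ (by omega), hu.rank]
  · rw [hblk _ (by omega), hu.left]
  · rw [hblk _ (by omega), hu.right]
  · rw [hblk _ (by omega), hu.spL j h0 h1 h2, lsp_congr (μ' := μ') hu.ord (by omega) fun w hw => ?_]
    by_cases hw' : w = x
    · rw [hw', H.first]
    · rw [hf w hw hw']
  · have hj : r + 2 ≤ j := by exact_mod_cast hnr.trans h1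
    obtain rfl : j = r + 2 := by omega
    rw [hblk _ (by omega)]
    simpa [rsp] using hu.right

/-- Equal ranks, there is a new root above two nodes. -/
theorem HeldAt.root_left (hu : HeldAt μ M pu (r + 1) x pr lo m nv lu)
    (hy : Ordered μ (r + 1) y m hi)
    (H : Merged a b μ μ' r x y lo hi two s) (h0 : two ≠ 0) (hz : IsPair μ' z x s y)
    (hf : ∀ w ∈ recsAt μ (r + 1) x, w ≠ x → μ' w = μ w)
    (hblk : ∀ f, 3 < f → f < 2 * (r + 2) + 6 → μ' (M + pu) f = μ (M + pu) f)
    (hrank : μ' (M + pu) 0 = r + 3) (hL : μ' (M + pu) (2 * (r + 3) + 5) = z)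
    (hR : μ' (M + pu) (2 * (r + 3) + 6) = z) (hR' : μ' (M + pu) (2 * (r + 2) + 6) = y)
    (hlink : μ' (M + pu) 3 = link) (hnr : (r + 2 : ℕ) ≤ nr) :
    joinToLeft a b (treeAt μ (r + 1) x) (treeAt μ (r + 1) y) = (treeAt μ' (r + 2) z, none) ∧
    HeldAt μ' M pu (r + 2) z pr lo hi nr link ∧
    recsAt μ' (r + 2) z = {z} + (recsAt μ (r + 1) x + recsAt μ (r + 1) y) := by
  obtain ⟨h1, h2, h3⟩ := H.pair h0 hz
  refine ⟨?_, HeldAt.pair hz h2 hrank hL hR hlink (fun j i0 i1 i2 => ?_) fun j i0 i1 i2 => ?_, h3⟩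
  · rw [joinToLeft, hu.ord.rank_eq, hy.rank_eq, if_pos rfl, h1, (H.of_ne_zero h0).1, rootOf]
    simp
  · rw [hblk _ (by omega) (by omega), hu.spL j i0 i1 i2, lsp_congr (μ' := μ') hu.ord (by omega) fun w hw => ?_]
    by_cases hw' : w = x
    · rw [hw', H.first]
    · rw [hf w hw hw']
  · have hj : r + 2 ≤ j := by exact_mod_cast hnr.trans i1
    obtain rfl : j = r + 2 := by omega
    simpa [rsp] using hR'

/-! ### Joins to the right -/

/-- Only the first tree is joined to the right. Afterwards there is nothing to the left of `U`, or a
stealing tree of rank one more than before; either way the only entry of the left array that may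
have changed is no longer claimed, and the array needs no update. -/
theorem HeldAt.attach_left (hu : HeldAt μ M pu (r + 2 + d) vu pr m hi nr lu)
    (hn : (recsAt μ (r + 2 + d) vu).Nodup)
    (hf : ∀ w ∈ recsAt μ (r + 2 + d) vu, w ∉ recsAt μ (r + 2) (lsp μ vu d) → μ' w = μ w)
    (hlast : ∀ w ∈ recsAt μ (r + 2 + d) vu, lastKid μ' w = lastKid μ w)
    (hblk : ∀ f, f = 0 ∨ 5 ≤ f → μ' (M + pu) f = μ (M + pu) f)
    (hlink : μ' (M + pu) 3 = link) (hpr : pr ≤ (r + 2 : ℕ)) (hpr' : (r + 2 : ℕ) < pr')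
    {V : LTree} {o : Option LTree} {X Y : Multiset ℕ}
    (hq : ∀ hq, Ordered μ (r + 2) (lsp μ vu d) m hq →
      attachLeft a b 0 (treeAt μ (r + 2) (lsp μ vu d)) V = (treeAt μ' (r + 2) (lsp μ vu d), o) ∧
      Ordered μ' (r + 2) (lsp μ vu d) lo hq ∧
      recsAt μ' (r + 2) (lsp μ vu d) + X = recsAt μ (r + 2) (lsp μ vu d) + Y)
    (hV : V.rank = r + 2) :
    joinToRight a b V (treeAt μ (r + 2 + d) vu) = (treeAt μ' (r + 2 + d) vu, o) ∧
    HeldAt μ' M pu (r + 2 + d) vu pr' lo hi nr link ∧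
    recsAt μ' (r + 2 + d) vu + X = recsAt μ (r + 2 + d) vu + Y := by
  obtain ⟨⟨rest, i1, i1'⟩, ⟨lq, i2, i2'⟩, i3, i4, i5⟩ := spine_left a b hu.ord hn hf
  obtain ⟨j1, j2, j3⟩ := hq lq i2
  refine ⟨?_, ⟨?_, ?_, ?_, i2' _ j2, hlink, fun j h0 h1 h2 => ?_, fun j h0 h1 h2 => ?_⟩,
    by rw [i1, i1', add_assoc, j3, add_assoc]⟩
  · rw [joinToRight, hu.ord.rank_eq, hV, if_neg (by omega),
      show r + 2 + d + 1 - (r + 2) - 1 = d by omega]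
    exact Prod.ext (i5 V (by rw [j1])).symm (by rw [i4 V, j1])
  · rw [hblk _ (by omega), hu.rank]
  · rw [hblk _ (by omega), hu.left]
  · rw [hblk _ (by omega), hu.right]
  · have hj : r + 2 < j := by exact_mod_cast hpr'.trans_le h1
    rw [hblk _ (by omega), hu.spL j h0 (hpr.trans (by exact_mod_cast hj.le)) h2, i3 _ (by omega)]
  · rw [hblk _ (by omega), hu.spR j h0 h1 h2, rsp_congr (μ' := μ') hu.ord (by omega) hlast]

/-- The fused root is in the record of the vanishing tree, and it has inherited the last child of
`y`; so the right spine of `U` is the same below the root, and only the entries for the root are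
replaced. -/
theorem HeldAt.fuse_right (hu : HeldAt μ M pu (r + 1) y pr m hi nr lu)
    (hx : Ordered μ (r + 1) x lo m)
    (H : Merged a b μ μ' r x y lo hi two s) (h0 : two = 0)
    (hf : ∀ w ∈ recsAt μ (r + 1) y, w ≠ y → μ' w = μ w)
    (hblk : ∀ f, f = 0 ∨ 5 ≤ f → f < 2 * (r + 2) + 5 → μ' (M + pu) f = μ (M + pu) f)
    (hL : μ' (M + pu) (2 * (r + 2) + 5) = x) (hR : μ' (M + pu) (2 * (r + 2) + 6) = x)
    (hlink : μ' (M + pu) 3 = link) :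
    joinToRight a b (treeAt μ (r + 1) x) (treeAt μ (r + 1) y) = (treeAt μ' (r + 1) x, none) ∧
    HeldAt μ' M pu (r + 1) x ⊤ lo hi nr link ∧
    recsAt μ' (r + 1) x + {y} = recsAt μ (r + 1) x + recsAt μ (r + 1) y := by
  obtain ⟨h1, h2, h3, h4⟩ := H.of_eq_zero h0
  refine ⟨?_, ⟨?_, hL, hR, h2, hlink, fun j h0 h1 h2 => ?_, fun j h0 h1 h2 => ?_⟩, h3⟩
  · rw [joinToRight, hu.ord.rank_eq, hx.rank_eq, if_pos rfl, h1, rootOf]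
  · rw [hblk _ (by omega) (by omega), hu.rank]
  · simp at h1
  · by_cases hj : j = r + 2
    · subst hj; simpa [rsp] using hR
    · rw [hblk _ (by omega) (by omega), hu.spR j h0 h1 h2]
      obtain ⟨e, he⟩ : ∃ e, r + 1 + 1 - j = e + 1 := ⟨r + 1 - j, by omega⟩
      rw [he, rsp_succ' (μ := μ') x, h4, ← H.last, ← rsp_succ',
        rsp_congr (μ' := μ') hu.ord (by omega) fun w hw => ?_]
      by_cases hw' : w = y
      · rw [hw', H.last]
      · simp only [lastKid, hf w hw hw']

theorem HeldAt.root_right (hu : HeldAt μ M pu (r + 1) y pr m hi nr lu)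
    (hx : Ordered μ (r + 1) x lo m)
    (H : Merged a b μ μ' r x y lo hi two s) (h0 : two ≠ 0) (hz : IsPair μ' z x s y)
    (hf : ∀ w ∈ recsAt μ (r + 1) y, w ≠ y → μ' w = μ w)
    (hblk : ∀ f, 5 ≤ f → f < 2 * (r + 3) + 5 → μ' (M + pu) f = μ (M + pu) f)
    (hrank : μ' (M + pu) 0 = r + 3) (hL : μ' (M + pu) (2 * (r + 3) + 5) = z)
    (hR : μ' (M + pu) (2 * (r + 3) + 6) = z) (hlink : μ' (M + pu) 3 = link) :
    joinToRight a b (treeAt μ (r + 1) x) (treeAt μ (r + 1) y) = (treeAt μ' (r + 2) z, none) ∧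
    HeldAt μ' M pu (r + 2) z ⊤ lo hi nr link ∧
    recsAt μ' (r + 2) z = {z} + (recsAt μ (r + 1) x + recsAt μ (r + 1) y) := by
  obtain ⟨h1, h2, h3⟩ := H.pair h0 hz
  refine ⟨?_, HeldAt.pair hz h2 hrank hL hR hlink (fun j i0 i1 i2 => ?_) fun j i0 i1 i2 => ?_, h3⟩
  · rw [joinToRight, hu.ord.rank_eq, hx.rank_eq, if_pos rfl, h1, (H.of_ne_zero h0).1, rootOf]
    simp
  · simp at i1
  · rw [hblk _ (by omega) (by omega), hu.spR j i0 i1 i2, rsp_congr (μ' := μ') hu.ord (by omega) fun w hw => ?_]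
    by_cases hw' : w = y
    · rw [hw', H.last]
    · simp only [lastKid, hf w hw hw']

end


/-! ### The situation before a tree is attached to a spine -/

/-- The parts of a tree that has a node `q` above `x` on its spine, next to a tree with root `y`. -/
structure Spine (A B : Multiset ℕ) (q x y : ℕ) (K C X : Multiset ℕ) : Prop where
  q_mem : q ∈ A
  x_mem : x ∈ A
  y_mem : y ∈ B
  q_ne_x : q ≠ x
  q_ne_y : q ≠ y
  kids : ∀ w ∈ K, w ∈ A ∧ w ≠ q ∧ w ≠ x ∧ w ≠ y
  rest : ∀ w ∈ A, w ∉ C → w ≠ q ∧ w ≠ x ∧ w ≠ y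
  under : ∀ w, w ∈ X ∨ w ∈ B → (w ∈ A ∨ w ∈ B) ∧ w ≠ q

section

variable {a b M pu pv p r d h v vu x y z s n link link' lu lo m hi two key : ℕ}
  {μ μ' : ℕ → ℕ → ℕ} {pr nr pr' nr' nv pv' : ℕ∞}

theorem spine_of_parts {A B C K X : Multiset ℕ} {q : ℕ} (hn : (A + B).Nodup)
    (hC : C ≤ A) (hq : C = {q} + (K + X)) (hx : x ∈ X) (hy : y ∈ B) : Spine A B q x y K C X := by
  rw [Multiset.nodup_add, Multiset.disjoint_left] at hn
  obtain ⟨hA, -, hd⟩ := hn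
  have hCn := Multiset.nodup_of_le hC hA
  have hsub : ∀ w ∈ C, w ∈ A := fun w hw => Multiset.mem_of_le hC hw
  have hCn' := hCn
  rw [hq, Multiset.singleton_add, Multiset.nodup_cons, Multiset.nodup_add, Multiset.disjoint_left,
    Multiset.mem_add, not_or] at hCn'
  obtain ⟨⟨h1, h2⟩, -, -, h3⟩ := hCn'
  have hqC : q ∈ C := by simp [hq]
  have hxC : x ∈ C := by simp [hq, hx]
  have hne : ∀ w ∈ A, w ≠ y := by rintro w hw rfl; exact hd hw hy
  refine ⟨hsub q hqC, hsub x hxC, hy, ?_, hne q (hsub q hqC), fun w hw => ?_, fun w hw hwC => ?_,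
    fun w hw => ?_⟩
  · rintro rfl; exact h2 hx
  · have hwC : w ∈ C := by simp [hq, hw]
    refine ⟨hsub w hwC, ?_, ?_, hne w (hsub w hwC)⟩
    · rintro rfl; exact h1 hw
    · rintro rfl; exact h3 hw hx
  · refine ⟨?_, ?_, hne w hw⟩
    · rintro rfl; exact hwC hqC
    · rintro rfl; exact hwC hxC
  · rcases hw with hw | hw
    · have hwC : w ∈ C := by simp [hq, hw]
      refine ⟨.inl (hsub w hwC), ?_⟩
      rintro rfl; exact h2 hw
    · refine ⟨.inr hw, ?_⟩
      rintro rfl; exact hd (hsub w hqC) hw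

/-- The right array is correct from the rank of the right neighbour on, and this neighbour is the
tree to be attached. So the entry for its rank is the node to be combined with it, and the next
entry is the parent of that node. -/
theorem HeldAt.spine_right (hu : HeldAt μ M pu (r + 2 + d) vu pr lo m (r + 2 : ℕ) lu)
    (hv : Ordered μ (r + 1) y m hi) (hU : Inner a b 2 (r + 2 + d) (treeAt μ (r + 2 + d) vu))
    (ha : 2 ≤ a) (hV : Inner a b 1 (r + 1) (treeAt μ (r + 1) y))
    (hn : (recsAt μ (r + 2 + d) vu + recsAt μ (r + 1) y).Nodup) :
    ∃ q n x, q = rsp μ vu d ∧ x = μ q (2 * n + 1) ∧ μ q 0 = n + 1 ∧ 0 < n ∧ n + 1 ≤ b ∧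
      μ (M + pu) (2 * (r + 2) + 6) = x ∧ μ (M + pu) (2 * (r + 2) + 8) = q ∧
      Combinable b μ r x y (μ q (2 * n)) m hi ∧
      Spine (recsAt μ (r + 2 + d) vu) (recsAt μ (r + 1) y) q x y
        (recsKids μ (r + 1) n (μ q)) (recsAt μ (r + 2) q) (recsAt μ (r + 1) x) := by
  obtain ⟨⟨rest, i1, -⟩, ⟨lq, i2, -⟩, -⟩ :=
    LightJoin.spine_right (μ' := μ) a b hu.ord (Multiset.nodup_add.1 hn).1 fun _ _ _ => rfl
  have e1 : r + 2 + d = r + 1 + d + 1 := by omega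
  have e2 : r + 2 + d = r + (d + 1) + 1 := by omega
  have hq := Inner.degree_rsp (r := r + 1) (d := d) (by norm_num) ha (by rwa [← e1])
  have hx := Inner.degree_rsp (r := r) (d := d + 1) (by norm_num) ha (by rwa [← e2])
  have hy := hV.degree
  obtain ⟨n, hqn⟩ : ∃ n, μ (rsp μ vu d) 0 = n + 1 := ⟨μ (rsp μ vu d) 0 - 1, by omega⟩
  have hxk : rsp μ vu (d + 1) = μ (rsp μ vu d) (2 * n + 1) := by
    rw [rsp, lastKid, hqn]; rfl
  obtain ⟨-, j2, -, j4⟩ := right_parts hqn (by omega) i2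
  have hle : recsAt μ (r + 2) (rsp μ vu d) ≤ recsAt μ (r + 2 + d) vu :=
    i1 ▸ Multiset.le_add_left _ _
  refine ⟨_, n, _, rfl, rfl, hqn, by omega, by omega, ?_, ?_, ⟨j4, hv, ?_, ?_, hy.2⟩,
    spine_of_parts hn hle j2 (self_mem_recsAt _ _) (self_mem_recsAt _ _)⟩
  · rw [← hxk, hu.spR _ (by omega) (by exact_mod_cast le_rfl) (by omega),
      show r + 2 + d + 1 - (r + 2) = d + 1 by omega]
  · rw [show 2 * (r + 2) + 8 = 2 * (r + 3) + 6 by omega,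
      hu.spR _ (by omega) (by exact_mod_cast Nat.le_succ _) (by omega),
      show r + 2 + d + 1 - (r + 3) = d by omega]
  · refine Multiset.nodup_of_le (add_le_add_left ?_ _) hn
    refine le_trans ?_ hle
    rw [j2, ← add_assoc]
    exact Multiset.le_add_left _ _
  · rw [← hxk]; exact hx.2

theorem HeldAt.spine_left (hu : HeldAt μ M pu (r + 2 + d) vu (r + 2 : ℕ) m hi nr lu)
    (hv : Ordered μ (r + 1) x lo m) (hU : Inner a b 2 (r + 2 + d) (treeAt μ (r + 2 + d) vu))
    (ha : 2 ≤ a) (hV : Inner a b 1 (r + 1) (treeAt μ (r + 1) x))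
    (hn : (recsAt μ (r + 2 + d) vu + recsAt μ (r + 1) x).Nodup) :
    ∃ q n y, q = lsp μ vu d ∧ y = μ q 1 ∧ μ q 0 = 1 + n ∧ 0 < n ∧ n + 1 ≤ b ∧
      μ (M + pu) (2 * (r + 2) + 5) = y ∧ μ (M + pu) (2 * (r + 2) + 7) = q ∧
      Combinable b μ r x y lo m (μ q 2) ∧
      Spine (recsAt μ (r + 2 + d) vu) (recsAt μ (r + 1) x) q y x
        (recsKids μ (r + 1) n (fun f => μ q (2 * 1 + f))) (recsAt μ (r + 2) q)
        (recsAt μ (r + 1) y) := by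
  obtain ⟨⟨rest, i1, -⟩, ⟨lq, i2, -⟩, -⟩ :=
    LightJoin.spine_left (μ' := μ) a b hu.ord (Multiset.nodup_add.1 hn).1 fun _ _ _ => rfl
  have e1 : r + 2 + d = r + 1 + d + 1 := by omega
  have e2 : r + 2 + d = r + (d + 1) + 1 := by omega
  have hq := Inner.degree_lsp (r := r + 1) (d := d) (by norm_num) ha (by rwa [← e1])
  have hx := Inner.degree_lsp (r := r) (d := d + 1) (by norm_num) ha (by rwa [← e2])
  have hy := hV.degree
  obtain ⟨n, hqn⟩ : ∃ n, μ (lsp μ vu d) 0 = 1 + n := ⟨μ (lsp μ vu d) 0 - 1, by omega⟩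
  obtain ⟨-, j2, j4, -⟩ := left_parts hqn (by omega) i2
  have hle : recsAt μ (r + 2) (lsp μ vu d) ≤ recsAt μ (r + 2 + d) vu :=
    i1 ▸ Multiset.le_add_left _ _
  have j2' : recsAt μ (r + 2) (lsp μ vu d) = {lsp μ vu d} +
      ((recsKids μ (r + 1) n fun f => μ (lsp μ vu d) (2 * 1 + f)) +
        recsAt μ (r + 1) (μ (lsp μ vu d) 1)) := by
    rw [j2, add_comm (recsAt _ _ _)]
  refine ⟨_, n, _, rfl, rfl, hqn, by omega, by omega, ?_, ?_, ⟨hv, j4, ?_, hy.2, hx.2⟩,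
    spine_of_parts hn hle j2' (self_mem_recsAt _ _) (self_mem_recsAt _ _)⟩
  · rw [hu.spL _ (by omega) (by exact_mod_cast le_rfl) (by omega),
      show r + 2 + d + 1 - (r + 2) = d + 1 by omega]; rfl
  · rw [show 2 * (r + 2) + 7 = 2 * (r + 3) + 5 by omega,
      hu.spL _ (by omega) (by exact_mod_cast Nat.le_succ _) (by omega),
      show r + 2 + d + 1 - (r + 3) = d by omega]
  · rw [add_comm]
    refine Multiset.nodup_of_le (add_le_add_left ?_ _) hn
    refine le_trans ?_ hle
    rw [j2', ← add_assoc]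
    exact Multiset.le_add_left _ _

end

/-! ### Sequences of trees in memory -/

/-- The rank of the first tree; `nr` if there is none. -/
def rankOf (nr : ℕ∞) : List Entry → ℕ∞
  | [] => nr
  | e :: _ => e.2.rank

/-- The link to the first tree; `link` if there is none. -/
def linkOf (link : ℕ) : List Entry → ℕ
  | [] => link
  | e :: _ => e.1 + 1

/-- A lower bound on the values of the first tree, from field `4` of the block of its processor; `hi`
if there is none. -/
def sepOf (μ : ℕ → ℕ → ℕ) (M hi : ℕ) : List Entry → ℕ
  | [] => hi
  | e :: _ => μ (M + e.1) 4

/-- The tree of an entry is in memory. -/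
def Held (μ : ℕ → ℕ → ℕ) (M : ℕ) (e : Entry) (pr : ℕ∞) (hi : ℕ) (nr : ℕ∞) (link : ℕ) : Prop :=
  ∃ h v, e.2 = treeAt μ h v ∧ HeldAt μ M e.1 h v pr (μ (M + e.1) 4) hi nr link

/-- The records of the tree of an entry. -/
def recs (μ : ℕ → ℕ → ℕ) (M : ℕ) (e : Entry) : Multiset ℕ :=
  recsAt μ (μ (M + e.1) 0 - 1) (μ (M + e.1) (2 * μ (M + e.1) 0 + 6))

/-- The sequence of trees is in memory.  The tree to its left has rank `pr`, the one to its right has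
rank `nr`, and `hi` is an upper bound on the values. -/
def Chain (μ : ℕ → ℕ → ℕ) (M hi : ℕ) (nr : ℕ∞) (link : ℕ) : ℕ∞ → List Entry → Prop
  | _, [] => True
  | pr, e :: l => Held μ M e pr (sepOf μ M hi l) (rankOf nr l) (linkOf link l) ∧
      Chain μ M hi nr link e.2.rank l

/-- The records of a sequence of trees. -/
def total (μ : ℕ → ℕ → ℕ) (M : ℕ) (l : List Entry) : Multiset ℕ := (l.map (recs μ M)).sum

-- Changing memory outside of a sequence of trees.

section

variable {M p h v hi link lo : ℕ} {μ μ' : ℕ → ℕ → ℕ} {pr nr : ℕ∞}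

theorem HeldAt.recs_eq (H : HeldAt μ M p h v pr lo hi nr link) (t : LTree) :
    recs μ M (p, t) = recsAt μ h v := by
  simp only [recs, H.rank, H.right, Nat.add_sub_cancel]

theorem Held.mono {e : Entry} {pr' nr' : ℕ∞} (H : Held μ M e pr hi nr link) (hp : pr ≤ pr')
    (hn : nr ≤ nr') : Held μ M e pr' hi nr' link := by
  obtain ⟨h, v, h1, h2⟩ := H
  exact ⟨h, v, h1, h2.mono hp hn⟩

theorem Held.frame_fields {e : Entry} (H : Held μ M e pr hi nr link)
    (hr : ∀ w ∈ recs μ M e, μ' w = μ w)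
    (hb : ∀ f, f ≠ 1 → f ≠ 2 → μ' (M + e.1) f = μ (M + e.1) f) :
    Held μ' M e pr hi nr link ∧ recs μ' M e = recs μ M e := by
  obtain ⟨h, v, h1, h2⟩ := H
  have hrec : recs μ M e = recsAt μ h v := h2.recs_eq e.2
  rw [hrec] at hr
  have h3 : HeldAt μ' M e.1 h v pr (μ (M + e.1) 4) hi nr link :=
    h2.frame hr (fun f hf => hb f (by omega) (by omega)) ((hb 3 (by norm_num) (by norm_num)).trans h2.link)
  refine ⟨⟨h, v, by rw [treeAt_frame hr, h1], ?_⟩, ?_⟩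
  · rwa [hb 4 (by norm_num) (by norm_num)]
  · rw [hrec, ← recsAt_frame hr]
    exact h3.recs_eq e.2

theorem Held.frame {e : Entry} (H : Held μ M e pr hi nr link)
    (hr : ∀ w ∈ recs μ M e, μ' w = μ w) (hb : μ' (M + e.1) = μ (M + e.1)) :
    Held μ' M e pr hi nr link ∧ recs μ' M e = recs μ M e :=
  H.frame_fields hr fun f _ _ => by rw [hb]

/-- Fields 1 and 2 of a block, for the random bit and the left link, are scratch space; the
description of the trees does not mention them. -/
theorem Chain.frame_fields {l : List Entry} (H : Chain μ M hi nr link pr l)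
    (hr : ∀ w ∈ total μ M l, μ' w = μ w)
    (hb : ∀ e ∈ l, ∀ f, f ≠ 1 → f ≠ 2 → μ' (M + e.1) f = μ (M + e.1) f) :
    Chain μ' M hi nr link pr l ∧ total μ' M l = total μ M l ∧
      sepOf μ' M hi l = sepOf μ M hi l := by
  induction l generalizing pr with
  | nil => exact ⟨trivial, rfl, rfl⟩
  | cons e l ih =>
    simp only [total, List.map_cons, List.sum_cons, Multiset.mem_add] at hr ⊢
    obtain ⟨i1, i2, i3⟩ := ih H.2 (fun w hw => hr w (.inr hw)) fun e he => hb e (by simp [he])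
    obtain ⟨j1, j2⟩ := H.1.frame_fields (fun w hw => hr w (.inl hw)) (hb e (by simp))
    refine ⟨⟨?_, i1⟩, ?_, ?_⟩
    · rw [i3]; exact j1
    · rw [j2]; congr 1
    · simp only [sepOf, hb e (by simp) 4 (by norm_num) (by norm_num)]

theorem Chain.frame {l : List Entry} (H : Chain μ M hi nr link pr l)
    (hr : ∀ w ∈ total μ M l, μ' w = μ w) (hb : ∀ e ∈ l, μ' (M + e.1) = μ (M + e.1)) :
    Chain μ' M hi nr link pr l ∧ total μ' M l = total μ M l ∧
      sepOf μ' M hi l = sepOf μ M hi l :=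
  H.frame_fields hr fun e he f _ _ => by rw [hb e he]

theorem Chain.mono {l : List Entry} {pr' : ℕ∞} (H : Chain μ M hi nr link pr l) (hp : pr ≤ pr') :
    Chain μ M hi nr link pr' l := by
  cases l with
  | nil => trivial
  | cons e l => exact ⟨H.1.mono hp le_rfl, H.2⟩

/-- The rank of the last tree; `pr` if there is none. -/
def lastRank : ℕ∞ → List Entry → ℕ∞
  | pr, [] => pr
  | _, e :: l => lastRank e.2.rank l

theorem chain_append {l l' : List Entry} : Chain μ M hi nr link pr (l ++ l') ↔
    Chain μ M (sepOf μ M hi l') (rankOf nr l') (linkOf link l') pr l ∧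
      Chain μ M hi nr link (lastRank pr l) l' := by
  induction l generalizing pr with
  | nil => simp [Chain, lastRank]
  | cons e l ih =>
    have h1 : sepOf μ M hi (l ++ l') = sepOf μ M (sepOf μ M hi l') l := by cases l <;> rfl
    have h2 : rankOf nr (l ++ l') = rankOf (rankOf nr l') l := by cases l <;> rfl
    have h3 : linkOf link (l ++ l') = linkOf (linkOf link l') l := by cases l <;> rfl
    simp only [List.cons_append, Chain, ih, h1, h2, h3, lastRank, and_assoc]

end


/-! ### The program for a join to the left neighbour -/

/-- The block of the processor. -/
abbrev ownBlock : Expr := rg 2 + .pid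

/-- The tree of the processor disappears, and the block in register 23 gets its link. -/
def vanish : Cmd := seq (store (rg 23) (.const 3) (rg 6)) (assign 1 (.const 0))

/-- Make a new node whose children are the nodes in registers 14 and 15. -/
def newPair : Cmd :=
  seq (store (rg 24) (.const 0) (.const 2)) <| seq (store (rg 24) (.const 1) (rg 14)) <|
  seq (store (rg 24) (.const 2) (rg 16)) (store (rg 24) (.const 3) (rg 15))

/-- Replace the root in the block `e` by the new node, of rank one more than register 12. -/
def newRoot (e : Expr) : Cmd :=
  seq (store e (.const 0) (rg 12 + .const 1)) <|
  seq (store e (rg 12 + rg 12 + .const 7) (rg 24)) (store e (rg 12 + rg 12 + .const 8) (rg 24))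

/-- The second half of a join to a left neighbour of larger rank. -/
def attachRightP (b : ℕ) : Cmd :=
  seq (load 21 (rg 23) (rg 12 + rg 12 + .const 8)) <| seq (load 22 (rg 21) (.const 0)) <|
  ite (rg 19)
    (ite (.const b - rg 22)
      (seq (store (rg 21) (rg 22 + rg 22) (rg 16)) <|
       seq (store (rg 21) (rg 22 + rg 22 + .const 1) (rg 15)) <|
       seq (store (rg 21) (.const 0) (rg 22 + .const 1)) <|
       seq (store (rg 23) (rg 12 + rg 12 + .const 6) (rg 15)) vanish)
      (seq (load 25 (rg 21) (rg 22 + rg 22 - .const 2)) <|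
       seq (store (rg 21) (.const 0) (rg 22 - .const 1)) <|
       seq newPair <| seq (newRoot ownBlock) (store ownBlock (.const 4) (rg 25))))
    vanish

/-- The second half of a join to a left neighbour of the same rank. -/
def raiseRightP : Cmd :=
  ite (rg 19)
    (seq newPair <| seq (newRoot (rg 23)) <|
     seq (store (rg 23) (rg 12 + rg 12 + .const 6) (rg 15)) vanish)
    vanish

/-- Join the tree of the processor to its left neighbour. -/
def joinRightP (a b : ℕ) : Cmd :=
  seq (assign 23 (rg 2 + (rg 5 - .const 1))) <|
  seq (load 12 ownBlock (.const 0)) <| seq (load 13 (rg 23) (.const 0)) <|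
  seq (load 14 (rg 23) (rg 12 + rg 12 + .const 6)) <|
  seq (load 15 ownBlock (rg 12 + rg 12 + .const 5)) <|
  seq (load 16 ownBlock (.const 4)) <| seq (combineP a b) <|
  ite (rg 13 - rg 12) (attachRightP b) raiseRightP

/-- The state after the trees of `u` and `v` have been replaced by the entries `l`, by processor `p`. -/
structure AfterJoin (M hi : ℕ) (nr : ℕ∞) (link : ℕ) (pr : ℕ∞) (z : ℕ) (u v : Entry) (p : ℕ) (s : Loc)
    (l : List Entry) (s' : Loc) : Prop where
  chain : Chain s'.1 M hi nr link pr l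
  total : total s'.1 M l ≤ recs s.1 M u + recs s.1 M v + {z}
  alive : s'.2 1 = if p ∈ l.map Prod.fst then 1 else 0
  regs : ∀ i < 12, i ≠ 1 → s'.2 i = s.2 i

-- Correctness of a join to the left neighbour, by cases.

section

variable {a b M pu pv p r d h v vu x y z s n link link' lu lo m hi two key k : ℕ}
  {μ μ₁ μ' : ℕ → ℕ → ℕ} {pr nr pr' nr' nv pv' : ℕ∞} {ρ ρ' : ℕ → ℕ} {R W : Set ℕ}

/-- The registers after two nodes have been combined. -/
structure JoinRegs (M link z : ℕ) (rv pb x y s two : ℕ) (ρ : ℕ → ℕ) : Prop where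
  r2 : ρ 2 = M
  r6 : ρ 6 = link
  r12 : ρ 12 = rv
  r14 : ρ 14 = x
  r15 : ρ 15 = y
  r16 : ρ 16 = s
  r19 : ρ 19 = two
  r23 : ρ 23 = M + pb
  r24 : ρ 24 = z

/-- The blocks of two processors and a new record do not belong to the trees `A`. -/
structure Outside (A : Multiset ℕ) (M pu pv z : ℕ) : Prop where
  blocks : pu ≠ pv
  zu : z ≠ M + pu
  zv : z ≠ M + pv
  mem : ∀ w ∈ A, w ≠ M + pu ∧ w ≠ M + pv ∧ w ≠ z

theorem put_ne {v v' i i' x : ℕ} (h : v' ≠ v ∨ i' ≠ i) : put μ v i x v' i' = μ v' i' :=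
  if_neg fun h' => h.elim (· h'.1) (· h'.2)

theorem put_eq {v v' i i' x : ℕ} (hv : v' = v) (hi : i' = i) : put μ v i x v' i' = x :=
  if_pos ⟨hv, hi⟩

theorem put_steal {B c i j : ℕ} (hqz : q ≠ z) (hqB : q ≠ B) (hzB : z ≠ B)
    (hi : i = 2 * (r + 3) + 5) (hj : j = 2 * (r + 3) + 6)
    (hμ : put (put (put (put (put (put (put (put (put μ₁ q 0 n) z 0 2) z 1 x) z 2 s) z 3 y)
      B 0 c) B i z) B j z) B 4 key = μ') :
    (∀ w, w ≠ q → w ≠ z → w ≠ B → μ' w = μ₁ w) ∧ μ' q 0 = n ∧ (∀ f, 0 < f → μ' q f = μ₁ q f) ∧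
      IsPair μ' z x s y ∧ (∀ f, f ≠ 0 → f ≠ 4 → f < 2 * (r + 3) + 5 → μ' B f = μ₁ B f) ∧
      μ' B 4 = key ∧ μ' B 0 = c ∧ μ' B (2 * (r + 3) + 5) = z ∧ μ' B (2 * (r + 3) + 6) = z := by
  subst hμ
  refine ⟨fun w i1 i2 i3 => ?_, ?_, fun f hf => ?_, ⟨?_, ?_, ?_, ?_⟩, fun f i1 i2 i3 => ?_,
    ?_, ?_, ?_, ?_⟩
  · simp only [put_of_ne i1, put_of_ne i2, put_of_ne i3]
  · (repeat rw [put_ne (by omega)]); rw [put_eq (by omega) (by omega)]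
  · repeat rw [put_ne (by omega)]
  · (repeat rw [put_ne (by omega)]); rw [put_eq (by omega) (by omega)]
  · (repeat rw [put_ne (by omega)]); rw [put_eq (by omega) (by omega)]
  · (repeat rw [put_ne (by omega)]); rw [put_eq (by omega) (by omega)]
  · (repeat rw [put_ne (by omega)]); rw [put_eq (by omega) (by omega)]
  · repeat rw [put_ne (by omega)]
  · rw [put_eq (by omega) (by omega)]
  · (repeat rw [put_ne (by omega)]); rw [put_eq (by omega) (by omega)]
  · (repeat rw [put_ne (by omega)]); rw [put_eq (by omega) (by omega)]
  · (repeat rw [put_ne (by omega)]); rw [put_eq (by omega) (by omega)]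

theorem put_append {B i j l : ℕ} (hqB : q ≠ B) (hi : i = 2 * (n + 1)) (hj : j = 2 * (n + 1) + 1)
    (hl : l = 2 * (r + 2) + 6)
    (hμ : put (put (put (put (put μ₁ q i s) q j y) q 0 (n + 2)) B l y) B 3 link = μ') :
    (∀ w, w ≠ q → w ≠ B → μ' w = μ₁ w) ∧
      (∀ f, f ≠ 3 → f ≠ 2 * (r + 2) + 6 → μ' B f = μ₁ B f) ∧ μ' q 0 = n + 2 ∧
      (∀ f, 0 < f → f < 2 * (n + 1) → μ' q f = μ₁ q f) ∧ μ' q (2 * (n + 1)) = s ∧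
      μ' q (2 * (n + 1) + 1) = y ∧ μ' B (2 * (r + 2) + 6) = y := by
  subst hμ
  refine ⟨fun w i1 i2 => ?_, fun f i1 i2 => ?_, ?_, fun f i1 i2 => ?_, ?_, ?_, ?_⟩
  · simp only [put_of_ne i1, put_of_ne i2]
  · repeat rw [put_ne (by omega)]
  · (repeat rw [put_ne (by omega)]); rw [put_eq (by omega) (by omega)]
  · repeat rw [put_ne (by omega)]
  · (repeat rw [put_ne (by omega)]); rw [put_eq (by omega) (by omega)]
  · (repeat rw [put_ne (by omega)]); rw [put_eq (by omega) (by omega)]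
  · (repeat rw [put_ne (by omega)]); rw [put_eq (by omega) (by omega)]

theorem joinEntries_none {U V U' : LTree} (h : joinToLeft a b U V = (U', none)) :
    joinEntries a b (pu, U) (pv, V) = [(pu, U')] := by
  simp only [joinEntries, h]

theorem joinEntries_some {U V U' V' : LTree} (h : joinToLeft a b U V = (U', some V')) :
    joinEntries a b (pu, U) (pv, V) = [(pu, U'), (pv, V')] := by
  simp only [joinEntries, h]

theorem AfterJoin.single {u v e : Entry} {st : Loc} (H : Held μ' M e pr hi nr link)
    (ht : recs μ' M e ≤ recs st.1 M u + recs st.1 M v + {z}) (h0 : ρ' 1 = 0) (hp : e.1 ≠ p)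
    (hr : ∀ i < 12, i ≠ 1 → ρ' i = st.2 i) :
    AfterJoin M hi nr link pr z u v p st [e] (μ', ρ') :=
  ⟨⟨H, trivial⟩, by simpa [LightJoin.total] using ht, by simp [h0, hp.symm], hr⟩

theorem AfterJoin.pair {u v e f : Entry} {st : Loc}
    (He : Held μ' M e pr (μ' (M + f.1) 4) f.2.rank (f.1 + 1))
    (Hf : Held μ' M f e.2.rank hi nr link)
    (ht : recs μ' M e + recs μ' M f ≤ recs st.1 M u + recs st.1 M v + {z}) (h1 : ρ' 1 = 1)
    (hp : p = e.1 ∨ p = f.1) (hr : ∀ i < 12, i ≠ 1 → ρ' i = st.2 i) :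
    AfterJoin M hi nr link pr z u v p st [e, f] (μ', ρ') :=
  ⟨⟨He, Hf, trivial⟩, by simpa [LightJoin.total] using ht, by
    rw [if_pos (by simpa using hp)]; exact h1, hr⟩

-- The three outcomes below the parent `q` are treated separately; all of them write only to `q`, to
-- the two blocks and to the new record `z`, and leave the first child of `q` alone, so the left
-- spine of `U` is never affected.
set_option maxHeartbeats 1000000 in
theorem wp_attachRightP
    (hu : HeldAt μ M pu (r + 2 + d) vu pr (μ (M + pu) 4) m (r + 2 : ℕ) lu)
    (hv : HeldAt μ M pv (r + 1) y pr' m hi nr link)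
    (hU : Inner a b 2 (r + 2 + d) (treeAt μ (r + 2 + d) vu))
    (ha : 2 ≤ a) (hV : Inner a b 1 (r + 1) (treeAt μ (r + 1) y))
    (hn : (recsAt μ (r + 2 + d) vu + recsAt μ (r + 1) y).Nodup)
    (hout : Outside (recsAt μ (r + 2 + d) vu + recsAt μ (r + 1) y) M pu pv z)
    (hnr : (r + 2 : ℕ) ≤ nr) (hlink : lu = pv + 1)
    (hC : Combined a b μ μ₁ r (μ (M + pu) (2 * (r + 2) + 6)) y
      (μ (rsp μ vu d) (2 * (μ (rsp μ vu d) 0 - 1))) hi two s)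
    (hρ : JoinRegs M link z (r + 2) pu (μ (M + pu) (2 * (r + 2) + 6)) y s two ρ) (h1 : ρ 1 = 1)
    (hW : ∀ w, w ∈ recsAt μ (r + 2 + d) vu + recsAt μ (r + 1) y ∨ w = M + pu ∨ w = M + pv ∨ w = z →
      w ∈ W) (hWR : W ⊆ R) :
    wp R W k pv (attachRightP b) (fun s' =>
      AfterJoin M hi nr link pr z (pu, treeAt μ (r + 2 + d) vu) (pv, treeAt μ (r + 1) y) pv (μ, ρ)
        (joinEntries a b (pu, treeAt μ (r + 2 + d) vu) (pv, treeAt μ (r + 1) y)) s' ∧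
      s'.1 (M + pu) 4 = μ (M + pu) 4) (μ₁, ρ) := by
  obtain ⟨q, n, x, hq, hx, hqn, hn0, hnb, hbx, hbq, hcb, hsp⟩ := hu.spine_right hv.ord hU ha hV hn
  rw [← hq, hqn, hbx, Nat.add_sub_cancel] at hC
  rw [hbx] at hρ
  obtain ⟨r2, r6, r12, r14, r15, r16, r19, r23, r24⟩ := hρ
  have qo := hout.mem q (Multiset.mem_add.2 (.inl hsp.q_mem))
  have xo := hout.mem x (Multiset.mem_add.2 (.inl hsp.x_mem))
  have yo := hout.mem y (Multiset.mem_add.2 (.inr hsp.y_mem))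
  have hqx := hsp.q_ne_x
  have hqy := hsp.q_ne_y
  have hblk := hout.blocks
  have hzu := hout.zu
  have hzv := hout.zv
  have e1q : μ₁ q = μ q := hC.frame q hqx hqy
  have e1u : μ₁ (M + pu) = μ (M + pu) := hC.frame _ xo.1.symm yo.1.symm
  have e1v : μ₁ (M + pv) = μ (M + pv) := hC.frame _ xo.2.1.symm yo.2.1.symm
  have uW : M + pu ∈ W := hW _ (by simp)
  have vW : M + pv ∈ W := hW _ (by simp)
  have zW : z ∈ W := hW _ (by simp)
  have qW : q ∈ W := hW _ (.inl (Multiset.mem_add.2 (.inl hsp.q_mem)))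
  have common : ∀ μ' : ℕ → ℕ → ℕ, (∀ w, w ≠ q → w ≠ z → w ≠ M + pu → w ≠ M + pv → μ' w = μ₁ w) →
      μ' q 1 = μ q 1 →
      (∀ w ∈ recsAt μ (r + 2 + d) vu, w ∉ recsAt μ (r + 2) (rsp μ vu d) → μ' w = μ w) ∧
      (∀ w ∈ recsAt μ (r + 2 + d) vu, μ' w 1 = μ w 1) ∧
      Merged a b μ μ' r (μ q (2 * n + 1)) y (μ q (2 * n)) hi two s ∧
      (∀ w ∈ recsKids μ (r + 1) n (μ q), μ' w = μ w) := by
    intro μ' ho hq1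
    have hoA : ∀ w ∈ recsAt μ (r + 2 + d) vu, w ≠ q → μ' w = μ₁ w := fun w hw hwq => by
      obtain ⟨i1, i2, i3⟩ := hout.mem w (Multiset.mem_add.2 (.inl hw))
      exact ho w hwq i3 i1 i2
    have hmg : Merged a b μ μ' r x y (μ q (2 * n)) hi two s := hC.merged fun w hw => by
      obtain ⟨i0, hwq⟩ := hsp.under w (Multiset.mem_add.1 hw)
      obtain ⟨i1, i2, i3⟩ := hout.mem w (Multiset.mem_add.2 i0)
      exact ho w hwq i3 i1 i2
    refine ⟨fun w hw hwq => ?_, fun w hw => ?_, hx ▸ hmg, fun w hw => ?_⟩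
    · rw [← hq] at hwq
      obtain ⟨i1, i2, i3⟩ := hsp.rest w hw hwq
      rw [hoA w hw i1, hC.frame w i2 i3]
    · by_cases hwq : w = q
      · rw [hwq, hq1]
      · by_cases hwx : w = x
        · rw [hwx, hmg.first]
        · have hwy : w ≠ y := by
            rintro rfl
            exact Multiset.disjoint_left.1 (Multiset.nodup_add.1 hn).2.2 hw hsp.y_mem
          rw [hoA w hw hwq, hC.frame w hwx hwy]
    · obtain ⟨i0, i1, i2, i3⟩ := hsp.kids w hw
      rw [hoA w i0 i1, hC.frame w i2 i3]
  have hnu := (Multiset.nodup_add.1 hn).1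
  have hrv : (treeAt μ (r + 1) y).rank = r + 2 := hv.ord.rank_eq
  have recs_u := hu.recs_eq (treeAt μ (r + 2 + d) vu)
  have recs_v := hv.recs_eq (treeAt μ (r + 1) y)
  have e8 : r + 2 + (r + 2) + 8 = 2 * (r + 2) + 8 := by omega
  simp only [attachRightP, vanish, newPair, newRoot, wp_seq, wp_load, wp_ite, wp_store, wp_assign,
    val_add, val_sub, val_const, val_reg, val_pid, Function.update_apply]
  norm_num [r2, r6, r12, r14, r15, r16, r19, r23, r24, e1u, e8, hbq, e1q, hqn, uW, vW, zW, qW, hWR uW, hWR qW]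
  split_ifs with h2 h3
  -- The nodes have been fused: only the link of the left neighbour has to change.
  · generalize hμ' : put μ₁ (M + pu) 3 link = μ'
    have ho : ∀ w, w ≠ M + pu → μ' w = μ₁ w := fun w hw => by
      rw [← hμ', put_of_ne hw]
    have hb : ∀ f, f ≠ 3 → μ' (M + pu) f = μ (M + pu) f := fun f hf => by
      rw [← e1u, ← hμ', put_ne (by omega)]
    have hqq : μ' q = μ q := (ho q qo.1).trans e1q
    obtain ⟨c1, c2, c3, c4⟩ := common μ' (fun w _ _ h _ => ho w h) (by rw [hqq])
    obtain ⟨j1, j2, j3⟩ := hu.attach_right (a := a) (b := b) (hi := hi) (link := link)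
      (nr := nr) (V := treeAt μ (r + 1) y) (o := none) (X := {y}) (Y := recsAt μ (r + 1) y)
      hnu c1 c2 (fun f hf _ => hb f hf) (by rw [← hμ', put_eq rfl rfl]) le_rfl hnr
      (fun _ => by
        rw [hb _ (by omega), hbx, ← hq, lastKid, hqq, hqn, hx]; rfl)
      (fun lq ho => by
        rw [← hq] at ho ⊢
        exact right_fused hqn hn0 hnb ho c3 h2 c4 hqq) hrv
    have hsep : μ' (M + pu) 4 = μ (M + pu) 4 := hb 4 (by norm_num)
    rw [joinEntries_none j1]
    refine ⟨AfterJoin.single ⟨_, _, rfl, hsep ▸ j2⟩ ?_ (by simp) hblk fun i hi _ => ?_, hsep⟩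
    · rw [j2.recs_eq, recs_u, recs_v]
      exact (Multiset.le_add_right _ {y}).trans (j3.le.trans (Multiset.le_add_right _ _))
    · rw [Function.update_of_ne (by omega), Function.update_of_ne (by omega),
        Function.update_of_ne (by omega)]
  -- Stealing: the parent loses its last child, and the key in front of this child becomes the
  -- separator between the two trees.
  · generalize hμ' : put (put (put (put (put (put (put (put (put μ₁ q 0 n) z 0 2) z 1 x) z 2 s) z 3 y)
      (M + pv) 0 (r + 2 + 1)) (M + pv) (r + 2 + (r + 2) + 7) z) (M + pv) (2 * (r + 2) + 8) z)
      (M + pv) 4 (μ q (n + 1 + (n + 1) - 2)) = μ'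
    obtain ⟨ho, hqd, hqf, hz, hvf, hkey, hv0, hvL, hvR⟩ :=
      put_steal (r := r) qo.2.2 qo.2.1 hzv (by omega) (by omega) hμ'
    rw [e1q] at hqf
    rw [e1v] at hvf
    rw [show n + 1 + (n + 1) - 2 = 2 * n by omega] at hkey
    have hub : μ' (M + pu) = μ (M + pu) := by rw [ho _ qo.1.symm hzu.symm (by omega), e1u]
    obtain ⟨c1, c2, c3, c4⟩ := common μ' (fun w i1 i2 _ i3 => ho w i1 i2 i3) (hqf 1 (by norm_num))
    obtain ⟨p1, p2, p3⟩ := c3.pair h2 (hx ▸ hz)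
    -- The right neighbour of `U` is now the stealing tree of rank r + 3, so the entry for rank r +
    -- 2, which still names the stolen node, need not be correct.
    obtain ⟨j1, j2, j3⟩ := hu.attach_right (a := a) (b := b) (hi := μ q (2 * n)) (link := pv + 1)
      (nr := (r + 3 : ℕ)) (V := treeAt μ (r + 1) y) (o := some (treeAt μ' (r + 2) z))
      (X := recsAt μ' (r + 2) z) (Y := recsAt μ (r + 1) y + {z})
      hnu c1 c2 (fun f _ _ => by rw [hub]) (by rw [hub, hu.link, hlink]) le_rfl
      (by exact_mod_cast Nat.le_succ _)
      (fun h => absurd h (by exact_mod_cast Nat.not_succ_le_self _))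
      (fun lq ho => by
        rw [← hq] at ho ⊢
        obtain ⟨k1, k2, -, k3⟩ := right_steal hqn hn0 (by omega) ho c3 h2 c4 hqd
          (fun f hf _ => hqf f hf) (hx ▸ hz)
        exact ⟨k1, k2, by rw [k3, add_assoc]⟩) hrv
    have hp : HeldAt μ' M pv (r + 2) z (r + 3 : ℕ) (μ q (2 * n)) hi nr link := by
      refine HeldAt.pair hz p2 hv0 hvL hvR ?_ (fun j i0 i1 i2 => ?_) fun j i0 i1 i2 => ?_
      · rw [hvf 3 (by norm_num) (by norm_num) (by omega), hv.link]
      · have : r + 3 ≤ j := by exact_mod_cast i1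
        omega
      -- Below the new root only the entry for the old root is claimed on the right, and the old
      -- root is the second child of the new one.
      · have : r + 2 ≤ j := by exact_mod_cast hnr.trans i1
        obtain rfl : j = r + 2 := by omega
        rw [hvf _ (by omega) (by omega) (by omega)]
        simpa [rsp] using hv.right
    have hsep : μ' (M + pu) 4 = μ (M + pu) 4 := by rw [hub]
    have hru : (treeAt μ' (r + 2 + d) vu).rank = r + 2 + d + 1 := j2.ord.rank_eq
    have hrz : (treeAt μ' (r + 2) z).rank = r + 3 := hp.ord.rank_eq
    rw [joinEntries_some j1]
    refine ⟨AfterJoin.pair ⟨_, _, rfl, ?_⟩ ⟨_, _, rfl, ?_⟩ ?_ (by simp [h1]) (by simp)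
      fun i hi _ => ?_, hsep⟩
    · simp only [hsep, hkey, hrz]; exact j2
    · simp only [hkey, hru]
      exact hp.mono (by exact_mod_cast (by omega)) le_rfl
    · rw [j2.recs_eq, hp.recs_eq, recs_u, recs_v, j3]
      exact (add_assoc _ _ _).ge
    · rw [Function.update_of_ne (by omega), Function.update_of_ne (by omega),
        Function.update_of_ne (by omega)]
  -- The parent has room for a further child, whose pointer and key go behind the last ones; the
  -- entry of the right array for rank r + 2 moves on to it.
  · generalize hμ' : put (put (put (put (put μ₁ q (n + 1 + (n + 1)) s) q (n + 1 + (n + 1) + 1) y) q 0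
      (n + 1 + 1)) (M + pu) (r + 2 + (r + 2) + 6) y) (M + pu) 3 link = μ'
    obtain ⟨ho, hb, hqd, hqf, hqs, hqy', hub⟩ :=
      put_append (r := r) (n := n) qo.1 (by omega) (by omega) (by omega) hμ'
    rw [e1q] at hqf
    rw [e1u] at hb
    obtain ⟨c1, c2, c3, c4⟩ := common μ' (fun w i1 _ i2 _ => ho w i1 i2)
      (hqf 1 (by norm_num) (by omega))
    obtain ⟨j1, j2, j3⟩ := hu.attach_right (a := a) (b := b) (hi := hi) (link := link)
      (nr := nr) (V := treeAt μ (r + 1) y) (o := none) (X := 0) (Y := recsAt μ (r + 1) y)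
      hnu c1 c2 hb (by rw [← hμ', put_eq rfl rfl]) le_rfl hnr
      (fun _ => by
        rw [hub, ← hq, lastKid, hqd, show 2 * (n + 2) - 1 = 2 * (n + 1) + 1 by omega, hqy'])
      (fun lq ho => by
        rw [← hq] at ho ⊢
        rw [add_zero]
        exact right_append hqn hn0 (by omega) ho c3 h2 c4 hqd hqf hqs hqy') hrv
    have hsep : μ' (M + pu) 4 = μ (M + pu) 4 := hb 4 (by norm_num) (by omega)
    rw [joinEntries_none j1]
    refine ⟨AfterJoin.single ⟨_, _, rfl, hsep ▸ j2⟩ ?_ (by simp) hblk fun i hi _ => ?_, hsep⟩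
    · rw [j2.recs_eq, recs_u, recs_v]
      rw [add_zero] at j3
      exact j3.le.trans (Multiset.le_add_right _ _)
    · rw [Function.update_of_ne (by omega), Function.update_of_ne (by omega),
        Function.update_of_ne (by omega)]

theorem put_raise {B c i j l : ℕ} (hzB : z ≠ B) (hi : i = 2 * (r + 3) + 5)
    (hj : j = 2 * (r + 3) + 6) (hl : l = 2 * (r + 2) + 6)
    (hμ : put (put (put (put (put (put (put (put (put μ₁ z 0 2) z 1 x) z 2 s) z 3 y)
      B 0 c) B i z) B j z) B l y) B 3 link = μ') :
    (∀ w, w ≠ z → w ≠ B → μ' w = μ₁ w) ∧ IsPair μ' z x s y ∧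
      (∀ f, 3 < f → f < 2 * (r + 2) + 6 → μ' B f = μ₁ B f) ∧ μ' B 0 = c ∧
      μ' B (2 * (r + 3) + 5) = z ∧ μ' B (2 * (r + 3) + 6) = z ∧ μ' B (2 * (r + 2) + 6) = y := by
  subst hμ
  refine ⟨fun w i1 i2 => ?_, ⟨?_, ?_, ?_, ?_⟩, fun f i1 i2 => ?_, ?_, ?_, ?_, ?_⟩
  · simp only [put_of_ne i1, put_of_ne i2]
  · (repeat rw [put_ne (by omega)]); rw [put_eq (by omega) (by omega)]
  · (repeat rw [put_ne (by omega)]); rw [put_eq (by omega) (by omega)]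
  · (repeat rw [put_ne (by omega)]); rw [put_eq (by omega) (by omega)]
  · (repeat rw [put_ne (by omega)]); rw [put_eq (by omega) (by omega)]
  · repeat rw [put_ne (by omega)]
  · (repeat rw [put_ne (by omega)]); rw [put_eq (by omega) (by omega)]
  · (repeat rw [put_ne (by omega)]); rw [put_eq (by omega) (by omega)]
  · (repeat rw [put_ne (by omega)]); rw [put_eq (by omega) (by omega)]
  · (repeat rw [put_ne (by omega)]); rw [put_eq (by omega) (by omega)]

theorem wp_raiseRightP
    (hu : HeldAt μ M pu (r + 1) x pr (μ (M + pu) 4) m (r + 2 : ℕ) lu)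
    (hv : HeldAt μ M pv (r + 1) y pr' m hi nr link)
    (hn : (recsAt μ (r + 1) x + recsAt μ (r + 1) y).Nodup)
    (hout : Outside (recsAt μ (r + 1) x + recsAt μ (r + 1) y) M pu pv z)
    (hnr : (r + 2 : ℕ) ≤ nr)
    (hC : Combined a b μ μ₁ r x y (μ (M + pu) 4) hi two s)
    (hρ : JoinRegs M link z (r + 2) pu x y s two ρ)
    (hW : ∀ w, w ∈ recsAt μ (r + 1) x + recsAt μ (r + 1) y ∨ w = M + pu ∨ w = M + pv ∨ w = z →
      w ∈ W) :
    wp R W k pv raiseRightP (fun s' =>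
      AfterJoin M hi nr link pr z (pu, treeAt μ (r + 1) x) (pv, treeAt μ (r + 1) y) pv (μ, ρ)
        (joinEntries a b (pu, treeAt μ (r + 1) x) (pv, treeAt μ (r + 1) y)) s' ∧
      s'.1 (M + pu) 4 = μ (M + pu) 4) (μ₁, ρ) := by
  obtain ⟨r2, r6, r12, r14, r15, r16, r19, r23, r24⟩ := hρ
  have xo := hout.mem x (Multiset.mem_add.2 (.inl (self_mem_recsAt _ _)))
  have yo := hout.mem y (Multiset.mem_add.2 (.inr (self_mem_recsAt _ _)))
  have hblk := hout.blocks
  have hzu := hout.zu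
  have e1u : μ₁ (M + pu) = μ (M + pu) := hC.frame _ xo.1.symm yo.1.symm
  have uW : M + pu ∈ W := hW _ (by simp)
  have zW : z ∈ W := hW _ (by simp)
  have recs_u := hu.recs_eq (treeAt μ (r + 1) x)
  have recs_v := hv.recs_eq (treeAt μ (r + 1) y)
  have common : ∀ μ' : ℕ → ℕ → ℕ, (∀ w, w ≠ z → w ≠ M + pu → μ' w = μ₁ w) →
      Merged a b μ μ' r x y (μ (M + pu) 4) hi two s ∧
      ∀ w ∈ recsAt μ (r + 1) x, w ≠ x → μ' w = μ w := by
    intro μ' ho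
    refine ⟨hC.merged fun w hw => ?_, fun w hw hwx => ?_⟩
    · obtain ⟨i1, -, i3⟩ := hout.mem w hw
      exact ho w i3 i1
    · obtain ⟨i1, -, i3⟩ := hout.mem w (Multiset.mem_add.2 (.inl hw))
      rw [ho w i3 i1, hC.frame w hwx]
      rintro rfl
      exact Multiset.disjoint_left.1 (Multiset.nodup_add.1 hn).2.2 hw (self_mem_recsAt _ _)
  simp only [raiseRightP, vanish, newPair, newRoot, wp_seq, wp_ite, wp_store, wp_assign,
    val_add, val_const, val_reg]
  norm_num [r6, r12, r14, r15, r16, r19, r23, r24, uW, zW]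
  split_ifs with h2
  · generalize hμ' : put μ₁ (M + pu) 3 link = μ'
    have ho : ∀ w, w ≠ M + pu → μ' w = μ₁ w := fun w hw => by rw [← hμ', put_of_ne hw]
    have hb : ∀ f, f ≠ 3 → μ' (M + pu) f = μ (M + pu) f := fun f hf => by
      rw [← e1u, ← hμ', put_ne (.inr hf)]
    obtain ⟨c1, c2⟩ := common μ' fun w _ h => ho w h
    obtain ⟨j1, j2, j3⟩ := hu.fuse_left hv.ord c1 h2 c2 hb
      (by rw [← hμ', put_eq rfl rfl]) hnr
    have hsep : μ' (M + pu) 4 = μ (M + pu) 4 := hb 4 (by norm_num)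
    rw [joinEntries_none j1]
    refine ⟨AfterJoin.single ⟨_, _, rfl, hsep ▸ j2⟩ ?_ (by simp) hblk fun i hi _ => ?_, hsep⟩
    · rw [j2.recs_eq, recs_u, recs_v]
      exact (Multiset.le_add_right _ {y}).trans (j3.le.trans (Multiset.le_add_right _ _))
    · rw [Function.update_of_ne (by omega)]
  · generalize hμ' : put (put (put (put (put (put (put (put (put _ _ _ _) _ _ _) _ _ _) _ _ _)
      _ _ _) _ _ _) _ _ _) _ _ _) _ _ _ = μ'
    obtain ⟨ho, hz, hb, h0, hL, hR, hR'⟩ := put_raise (r := r) hzu (by omega) (by omega)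
      (by omega) hμ'
    rw [e1u] at hb
    obtain ⟨c1, c2⟩ := common μ' ho
    obtain ⟨j1, j2, j3⟩ := hu.root_left hv.ord c1 h2 hz c2 hb h0 hL hR hR'
      (by rw [← hμ', put_eq rfl rfl]) hnr
    have hsep : μ' (M + pu) 4 = μ (M + pu) 4 := hb 4 (by norm_num) (by omega)
    rw [joinEntries_none j1]
    refine ⟨AfterJoin.single ⟨_, _, rfl, hsep ▸ j2⟩ ?_ (by simp) hblk fun i hi _ => ?_, hsep⟩
    · rw [j2.recs_eq, recs_u, recs_v, j3, add_comm]
    · rw [Function.update_of_ne (by omega)]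

end


-- A join to the left neighbour as a whole.

section

variable {a b M z link hi k : ℕ} {μ : ℕ → ℕ → ℕ} {pr nr : ℕ∞} {ρ : ℕ → ℕ} {R W : Set ℕ}
  {u v : Entry}

theorem AfterJoin.congr {p : ℕ} {s s₀ s' : Loc} {l : List Entry}
    (h : AfterJoin M hi nr link pr z u v p s l s') (hm : s₀.1 = s.1)
    (hr : ∀ i < 12, i ≠ 1 → s.2 i = s₀.2 i) : AfterJoin M hi nr link pr z u v p s₀ l s' :=
  ⟨h.chain, hm ▸ h.total, h.alive, fun i hi h1 => (h.regs i hi h1).trans (hr i hi h1)⟩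

theorem Outside.of_nodup {pu pv : ℕ} {A : Multiset ℕ}
    (h : ((M + pu) ::ₘ (M + pv) ::ₘ z ::ₘ A).Nodup) : Outside A M pu pv z := by
  simp only [Multiset.nodup_cons, Multiset.mem_cons, not_or] at h
  obtain ⟨⟨h1, h2, h3⟩, ⟨h4, h5⟩, h6, -⟩ := h
  refine ⟨fun h => h1 (by rw [h]), Ne.symm h2, Ne.symm h4, fun w hw => ⟨?_, ?_, ?_⟩⟩ <;>
  · rintro rfl; contradiction

/-- The hypotheses under which processor `p` may join two trees. -/
structure JoinPre (a b : ℕ) (M hi : ℕ) (nr : ℕ∞) (link : ℕ) (pr : ℕ∞) (z : ℕ) (u v : Entry)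
    (R W : Set ℕ) (s : Loc) : Prop where
  chain : Chain s.1 M hi nr link pr [u, v]
  fst : IsABTree a b u.2
  snd : IsABTree a b v.2
  nodup : ((M + u.1) ::ₘ (M + v.1) ::ₘ z ::ₘ (recs s.1 M u + recs s.1 M v)).Nodup
  mem : ∀ w ∈ (M + u.1) ::ₘ (M + v.1) ::ₘ z ::ₘ (recs s.1 M u + recs s.1 M v), w ∈ W
  sub : W ⊆ R
  r1 : s.2 1 = 1
  r2 : s.2 2 = M
  r24 : s.2 24 = z

set_option maxHeartbeats 1000000 in
theorem wp_joinRightP (ha : 2 ≤ a) (hab : 2 * a ≤ b)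
    (h : JoinPre a b M hi nr link pr z u v R W (μ, ρ)) (hle : v.2.rank ≤ u.2.rank)
    (hnr : (v.2.rank : ℕ∞) ≤ nr) (h5 : ρ 5 = u.1 + 1) (h6 : ρ 6 = link) :
    wp R W k v.1 (joinRightP a b) (fun s' =>
      AfterJoin M hi nr link pr z u v v.1 (μ, ρ) (joinEntries a b u v) s' ∧
      s'.1 (M + u.1) 4 = μ (M + u.1) 4) (μ, ρ) := by
  obtain ⟨pu, U⟩ := u
  obtain ⟨pv, V⟩ := v
  obtain ⟨⟨⟨e, vu, hU, hu⟩, ⟨f, y, hV, hv⟩, -⟩, abU, abV, hn, hmem, hWR, r1, r2, r24⟩ := h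
  simp only at hU hV hle hnr h5 abU abV r1 r2 r24
  subst hU hV
  have hrv : (treeAt μ f y).rank = f + 1 := hv.ord.rank_eq
  have hru : (treeAt μ e vu).rank = e + 1 := hu.ord.rank_eq
  have h2v := abV.two_le_rank ha
  obtain ⟨r, rfl⟩ : ∃ r, f = r + 1 := ⟨f - 1, by omega⟩
  simp only [hu.recs_eq, hv.recs_eq] at hn hmem
  have hout := Outside.of_nodup hn
  have hn' : (recsAt μ e vu + recsAt μ (r + 1) y).Nodup :=
    (Multiset.nodup_cons.1 (Multiset.nodup_cons.1 (Multiset.nodup_cons.1 hn).2).2).2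
  have iV := (abV.inner_one ha hrv).2
  have iU := (abU.inner_one ha hru).2
  simp only [sepOf, rankOf, linkOf] at hu hv
  rw [hrv] at hnr hu
  have uW := hmem (M + pu) (by simp)
  have vW := hmem (M + pv) (by simp)
  have cW : ∀ w ∈ recsAt μ e vu + recsAt μ (r + 1) y, w ∈ W := fun w hw =>
    hmem w (by simp only [Multiset.mem_cons]; exact .inr (.inr (.inr hw)))
  have hW : ∀ w, w ∈ recsAt μ e vu + recsAt μ (r + 1) y ∨ w = M + pu ∨ w = M + pv ∨ w = z →
      w ∈ W := fun w hw => hmem w (by simp only [Multiset.mem_cons]; tauto)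
  have yA : y ∈ recsAt μ e vu + recsAt μ (r + 1) y :=
    Multiset.mem_add.2 (.inr (self_mem_recsAt _ _))
  have ey : μ (M + pv) (r + 2 + (r + 2) + 5) = y := by
    rw [← hv.left]; congr 1; omega
  simp only [joinRightP, wp_seq, wp_load, wp_assign, val_add, val_sub, val_const, val_reg, val_pid,
    Function.update_apply]
  norm_num [r2, h5, hWR uW, hWR vW, hv.rank, hu.rank, ey]
  rw [show r + 1 + 1 + (r + 1 + 1) + 6 = 2 * (r + 2) + 6 by omega]
  rcases Nat.lt_or_ge (r + 1) e with hlt | hge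
  · obtain ⟨d, rfl⟩ : ∃ d, e = r + 2 + d := ⟨e - (r + 2), by omega⟩
    have iU2 := abU.inner_two ha hru (by omega)
    obtain ⟨q, n, x, hq, hx, hqn, hn0, hnb, hbx, hbq, hcb, hsp⟩ :=
      hu.spine_right hv.ord iU2 ha iV hn'
    have xW := cW x (Multiset.mem_add.2 (.inl hsp.x_mem))
    rw [hbx]
    refine wp_combineP ha hab hcb rfl rfl rfl (hWR xW) (hWR (cW y yA)) xW (cW y yA)
      fun μ₁ ρ₁ hC hρ => ?_
    have hlow : ∀ i < 12, ρ₁ i = ρ i := fun i hi => by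
      rw [hρ i (by omega) (by omega)]
      simp only [Function.update_apply]
      split_ifs <;> first | rfl | omega
    have e13 : ρ₁ 13 = r + 2 + d + 1 := by simpa [Function.update_apply] using hρ 13 (by norm_num) (by norm_num)
    have hreg : JoinRegs M link z (r + 2) pu x y (ρ₁ 16) (ρ₁ 19) ρ₁ := by
      refine ⟨(hlow 2 (by norm_num)).trans r2, (hlow 6 (by norm_num)).trans h6, ?_, ?_, ?_, rfl, rfl,
        ?_, ?_⟩
      · simpa [Function.update_apply] using hρ 12 (by norm_num) (by norm_num)
      · simpa [Function.update_apply] using hρ 14 (by norm_num) (by norm_num)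
      · simpa [Function.update_apply] using hρ 15 (by norm_num) (by norm_num)
      · simpa [Function.update_apply] using hρ 23 (by norm_num) (by norm_num)
      · simpa [Function.update_apply, r24] using hρ 24 (by norm_num) (by norm_num)
    rw [wp_ite]
    simp only [val_sub, val_reg, hreg.r12, e13]
    rw [if_neg (by omega)]
    refine (wp_attachRightP hu hv iU2 ha iV hn' hout hnr rfl ?_ (hbx.symm ▸ hreg)
      ((hlow 1 (by norm_num)).trans r1) hW hWR).mono fun s' hs =>
        ⟨hs.1.congr rfl fun i hi _ => hlow i hi, hs.2⟩
    rw [← hq, hqn, hbx]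
    exact hC
  · obtain rfl : e = r + 1 := by omega
    have hcb : Combinable b μ r vu y (μ (M + pu) 4) (μ (M + pv) 4) hi :=
      ⟨hu.ord, hv.ord, hn', iU.degree.2, iV.degree.2⟩
    have xW := cW vu (Multiset.mem_add.2 (.inl (self_mem_recsAt _ _)))
    rw [hu.right]
    refine wp_combineP ha hab hcb rfl rfl rfl (hWR xW) (hWR (cW y yA)) xW (cW y yA)
      fun μ₁ ρ₁ hC hρ => ?_
    have hlow : ∀ i < 12, ρ₁ i = ρ i := fun i hi => by
      rw [hρ i (by omega) (by omega)]
      simp only [Function.update_apply]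
      split_ifs <;> first | rfl | omega
    have e13 : ρ₁ 13 = r + 2 := by simpa [Function.update_apply] using hρ 13 (by norm_num) (by norm_num)
    have hreg : JoinRegs M link z (r + 2) pu vu y (ρ₁ 16) (ρ₁ 19) ρ₁ := by
      refine ⟨(hlow 2 (by norm_num)).trans r2, (hlow 6 (by norm_num)).trans h6, ?_, ?_, ?_, rfl, rfl,
        ?_, ?_⟩
      · simpa [Function.update_apply] using hρ 12 (by norm_num) (by norm_num)
      · simpa [Function.update_apply] using hρ 14 (by norm_num) (by norm_num)
      · simpa [Function.update_apply] using hρ 15 (by norm_num) (by norm_num)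
      · simpa [Function.update_apply] using hρ 23 (by norm_num) (by norm_num)
      · simpa [Function.update_apply, r24] using hρ 24 (by norm_num) (by norm_num)
    rw [wp_ite]
    simp only [val_sub, val_reg, hreg.r12, e13]
    rw [if_pos (by omega)]
    exact (wp_raiseRightP hu hv hn' hout hnr hC hreg hW).mono fun s' hs =>
      ⟨hs.1.congr rfl fun i hi _ => hlow i hi, hs.2⟩

end


/-! ### The program for a join to the right neighbour -/

/-- The tree of the processor disappears, and the block in register 23 gets its lower bound. -/
def vanishLeft : Cmd :=
  seq (load 25 ownBlock (.const 4)) <| seq (store (rg 23) (.const 4) (rg 25)) (assign 1 (.const 0))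

/-- The second half of a join to a right neighbour of larger rank. -/
def attachLeftP (b : ℕ) : Cmd :=
  seq (load 21 (rg 23) (rg 12 + rg 12 + .const 7)) <| seq (load 22 (rg 21) (.const 0)) <|
  ite (rg 19)
    (ite (.const b - rg 22)
      (seq (move (2 * b) (rg 21) (.const 1) (rg 21) (.const 3)) <|
       seq (store (rg 21) (.const 1) (rg 14)) <| seq (store (rg 21) (.const 2) (rg 16)) <|
       seq (store (rg 21) (.const 0) (rg 22 + .const 1)) vanishLeft)
      (seq (load 25 (rg 21) (.const 2)) <|
       seq (move (2 * b) (rg 21) (.const 3) (rg 21) (.const 1)) <|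
       seq (store (rg 21) (.const 0) (rg 22 - .const 1)) <|
       seq newPair <| seq (newRoot ownBlock) (store (rg 23) (.const 4) (rg 25))))
    (seq (store (rg 21) (.const 1) (rg 14)) vanishLeft)

/-- The second half of a join to a right neighbour of the same rank. -/
def raiseLeftP : Cmd :=
  ite (rg 19)
    (seq newPair <| seq (newRoot (rg 23)) vanishLeft)
    (seq (store (rg 23) (rg 12 + rg 12 + .const 5) (rg 14)) <|
     seq (store (rg 23) (rg 12 + rg 12 + .const 6) (rg 14)) vanishLeft)

/-- Join the tree of the processor to its right neighbour. -/
def joinLeftP (a b : ℕ) : Cmd :=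
  seq (assign 23 (rg 2 + (rg 6 - .const 1))) <|
  seq (load 12 ownBlock (.const 0)) <| seq (load 13 (rg 23) (.const 0)) <|
  seq (load 14 ownBlock (rg 12 + rg 12 + .const 6)) <|
  seq (load 15 (rg 23) (rg 12 + rg 12 + .const 5)) <|
  seq (load 16 (rg 23) (.const 4)) <| seq (combineP a b) <|
  ite (rg 13 - rg 12) (attachLeftP b) raiseLeftP

-- Correctness of a join of the first tree to the second.

section

variable {a b M pu pv p r d h v vu x y z s n link link' lv lu lo m hi two key k q : ℕ}
  {μ μ₁ μ' : ℕ → ℕ → ℕ} {pr nr pr' nr' nv pv' : ℕ∞} {ρ ρ' : ℕ → ℕ} {R W : Set ℕ}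

theorem moved_of_ne {c src i dst j w : ℕ} (h : w ≠ dst) : moved μ c src i dst j w = μ w := by
  funext f; simp [moved, h]

theorem put_append_left {B : ℕ} (hqB : q ≠ B) (hb : n + 1 ≤ b)
    (hμ : put (put (put (put (moved μ₁ (2 * b) q 1 q 3) q 1 x) q 2 s) q 0 (n + 2)) B 4 key = μ') :
    (∀ w, w ≠ q → w ≠ B → μ' w = μ₁ w) ∧ (∀ f, f ≠ 4 → μ' B f = μ₁ B f) ∧ μ' q 0 = n + 2 ∧
      μ' q 1 = x ∧ μ' q 2 = s ∧ (∀ f, 0 < f → f < 2 * (n + 1) → μ' q (f + 2) = μ₁ q f) := by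
  subst hμ
  refine ⟨fun w i1 i2 => ?_, fun f i1 => ?_, ?_, ?_, ?_, fun f i1 i2 => ?_⟩
  · simp only [put_of_ne i1, put_of_ne i2, moved_of_ne i1]
  · (repeat rw [put_ne (by omega)]); rw [moved_of_ne hqB.symm]
  · (repeat rw [put_ne (by omega)]); rw [put_eq (by omega) (by omega)]
  · (repeat rw [put_ne (by omega)]); rw [put_eq (by omega) (by omega)]
  · (repeat rw [put_ne (by omega)]); rw [put_eq (by omega) (by omega)]
  · repeat rw [put_ne (by omega)]
    simp only [moved, true_and]
    rw [if_pos (by omega)]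
    congr 1; omega

theorem put_steal_left {A B c i j : ℕ} (hqz : q ≠ z) (hqA : q ≠ A) (hqB : q ≠ B) (hzA : z ≠ A)
    (hzB : z ≠ B) (hAB : A ≠ B) (hb : n ≤ b) (hi : i = 2 * (r + 3) + 5) (hj : j = 2 * (r + 3) + 6)
    (hμ : put (put (put (put (put (put (put (put (put (moved μ₁ (2 * b) q 3 q 1) q 0 n)
      z 0 2) z 1 x) z 2 s) z 3 y) A 0 c) A i z) A j z) B 4 key = μ') :
    (∀ w, w ≠ q → w ≠ z → w ≠ A → w ≠ B → μ' w = μ₁ w) ∧ μ' q 0 = n ∧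
      (∀ f, 0 < f → f < 2 * n → μ' q f = μ₁ q (f + 2)) ∧ IsPair μ' z x s y ∧
      (∀ f, f ≠ 4 → μ' B f = μ₁ B f) ∧ μ' B 4 = key ∧
      (∀ f, f ≠ 0 → f < 2 * (r + 3) + 5 → μ' A f = μ₁ A f) ∧
      μ' A 0 = c ∧ μ' A (2 * (r + 3) + 5) = z ∧ μ' A (2 * (r + 3) + 6) = z := by
  subst hμ
  refine ⟨fun w i1 i2 i3 i4 => ?_, ?_, fun f i1 i2 => ?_, ⟨?_, ?_, ?_, ?_⟩, fun f i1 => ?_, ?_,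
    fun f i1 i2 => ?_, ?_, ?_, ?_⟩
  · simp only [put_of_ne i1, put_of_ne i2, put_of_ne i3, put_of_ne i4, moved_of_ne i1]
  · (repeat rw [put_ne (by omega)]); rw [put_eq (by omega) (by omega)]
  · repeat rw [put_ne (by omega)]
    simp only [moved, true_and]
    rw [if_pos (by omega)]
    congr 1; omega
  · (repeat rw [put_ne (by omega)]); rw [put_eq (by omega) (by omega)]
  · (repeat rw [put_ne (by omega)]); rw [put_eq (by omega) (by omega)]
  · (repeat rw [put_ne (by omega)]); rw [put_eq (by omega) (by omega)]
  · (repeat rw [put_ne (by omega)]); rw [put_eq (by omega) (by omega)]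
  · (repeat rw [put_ne (by omega)]); rw [moved_of_ne hqB.symm]
  · rw [put_eq (by omega) (by omega)]
  · (repeat rw [put_ne (by omega)]); rw [moved_of_ne hqA.symm]
  · (repeat rw [put_ne (by omega)]); rw [put_eq (by omega) (by omega)]
  · (repeat rw [put_ne (by omega)]); rw [put_eq (by omega) (by omega)]
  · (repeat rw [put_ne (by omega)]); rw [put_eq (by omega) (by omega)]

theorem firstEntries_none {U V U' : LTree} (h : joinToRight a b V U = (U', none)) :
    firstEntries a b (pv, V) (pu, U) = [(pu, U')] := by
  simp only [firstEntries, h]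

theorem firstEntries_some {U V U' V' : LTree} (h : joinToRight a b V U = (U', some V')) :
    firstEntries a b (pv, V) (pu, U) = [(pv, V'), (pu, U')] := by
  simp only [firstEntries, h]

-- Unlike on the right side, a new first child or the loss of one shifts all fields of the parent by
-- two. The separator to be maintained is that of the surviving neighbour: it becomes the lower
-- bound of the vanishing tree, or the key behind the stolen child.
set_option maxHeartbeats 1000000 in
theorem wp_attachLeftP
    (hv : HeldAt μ M pv (r + 1) x pr (μ (M + pv) 4) m nv (pu + 1))
    (hu : HeldAt μ M pu (r + 2 + d) vu (r + 2 : ℕ) m hi nr link)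
    (hU : Inner a b 2 (r + 2 + d) (treeAt μ (r + 2 + d) vu))
    (ha : 2 ≤ a) (hV : Inner a b 1 (r + 1) (treeAt μ (r + 1) x))
    (hn : (recsAt μ (r + 2 + d) vu + recsAt μ (r + 1) x).Nodup)
    (hout : Outside (recsAt μ (r + 2 + d) vu + recsAt μ (r + 1) x) M pv pu z)
    (hC : Combined a b μ μ₁ r x (μ (M + pu) (2 * (r + 2) + 5)) (μ (M + pv) 4)
      (μ (lsp μ vu d) 2) two s)
    (hρ : JoinRegs M link' z (r + 2) pu x (μ (M + pu) (2 * (r + 2) + 5)) s two ρ) (h1 : ρ 1 = 1)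
    (hW : ∀ w, w ∈ recsAt μ (r + 2 + d) vu + recsAt μ (r + 1) x ∨ w = M + pv ∨ w = M + pu ∨ w = z →
      w ∈ W) (hWR : W ⊆ R) :
    wp R W k pv (attachLeftP b) (
      AfterJoin M hi nr link ⊤ z (pv, treeAt μ (r + 1) x) (pu, treeAt μ (r + 2 + d) vu) pv (μ, ρ)
        (firstEntries a b (pv, treeAt μ (r + 1) x) (pu, treeAt μ (r + 2 + d) vu))) (μ₁, ρ) := by
  obtain ⟨q, n, y, hq, hy, hqn, hn0, hnb, hby, hbq, hcb, hsp⟩ := hu.spine_left hv.ord hU ha hV hn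
  rw [← hq, hby] at hC
  rw [hby] at hρ
  obtain ⟨r2, r6, r12, r14, r15, r16, r19, r23, r24⟩ := hρ
  have qo := hout.mem q (Multiset.mem_add.2 (.inl hsp.q_mem))
  have yo := hout.mem y (Multiset.mem_add.2 (.inl hsp.x_mem))
  have xo := hout.mem x (Multiset.mem_add.2 (.inr hsp.y_mem))
  have hqy := hsp.q_ne_x
  have hqx := hsp.q_ne_y
  have hblk := hout.blocks
  have hzv := hout.zu
  have hzu := hout.zv
  have e1q : μ₁ q = μ q := hC.frame q hqx hqy
  have e1u : μ₁ (M + pu) = μ (M + pu) := hC.frame _ xo.2.1.symm yo.2.1.symm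
  have e1v : μ₁ (M + pv) = μ (M + pv) := hC.frame _ xo.1.symm yo.1.symm
  have uW : M + pu ∈ W := hW _ (by simp)
  have vW : M + pv ∈ W := hW _ (by simp)
  have zW : z ∈ W := hW _ (by simp)
  have qW : q ∈ W := hW _ (.inl (Multiset.mem_add.2 (.inl hsp.q_mem)))
  have common : ∀ μ' : ℕ → ℕ → ℕ, (∀ w, w ≠ q → w ≠ z → w ≠ M + pv → w ≠ M + pu → μ' w = μ₁ w) →
      lastKid μ' q = lastKid μ q →
      (∀ w ∈ recsAt μ (r + 2 + d) vu, w ∉ recsAt μ (r + 2) (lsp μ vu d) → μ' w = μ w) ∧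
      (∀ w ∈ recsAt μ (r + 2 + d) vu, lastKid μ' w = lastKid μ w) ∧
      Merged a b μ μ' r x (μ q 1) (μ (M + pv) 4) (μ q 2) two s ∧
      (∀ w ∈ recsKids μ (r + 1) n (fun f => μ q (2 * 1 + f)), μ' w = μ w) := by
    intro μ' ho hq1
    have hoA : ∀ w ∈ recsAt μ (r + 2 + d) vu, w ≠ q → μ' w = μ₁ w := fun w hw hwq => by
      obtain ⟨i1, i2, i3⟩ := hout.mem w (Multiset.mem_add.2 (.inl hw))
      exact ho w hwq i3 i1 i2
    have hmg : Merged a b μ μ' r x y (μ (M + pv) 4) (μ q 2) two s := hC.merged fun w hw => by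
      obtain ⟨i0, hwq⟩ := hsp.under w (Multiset.mem_add.1 hw).symm
      obtain ⟨i1, i2, i3⟩ := hout.mem w (Multiset.mem_add.2 i0)
      exact ho w hwq i3 i1 i2
    refine ⟨fun w hw hwq => ?_, fun w hw => ?_, hy ▸ hmg, fun w hw => ?_⟩
    · rw [← hq] at hwq
      obtain ⟨i1, i2, i3⟩ := hsp.rest w hw hwq
      rw [hoA w hw i1, hC.frame w i3 i2]
    · by_cases hwq : w = q
      · rw [hwq, hq1]
      · by_cases hwy : w = y
        · rw [hwy, hmg.last]
        · have hwx : w ≠ x := by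
            rintro rfl
            exact Multiset.disjoint_left.1 (Multiset.nodup_add.1 hn).2.2 hw hsp.y_mem
          simp only [lastKid, hoA w hw hwq, hC.frame w hwx hwy]
    · obtain ⟨i0, i1, i2, i3⟩ := hsp.kids w hw
      rw [hoA w i0 i1, hC.frame w i3 i2]
  have hnu := (Multiset.nodup_add.1 hn).1
  have hrv : (treeAt μ (r + 1) x).rank = r + 2 := hv.ord.rank_eq
  have recs_u := hu.recs_eq (treeAt μ (r + 2 + d) vu)
  have recs_v := hv.recs_eq (treeAt μ (r + 1) x)
  have e7 : r + 2 + (r + 2) + 7 = 2 * (r + 2) + 7 := by omega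
  simp only [attachLeftP, vanishLeft, newPair, newRoot, wp_seq, wp_load, wp_ite, wp_store, wp_assign,
    val_add, val_sub, val_const, val_reg, val_pid, Function.update_apply]
  norm_num [r2, r6, r12, r14, r15, r16, r19, r23, r24, e1u, e7, hbq, e1q, hqn, uW, vW, zW, qW, hWR uW, hWR qW]
  split_ifs with h2 h3
  · refine ⟨hWR vW, ?_⟩
    rw [put_of_ne qo.1.symm, e1v]
    generalize hμ' : put (put μ₁ q 1 x) (M + pu) 4 (μ (M + pv) 4) = μ'
    have ho : ∀ w, w ≠ q → w ≠ M + pu → μ' w = μ₁ w := fun w i1 i2 => by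
      rw [← hμ', put_of_ne i2, put_of_ne i1]
    have hb : ∀ f, f ≠ 4 → μ' (M + pu) f = μ (M + pu) f := fun f hf => by
      rw [← e1u, ← hμ', put_ne (.inr hf), put_of_ne qo.2.1.symm]
    have hqf : ∀ f, f ≠ 1 → μ' q f = μ q f := fun f hf => by
      rw [← e1q, ← hμ', put_of_ne qo.2.1, put_ne (.inr hf)]
    obtain ⟨c1, c2, c3, c4⟩ := common μ' (fun w i1 _ _ i2 => ho w i1 i2) (by
      rw [lastKid, hqf 0 (by norm_num), hqf _ (by rw [hqn]; clear * - hn0; omega), lastKid])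
    obtain ⟨j1, j2, j3⟩ := hu.attach_left (a := a) (b := b) (lo := μ (M + pv) 4) (link := link)
      (pr' := ⊤) (V := treeAt μ (r + 1) x) (o := none) (X := {y}) (Y := recsAt μ (r + 1) x)
      hnu c1 c2 (fun f hf => hb f (by clear * - hf; omega)) (by rw [hb _ (by norm_num), hu.link])
      le_rfl (ENat.natCast_lt_top _)
      (fun lq ho => by
        rw [← hq] at ho ⊢
        rw [hy]
        exact left_fused hqn hn0 hnb ho c3 h2 c4 (by rw [hqf 0 (by norm_num), hqn])
          (by rw [← hμ', put_of_ne qo.2.1, put_eq rfl rfl]) fun f hf => hqf f (by clear * - hf; omega)) hrv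
    have hsep : μ' (M + pu) 4 = μ (M + pv) 4 := by rw [← hμ', put_eq rfl rfl]
    rw [firstEntries_none j1]
    refine AfterJoin.single ⟨_, _, rfl, hsep ▸ j2⟩ ?_ (by simp) hblk.symm fun i hi i1 => ?_
    · rw [j2.recs_eq, recs_u, recs_v, add_comm (recsAt μ (r + 1) x)]
      exact (Multiset.le_add_right _ {y}).trans (j3.le.trans (Multiset.le_add_right _ _))
    · simp only [Function.update_apply]
      split_ifs <;> first | rfl | omega
  · refine wp_move (low_reg (by norm_num)) (low_const _) (low_reg (by norm_num)) (low_const _)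
      (hWR ?_) ?_ fun ρ₂ hρ₂ => ?_
    · simpa [Function.update_apply] using qW
    · simpa [Function.update_apply] using qW
    have g : ∀ i, i < 21 ∨ i = 23 ∨ i = 24 → ρ₂ i = ρ i := fun i hi => by
      rw [hρ₂ i (by clear * - hi; omega)]
      repeat rw [Function.update_of_ne (by clear * - hi; omega)]
    have g21 : ρ₂ 21 = q := (hρ₂ 21 (by norm_num)).trans (by simp)
    have g22 : ρ₂ 22 = 1 + n := (hρ₂ 22 (by norm_num)).trans (by simp)
    have g25 : ρ₂ 25 = μ q 2 := (hρ₂ 25 (by norm_num)).trans (by simp)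
    simp only [wp_seq, wp_store, val_add, val_sub, val_const, val_reg, val_pid, g _ (.inr (.inl rfl)),
      g _ (.inr (.inr rfl)), g 2 (by norm_num), g 12 (by norm_num), g 14 (by norm_num),
      g 15 (by norm_num), g 16 (by norm_num), r2, r12, r14, r15, r16, r23, r24, 
      g21, g22, g25, qW, zW, vW, uW, true_and]
    simp only [Function.update_apply]
    norm_num
    generalize hμ' : put (put (put (put (put (put _ _ _ _) _ _ _) _ _ _) _ _ _) _ _ _) _ _ _ = μ'
    obtain ⟨ho, hqd, hqf, hz, huf, hkey, hvf, hv0, hvL, hvR⟩ :=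
      put_steal_left (r := r) qo.2.2 qo.1 qo.2.1 hzv hzu (by omega) (by omega) (by omega) (by omega) hμ'
    rw [e1q] at hqf
    rw [e1v] at hvf
    rw [e1u] at huf
    obtain ⟨c1, c2, c3, c4⟩ := common μ' (fun w i1 i2 i3 i4 => ho w i1 i2 i3 i4) (by
      rw [lastKid, hqd, hqf _ (by omega) (by omega), lastKid, hqn]
      congr 1; omega)
    obtain ⟨p1, p2, p3⟩ := c3.pair h2 (hy ▸ hz)
    obtain ⟨j1, j2, j3⟩ := hu.attach_left (a := a) (b := b) (lo := μ q 2) (link := link)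
      (pr' := (r + 3 : ℕ)) (V := treeAt μ (r + 1) x) (o := some (treeAt μ' (r + 2) z))
      (X := recsAt μ' (r + 2) z) (Y := recsAt μ (r + 1) x + {z})
      hnu c1 c2 (fun f hf => huf f (by clear * - hf; omega)) (by rw [huf _ (by norm_num), hu.link])
      le_rfl (by exact_mod_cast Nat.lt_succ_self _)
      (fun lq ho => by
        rw [← hq] at ho ⊢
        obtain ⟨k1, k2, -, k3⟩ := left_steal hqn hn0 (by omega) ho c3 h2 c4 hqd
          (fun f i1 i2 => by rw [hqf f i1 i2, add_comm]) (hy ▸ hz)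
        exact ⟨k1, k2, by rw [k3, add_assoc]⟩) hrv
    have hru : (treeAt μ' (r + 2 + d) vu).rank = r + 2 + d + 1 := j2.ord.rank_eq
    -- The rank of the right neighbour is not below that of the stealing tree, so nothing below the
    -- new root is claimed on its right spine; on the left side nothing is claimed at all.
    have hp : HeldAt μ' M pv (r + 2) z ⊤ (μ (M + pv) 4) (μ q 2) (r + 2 + d + 1 : ℕ) (pu + 1) := by
      refine HeldAt.pair hz p2 hv0 hvL hvR ?_ (fun j i0 i1 i2 => by simp at i1) fun j i0 i1 i2 => ?_
      · rw [hvf 3 (by norm_num) (by omega), hv.link]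
      · have : r + 2 + d + 1 ≤ j := by exact_mod_cast i1
        obtain rfl : j = r + 2 := by omega
        omega
    have hsep : μ' (M + pv) 4 = μ (M + pv) 4 := hvf 4 (by norm_num) (by omega)
    have hrz : (treeAt μ' (r + 2) z).rank = r + 3 := hp.ord.rank_eq
    rw [firstEntries_some j1]
    refine AfterJoin.pair ⟨_, _, rfl, ?_⟩ ⟨_, _, rfl, ?_⟩ ?_ ?_ (by simp) fun i hi _ => ?_
    · simp only [hsep, hkey, hru]; exact hp
    · simp only [hkey, hrz]; exact j2
    · rw [j2.recs_eq, hp.recs_eq, recs_u, recs_v, add_comm, j3]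
      exact (by abel : _ = _).le
    · rw [g 1 (by norm_num), h1]
    · exact g i (by omega)
  · refine wp_move (low_reg (by norm_num)) (low_const _) (low_reg (by norm_num)) (low_const _)
      (hWR ?_) ?_ fun ρ₂ hρ₂ => ?_
    · simpa [Function.update_apply] using qW
    · simpa [Function.update_apply] using qW
    have g : ∀ i, i < 21 ∨ i = 23 ∨ i = 24 → ρ₂ i = ρ i := fun i hi => by
      rw [hρ₂ i (by clear * - hi; omega)]
      repeat rw [Function.update_of_ne (by clear * - hi; omega)]
    have g21 : ρ₂ 21 = q := (hρ₂ 21 (by norm_num)).trans (by simp)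
    have g22 : ρ₂ 22 = 1 + n := (hρ₂ 22 (by norm_num)).trans (by simp)
    simp only [wp_load, wp_assign, wp_seq, wp_store, val_add, val_const, val_reg, val_pid,
      g 2 (by norm_num), g 14 (by norm_num),
      g 16 (by norm_num), r2, r14, r16, g21, g22, hWR vW, qW, true_and]
    simp only [Function.update_apply]
    norm_num
    simp only [put_of_ne qo.1.symm, moved_of_ne qo.1.symm, e1v]
    rw [(g 23 (by norm_num)).trans r23, show 1 + n + 1 = n + 2 by omega]
    refine ⟨uW, ?_⟩
    generalize hμ' : put (put (put (put _ _ _ _) _ _ _) _ _ _) _ _ _ = μ'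
    obtain ⟨ho, huf, hqd, hqx', hqs, hqf⟩ := put_append_left qo.2.1 hnb
      hμ'
    rw [e1q] at hqf
    rw [e1u] at huf
    obtain ⟨c1, c2, c3, c4⟩ := common μ' (fun w i1 _ _ i2 => ho w i1 i2) (by
      rw [lastKid, hqd, show 2 * (n + 2) - 1 = 2 * n + 1 + 2 by omega, hqf _ (by omega) (by omega),
        lastKid, hqn]
      congr 1; omega)
    obtain ⟨j1, j2, j3⟩ := hu.attach_left (a := a) (b := b) (lo := μ (M + pv) 4) (link := link)
      (pr' := ⊤) (V := treeAt μ (r + 1) x) (o := none) (X := 0) (Y := recsAt μ (r + 1) x)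
      hnu c1 c2 (fun f hf => huf f (by clear * - hf; omega)) (by rw [huf _ (by norm_num), hu.link])
      le_rfl (ENat.natCast_lt_top _)
      (fun lq ho => by
        rw [← hq] at ho ⊢
        rw [add_zero]
        exact left_append hqn hn0 (by omega) ho c3 h2 c4 hqd hqx' hqs
          (hqf 1 (by norm_num) (by omega)) fun f i1 i2 => hqf f (by omega) i2) hrv
    have hsep : μ' (M + pu) 4 = μ (M + pv) 4 := by rw [← hμ', put_eq rfl rfl]
    rw [firstEntries_none j1]
    refine AfterJoin.single ⟨_, _, rfl, hsep ▸ j2⟩ ?_ (by simp) hblk.symm fun i hi i1 => ?_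
    · rw [j2.recs_eq, recs_u, recs_v, add_comm (recsAt μ (r + 1) x)]
      rw [add_zero] at j3
      exact j3.le.trans (Multiset.le_add_right _ _)
    · refine Eq.trans ?_ (g i (by omega))
      simp only [Function.update_apply]
      split_ifs <;> first | rfl | omega

theorem put_raise_left {B c i j : ℕ} (hzB : z ≠ B) (hi : i = 2 * (r + 3) + 5)
    (hj : j = 2 * (r + 3) + 6)
    (hμ : put (put (put (put (put (put (put (put μ₁ z 0 2) z 1 x) z 2 s) z 3 y)
      B 0 c) B i z) B j z) B 4 key = μ') :
    (∀ w, w ≠ z → w ≠ B → μ' w = μ₁ w) ∧ IsPair μ' z x s y ∧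
      (∀ f, f ≠ 0 → f ≠ 4 → f < 2 * (r + 3) + 5 → μ' B f = μ₁ B f) ∧ μ' B 0 = c ∧ μ' B 4 = key ∧
      μ' B (2 * (r + 3) + 5) = z ∧ μ' B (2 * (r + 3) + 6) = z := by
  subst hμ
  refine ⟨fun w i1 i2 => ?_, ⟨?_, ?_, ?_, ?_⟩, fun f i1 i2 i3 => ?_, ?_, ?_, ?_, ?_⟩
  · simp only [put_of_ne i1, put_of_ne i2]
  · (repeat rw [put_ne (by omega)]); rw [put_eq (by omega) (by omega)]
  · (repeat rw [put_ne (by omega)]); rw [put_eq (by omega) (by omega)]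
  · (repeat rw [put_ne (by omega)]); rw [put_eq (by omega) (by omega)]
  · (repeat rw [put_ne (by omega)]); rw [put_eq (by omega) (by omega)]
  · repeat rw [put_ne (by omega)]
  · (repeat rw [put_ne (by omega)]); rw [put_eq (by omega) (by omega)]
  · rw [put_eq (by omega) (by omega)]
  · (repeat rw [put_ne (by omega)]); rw [put_eq (by omega) (by omega)]
  · (repeat rw [put_ne (by omega)]); rw [put_eq (by omega) (by omega)]

theorem put_fuse_left {B i j : ℕ} (hi : i = 2 * (r + 2) + 5) (hj : j = 2 * (r + 2) + 6)
    (hμ : put (put (put μ₁ B i x) B j x) B 4 key = μ') :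
    (∀ w, w ≠ B → μ' w = μ₁ w) ∧ (∀ f, f ≠ 4 → f < 2 * (r + 2) + 5 → μ' B f = μ₁ B f) ∧
      μ' B 4 = key ∧ μ' B (2 * (r + 2) + 5) = x ∧ μ' B (2 * (r + 2) + 6) = x := by
  subst hμ
  refine ⟨fun w i1 => ?_, fun f i1 i2 => ?_, ?_, ?_, ?_⟩
  · simp only [put_of_ne i1]
  · repeat rw [put_ne (by omega)]
  · rw [put_eq (by omega) (by omega)]
  · (repeat rw [put_ne (by omega)]); rw [put_eq (by omega) (by omega)]
  · (repeat rw [put_ne (by omega)]); rw [put_eq (by omega) (by omega)]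

theorem wp_raiseLeftP
    (hv : HeldAt μ M pv (r + 1) x pr (μ (M + pv) 4) m nv lv)
    (hu : HeldAt μ M pu (r + 1) y (r + 2 : ℕ) m hi nr link)
    (hn : (recsAt μ (r + 1) y + recsAt μ (r + 1) x).Nodup)
    (hout : Outside (recsAt μ (r + 1) y + recsAt μ (r + 1) x) M pv pu z)
    (hC : Combined a b μ μ₁ r x y (μ (M + pv) 4) hi two s)
    (hρ : JoinRegs M link' z (r + 2) pu x y s two ρ)
    (hW : ∀ w, w ∈ recsAt μ (r + 1) y + recsAt μ (r + 1) x ∨ w = M + pv ∨ w = M + pu ∨ w = z →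
      w ∈ W) (hWR : W ⊆ R) :
    wp R W k pv raiseLeftP (
      AfterJoin M hi nr link ⊤ z (pv, treeAt μ (r + 1) x) (pu, treeAt μ (r + 1) y) pv (μ, ρ)
        (firstEntries a b (pv, treeAt μ (r + 1) x) (pu, treeAt μ (r + 1) y))) (μ₁, ρ) := by
  obtain ⟨r2, -, r12, r14, r15, r16, r19, r23, r24⟩ := hρ
  have yo := hout.mem y (Multiset.mem_add.2 (.inl (self_mem_recsAt _ _)))
  have xo := hout.mem x (Multiset.mem_add.2 (.inr (self_mem_recsAt _ _)))
  have hblk := hout.blocks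
  have hzv := hout.zu
  have hzu := hout.zv
  have hvu : M + pv ≠ M + pu := by omega
  have e1u : μ₁ (M + pu) = μ (M + pu) := hC.frame _ xo.2.1.symm yo.2.1.symm
  have e1v : μ₁ (M + pv) = μ (M + pv) := hC.frame _ xo.1.symm yo.1.symm
  have uW : M + pu ∈ W := hW _ (by simp)
  have vR : M + pv ∈ R := hWR (hW _ (by simp))
  have zW : z ∈ W := hW _ (by simp)
  have recs_u := hu.recs_eq (treeAt μ (r + 1) y)
  have recs_v := hv.recs_eq (treeAt μ (r + 1) x)
  have common : ∀ μ' : ℕ → ℕ → ℕ, (∀ w, w ≠ z → w ≠ M + pu → μ' w = μ₁ w) →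
      Merged a b μ μ' r x y (μ (M + pv) 4) hi two s ∧
      ∀ w ∈ recsAt μ (r + 1) y, w ≠ y → μ' w = μ w := by
    intro μ' ho
    refine ⟨hC.merged fun w hw => ?_, fun w hw hwx => ?_⟩
    · rw [add_comm] at hw
      obtain ⟨-, i1, i3⟩ := hout.mem w hw
      exact ho w i3 i1
    · obtain ⟨-, i1, i3⟩ := hout.mem w (Multiset.mem_add.2 (.inl hw))
      rw [ho w i3 i1, hC.frame w _ hwx]
      rintro rfl
      exact Multiset.disjoint_left.1 (Multiset.nodup_add.1 hn).2.2 hw (self_mem_recsAt _ _)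
  simp only [raiseLeftP, vanishLeft, newPair, newRoot, wp_seq, wp_load, wp_ite, wp_store, wp_assign,
    val_add, val_const, val_reg, val_pid, Function.update_apply]
  norm_num [r2, r12, r14, r15, r16, r19, r23, r24, uW, zW, vR]
  simp only [put_of_ne hvu, put_of_ne hzv.symm, e1v]
  split_ifs with h2
  · generalize hμ' : put (put (put _ _ _ _) _ _ _) _ _ _ = μ'
    obtain ⟨ho, hb, hsep, hL, hR⟩ := put_fuse_left (r := r) (by omega) (by omega) hμ'
    rw [e1u] at hb
    obtain ⟨c1, c2⟩ := common μ' fun w _ h => ho w h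
    obtain ⟨j1, j2, j3⟩ := hu.fuse_right hv.ord c1 h2 c2 (fun f hf i => hb f (by omega) i) hL hR
      ((hb 3 (by norm_num) (by omega)).trans hu.link)
    rw [firstEntries_none j1]
    refine AfterJoin.single ⟨_, _, rfl, hsep ▸ j2⟩ ?_ (by simp) hblk.symm fun i hi i1 => ?_
    · rw [j2.recs_eq, recs_u, recs_v]
      exact (Multiset.le_add_right _ {y}).trans (j3.le.trans (Multiset.le_add_right _ _))
    · rw [Function.update_of_ne i1, Function.update_of_ne (by omega)]
  · generalize hμ' : put (put (put (put (put (put (put (put _ _ _ _) _ _ _) _ _ _) _ _ _)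
      _ _ _) _ _ _) _ _ _) _ _ _ = μ'
    obtain ⟨ho, hz, hb, h0, hsep, hL, hR⟩ := put_raise_left (r := r) hzu (by omega) (by omega) hμ'
    rw [e1u] at hb
    obtain ⟨c1, c2⟩ := common μ' ho
    obtain ⟨j1, j2, j3⟩ := hu.root_right hv.ord c1 h2 hz c2
      (fun f i1 i2 => hb f (by omega) (by omega) i2) h0 hL hR
      ((hb 3 (by norm_num) (by norm_num) (by omega)).trans hu.link)
    rw [firstEntries_none j1]
    refine AfterJoin.single ⟨_, _, rfl, hsep ▸ j2⟩ ?_ (by simp) hblk.symm fun i hi i1 => ?_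
    · rw [j2.recs_eq, recs_u, recs_v, j3, add_comm]
    · rw [Function.update_of_ne i1, Function.update_of_ne (by omega)]

set_option maxHeartbeats 1000000 in
theorem wp_joinLeftP {u v : Entry} (ha : 2 ≤ a) (hab : 2 * a ≤ b)
    (h : JoinPre a b M hi nr link ⊤ z v u R W (μ, ρ)) (hle : v.2.rank ≤ u.2.rank)
    (h6 : ρ 6 = u.1 + 1) :
    wp R W k v.1 (joinLeftP a b)
      (AfterJoin M hi nr link ⊤ z v u v.1 (μ, ρ) (firstEntries a b v u)) (μ, ρ) := by
  obtain ⟨pu, U⟩ := u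
  obtain ⟨pv, V⟩ := v
  obtain ⟨⟨⟨f, x, hV, hv⟩, ⟨e, vu, hU, hu⟩, -⟩, abV, abU, hn, hmem, hWR, r1, r2, r24⟩ := h
  simp only at hU hV hle h6 abU abV r1 r2 r24
  subst hU hV
  have hrv : (treeAt μ f x).rank = f + 1 := hv.ord.rank_eq
  have hru : (treeAt μ e vu).rank = e + 1 := hu.ord.rank_eq
  have h2v := abV.two_le_rank ha
  obtain ⟨r, rfl⟩ : ∃ r, f = r + 1 := ⟨f - 1, by omega⟩
  simp only [hu.recs_eq, hv.recs_eq] at hn hmem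
  rw [add_comm (recsAt μ (r + 1) x)] at hn hmem
  have hout := Outside.of_nodup hn
  have hn' : (recsAt μ e vu + recsAt μ (r + 1) x).Nodup :=
    (Multiset.nodup_cons.1 (Multiset.nodup_cons.1 (Multiset.nodup_cons.1 hn).2).2).2
  have iV := (abV.inner_one ha hrv).2
  have iU := (abU.inner_one ha hru).2
  simp only [sepOf, rankOf, linkOf] at hu hv
  rw [hrv] at hu
  have uW := hmem (M + pu) (by simp)
  have vW := hmem (M + pv) (by simp)
  have cW : ∀ w ∈ recsAt μ e vu + recsAt μ (r + 1) x, w ∈ W := fun w hw =>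
    hmem w (by simp only [Multiset.mem_cons]; exact .inr (.inr (.inr hw)))
  have hW : ∀ w, w ∈ recsAt μ e vu + recsAt μ (r + 1) x ∨ w = M + pv ∨ w = M + pu ∨ w = z →
      w ∈ W := fun w hw => hmem w (by simp only [Multiset.mem_cons]; tauto)
  have xA : x ∈ recsAt μ e vu + recsAt μ (r + 1) x :=
    Multiset.mem_add.2 (.inr (self_mem_recsAt _ _))
  have ex : μ (M + pv) (r + 1 + 1 + (r + 1 + 1) + 6) = x := by
    rw [← hv.right]; congr 1; omega
  simp only [joinLeftP, wp_seq, wp_load, wp_assign, val_add, val_sub, val_const, val_reg, val_pid,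
    Function.update_apply]
  norm_num [r2, h6, hWR uW, hWR vW, hv.rank, hu.rank]
  rw [show r + 2 + (r + 2) + 5 = 2 * (r + 2) + 5 by omega, ex]
  rcases Nat.lt_or_ge (r + 1) e with hlt | hge
  · obtain ⟨d, rfl⟩ : ∃ d, e = r + 2 + d := ⟨e - (r + 2), by omega⟩
    have iU2 := abU.inner_two ha hru (by omega)
    obtain ⟨q, n, y, hq, hy, hqn, hn0, hnb, hby, hbq, hcb, hsp⟩ :=
      hu.spine_left hv.ord iU2 ha iV hn'
    have yW := cW y (Multiset.mem_add.2 (.inl hsp.x_mem))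
    rw [hby]
    refine wp_combineP ha hab hcb rfl rfl rfl (hWR (cW x xA)) (hWR yW) (cW x xA) yW
      fun μ₁ ρ₁ hC hρ => ?_
    have hlow : ∀ i < 12, ρ₁ i = ρ i := fun i hi => by
      rw [hρ i (by omega) (by omega)]
      simp only [Function.update_apply]
      split_ifs <;> first | rfl | omega
    have e13 : ρ₁ 13 = r + 2 + d + 1 := by simpa [Function.update_apply] using hρ 13 (by norm_num) (by norm_num)
    have hreg : JoinRegs M (pu + 1) z (r + 2) pu x y (ρ₁ 16) (ρ₁ 19) ρ₁ := by
      refine ⟨(hlow 2 (by norm_num)).trans r2, (hlow 6 (by norm_num)).trans h6, ?_, ?_, ?_, rfl, rfl,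
        ?_, ?_⟩
      · simpa [Function.update_apply] using hρ 12 (by norm_num) (by norm_num)
      · simpa [Function.update_apply] using hρ 14 (by norm_num) (by norm_num)
      · simpa [Function.update_apply] using hρ 15 (by norm_num) (by norm_num)
      · simpa [Function.update_apply] using hρ 23 (by norm_num) (by norm_num)
      · simpa [Function.update_apply, r24] using hρ 24 (by norm_num) (by norm_num)
    rw [wp_ite]
    simp only [val_sub, val_reg, hreg.r12, e13]
    rw [if_neg (by omega)]
    refine (wp_attachLeftP hv hu iU2 ha iV hn' hout ?_ (hby.symm ▸ hreg)
      ((hlow 1 (by norm_num)).trans r1) hW hWR).mono fun s' hs =>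
        hs.congr rfl fun i hi _ => hlow i hi
    rw [← hq, hby]
    exact hC
  · obtain rfl : e = r + 1 := by omega
    have hcb : Combinable b μ r x vu (μ (M + pv) 4) (μ (M + pu) 4) hi :=
      ⟨hv.ord, hu.ord, by rwa [add_comm], iV.degree.2, iU.degree.2⟩
    have yW := cW vu (Multiset.mem_add.2 (.inl (self_mem_recsAt _ _)))
    rw [hu.left]
    refine wp_combineP ha hab hcb rfl rfl rfl (hWR (cW x xA)) (hWR yW) (cW x xA) yW
      fun μ₁ ρ₁ hC hρ => ?_
    have hlow : ∀ i < 12, ρ₁ i = ρ i := fun i hi => by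
      rw [hρ i (by omega) (by omega)]
      simp only [Function.update_apply]
      split_ifs <;> first | rfl | omega
    have e13 : ρ₁ 13 = r + 2 := by simpa [Function.update_apply] using hρ 13 (by norm_num) (by norm_num)
    have hreg : JoinRegs M (pu + 1) z (r + 2) pu x vu (ρ₁ 16) (ρ₁ 19) ρ₁ := by
      refine ⟨(hlow 2 (by norm_num)).trans r2, (hlow 6 (by norm_num)).trans h6, ?_, ?_, ?_, rfl, rfl,
        ?_, ?_⟩
      · simpa [Function.update_apply] using hρ 12 (by norm_num) (by norm_num)
      · simpa [Function.update_apply] using hρ 14 (by norm_num) (by norm_num)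
      · simpa [Function.update_apply] using hρ 15 (by norm_num) (by norm_num)
      · simpa [Function.update_apply] using hρ 23 (by norm_num) (by norm_num)
      · simpa [Function.update_apply, r24] using hρ 24 (by norm_num) (by norm_num)
    rw [wp_ite]
    simp only [val_sub, val_reg, hreg.r12, e13]
    rw [if_pos (by omega)]
    exact (wp_raiseLeftP hv hu hn' hout hC hreg hW hWR).mono fun s' hs =>
      hs.congr rfl fun i hi _ => hlow i hi

end


/-! ### The pairs of trees that are joined -/

theorem disjoint_of_nodup_sum {α : Type*} {L : List α} {f : α → Multiset ℕ}
    (h : (L.map f).sum.Nodup) {x y : α} (hx : x ∈ L) (hy : y ∈ L) (hne : x ≠ y) :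
    Disjoint (f x) (f y) := by
  induction L with
  | nil => simp at hx
  | cons z L ih =>
    rw [List.map_cons, List.sum_cons, Multiset.nodup_add] at h
    obtain ⟨-, h2, h3⟩ := h
    have hle : ∀ w ∈ L, f w ≤ (L.map f).sum := fun w hw =>
      List.single_le_sum (fun _ _ => zero_le) _ (List.mem_map_of_mem hw)
    rcases List.mem_cons.1 hx with rfl | hx' <;> rcases List.mem_cons.1 hy with rfl | hy'
    · exact absurd rfl hne
    · exact h3.mono_right (hle y hy')
    · exact (h3.mono_right (hle x hx')).symm
    · exact ih h2 hx' hy'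

open Classical in
/-- The pairs of neighbours of which the right one is joined to the left one. -/
noncomputable def leftPairs (c : ℕ → Bool) : List Entry → List (Entry × Entry)
  | u :: v :: rest =>
    if Joins u.2.rank (c u.1) v.2.rank (c v.1) (headRank rest) then (u, v) :: leftPairs c rest
    else leftPairs c (v :: rest)
  | _ => []

-- Disjoint pairs, and all their joins together.

section

variable {a b M base hi link k : ℕ} {μ μ' : ℕ → ℕ → ℕ} {pr nr : ℕ∞} {c : ℕ → Bool} {l : List Entry}

theorem leftPairs_join {u v : Entry} {rest : List Entry}
    (h : Joins u.2.rank (c u.1) v.2.rank (c v.1) (headRank rest)) :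
    leftPairs c (u :: v :: rest) = (u, v) :: leftPairs c rest := by
  rw [leftPairs, if_pos h]

theorem leftPairs_skip {u v : Entry} {rest : List Entry}
    (h : ¬ Joins u.2.rank (c u.1) v.2.rank (c v.1) (headRank rest)) :
    leftPairs c (u :: v :: rest) = leftPairs c (v :: rest) := by
  rw [leftPairs, if_neg h]

@[simp] theorem leftPairs_nil : leftPairs c [] = [] := by rw [leftPairs]; simp

@[simp] theorem leftPairs_single (u : Entry) : leftPairs c [u] = [] := by rw [leftPairs]; simp

/-- The recursion jumps over a joined pair but misses nothing, since the tree behind a joining one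
does not join. So membership is a local condition, which each processor can check by itself. -/
theorem mem_leftPairs {u v : Entry} : (u, v) ∈ leftPairs c l ↔
    ∃ l₁ l₂, l = l₁ ++ u :: v :: l₂ ∧ Joins u.2.rank (c u.1) v.2.rank (c v.1) (headRank l₂) := by
  induction l using leftJoins_induction c with
  | nil => simp
  | single w =>
    simp only [leftPairs_single, List.not_mem_nil, false_iff]
    rintro ⟨l₁, l₂, h, -⟩
    have := congrArg List.length h
    simp at this
    omega
  | join u' v' rest hj ih =>
    rw [leftPairs_join hj, List.mem_cons, ih, Prod.mk.injEq]
    constructor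
    · rintro (⟨rfl, rfl⟩ | ⟨l₁, l₂, rfl, h⟩)
      · exact ⟨[], rest, rfl, hj⟩
      · exact ⟨u' :: v' :: l₁, l₂, rfl, h⟩
    · rintro ⟨l₁, l₂, h, h'⟩
      match l₁ with
      | [] =>
        simp only [List.nil_append, List.cons.injEq] at h
        exact .inl ⟨h.1.symm, h.2.1.symm⟩
      | [w] =>
        simp only [List.cons_append, List.nil_append, List.cons.injEq] at h
        obtain ⟨rfl, rfl, rfl⟩ := h
        exact absurd h' hj.not_joins
      | w :: w' :: l₁ =>
        simp only [List.cons_append, List.cons.injEq] at h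
        exact .inr ⟨l₁, l₂, h.2.2, h'⟩
  | skip u' v' rest hj ih =>
    rw [leftPairs_skip hj, ih]
    constructor
    · rintro ⟨l₁, l₂, h, h'⟩
      exact ⟨u' :: l₁, l₂, by rw [h]; rfl, h'⟩
    · rintro ⟨l₁, l₂, h, h'⟩
      match l₁ with
      | [] =>
        simp only [List.nil_append, List.cons.injEq] at h
        obtain ⟨rfl, rfl, rfl⟩ := h
        exact absurd h' hj
      | w :: l₁ =>
        simp only [List.cons_append, List.cons.injEq] at h
        exact ⟨l₁, l₂, h.2, h'⟩

/-- The records that processor `e.1` has at its disposal. -/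
def area (μ : ℕ → ℕ → ℕ) (M base : ℕ) (e : Entry) : Multiset ℕ :=
  (M + e.1) ::ₘ (base + e.1) ::ₘ recs μ M e

/-- No tree belongs to two pairs; for areas of records this gives the disjointness of the areas of
different pairs. -/
theorem leftPairs_le (f : Entry → Multiset ℕ) :
    ((leftPairs c l).map fun x => f x.1 + f x.2).sum ≤ (l.map f).sum := by
  induction l using leftJoins_induction c with
  | nil => simp
  | single w => simp
  | join u v rest hj ih =>
    rw [leftPairs_join hj]
    simp only [List.map_cons, List.sum_cons, ← add_assoc]
    exact add_le_add_right ih _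
  | skip u v rest hj ih =>
    rw [leftPairs_skip hj, List.map_cons, List.sum_cons]
    exact ih.trans (Multiset.le_add_left _ _)

/-- For the tree behind a joined pair, the rank on its left has not decreased; hence no new claims
arise about its left array. -/
theorem le_lastRank_joinEntries (ha : 2 ≤ a) (hab : 2 * a ≤ b) {u v : Entry} (hu : IsABTree a b u.2)
    (hv : IsABTree a b v.2) (h : v.2.rank ≤ u.2.rank) :
    (v.2.rank : ℕ∞) ≤ lastRank pr (joinEntries a b u v) := by
  obtain ⟨h1, h2, h3⟩ := joinToLeft_spec ha hab hu hv h
  unfold joinEntries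
  rcases hj : joinToLeft a b u.2 v.2 with ⟨u', _ | v'⟩
  · rw [hj] at h2
    simp only [lastRank]
    exact_mod_cast h.trans h2
  · rw [hj] at h3
    simp only [reduceCtorEq, false_and, false_or, Option.some.injEq] at h3
    obtain ⟨_, rfl, h4, h5, h6⟩ := h3
    simp only [lastRank, h5]
    exact_mod_cast Nat.le_succ _

theorem Chain.mono_next {l : List Entry} {nr' : ℕ∞} (H : Chain μ M hi nr link pr l) (h : nr ≤ nr') :
    Chain μ M hi nr' link pr l := by
  induction l generalizing pr with
  | nil => trivial
  | cons e l ih =>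
    refine ⟨H.1.mono le_rfl ?_, ih H.2⟩
    cases l with
    | nil => exact h
    | cons => exact le_rfl

/-- All joins to the left have been carried out. -/
theorem chain_leftJoins (ha : 2 ≤ a) (hab : 2 * a ≤ b) (hT : ∀ e ∈ l, IsABTree a b e.2)
    (hc : Chain μ M hi ⊤ link pr l) (hn : (l.map (area μ M base)).sum.Nodup)
    (hstep : ∀ x ∈ leftPairs c l, ∀ hi nr link pr, Chain μ M hi nr link pr [x.1, x.2] →
      (x.2.2.rank : ℕ∞) ≤ nr → Chain μ' M hi nr link pr (joinEntries a b x.1 x.2) ∧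
        total μ' M (joinEntries a b x.1 x.2) ≤ recs μ M x.1 + recs μ M x.2 + {base + x.2.1} ∧
        μ' (M + x.1.1) 4 = μ (M + x.1.1) 4)
    (hkeep : ∀ e ∈ l, ∀ w ∈ area μ M base e, (∀ x ∈ leftPairs c l, w ∉ area μ M base x.1 + area μ M base x.2) → μ' w = μ w) :
    Chain μ' M hi ⊤ link pr (leftJoins a b c l) ∧
      total μ' M (leftJoins a b c l) ≤ total μ M l +
        ((leftPairs c l).map fun x => {base + x.2.1}).sum ∧
      sepOf μ' M hi (leftJoins a b c l) = sepOf μ M hi l ∧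
      rankOf ⊤ l ≤ rankOf ⊤ (leftJoins a b c l) ∧
      linkOf link (leftJoins a b c l) = linkOf link l := by
  have hsub : ∀ {u : Entry} {l : List Entry}, u ∈ l → area μ M base u ≤ (l.map (area μ M base)).sum :=
    fun hu => List.single_le_sum (fun _ _ => zero_le) _ (List.mem_map_of_mem hu)
  have hout : ∀ {u : Entry} {l : List Entry} (w : ℕ), w ∈ area μ M base u →
      (area μ M base u + (l.map (area μ M base)).sum).Nodup →
      ∀ x ∈ leftPairs c l, w ∉ area μ M base x.1 + area μ M base x.2 := fun w hw hn x hx hwx => by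
    rw [Multiset.nodup_add, Multiset.disjoint_left] at hn
    exact hn.2.2 hw (Multiset.mem_of_le ((List.single_le_sum (fun _ _ => zero_le) _
      (List.mem_map_of_mem hx)).trans (leftPairs_le (c := c) (area μ M base))) hwx)
  have same : ∀ {u : Entry}, (∀ w ∈ area μ M base u, μ' w = μ w) →
      (∀ w ∈ recs μ M u, μ' w = μ w) ∧ μ' (M + u.1) = μ (M + u.1) := fun h =>
    ⟨fun w hw => h w (by simp [area, hw]), h _ (by simp [area])⟩
  induction l using leftJoins_induction c generalizing pr with
  | nil => simp [leftJoins_nil, LightJoin.total, Chain, sepOf, rankOf, linkOf]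
  | single u =>
    rw [leftJoins_single]
    obtain ⟨h1, h2⟩ := same (u := u) fun w hw => hkeep u (by simp) w hw (by simp)
    obtain ⟨i1, i2, i3⟩ := hc.frame (μ' := μ') (by simpa [LightJoin.total] using h1) (by simpa using h2)
    exact ⟨i1, by rw [i2]; exact Multiset.le_add_right _ _, i3, le_rfl, rfl⟩
  | join u v rest hj ih =>
    rw [leftPairs_join hj] at hstep hkeep
    have hle : v.2.rank ≤ u.2.rank := by exact_mod_cast ((joins_iff _ _ _ _ _).1 hj).1
    have hnr : (v.2.rank : ℕ∞) ≤ rankOf ⊤ rest := by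
      have := ((joins_iff _ _ _ _ _).1 hj).2.1
      cases rest <;> exact this
    have hn' := hn
    rw [List.map_cons, List.map_cons, List.sum_cons, List.sum_cons, ← add_assoc] at hn'
    rw [show u :: v :: rest = [u, v] ++ rest from rfl, chain_append] at hc
    obtain ⟨i1, i2, i3, i4, i5⟩ := ih (fun e he => hT e (by simp [he])) hc.2
      (Multiset.nodup_add.1 hn').2.1 (fun x hx => hstep x (by simp [hx]))
      fun e he w hw hx => hkeep e (by simp [he]) w hw fun x hx' => by
        rcases List.mem_cons.1 hx' with rfl | hx'
        · exact fun hwx => Multiset.disjoint_left.1 (Multiset.nodup_add.1 hn').2.2 hwx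
            (Multiset.mem_of_le (hsub he) hw)
        · exact hx x hx'
    obtain ⟨j1, j2, j3⟩ := hstep (u, v) (by simp) _ _ _ _ hc.1 hnr
    rw [leftJoins_join hj]
    obtain ⟨-, u', l', k1, k2⟩ := joinEntries_spec ha hab (hT u (by simp)) (hT v (by simp)) hle
    refine ⟨chain_append.2 ⟨?_, i1.mono ?_⟩, ?_, ?_, ?_, ?_⟩
    -- The next tree behind the pair keeps its separator and its processor, and its rank has not
    -- dropped, so what was shown with the old neighbour holds with the new one.
    · rw [i3, i5]
      exact j1.mono_next i4
    · simp only [lastRank]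
      exact le_lastRank_joinEntries ha hab (hT u (by simp)) (hT v (by simp)) hle
    · simp only [LightJoin.total, List.map_append, List.map_cons, List.sum_append, List.sum_cons] at i2 j2 ⊢
      refine (add_le_add j2 i2).trans ?_
      rw [leftPairs_join hj]
      simp only [List.map_cons, List.sum_cons]
      exact (by abel : _ = _).le
    · rw [k1]; exact j3
    · rw [k1]; simp only [List.cons_append, rankOf]; exact_mod_cast k2
    · rw [k1]; rfl
  | skip u v rest hj ih =>
    rw [leftPairs_skip hj] at hstep hkeep
    have hn' := hn
    rw [List.map_cons, List.sum_cons] at hn'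
    obtain ⟨h1, h2⟩ := same (u := u) fun w hw => hkeep u (by simp) w hw (hout w hw hn')
    obtain ⟨i1, i2, i3, i4, i5⟩ := ih (fun e he => hT e (List.mem_cons_of_mem _ he)) hc.2
      (Multiset.nodup_add.1 hn').2.1 hstep fun e he => hkeep e (List.mem_cons_of_mem _ he)
    obtain ⟨j1, j2⟩ := hc.1.frame h1 h2
    rw [leftJoins_skip hj]
    refine ⟨⟨?_, i1⟩, ?_, ?_, le_rfl, rfl⟩
    · rw [i3, i5]
      exact j1.mono le_rfl i4
    · simp only [LightJoin.total, List.map_cons, List.sum_cons, j2] at i2 ⊢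
      rw [leftPairs_skip hj, add_assoc]
      exact add_le_add_right i2 _
    · simp only [sepOf, h2]

/-- The processors that are still in charge of a tree. -/
theorem leftJoins_pids (ha : 2 ≤ a) (hab : 2 * a ≤ b) (hT : ∀ e ∈ l, IsABTree a b e.2)
    (hn : (l.map Prod.fst).Nodup) :
    (∀ e ∈ l, (∀ x ∈ leftPairs c l, x.2.1 ≠ e.1) → e.1 ∈ (leftJoins a b c l).map Prod.fst) ∧
      ∀ x ∈ leftPairs c l, x.2.1 ∈ (leftJoins a b c l).map Prod.fst ↔
        x.2.1 ∈ (joinEntries a b x.1 x.2).map Prod.fst := by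
  induction l using leftJoins_induction c with
  | nil => simp
  | single u => simp [leftJoins_single]
  | join u v rest hj ih =>
    have hle : v.2.rank ≤ u.2.rank := by exact_mod_cast ((joins_iff _ _ _ _ _).1 hj).1
    obtain ⟨⟨-, -, j3, -⟩, u', l', k1, -⟩ :=
      joinEntries_spec ha hab (hT u (by simp)) (hT v (by simp)) hle
    simp only [List.map_cons, List.nodup_cons, List.mem_cons, not_or] at hn
    obtain ⟨⟨-, n1⟩, n2, n3⟩ := hn
    have hT' : ∀ e ∈ rest, IsABTree a b e.2 := fun e he => hT e (by simp [he])
    obtain ⟨i1, i2⟩ := ih hT' n3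
    have hsub := (leftJoins_spec ha hab c rest hT').2.2.1.subset
    rw [leftPairs_join hj, leftJoins_join hj, List.map_append]
    refine ⟨fun e he hx => ?_, fun x hx => ?_⟩
    · rw [List.mem_append]
      rcases List.mem_cons.1 he with rfl | he
      · rw [k1]; simp
      · rcases List.mem_cons.1 he with rfl | he
        · exact absurd rfl (hx (u, e) (by simp))
        · exact .inr (i1 e he fun x hx' => hx x (by simp [hx']))
    · rw [List.mem_append]
      rcases List.mem_cons.1 hx with rfl | hx
      · exact or_iff_left fun h => n2 (hsub h)
      · rw [← i2 x hx]
        obtain ⟨l₁, l₂, h1, -⟩ := mem_leftPairs.1 hx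
        have hm : x.2.1 ∈ rest.map Prod.fst := by rw [h1]; simp
        refine or_iff_right fun h => ?_
        have := j3.subset h
        simp only [List.mem_cons, List.not_mem_nil, or_false] at this
        rcases this with h | h
        · exact n1 (h ▸ hm)
        · exact n2 (h ▸ hm)
  | skip u v rest hj ih =>
    have hT' : ∀ e ∈ v :: rest, IsABTree a b e.2 := fun e he => hT e (List.mem_cons_of_mem _ he)
    rw [List.map_cons, List.nodup_cons] at hn
    obtain ⟨i1, i2⟩ := ih hT' hn.2
    rw [leftPairs_skip hj, leftJoins_skip hj, List.map_cons]
    refine ⟨fun e he hx => ?_, fun x hx => ?_⟩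
    · rcases List.mem_cons.1 he with rfl | he
      · simp
      · exact List.mem_cons_of_mem _ (i1 e he hx)
    · rw [← i2 x hx, List.mem_cons]
      obtain ⟨l₁, l₂, h1, -⟩ := mem_leftPairs.1 hx
      refine or_iff_right fun h => hn.1 (h ▸ ?_)
      rw [h1]; simp

end


/-! ### Phases of an iteration -/

/-- A complete execution within the time that `c` takes. -/
def Runs {k : ℕ} (ω : ℕ → ℕ → Bool) (c : Cmd) (A : Finset (Fin k)) (σ σ' : State k) : Prop :=
  ∃ t w, Exec ω c A σ σ' t w ∧ t ≤ cost c ∧ w ≤ cost c * A.card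

section

variable {k : ℕ} {ω : ℕ → ℕ → Bool} {c d : Cmd} {A : Finset (Fin k)} {σ σ₁ σ₂ : State k}

theorem Runs.seq (h : Runs ω c A σ σ₁) (h' : Runs ω d A σ₁ σ₂) : Runs ω (seq c d) A σ σ₂ := by
  obtain ⟨t, w, e, ht, hw⟩ := h
  obtain ⟨t', w', e', ht', hw'⟩ := h'
  exact ⟨_, _, .seq _ _ _ _ _ _ _ _ _ _ e e', by simp only [cost]; omega,
    by simp only [cost, add_mul]; omega⟩

/-- What is known after all processors in `A` have executed a program on their own records. -/
structure After (R W : Fin k → Set ℕ) (A : Finset (Fin k)) (Q : Fin k → Loc → Prop) (σ σ' : State k) :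
    Prop where
  post : ∀ p ∈ A, ∃ μ, (∀ v ∈ R p, σ'.mem v = μ v) ∧ Q p (μ, σ'.regs p)
  regs : ∀ p ∉ A, σ'.regs p = σ.regs p
  mem : ∀ v, (∀ p ∈ A, v ∉ W p) → σ'.mem v = σ.mem v
  draws : σ'.draws = σ.draws

theorem runs_of_wp (ω : ℕ → ℕ → Bool) {R W : Fin k → Set ℕ} (hRW : Apart R W) (hs : Simple c)
    {Q : Fin k → Loc → Prop} (h : ∀ p ∈ A, wp (R p) (W p) k p c (Q p) (σ.mem, σ.regs p)) :
    ∃ σ', Runs ω c A σ σ' ∧ After R W A Q σ σ' := by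
  obtain ⟨σ', t, w, e, ht, hw, o⟩ := exec_of_safe ω hRW c hs A σ fun p hp => (h p hp).1
  refine ⟨σ', ⟨t, w, e, ht, hw⟩, fun p hp => ⟨_, o.mem p hp, ?_⟩, o.regs_of_notMem,
    o.mem_of_notMem, o.draws⟩
  rw [o.regs p hp]
  exact (h p hp).2

theorem apart_empty (R : Fin k → Set ℕ) : Apart R fun _ => ∅ :=
  ⟨fun _ => Set.empty_subset _, fun _ _ _ _ _ => id⟩

/-- A phase in which nothing is stored. -/
theorem runs_of_wp_reads (ω : ℕ → ℕ → Bool) (hs : Simple c)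
    {Q : Fin k → Loc → Prop} (h : ∀ p ∈ A, wp Set.univ ∅ k p c (Q p) (σ.mem, σ.regs p)) :
    ∃ σ', Runs ω c A σ σ' ∧ σ'.mem = σ.mem ∧ σ'.draws = σ.draws ∧
      (∀ p ∉ A, σ'.regs p = σ.regs p) ∧ ∀ p ∈ A, Q p (σ.mem, σ'.regs p) := by
  obtain ⟨σ', hr, ho⟩ := runs_of_wp ω (apart_empty fun _ => Set.univ) hs h
  have hm : σ'.mem = σ.mem := funext fun v => ho.mem v fun _ _ => id
  refine ⟨σ', hr, hm, ho.draws, ho.regs, fun p hp => ?_⟩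
  obtain ⟨μ, h1, h2⟩ := ho.post p hp
  rwa [show μ = σ.mem from funext fun v => by rw [← h1 v trivial, hm]] at h2

end

/-! ### Links and rules -/

/-- The link to the last tree of the sequence to the left. -/
def leftLink (l : List Entry) : ℕ := l.getLast?.elim 0 fun e => e.1 + 1

/-- The random bit of the last tree. -/
def lastBit (c : ℕ → Bool) (l : List Entry) : Bool := l.getLast?.elim false fun e => c e.1

@[simp] theorem leftLink_nil : leftLink [] = 0 := rfl
@[simp] theorem leftLink_append (l : List Entry) (u : Entry) : leftLink (l ++ [u]) = u.1 + 1 := by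
  simp [leftLink]

@[simp] theorem lastBit_nil (c : ℕ → Bool) : lastBit c [] = false := rfl

@[simp] theorem lastBit_append (c : ℕ → Bool) (l : List Entry) (u : Entry) :
    lastBit c (l ++ [u]) = c u.1 := by simp [lastBit]

@[simp] theorem lastRank_append (pr : ℕ∞) (l : List Entry) (u : Entry) :
    lastRank pr (l ++ [u]) = u.2.rank := by
  induction l generalizing pr with
  | nil => rfl
  | cons e l ih => exact ih _

/-- Load the rank and the random bit of the left neighbour. -/
def lookLeftP : Cmd :=
  ite (rg 5)
    (seq (assign 23 (rg 2 + (rg 5 - .const 1))) <|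
      seq (load 8 (rg 23) (.const 0)) (load 10 (rg 23) (.const 1)))
    (seq (assign 8 (rg 7 + .const 1)) (assign 10 (.const 0)))

/-- Load the rank of the right neighbour. -/
def lookRightP : Cmd :=
  ite (rg 6)
    (seq (assign 23 (rg 2 + (rg 6 - .const 1))) (load 9 (rg 23) (.const 0)))
    (assign 9 (rg 7 + .const 1))

/-- Choose a new record in register 24, and find out whether one of the rules holds. -/
def decideP : Cmd :=
  seq (assign 24 (rg 3 + .pid)) <|
  assign 11 (.const 1 - (((rg 7 - rg 8) + (rg 7 - rg 9)) +
    (((rg 10 + (.const 1 - rg 4)) - ((rg 8 - rg 7) + (rg 8 - rg 7))) +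
      ((.const 1 - rg 4) - (rg 9 - rg 7)))))

/-- Compare the ranks and the random bits of the tree and its neighbours: afterwards register 11 is
nonzero if the tree is to be joined. -/
def lookP : Cmd := seq (load 7 ownBlock (.const 0)) (seq lookLeftP (seq lookRightP decideP))

/-- Each summand measures the violation of one condition and vanishes if there is none. The
conditions on the bits matter only in case of ties, so the differences of ranks are subtracted from
them; on the left, where two bits are involved and the violation can be 2, the difference is
subtracted twice. -/
theorem joins_iff_nat {rl r rr : ℕ} {cl c : Bool} :
    Joins rl cl r c rr ↔ 1 - (((r - rl) + (r - rr)) + (((cl.toNat + (1 - c.toNat)) -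
      ((rl - r) + (rl - r))) + ((1 - c.toNat) - (rr - r)))) ≠ 0 := by
  rw [joins_iff]
  norm_cast
  cases cl <;> cases c <;> simp <;> omega

/-- A missing neighbour can be simulated by one of rank r + 1, whose bit is irrelevant; the machine
has no infinite rank. -/
theorem joins_top_left {r : ℕ} {rr : ℕ∞} {cl c : Bool} :
    Joins ⊤ cl r c rr ↔ Joins (r + 1 : ℕ) false r c rr := by
  rw [joins_iff, joins_iff]
  have h1 : (⊤ : ℕ∞) ≠ r := ENat.top_ne_natCast r
  have h2 : ((r + 1 : ℕ) : ℕ∞) ≠ r := by exact_mod_cast Nat.succ_ne_self r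
  have h3 : (r : ℕ∞) ≤ (r + 1 : ℕ) := by exact_mod_cast Nat.le_succ r
  simp only [h1, h2, h3, le_top, false_imp_iff, true_and]

theorem joins_top_right {r : ℕ} {rl : ℕ∞} {cl c : Bool} :
    Joins rl cl r c ⊤ ↔ Joins rl cl r c (r + 1 : ℕ) := by
  rw [joins_iff, joins_iff]
  have h1 : (r : ℕ∞) ≠ ⊤ := ENat.natCast_ne_top r
  have h2 : (r : ℕ∞) ≠ (r + 1 : ℕ) := by exact_mod_cast (Nat.succ_ne_self r).symm
  have h3 : (r : ℕ∞) ≤ (r + 1 : ℕ) := by exact_mod_cast Nat.le_succ r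
  simp only [h1, h2, h3, le_top, false_imp_iff, true_and, and_true]

/-- The rank and the random bit of a tree are in the block of its processor. -/
def Shown (μ : ℕ → ℕ → ℕ) (M : ℕ) (c : ℕ → Bool) (e : Entry) : Prop :=
  μ (M + e.1) 0 = e.2.rank ∧ μ (M + e.1) 1 = (c e.1).toNat

/-- A processor only reads the published ranks and bits of its neighbours. Concurrent reads occur
here, as both neighbours of a tree look at its block, but nothing is written. -/
theorem wp_lookP {k p M base : ℕ} {μ : ℕ → ℕ → ℕ} {ρ : ℕ → ℕ} {c : ℕ → Bool} {t : LTree}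
    {l₁ l₂ : List Entry} (h : ∀ e ∈ l₁ ++ (p, t) :: l₂, Shown μ M c e) (r2 : ρ 2 = M)
    (r3 : ρ 3 = base) (r4 : ρ 4 = (c p).toNat)
    (r5 : ρ 5 = leftLink l₁) (r6 : ρ 6 = linkOf 0 l₂) :
    wp Set.univ ∅ k p lookP (fun s => (∀ i < 7, s.2 i = ρ i) ∧ s.2 24 = base + p ∧
      (s.2 11 ≠ 0 ↔ Joins (lastRank ⊤ l₁) (lastBit c l₁) t.rank (c p) (rankOf ⊤ l₂))) (μ, ρ) := by
  obtain ⟨h1, h2⟩ := h (p, t) (by simp)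
  have key : ∀ {rl rr : ℕ} {cl : Bool} {ρ' : ℕ → ℕ}, (∀ i < 7, ρ' i = ρ i) → ρ' 7 = t.rank →
      ρ' 8 = rl → ρ' 9 = rr → ρ' 10 = cl.toNat → (Joins (lastRank ⊤ l₁) (lastBit c l₁) t.rank (c p)
        (rankOf ⊤ l₂) ↔ Joins rl cl t.rank (c p) rr) →
      wp Set.univ ∅ k p decideP (fun s => (∀ i < 7, s.2 i = ρ i) ∧ s.2 24 = base + p ∧
      (s.2 11 ≠ 0 ↔ Joins (lastRank ⊤ l₁) (lastBit c l₁) t.rank (c p) (rankOf ⊤ l₂))) (μ, ρ') := by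
    intro rl rr cl ρ' h0 h7 h8 h9 h10 hj
    rw [hj, joins_iff_nat]
    simp only [decideP, wp_seq, wp_assign, val_add, val_sub, val_const, val_reg, val_pid]
    refine ⟨fun i hi => ?_, ?_, ?_⟩
    · rw [Function.update_of_ne (by omega), Function.update_of_ne (by omega), h0 i hi]
    · simp [h0 3 (by norm_num), r3]
    · simp [h7, h8, h9, h10, h0 4 (by norm_num), r4]
  simp only [lookP, lookLeftP, wp_seq, wp_load, val_add, val_const, val_reg, val_pid, r2, h1, Set.mem_univ, true_and]
  have hrr : ∃ rr : ℕ, (∀ rl cl, Joins rl cl t.rank (c p) (rankOf ⊤ l₂) ↔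
      Joins rl cl t.rank (c p) rr) ∧ ∀ ρ' Q, ρ' 2 = M → ρ' 6 = ρ 6 → ρ' 7 = t.rank →
        (∀ ρ'', (∀ i < 23, i ≠ 9 → ρ'' i = ρ' i) → ρ'' 9 = rr → Q (μ, ρ'')) →
        wp Set.univ ∅ k p lookRightP Q (μ, ρ') := by
    cases l₂ with
    | nil =>
      refine ⟨t.rank + 1, fun rl cl => joins_top_right, fun ρ' Q e2 e6 e7 hQ => ?_⟩
      simp only [lookRightP, wp_ite, val_reg, e6, r6, linkOf, if_true, wp_assign, val_add, val_const, e7]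
      refine hQ _ (fun i _ hi => ?_) (by simp)
      rw [Function.update_of_ne hi]
    | cons v l₂ =>
      refine ⟨v.2.rank, fun rl cl => Iff.rfl, fun ρ' Q e2 e6 e7 hQ => ?_⟩
      have hv := (h v (by simp)).1
      simp only [lookRightP, wp_ite, val_reg, e6, r6, linkOf, wp_seq, wp_assign, wp_load, val_add, val_sub,
        val_const, e2, Set.mem_univ, true_and]
      rw [if_neg (by omega)]
      refine hQ _ (fun i _ hi => ?_) ?_
      · rw [Function.update_of_ne hi, Function.update_of_ne (by omega)]
      · simp [hv]
  obtain ⟨rr, hrr, hright⟩ := hrr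
  rcases List.eq_nil_or_concat l₁ with rfl | ⟨l₁, u, rfl⟩
  · rw [leftLink_nil] at r5
    simp only [wp_ite, wp_seq, wp_assign, val_reg, val_add, val_const, Function.update_apply]
    norm_num [r5]
    refine hright _ _ (by simp [r2]) (by simp) (by simp) fun ρ' e1 e2 => ?_
    refine key (rl := t.rank + 1) (rr := rr) (cl := false) (fun i hi => ?_) ?_ ?_ e2 ?_ ?_
    · rw [e1 i (by omega) (by omega)]
      repeat rw [Function.update_of_ne (by omega)]
    · rw [e1 7 (by omega) (by omega)]; simp
    · rw [e1 8 (by omega) (by omega)]; simp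
    · rw [e1 10 (by omega) (by omega)]; simp
    · rw [hrr]; exact joins_top_left
  · rw [List.concat_eq_append] at r5 h ⊢
    rw [leftLink_append] at r5
    obtain ⟨u1, u2⟩ := h u (by simp)
    simp only [wp_ite, wp_seq, wp_assign, wp_load, val_reg, val_add, val_sub, val_const,
      Function.update_apply]
    norm_num [r5, r2, u1, u2]
    refine hright _ _ (by simp [r2]) (by simp) (by simp) fun ρ' e1 e2 => ?_
    rw [List.concat_eq_append, lastRank_append, lastBit_append] at key
    refine key (rl := u.2.rank) (rr := rr) (cl := c u.1) (fun i hi => ?_) ?_ ?_ e2 ?_ ?_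
    · rw [e1 i (by omega) (by omega)]
      repeat rw [Function.update_of_ne (by omega)]
    · rw [e1 7 (by omega) (by omega)]; simp
    · rw [e1 8 (by omega) (by omega)]; simp
    · rw [e1 10 (by omega) (by omega)]; simp
    · rw [hrr]


/-! ### The joins of an iteration -/

/-- What is known of the sequence of trees itself. -/
structure Entries (a b k : ℕ) (l : List Entry) : Prop where
  tree : ∀ e ∈ l, IsABTree a b e.2
  nodup : (l.map Prod.fst).Nodup
  lt : ∀ e ∈ l, e.1 < k

/-- The sequence of trees is in the memory of the machine, below record `base`; the blocks of the
processors are the records from `M` on. -/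
structure Holds {k : ℕ} (M hi base : ℕ) (l : List Entry) (σ : State k) : Prop where
  chain : Chain σ.mem M hi ⊤ 0 ⊤ l
  nodup : (total σ.mem M l).Nodup
  range : ∀ w ∈ total σ.mem M l, 0 < w ∧ w < base ∧ (w < M ∨ M + k ≤ w)
  pos : 0 < M
  le_base : M + k ≤ base
  alive : ∀ p : Fin k, σ.regs p 1 = if (p : ℕ) ∈ l.map Prod.fst then 1 else 0
  r2 : ∀ p : Fin k, σ.regs p 2 = M

/-- Every processor knows its neighbours. -/
def Linked {k : ℕ} (l : List Entry) (σ : State k) : Prop :=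
  ∀ (p : Fin k) (t : LTree) (l₁ l₂ : List Entry), l = l₁ ++ ((p : ℕ), t) :: l₂ →
    σ.regs p 5 = leftLink l₁ ∧ σ.regs p 6 = linkOf 0 l₂

/-- The processors in charge of the trees. -/
def team (k : ℕ) (l : List Entry) : Finset (Fin k) :=
  Finset.univ.filter fun p => (p : ℕ) ∈ l.map Prod.fst

theorem wp_ite_pos {R W : Set ℕ} {k p x : ℕ} {c d : Cmd} {Q : Loc → Prop} {μ : ℕ → ℕ → ℕ} {ρ : ℕ → ℕ}
    (h : ρ x ≠ 0) : wp R W k p (ite (rg x) c d) Q (μ, ρ) ↔ wp R W k p c Q (μ, ρ) := by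
  rw [wp_ite, val_reg, if_neg h]

theorem wp_ite_neg {R W : Set ℕ} {k p x : ℕ} {c d : Cmd} {Q : Loc → Prop} {μ : ℕ → ℕ → ℕ} {ρ : ℕ → ℕ}
    (h : ρ x = 0) : wp R W k p (ite (rg x) c d) Q (μ, ρ) ↔ wp R W k p d Q (μ, ρ) := by
  rw [wp_ite, val_reg, if_pos h]

-- The phase in which trees are joined to the left.

section

variable {a b k M hi base z : ℕ} {l : List Entry} {σ σ' : State k} {μ μ' : ℕ → ℕ → ℕ}
  {c : ℕ → Bool} {ω : ℕ → ℕ → Bool}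

theorem mem_team {p : Fin k} : p ∈ team k l ↔ ∃ t l₁ l₂, l = l₁ ++ ((p : ℕ), t) :: l₂ := by
  simp only [team, Finset.mem_filter, Finset.mem_univ, true_and, List.mem_map]
  constructor
  · rintro ⟨⟨q, t⟩, he, rfl⟩
    obtain ⟨l₁, l₂, h⟩ := List.append_of_mem he
    exact ⟨t, l₁, l₂, h⟩
  · rintro ⟨t, l₁, l₂, rfl⟩
    exact ⟨((p : ℕ), t), by simp, rfl⟩

theorem area_sum (μ : ℕ → ℕ → ℕ) (M base : ℕ) (l : List Entry) :
    (l.map (area μ M base)).sum = ((l.map fun e => M + e.1 : List ℕ) : Multiset ℕ) +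
      (((l.map fun e => base + e.1 : List ℕ) : Multiset ℕ) + total μ M l) := by
  induction l with
  | nil => rfl
  | cons e l ih =>
    simp only [List.map_cons, List.sum_cons, ih, total, area, ← Multiset.cons_coe,
      ← Multiset.singleton_add]
    abel

theorem sum_singletons {α : Type*} (L : List α) (f : α → ℕ) :
    (L.map fun x => ({f x} : Multiset ℕ)).sum = ((L.map f : List ℕ) : Multiset ℕ) := by
  induction L with
  | nil => rfl
  | cons x L ih => rw [List.map_cons, List.sum_cons, ih, List.map_cons, Multiset.singleton_add,
      Multiset.cons_coe]

theorem nodup_add_pids {l : List Entry} (h : (l.map Prod.fst).Nodup) (M : ℕ) :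
    (l.map fun e => M + e.1).Nodup := by
  have := h.map (f := fun p => M + p) fun x y hxy => by simpa using hxy
  rwa [List.map_map] at this

theorem Holds.nodup_area (H : Holds M hi base l σ) (E : Entries a b k l) :
    (l.map (area σ.mem M base)).sum.Nodup := by
  rw [area_sum, Multiset.nodup_add, Multiset.nodup_add]
  refine ⟨nodup_add_pids E.nodup M, ⟨nodup_add_pids E.nodup base, H.nodup, ?_⟩, ?_⟩
  · rw [Multiset.disjoint_left]
    intro w hw hw'
    obtain ⟨e, he, rfl⟩ := List.mem_map.1 (Multiset.mem_coe.1 hw)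
    have := (H.range _ hw').2.1
    omega
  · rw [Multiset.disjoint_left]
    intro w hw hw'
    obtain ⟨e, he, rfl⟩ := List.mem_map.1 (Multiset.mem_coe.1 hw)
    have h1 := E.lt e he
    have h2 := H.le_base
    rcases Multiset.mem_add.1 hw' with hw' | hw'
    · obtain ⟨f, hf, h⟩ := List.mem_map.1 (Multiset.mem_coe.1 hw')
      omega
    · have := (H.range _ hw').2.2
      omega

theorem Entries.eq_of_pid (E : Entries a b k l) {e f : Entry} (he : e ∈ l) (hf : f ∈ l)
    (h : e.1 = f.1) : e = f := List.inj_on_of_nodup_map E.nodup he hf h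

/-- The records that processor `p` needs for a join to the left neighbour. -/
def leftArea (μ : ℕ → ℕ → ℕ) (M base : ℕ) (c : ℕ → Bool) (l : List Entry) (p : Fin k) : Set ℕ :=
  {w | ∃ x ∈ leftPairs c l, x.2.1 = p ∧ w ∈ area μ M base x.1 + area μ M base x.2}

theorem mem_of_leftPairs {x : Entry × Entry} (hx : x ∈ leftPairs c l) : x.1 ∈ l ∧ x.2 ∈ l := by
  obtain ⟨l₁, l₂, rfl, -⟩ := mem_leftPairs.1 hx
  simp

theorem Entries.split_unique (E : Entries a b k l) {e e' : Entry} {l₁ l₂ l₃ l₄ : List Entry}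
    (h : l = l₁ ++ e :: l₂) (h' : l = l₃ ++ e' :: l₄) (he : e.1 = e'.1) : l₁ = l₃ ∧ e = e' ∧ l₂ = l₄ := by
  obtain rfl := E.eq_of_pid (e := e) (f := e') (by simp [h]) (by simp [h']) he
  have hn : ∀ {l₁ l₂}, l = l₁ ++ e :: l₂ → e ∉ l₁ ∧ e ∉ l₂ := fun h => by
    have := List.Nodup.of_map _ E.nodup
    rw [h, List.nodup_append, List.nodup_cons] at this
    exact ⟨fun he => this.2.2 e he e (by simp) rfl, this.2.1.1⟩
  have := (List.append_cons_inj_of_notMem (hn h).1 (hn h).2).1 (h.symm.trans h')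
  exact ⟨this.1, rfl, this.2.2⟩

theorem Entries.pred_unique (E : Entries a b k l) {u v u' v' : Entry} {l₁ l₂ l₃ l₄ : List Entry}
    (h : l = l₁ ++ u :: v :: l₂) (h' : l = l₃ ++ u' :: v' :: l₄) (hv : v.1 = v'.1) : u = u' := by
  have := (E.split_unique (l₁ := l₁ ++ [u]) (l₃ := l₃ ++ [u']) (by simpa using h) (by simpa using h') hv).1
  simpa using (List.append_inj' this rfl).2

theorem Entries.leftPairs_unique (E : Entries a b k l) {x y : Entry × Entry}
    (hx : x ∈ leftPairs c l) (hy : y ∈ leftPairs c l) (h : x.2.1 = y.2.1) : x = y := by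
  have h2 := E.eq_of_pid (mem_of_leftPairs hx).2 (mem_of_leftPairs hy).2 h
  obtain ⟨l₁, l₂, h1, -⟩ := mem_leftPairs.1 hx
  obtain ⟨l₃, l₄, h3, -⟩ := mem_leftPairs.1 hy
  exact Prod.ext (E.pred_unique h1 h3 h) h2

/-- Different joining processors belong to different pairs, and the records of different pairs are
disjoint; so the joins do not interfere. -/
theorem apart_leftArea (h : (l.map (area μ M base)).sum.Nodup) :
    Apart (leftArea (k := k) μ M base c l) (leftArea μ M base c l) := by
  refine ⟨fun _ => subset_rfl, fun p q hpq v hv hv' => ?_⟩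
  obtain ⟨x, hx, h1, h2⟩ := hv
  obtain ⟨y, hy, h3, h4⟩ := hv'
  have hne : x ≠ y := by
    rintro rfl
    exact hpq (Fin.ext (h1.symm.trans h3))
  exact Multiset.disjoint_left.1 (disjoint_of_nodup_sum
    (Multiset.nodup_of_le (leftPairs_le (c := c) (area μ M base)) h) hx hy hne) h2 h4

/-- The trees to which a rule applies are joined to their left neighbours. -/
def leftPhase (a b : ℕ) : Cmd := ite (rg 11) (ite (rg 5) (joinRightP a b) skip) skip

theorem simple_leftPhase (a b : ℕ) : Simple (leftPhase a b) := by
  simp [leftPhase, joinRightP, attachRightP, raiseRightP, vanish, newPair, newRoot, Simple,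
    simple_combineP]

/-- The rules have been evaluated. -/
def Decided {k : ℕ} (base : ℕ) (c : ℕ → Bool) (l : List Entry) (σ : State k) : Prop :=
  ∀ (p : Fin k) (t : LTree) (l₁ l₂ : List Entry), l = l₁ ++ ((p : ℕ), t) :: l₂ →
    σ.regs p 24 = base + p ∧
      (σ.regs p 11 ≠ 0 ↔ Joins (lastRank ⊤ l₁) (lastBit c l₁) t.rank (c p) (rankOf ⊤ l₂))

theorem Holds.pair_pre (H : Holds M hi base l σ) (E : Entries a b k l) {p : Fin k}
    {u v : Entry} {l₁ l₂ : List Entry} (hl : l = l₁ ++ u :: v :: l₂) (hp : v.1 = p)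
    (h24 : σ.regs p 24 = base + p) {W : Set ℕ}
    (hW : ∀ w ∈ area σ.mem M base u + area σ.mem M base v, w ∈ W) {hi' link : ℕ} {nr pr : ℕ∞}
    (hc : Chain σ.mem M hi' nr link pr [u, v]) :
    JoinPre a b M hi' nr link pr (base + p) u v W W (σ.mem, σ.regs p) := by
  have hv : v ∈ l := by simp [hl]
  have hle : area σ.mem M base u + area σ.mem M base v ≤ (l.map (area σ.mem M base)).sum := by
    rw [hl]
    simp only [List.map_append, List.map_cons, List.sum_append, List.sum_cons, ← add_assoc]
    refine le_trans ?_ (Multiset.le_add_right _ _)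
    rw [add_assoc]
    exact Multiset.le_add_left _ _
  have hsub : (M + u.1) ::ₘ (M + v.1) ::ₘ (base + (p : ℕ)) ::ₘ (recs σ.mem M u + recs σ.mem M v) ≤
      area σ.mem M base u + area σ.mem M base v := by
    simp only [area, ← hp, ← Multiset.singleton_add]
    rw [show {M + u.1} + ({base + u.1} + recs σ.mem M u) + ({M + v.1} + ({base + v.1} +
      recs σ.mem M v)) = {M + u.1} + ({M + v.1} + ({base + v.1} + (recs σ.mem M u + recs σ.mem M v))) +
        {base + u.1} by abel]
    exact Multiset.le_add_right _ _
  refine ⟨hc, E.tree u (by simp [hl]), E.tree v hv, Multiset.nodup_of_le (hsub.trans hle) (H.nodup_area E),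
    fun w hw => hW w (Multiset.mem_of_le hsub hw), subset_rfl, ?_, H.r2 p, h24⟩
  show σ.regs p 1 = 1
  rw [H.alive p, if_pos (hp ▸ List.mem_map_of_mem hv)]

theorem Chain.link_eq {M hi link : ℕ} {nr pr : ℕ∞} {e : Entry} {l₁ l₂ : List Entry}
    (h : Chain μ M hi nr link pr (l₁ ++ e :: l₂)) : μ (M + e.1) 3 = linkOf link l₂ := by
  obtain ⟨h, v, -, h2⟩ := (chain_append.1 h).2.1
  exact h2.link

theorem Entries.leftJoins (ha : 2 ≤ a) (hab : 2 * a ≤ b) (E : Entries a b k l) (c : ℕ → Bool) :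
    Entries a b k (leftJoins a b c l) := by
  obtain ⟨h1, -, h2, -⟩ := leftJoins_spec ha hab c l E.tree
  refine ⟨h1, h2.nodup E.nodup, fun e he => ?_⟩
  obtain ⟨f, hf, h⟩ := List.mem_map.1 (h2.subset (List.mem_map_of_mem he))
  exact h ▸ E.lt f hf

theorem runs_leftPhase (ha : 2 ≤ a) (hab : 2 * a ≤ b) (H : Holds M hi base l σ)
    (E : Entries a b k l) (hL : Linked l σ) (hD : Decided base c l σ) :
    ∃ σ', Runs ω (leftPhase a b) (team k l) σ σ' ∧
      Holds M hi (base + k) (leftJoins a b c l) σ' ∧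
      (∀ p i, i < 12 → i ≠ 1 → σ'.regs p i = σ.regs p i) ∧ σ'.draws = σ.draws ∧
      ∀ p : Fin k, (∀ x ∈ leftPairs c l, x.2.1 ≠ p) →
        σ'.regs p = σ.regs p ∧ base + p ∉ total σ'.mem M (leftJoins a b c l) := by
  have hn := H.nodup_area E
  have hA := apart_leftArea (k := k) (c := c) hn
  have hside : ∀ x ∈ leftPairs c l, x.2.2.rank ≤ x.1.2.rank := fun x hx => by
    obtain ⟨l₁, l₂, -, h⟩ := mem_leftPairs.1 hx
    exact_mod_cast ((joins_iff _ _ _ _ _).1 h).1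
  have hpair : ∀ x ∈ leftPairs c l, ∃ hi nr link pr, Chain σ.mem M hi nr link pr [x.1, x.2] ∧
      (x.2.2.rank : ℕ∞) ≤ nr := fun ⟨u, v⟩ hx => by
    obtain ⟨l₃, l₄, h1, h2⟩ := mem_leftPairs.1 hx
    have := H.chain
    rw [h1, chain_append, show u :: v :: l₄ = [u, v] ++ l₄ from rfl, chain_append] at this
    refine ⟨_, _, _, _, this.2.1, ?_⟩
    have h := ((joins_iff _ _ _ _ _).1 h2).2.1
    cases l₄ <;> exact h
  obtain ⟨σ', hr, ho⟩ := runs_of_wp (A := team k l) (σ := σ) ω hA (simple_leftPhase a b)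
    (Q := fun p s => (∀ x ∈ leftPairs c l, x.2.1 = p → ∀ hi nr link pr,
        Chain σ.mem M hi nr link pr [x.1, x.2] → (x.2.2.rank : ℕ∞) ≤ nr →
        AfterJoin M hi nr link pr (base + p) x.1 x.2 p (σ.mem, σ.regs p) (joinEntries a b x.1 x.2) s ∧
        s.1 (M + x.1.1) 4 = σ.mem (M + x.1.1) 4) ∧
      ((∀ x ∈ leftPairs c l, x.2.1 ≠ p) → s.2 = σ.regs p)) (fun p hp => by
    obtain ⟨t, l₁, l₂, hl⟩ := mem_team.1 hp
    obtain ⟨d1, d2⟩ := hD p t l₁ l₂ hl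
    obtain ⟨k1, k2⟩ := hL p t l₁ l₂ hl
    -- Register 11 tells whether a rule applies and register 5 whether there is a left neighbour;
    -- together they single out the right members of the pairs.
    have hcase : (∃ x ∈ leftPairs c l, x.2.1 = p) ↔ σ.regs p 11 ≠ 0 ∧ σ.regs p 5 ≠ 0 := by
      constructor
      · rintro ⟨⟨u, v⟩, hx, hp'⟩
        obtain ⟨l₃, l₄, h1, h2⟩ := mem_leftPairs.1 hx
        simp only at hp'
        have hv : v = ((p : ℕ), v.2) := Prod.ext hp' rfl
        have hl' : l = (l₃ ++ [u]) ++ ((p : ℕ), v.2) :: l₄ := by rw [h1, ← hv]; simp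
        obtain ⟨d3, d4⟩ := hD p _ _ _ hl'
        refine ⟨d4.2 ?_, ?_⟩
        · rw [lastRank_append, lastBit_append, ← hp']
          cases l₄ <;> exact h2
        · rw [(hL p _ _ _ hl').1]; simp
      · rintro ⟨h1, h2⟩
        rcases List.eq_nil_or_concat l₁ with rfl | ⟨l₁, u, rfl⟩
        · exact absurd k1 h2
        · rw [List.concat_eq_append] at d2 hl
          rw [lastRank_append, lastBit_append] at d2
          refine ⟨(u, ((p : ℕ), t)), mem_leftPairs.2 ⟨l₁, l₂, by rw [hl]; simp, ?_⟩, rfl⟩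
          have := d2.1 h1
          cases l₂ <;> exact this
    by_cases hx : ∃ x ∈ leftPairs c l, x.2.1 = p
    · obtain ⟨h11, h5⟩ := hcase.1 hx
      obtain ⟨⟨u, v⟩, hx, hp'⟩ := hx
      obtain ⟨l₃, l₄, h1, h2⟩ := mem_leftPairs.1 hx
      simp only at hp'
      have hv : v = ((p : ℕ), v.2) := Prod.ext hp' rfl
      have hl' : l = (l₃ ++ [u]) ++ ((p : ℕ), v.2) :: l₄ := by rw [h1, ← hv]; simp
      have main : ∀ hi nr link pr, Chain σ.mem M hi nr link pr [u, v] → (v.2.rank : ℕ∞) ≤ nr →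
          wp (leftArea σ.mem M base c l p) (leftArea σ.mem M base c l p) k p (leftPhase a b)
            (fun s => AfterJoin M hi nr link pr (base + p) u v p (σ.mem, σ.regs p)
              (joinEntries a b u v) s ∧ s.1 (M + u.1) 4 = σ.mem (M + u.1) 4)
            (σ.mem, σ.regs p) := fun hi' nr link pr hc hnr => by
        have pre := H.pair_pre E (u := u) (v := v) h1 hp' d1
          (W := leftArea σ.mem M base c l p) (fun w hw => ⟨(u, v), hx, hp', hw⟩) hc
        have h5' : σ.regs p 5 = u.1 + 1 := by rw [(hL p _ _ _ hl').1, leftLink_append]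
        have h6' : σ.regs p 6 = link := by
          have h1' : l = (l₃ ++ [u]) ++ v :: l₄ := by simp [h1]
          have hch := H.chain
          rw [h1'] at hch
          rw [(hL p _ _ _ hl').2, ← hch.link_eq]
          exact Chain.link_eq (l₁ := [u]) (l₂ := []) hc
        have := wp_joinRightP (k := k) ha hab pre (hside _ hx) hnr h5' h6'
        rw [leftPhase, wp_ite_pos h11, wp_ite_pos h5, ← hp']
        rwa [← hp'] at this
      -- Safety does not involve the surroundings of the pair, so one instance suffices for it,
      -- while the postcondition is needed for all surroundings.
      obtain ⟨hi0, nr0, link0, pr0, hc0, hnr0⟩ := hpair _ hx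
      refine ⟨(main _ _ _ _ hc0 hnr0).1, fun y hy hpy hi nr link pr hc hnr => ?_,
        fun h => absurd hp' (h _ hx)⟩
      obtain rfl : y = (u, v) := E.leftPairs_unique hy hx (hpy.trans hp'.symm)
      exact (main _ _ _ _ hc hnr).2
    · have hskip : wp (leftArea σ.mem M base c l p) (leftArea σ.mem M base c l p) k p (leftPhase a b)
          (fun s => s = (σ.mem, σ.regs p)) (σ.mem, σ.regs p) := by
        rw [hcase, not_and_or, not_not, not_not] at hx
        rw [leftPhase]
        by_cases h11 : σ.regs p 11 = 0
        · rw [wp_ite_neg h11, wp_skip]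
        · rw [wp_ite_pos h11, wp_ite_neg (hx.resolve_left h11), wp_skip]
      refine hskip.mono fun s hs => ⟨fun x hx' hp' => absurd ⟨x, hx', hp'⟩ hx, fun _ => by rw [hs]⟩)
  have hjoin : ∀ x ∈ leftPairs c l, ∃ p : Fin k, x.2.1 = p ∧ p ∈ team k l := fun x hx =>
    ⟨⟨x.2.1, E.lt _ (mem_of_leftPairs hx).2⟩, rfl,
      by simpa [team] using ⟨x.2.2, (mem_of_leftPairs hx).2⟩⟩
  obtain ⟨c1, c2, -⟩ := chain_leftJoins (μ' := σ'.mem) ha hab E.tree H.chain hn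
    (fun x hx hi nr link pr hc hnr => by
      obtain ⟨p, hp, hpt⟩ := hjoin x hx
      obtain ⟨μ, h1, h2, -⟩ := ho.post p hpt
      obtain ⟨h3, h4⟩ := h2 x hx hp hi nr link pr hc hnr
      have hmem : ∀ w ∈ area σ.mem M base x.1 + area σ.mem M base x.2, σ'.mem w = μ w :=
        fun w hw => h1 w ⟨x, hx, hp, hw⟩
      have hu : σ'.mem (M + x.1.1) = μ (M + x.1.1) := hmem _ (by simp [area])
      have hv : σ'.mem (M + x.2.1) = μ (M + x.2.1) := hmem _ (by simp [area])
      obtain ⟨i1, i2, -⟩ := h3.chain.frame (μ' := σ'.mem) (fun w hw => hmem w (by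
        have := Multiset.mem_of_le h3.total hw
        simp only [← hp, Multiset.mem_add, Multiset.mem_singleton] at this
        simp only [area, Multiset.mem_add, Multiset.mem_cons]
        tauto)) fun e he => by
          obtain ⟨⟨-, -, j3, -⟩, -⟩ := joinEntries_spec ha hab (E.tree _ (mem_of_leftPairs hx).1)
            (E.tree _ (mem_of_leftPairs hx).2) (hside x hx)
          have := j3.subset (List.mem_map_of_mem he)
          simp only [List.mem_cons, List.not_mem_nil, or_false] at this
          rcases this with h | h <;> rw [h] <;> assumption
      exact ⟨i1, by rw [i2, hp]; exact h3.total, by rw [hu]; exact h4⟩)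
    (fun e he w hw hx => ho.mem w fun p hp ⟨x, hx', hp', hw'⟩ => hx x hx' hw')
  rw [sum_singletons] at c2
  -- Besides old records, the trees can only contain the new records of right members of pairs; all
  -- of these lie between `base` and `base + k`.
  have hnew : ∀ w ∈ total σ'.mem M (leftJoins a b c l),
      w ∈ total σ.mem M l ∨ ∃ x ∈ leftPairs c l, base + x.2.1 = w := fun w hw =>
    (Multiset.mem_add.1 (Multiset.mem_of_le c2 hw)).imp_right fun h => by simpa using h
  obtain ⟨q1, q2⟩ := leftJoins_pids (c := c) ha hab E.tree E.nodup
  have hsub := (leftJoins_spec ha hab c l E.tree).2.2.1.subset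
  have hregs : ∀ p : Fin k, (∃ x ∈ leftPairs c l, x.2.1 = p ∧
      σ'.regs p 1 = (if (p : ℕ) ∈ (joinEntries a b x.1 x.2).map Prod.fst then 1 else 0) ∧
      ∀ i < 12, i ≠ 1 → σ'.regs p i = σ.regs p i) ∨
      (∀ x ∈ leftPairs c l, x.2.1 ≠ p) ∧ σ'.regs p = σ.regs p := fun p => by
    by_cases hx : ∃ x ∈ leftPairs c l, x.2.1 = p
    · obtain ⟨x, hx, hp⟩ := hx
      obtain ⟨q, hq, hqt⟩ := hjoin x hx
      obtain rfl : q = p := Fin.ext (hq.symm.trans hp)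
      obtain ⟨μ, -, h2, -⟩ := ho.post q hqt
      obtain ⟨hi, nr, link, pr, h3, h4⟩ := hpair x hx
      have h5 := (h2 x hx hp hi nr link pr h3 h4).1
      exact .inl ⟨x, hx, hp, h5.alive, h5.regs⟩
    · push Not at hx
      refine .inr ⟨hx, ?_⟩
      by_cases hp : p ∈ team k l
      · obtain ⟨μ, -, -, h⟩ := ho.post p hp
        exact h hx
      · exact ho.regs p hp
  refine ⟨σ', hr, ⟨c1, ?_, ?_, H.pos, by have := H.le_base; omega, fun p => ?_, fun p => ?_⟩,
    fun p i hi h1 => ?_, ho.draws, fun p hp => ⟨?_, fun hmem => ?_⟩⟩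
  · refine Multiset.nodup_of_le (c2.trans ?_) (Multiset.nodup_add.1 (area_sum σ.mem M base l ▸ hn)).2.1
    rw [add_comm, ← sum_singletons, ← sum_singletons]
    exact add_le_add_left ((List.sum_le_sum fun x _ => Multiset.le_add_left _ _).trans
      (leftPairs_le fun e => {base + e.1})) _
  · intro w hw
    have h0 := H.le_base
    rcases hnew w hw with h | ⟨x, hx, rfl⟩
    · have := H.range w h
      omega
    · have := E.lt _ (mem_of_leftPairs hx).2
      have := H.pos
      omega
  · rcases hregs p with ⟨x, hx, hp, h, -⟩ | ⟨hx, h⟩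
    · rw [h]
      simp only [← hp, q2 x hx]
    · rw [h, H.alive p]
      refine if_congr ⟨fun hm => ?_, fun hm => hsub hm⟩ rfl rfl
      obtain ⟨e, he, h⟩ := List.mem_map.1 hm
      exact h ▸ q1 e he fun x hx' => h ▸ hx x hx'
  · rcases hregs p with ⟨x, -, -, -, h⟩ | ⟨-, h⟩
    · rw [h 2 (by norm_num) (by norm_num), H.r2]
    · rw [h, H.r2]
  · rcases hregs p with ⟨x, -, -, -, h⟩ | ⟨-, h⟩
    · exact h i hi h1
    · rw [h]
  · exact ((hregs p).resolve_left fun ⟨x, hx, h, _⟩ => hp x hx h).2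
  · rcases hnew _ hmem with h | ⟨x, hx, h⟩
    · have := (H.range _ h).2.1
      omega
    · exact hp x hx (by omega)

end


-- The phase in which the first tree is joined to the second.

section

variable {a b k M hi base : ℕ} {l : List Entry} {σ : State k} {c : ℕ → Bool} {ω : ℕ → ℕ → Bool}

theorem exists_firstEntries (ha : 2 ≤ a) (hab : 2 * a ≤ b) {u v : Entry} (hu : IsABTree a b u.2)
    (hv : IsABTree a b v.2) (h : v.2.rank ≤ u.2.rank) : ∃ l u', firstEntries a b v u = l ++ [(u.1, u')] ∧
      u.2.rank ≤ u'.rank := by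
  obtain ⟨-, h2, -⟩ := joinToRight_spec ha hab hu hv h
  unfold firstEntries
  rcases hj : joinToRight a b v.2 u.2 with ⟨u', _ | v'⟩ <;> rw [hj] at h2
  · exact ⟨[], u', rfl, h2⟩
  · exact ⟨[(v.1, v')], u', rfl, h2⟩

/-- The first tree is joined to the second one if a rule applies to it. -/
def firstPhase (a b : ℕ) : Cmd := ite (rg 11) (ite (rg 5) skip (joinLeftP a b)) skip

theorem simple_firstPhase (a b : ℕ) : Simple (firstPhase a b) := by
  simp [firstPhase, joinLeftP, attachLeftP, raiseLeftP, vanishLeft, newPair, newRoot, Simple,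
    simple_combineP, simple_move]

theorem runs_firstPhase (ha : 2 ≤ a) (hab : 2 * a ≤ b) {u v : Entry} {rest : List Entry}
    (H : Holds M hi (base + k) (leftJoins a b c (u :: v :: rest)) σ)
    (E : Entries a b k (u :: v :: rest)) (hbase : M + k ≤ base)
    (hother : ∀ p ∈ team k (u :: v :: rest), (p : ℕ) ≠ u.1 → σ.regs p 5 ≠ 0)
    (hu : ∀ p : Fin k, (p : ℕ) = u.1 → σ.regs p 5 = 0 ∧ σ.regs p 6 = v.1 + 1 ∧
      (σ.regs p 11 ≠ 0 ↔ Joins ⊤ false u.2.rank (c u.1) v.2.rank) ∧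
      σ.regs p 24 = base + p ∧ base + p ∉ total σ.mem M (leftJoins a b c (u :: v :: rest))) :
    ∃ σ', Runs ω (firstPhase a b) (team k (u :: v :: rest)) σ σ' ∧
      Holds M hi (base + k) (iteration a b c (u :: v :: rest)) σ' ∧
      (∀ p i, i < 12 → i ≠ 1 → σ'.regs p i = σ.regs p i) ∧ σ'.draws = σ.draws := by
  obtain ⟨p₀, hp₀⟩ : ∃ p₀ : Fin k, (p₀ : ℕ) = u.1 := ⟨⟨u.1, E.lt u (by simp)⟩, rfl⟩
  obtain ⟨h5, h6, h11, h24, hz⟩ := hu p₀ hp₀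
  have hmem : p₀ ∈ team k (u :: v :: rest) := by simp [team, hp₀]
  by_cases hj : Joins ⊤ false u.2.rank (c u.1) v.2.rank
  swap
  · obtain ⟨σ', hr, hm, hd, hg', hg⟩ := runs_of_wp_reads (A := team k (u :: v :: rest)) (σ := σ) ω
      (simple_firstPhase a b) (Q := fun p s => s.2 = σ.regs p) fun p hp => by
        rw [firstPhase]
        by_cases h : σ.regs p 11 = 0
        · rw [wp_ite_neg h, wp_skip]
        · rw [wp_ite_pos h]
          by_cases hpu : (p : ℕ) = u.1
          · exact absurd ((hu p hpu).2.2.1.1 h) hj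
          · rw [wp_ite_pos (hother p hp hpu), wp_skip]
    have hg : ∀ p, σ'.regs p = σ.regs p := fun p =>
      (em (p ∈ team k (u :: v :: rest))).elim (hg p) (hg' p)
    rw [iteration_neg hj]
    exact ⟨σ', hr, ⟨hm ▸ H.chain, hm ▸ H.nodup, hm ▸ H.range, H.pos, H.le_base,
      fun p => by rw [hg, H.alive], fun p => by rw [hg, H.r2]⟩, fun p i _ _ => by rw [hg], hd⟩
  have hE := E.leftJoins ha hab c
  have hle0 : u.2.rank ≤ v.2.rank := by exact_mod_cast ((joins_iff _ _ _ _ _).1 hj).2.1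
  -- The second tree has stayed, under the same processor, but the third one may have been joined to
  -- it in the preceding phase.
  obtain ⟨v', r', hv', hrv⟩ := leftJoins_cons ha hab c (u := v) (rest := rest)
    fun e he => E.tree e (List.mem_cons_of_mem _ he)
  have hlist : leftJoins a b c (u :: v :: rest) = u :: (v.1, v') :: r' := by
    rw [leftJoins_skip hj.not_joins, hv']
  rw [iteration_pos hj, hv', firstJoin_eq]
  rw [hlist] at H hE hz
  have hle : u.2.rank ≤ v'.rank := hle0.trans hrv
  generalize hw : ((v.1, v') : Entry) = w at *
  have hw1 : v.1 = w.1 := by rw [← hw]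
  have hw2 : u.2.rank ≤ w.2.rank := by rw [← hw]; exact hle
  rw [hw1] at h6
  have huT := hE.tree u (by simp)
  have hwT := hE.tree w (by simp)
  obtain ⟨-, -, j3, -⟩ := firstEntries_spec ha hab hwT huT hw2
  obtain ⟨lf, w', jl, jr⟩ := exists_firstEntries ha hab hwT huT hw2
  -- The records that this join touches. The record `base + p₀` is still free, since new records
  -- have been used only by trees that were joined to the left.
  set B : Multiset ℕ := (M + u.1) ::ₘ (M + w.1) ::ₘ (base + p₀) ::ₘ (recs σ.mem M u + recs σ.mem M w) with hB
  have hc := H.chain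
  rw [show u :: w :: r' = [u, w] ++ r' from rfl, chain_append] at hc
  have hnd := H.nodup
  simp only [total, List.map_cons, List.sum_cons, ← add_assoc] at hnd hz
  have hrange : ∀ x ∈ recs σ.mem M u + recs σ.mem M w + total σ.mem M r',
      0 < x ∧ x < base + k ∧ (x < M ∨ M + k ≤ x) := fun x hx => H.range x (by
    simpa only [total, List.map_cons, List.sum_cons, ← add_assoc] using hx)
  have hul := hE.lt u (by simp)
  have hwl := hE.lt w (by simp)
  have hne : u.1 ≠ w.1 := by
    have := hE.nodup
    simp only [List.map_cons, List.nodup_cons, List.mem_cons, not_or] at this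
    exact this.1.1
  have hBn : B.Nodup := by
    have hr : ∀ x ∈ recs σ.mem M u + recs σ.mem M w, x < M ∨ M + k ≤ x := fun x hx =>
      (hrange x (Multiset.mem_add.2 (.inl hx))).2.2
    simp only [hB, Multiset.nodup_cons, Multiset.mem_cons, not_or]
    refine ⟨⟨by omega, by omega, fun h => ?_⟩, ⟨by omega, fun h => ?_⟩,
      fun h => hz (Multiset.mem_add.2 (.inl h)), (Multiset.nodup_add.1 hnd).1⟩
    · have := hr _ h; omega
    · have := hr _ h; omega
  have hBr : ∀ x ∈ B, ∀ e ∈ r', x ≠ M + e.1 := fun x hx e he => by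
    have h1 := hE.lt e (by simp [he])
    have h2 : u.1 ≠ e.1 ∧ w.1 ≠ e.1 := by
      have := hE.nodup
      simp only [List.map_cons, List.nodup_cons, List.mem_cons, List.mem_map, not_or, not_exists,
        not_and] at this
      exact ⟨Ne.symm (this.1.2 e he), Ne.symm (this.2.1 e he)⟩
    simp only [hB, Multiset.mem_cons] at hx
    rcases hx with rfl | rfl | rfl | hx
    · omega
    · omega
    · omega
    · have := (hrange x (Multiset.mem_add.2 (.inl hx))).2.2
      omega
  have hBt : ∀ x ∈ B, x ∉ total σ.mem M r' := fun x hx hx' => by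
    have h2 := (hrange x (Multiset.mem_add.2 (.inr hx'))).2.2
    simp only [hB, Multiset.mem_cons] at hx
    rcases hx with rfl | rfl | rfl | hx
    · omega
    · omega
    · exact hz (Multiset.mem_add.2 (.inr hx'))
    · exact Multiset.disjoint_left.1 (Multiset.nodup_add.1 hnd).2.2 hx hx'
  -- A single processor is at work here, so noninterference is trivial.
  let W : Fin k → Set ℕ := fun p => if p = p₀ then {x | x ∈ B} else ∅
  have hW : Apart W W := ⟨fun _ => subset_rfl, fun p q hpq x hx hx' => by
    simp only [W] at hx hx'
    split_ifs at hx hx' with h1 h2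
    exacts [hpq (h1.trans h2.symm), hx', hx, hx]⟩
  obtain ⟨σ', hr, ho⟩ := runs_of_wp (A := team k (u :: v :: rest)) (σ := σ) ω hW
    (simple_firstPhase a b) (Q := fun p s => if p = p₀ then
      AfterJoin M (sepOf σ.mem M hi r') (rankOf ⊤ r') (linkOf 0 r') ⊤ (base + p₀) u w p₀
        (σ.mem, σ.regs p₀) (firstEntries a b u w) s else s.2 = σ.regs p) fun p hp => by
      rw [firstPhase]
      by_cases hpp : p = p₀
      · subst hpp
        simp only [if_true, W]
        rw [wp_ite_pos (h11.2 hj), wp_ite_neg h5, hp₀]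
        have pre : JoinPre a b M (sepOf σ.mem M hi r') (rankOf ⊤ r') (linkOf 0 r') ⊤ (base + p) u w
            {x | x ∈ B} {x | x ∈ B} (σ.mem, σ.regs p) :=
          ⟨hc.1, huT, hwT, hBn, fun _ h => h, subset_rfl, by
            show σ.regs p 1 = 1
            rw [H.alive, hp₀]; simp, H.r2 p, h24⟩
        have := wp_joinLeftP (k := k) ha hab pre hw2 h6
        rwa [hp₀] at this
      · simp only [if_neg hpp]
        by_cases h : σ.regs p 11 = 0
        · rw [wp_ite_neg h, wp_skip]
        · rw [wp_ite_pos h, wp_ite_pos (hother p hp fun h => hpp (Fin.ext (h.trans hp₀.symm))), wp_skip]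
  obtain ⟨μ, hμ, hA⟩ := ho.post p₀ hmem
  rw [if_pos rfl] at hA
  have hμ : ∀ x ∈ B, σ'.mem x = μ x := fun x hx => hμ x (by simpa [W] using hx)
  have hkeep : ∀ x ∉ B, σ'.mem x = σ.mem x := fun x hx => ho.mem x fun p _ h => by
    simp only [W] at h
    split_ifs at h
    exacts [hx h, h]
  obtain ⟨i1, i2, i3⟩ := hA.chain.frame (μ' := σ'.mem) (fun x hx => hμ x (by
      have := Multiset.mem_of_le hA.total hx
      simp only [Multiset.mem_add, Multiset.mem_singleton] at this
      simp only [hB, Multiset.mem_cons, Multiset.mem_add]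
      tauto)) fun e he => hμ _ (by
        have := j3.subset (List.mem_map_of_mem he)
        simp only [List.mem_cons, List.not_mem_nil, or_false] at this
        rcases this with h | h <;> simp [hB, h])
  obtain ⟨k1, k2, k3⟩ := hc.2.frame (μ' := σ'.mem) (fun x hx => hkeep x fun h => hBt x h hx)
    fun e he => hkeep _ fun h => hBr _ h e he rfl
  have htot : total σ'.mem M (firstEntries a b u w ++ r') ≤
      (base + p₀) ::ₘ (recs σ.mem M u + recs σ.mem M w + total σ.mem M r') := by
    rw [← k2, ← Multiset.singleton_add]
    simp only [total, List.map_append, List.sum_append] at i2 ⊢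
    rw [i2]
    refine (add_le_add_left hA.total _).trans (le_of_eq ?_)
    abel
  have hregs : ∀ p, p ≠ p₀ → σ'.regs p = σ.regs p := fun p hp => by
    by_cases h : p ∈ team k (u :: v :: rest)
    · obtain ⟨μ, -, h⟩ := ho.post p h
      rwa [if_neg hp] at h
    · exact ho.regs p h
  have hregs' : ∀ p i, i < 12 → i ≠ 1 → σ'.regs p i = σ.regs p i := fun p i hi h1 => by
    by_cases hp : p = p₀
    · rw [hp]; exact hA.regs i hi h1
    · rw [hregs p hp]
  refine ⟨σ', hr, ⟨chain_append.2 ⟨k3 ▸ i1, k1.mono ?_⟩, Multiset.nodup_of_le htot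
    (Multiset.nodup_cons.2 ⟨hz, hnd⟩), fun x hx => ?_, H.pos, H.le_base, fun p => ?_, fun p => ?_⟩,
    hregs', ho.draws⟩
  · rw [jl, lastRank_append]
    simp only [lastRank]
    exact_mod_cast jr
  · have := H.pos
    rcases Multiset.mem_cons.1 (Multiset.mem_of_le htot hx) with rfl | hx
    · omega
    · exact hrange x hx
  · by_cases hp : p = p₀
    · subst hp
      refine hA.alive.trans ?_
      refine if_congr ?_ rfl rfl
      rw [List.map_append, List.mem_append]
      refine iff_self_or.2 fun h => ?_
      have := hE.nodup
      simp only [List.map_cons, List.nodup_cons, List.mem_cons, not_or] at this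
      exact absurd (hp₀ ▸ h) this.1.2
    · have hpu : (p : ℕ) ≠ u.1 := fun h => hp (Fin.ext (h.trans hp₀.symm))
      rw [hregs p hp, H.alive]
      refine if_congr ?_ rfl rfl
      have h2 : (p : ℕ) ∈ (firstEntries a b u w).map Prod.fst ↔ (p : ℕ) = w.1 := by
        constructor
        · intro h
          simpa [hpu] using j3.subset h
        · intro h
          rw [jl, h]; simp
      simp only [List.map_append, List.mem_append, h2, List.map_cons, List.mem_cons, hpu, false_or]
  · rw [hregs' p 2 (by norm_num) (by norm_num), H.r2]

end


/-! ### Links -/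

/-- The right links are read from memory, and the left links are found from them.  Register `0` is set
to a nonzero number if the tree has a neighbour. -/
def relinkP : Cmd :=
  seq (ite (rg 1) (seq (load 6 ownBlock (.const 3)) (store ownBlock (.const 2) (.const 0)))
    (assign 6 (.const 0))) <|
  seq (ite (rg 6) (store (rg 2 + (rg 6 - .const 1)) (.const 2) (.pid + .const 1)) skip) <|
  ite (rg 1) (seq (load 5 ownBlock (.const 2)) (assign 0 (rg 5 + rg 6))) (assign 0 (.const 0))

-- Recovering the left links.

section

variable {a b k M hi base : ℕ} {l : List Entry} {σ σ' : State k} {c : ℕ → Bool} {ω : ℕ → ℕ → Bool}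
  {A : Finset (Fin k)}

theorem Holds.alive_iff (H : Holds M hi base l σ) {p : Fin k} : σ.regs p 1 ≠ 0 ↔ p ∈ team k l := by
  rw [H.alive]
  simp [team]

theorem Holds.frame (H : Holds M hi base l σ)
    (hm : ∀ w, w < M ∨ M + k ≤ w → σ'.mem w = σ.mem w)
    (hb : ∀ e ∈ l, ∀ f, f ≠ 1 → f ≠ 2 → σ'.mem (M + e.1) f = σ.mem (M + e.1) f)
    (h1 : ∀ p, σ'.regs p 1 = σ.regs p 1) (h2 : ∀ p, σ'.regs p 2 = σ.regs p 2) :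
    Holds M hi base l σ' := by
  obtain ⟨i1, i2, -⟩ := H.chain.frame_fields (fun w hw => hm w (H.range w hw).2.2) hb
  exact ⟨i1, i2 ▸ H.nodup, i2 ▸ H.range, H.pos, H.le_base, fun p => by rw [h1, H.alive],
    fun p => by rw [h2, H.r2]⟩

theorem linkOf_ne_zero {l : List Entry} : linkOf 0 l ≠ 0 ↔ l ≠ [] := by
  cases l <;> simp [linkOf]

theorem leftLink_ne_zero {l : List Entry} : leftLink l ≠ 0 ↔ l ≠ [] := by
  rcases List.eq_nil_or_concat l with rfl | ⟨l, u, rfl⟩ <;> simp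

theorem apart_self {W : Fin k → Set ℕ} (h : ∀ p q w, w ∈ W p → w ∈ W q → p = q) : Apart W W :=
  ⟨fun _ => subset_rfl, fun p q hpq w hp hq => hpq (h p q w hp hq)⟩

/-- Every processor clears the cell for its left link and writes its number into that of its right
neighbour; these writes are exclusive because a tree has only one predecessor, and the first tree
keeps 0. `A` may contain processors that have just lost their trees: they end up with flag 0 and
leave the loop. -/
theorem runs_relinkP (H : Holds M hi base l σ) (E : Entries a b k l) (hA : team k l ⊆ A) :
    ∃ σ', Runs ω relinkP A σ σ' ∧ Holds M hi base l σ' ∧ Linked l σ' ∧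
      (∀ p ∈ A, σ'.regs p 0 ≠ 0 ↔ p ∈ team k l ∧ 2 ≤ l.length) ∧
      (∀ p ∉ A, σ'.regs p = σ.regs p) ∧
      (∀ p i, i ≠ 0 → i ≠ 5 → i ≠ 6 → σ'.regs p i = σ.regs p i) ∧ σ'.draws = σ.draws := by
  have hteam : ∀ {e : Entry}, e ∈ l → ∃ p ∈ team k l, (p : ℕ) = e.1 := fun {e} he =>
    ⟨⟨e.1, E.lt e he⟩, by simpa [team] using ⟨e.2, he⟩, rfl⟩
  have hblock : ∀ {e : Entry} {w}, e ∈ l → w < M ∨ M + k ≤ w → w ≠ M + e.1 := fun he hw => by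
    have := E.lt _ he
    omega
  obtain ⟨σ₁, hr₁, ho₁⟩ := runs_of_wp (A := A) (σ := σ) ω (R := fun p => {M + p}) (W := fun p => {M + p})
    (c := ite (rg 1) (seq (load 6 ownBlock (.const 3)) (store ownBlock (.const 2) (.const 0)))
      (assign 6 (.const 0)))
    (apart_self fun p q w hp hq => Fin.ext (Nat.add_left_cancel (hp.symm.trans hq))) (by simp [Simple])
    (Q := fun p s => s.2 = Function.update (σ.regs p) 6 (if p ∈ team k l then σ.mem (M + p) 3 else 0) ∧
      ∀ f, s.1 (M + p) f = if p ∈ team k l ∧ f = 2 then 0 else σ.mem (M + p) f) fun p _ => by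
      by_cases hp : p ∈ team k l
      · rw [wp_ite_pos (H.alive_iff.2 hp)]
        simp [H.r2, hp, put]
      · rw [wp_ite_neg (not_not.1 fun h => hp (H.alive_iff.1 h))]
        simp [hp]
  have hm₁ : ∀ {e : Entry}, e ∈ l → ∀ f, σ₁.mem (M + e.1) f = if f = 2 then 0 else σ.mem (M + e.1) f :=
    fun he f => by
      obtain ⟨p, hp, hpe⟩ := hteam he
      obtain ⟨μ, h1, -, h2⟩ := ho₁.post p (hA hp)
      rw [← hpe, h1 (M + p) rfl]
      simpa [hp] using h2 f
  have hg₁ : ∀ p i, i ≠ 6 → σ₁.regs p i = σ.regs p i := fun p i hi => by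
    by_cases hp : p ∈ A
    · obtain ⟨μ, -, h1, -⟩ := ho₁.post p hp
      exact (congrFun h1 i).trans (Function.update_of_ne hi _ _)
    · rw [ho₁.regs p hp]
  have h6₁ : ∀ p ∈ A, σ₁.regs p 6 = if p ∈ team k l then σ.mem (M + p) 3 else 0 := fun p hp => by
    obtain ⟨μ, -, h1, -⟩ := ho₁.post p hp
    exact (congrFun h1 6).trans (Function.update_self _ _ _)
  have h6 : ∀ {e : Entry} {l₁ l₂ : List Entry} {p : Fin k}, l = l₁ ++ e :: l₂ → (p : ℕ) = e.1 →
      σ₁.regs p 6 = linkOf 0 l₂ := fun {e l₁ l₂ p} hl hp => by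
    have ht : p ∈ team k l := mem_team.2 ⟨e.2, l₁, l₂, by rw [hl, hp]⟩
    have hch := H.chain
    rw [h6₁ p (hA ht), if_pos ht, hp]
    rw [hl] at hch
    exact hch.link_eq
  let W : Fin k → Set ℕ := fun p => {w | ∃ l₁ u v l₂, l = l₁ ++ u :: v :: l₂ ∧ u.1 = (p : ℕ) ∧ w = M + v.1}
  obtain ⟨σ₂, hr₂, ho₂⟩ := runs_of_wp (A := A) (σ := σ₁) ω (R := W) (W := W)
    (c := ite (rg 6) (store (rg 2 + (rg 6 - .const 1)) (.const 2) (.pid + .const 1)) skip)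
    (apart_self fun p q w ⟨l₁, u, v, l₂, h, hu, hw⟩ ⟨l₃, u', v', l₄, h', hu', hw'⟩ => Fin.ext (by
      rw [← hu, ← hu', E.pred_unique h h' (Nat.add_left_cancel (hw.symm.trans hw'))])) (by simp [Simple])
    (Q := fun p s => s.2 = σ₁.regs p ∧ ∀ l₁ u v l₂, l = l₁ ++ u :: v :: l₂ → u.1 = (p : ℕ) →
      ∀ f, s.1 (M + v.1) f = if f = 2 then u.1 + 1 else σ₁.mem (M + v.1) f) fun p hp => by
      by_cases hx : ∃ l₁ u v l₂, l = l₁ ++ u :: v :: l₂ ∧ u.1 = (p : ℕ)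
      · obtain ⟨l₁, u, v, l₂, hl, hu⟩ := hx
        have h6 := h6 hl hu.symm
        rw [linkOf] at h6
        rw [wp_ite_pos (by rw [h6]; omega)]
        simp only [wp_store, val_add, val_sub, val_reg, val_const, val_pid, h6, hg₁ p 2 (by norm_num),
          H.r2, Nat.add_sub_cancel, true_and]
        refine ⟨⟨l₁, u, v, l₂, hl, hu, rfl⟩, fun l₃ u' v' l₄ hl' hu' f => ?_⟩
        have hs := (E.split_unique hl hl' (hu.trans hu'.symm)).2.2
        rw [List.cons.injEq] at hs
        rw [hs.1, hu']
        simp [put]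
      · have h0 : σ₁.regs p 6 = 0 := by
          rw [h6₁ p hp]
          split_ifs with ht
          · obtain ⟨t, l₁, l₂, hl⟩ := mem_team.1 ht
            have := h6 hl rfl
            rw [h6₁ p hp, if_pos ht] at this
            rw [this]
            cases l₂ with
            | nil => rfl
            | cons v l₂ => exact absurd ⟨l₁, _, v, l₂, hl, rfl⟩ hx
          · rfl
        rw [wp_ite_neg h0, wp_skip]
        exact ⟨rfl, fun l₁ u v l₂ h h' => absurd ⟨l₁, u, v, l₂, h, h'⟩ hx⟩
  have hg₂ : ∀ p, σ₂.regs p = σ₁.regs p := fun p => by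
    by_cases hp : p ∈ A
    · exact (ho₂.post p hp).choose_spec.2.1
    · exact ho₂.regs p hp
  have hm₂ : ∀ {e : Entry} {l₁ l₂ : List Entry}, l = l₁ ++ e :: l₂ → ∀ f, σ₂.mem (M + e.1) f =
      if f = 2 then leftLink l₁ else σ.mem (M + e.1) f := fun {e l₁ l₂} hl f => by
    have he : e ∈ l := by simp [hl]
    rcases List.eq_nil_or_concat l₁ with rfl | ⟨l₁, u, rfl⟩
    · rw [ho₂.mem _ fun p _ ⟨l₃, u, v, l₄, h, _, hw⟩ => by
        simpa using (E.split_unique (l₃ := l₃ ++ [u]) hl (by simpa using h) (Nat.add_left_cancel hw)).1,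
        hm₁ he, leftLink_nil]
    · have hl' : l = l₁ ++ u :: e :: l₂ := by simpa using hl
      obtain ⟨p, hp, hpu⟩ := hteam (e := u) (by simp [hl'])
      obtain ⟨μ, h1, -, h2⟩ := ho₂.post p (hA hp)
      rw [h1 (M + e.1) ⟨_, _, _, _, hl', hpu.symm, rfl⟩]
      refine (h2 _ _ _ _ hl' hpu.symm f).trans ?_
      rw [hm₁ he, List.concat_eq_append, leftLink_append]
      split_ifs <;> rfl
  obtain ⟨σ₃, hr₃, hm₃, hd₃, hn₃, hg₃⟩ := runs_of_wp_reads (A := A) (σ := σ₂) ω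
    (c := ite (rg 1) (seq (load 5 ownBlock (.const 2)) (assign 0 (rg 5 + rg 6))) (assign 0 (.const 0)))
    (by simp [Simple])
    (Q := fun p s => (∀ i, i ≠ 0 → i ≠ 5 → s.2 i = σ₁.regs p i) ∧ (s.2 0 ≠ 0 ↔ p ∈ team k l ∧ 2 ≤ l.length) ∧
      ∀ t l₁ l₂, l = l₁ ++ ((p : ℕ), t) :: l₂ → s.2 5 = leftLink l₁) fun p _ => by
      by_cases hp : p ∈ team k l
      · rw [wp_ite_pos (by rw [hg₂, hg₁ p 1 (by norm_num)]; exact H.alive_iff.2 hp)]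
        obtain ⟨t, l₁, l₂, hl⟩ := mem_team.1 hp
        have h5 := hm₂ hl 2
        simp only [if_true] at h5
        simp only [wp_seq, wp_load, wp_assign, val_add, val_reg, val_const, val_pid, hg₂,
          hg₁ p 2 (by norm_num), H.r2, h5, Set.mem_univ, true_and, Function.update_self, hp]
        refine ⟨fun i h0 h5 => by rw [Function.update_of_ne h0, Function.update_of_ne h5], ?_,
          fun t' l₃ l₄ hl' => ?_⟩
        -- The sum of the links, which are shifted by one so that 0 means none, is nonzero exactly
        -- if there is another tree on some side.
        · rw [Function.update_of_ne (by norm_num), h6 hl rfl, ne_eq, Nat.add_eq_zero_iff,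
            not_and_or, ← ne_eq, ← ne_eq, leftLink_ne_zero, linkOf_ne_zero, hl, List.length_append,
            List.length_cons, ← List.length_pos_iff, ← List.length_pos_iff]
          omega
        · rw [Function.update_of_ne (by norm_num), Function.update_self,
            (E.split_unique hl hl' rfl).1]
      · rw [wp_ite_neg (by
          rw [hg₂, hg₁ p 1 (by norm_num)]; exact not_not.1 fun h => hp (H.alive_iff.1 h)), wp_assign]
        refine ⟨fun i h0 _ => (Function.update_of_ne h0 _ _).trans (congrFun (hg₂ p) i), by simp [hp], fun t l₁ l₂ hl => ?_⟩
        exact absurd (mem_team.2 ⟨t, l₁, l₂, hl⟩) hp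
  have hreg : ∀ p i, i ≠ 0 → i ≠ 5 → i ≠ 6 → σ₃.regs p i = σ.regs p i := fun p i h0 h5 h6 => by
    by_cases hp : p ∈ A
    · rw [← hg₁ p i h6]; exact (hg₃ p hp).1 i h0 h5
    · rw [hn₃ p hp, hg₂, hg₁ p i h6]
  refine ⟨σ₃, hr₁.seq (hr₂.seq hr₃), H.frame (fun w hw => ?_) (fun e he f _ h2 => ?_)
    (fun p => hreg p 1 (by norm_num) (by norm_num) (by norm_num))
    fun p => hreg p 2 (by norm_num) (by norm_num) (by norm_num), fun p t l₁ l₂ hl => ?_,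
    fun p hp => (hg₃ p hp).2.1, fun p hp => by rw [hn₃ p hp, hg₂, ho₁.regs p hp], hreg,
    by rw [hd₃, ho₂.draws, ho₁.draws]⟩
  · rw [hm₃, ho₂.mem w fun p _ ⟨l₁, u, v, l₂, hl, _, h⟩ => hblock (by simp [hl]) hw h,
      ho₁.mem w fun p _ h => by have := p.2; have h : w = M + p := h; omega]
  · obtain ⟨l₁, l₂, hl⟩ := List.append_of_mem he
    rw [hm₃, hm₂ hl, if_neg h2]
  · have hp := hA (mem_team.2 ⟨t, l₁, l₂, hl⟩)
    exact ⟨(hg₃ p hp).2.2 t l₁ l₂ hl, ((hg₃ p hp).1 6 (by norm_num) (by norm_num)).trans (h6 hl rfl)⟩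

end


/-! ### The loop -/

/-- An iteration of the lightweight parallel join. -/
def bodyP (a b : ℕ) : Cmd :=
  seq (seq (coin 4) (store ownBlock (.const 1) (rg 4))) <| seq lookP <| seq (leftPhase a b) <|
    seq (firstPhase a b) <| seq (assign 3 (rg 3 + .nprocs)) relinkP

/-- The state before iteration `i`, with the sequence `l` of trees. -/
structure Ready {k : ℕ} (M hi base i : ℕ) (l : List Entry) (σ : State k) : Prop where
  holds : Holds M hi base l σ
  linked : Linked l σ
  flag : ∀ p, σ.regs p 0 ≠ 0 ↔ p ∈ team k l ∧ 2 ≤ l.length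
  r3 : ∀ p ∈ team k l, σ.regs p 3 = base
  draws : ∀ p ∈ team k l, σ.draws p = i

-- One round of the main loop, and the loop itself.

section

variable {a b k M hi base i : ℕ} {l : List Entry} {σ σ' : State k} {c : ℕ → Bool}
  {ω : ℕ → ℕ → Bool} {A : Finset (Fin k)}

theorem runs_coin (x : ℕ) : Runs ω (coin x) A σ { σ.setReg A x (fun p => (ω (σ.draws p) p).toNat) with
    draws := fun p => if p ∈ A then σ.draws p + 1 else σ.draws p } :=
  ⟨1, A.card, .coin x A σ, le_rfl, by simp [cost]⟩

theorem team_iteration (ha : 2 ≤ a) (hab : 2 * a ≤ b) (E : Entries a b k l) :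
    team k (iteration a b c l) ⊆ team k l := fun p hp => by
  simp only [team, Finset.mem_filter, Finset.mem_univ, true_and] at hp ⊢
  exact (iteration_spec ha hab c l E.tree).2.2.1.subset hp

theorem Entries.iteration (ha : 2 ≤ a) (hab : 2 * a ≤ b) (E : Entries a b k l) (c : ℕ → Bool) :
    Entries a b k (iteration a b c l) := by
  obtain ⟨h1, -, h2, -⟩ := iteration_spec ha hab c l E.tree
  refine ⟨h1, h2.nodup E.nodup, fun e he => ?_⟩
  obtain ⟨f, hf, h⟩ := List.mem_map.1 (h2.subset (List.mem_map_of_mem he))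
  exact h ▸ E.lt f hf

/-- All trees draw and publish their random bits. -/
theorem runs_publish (R : Ready M hi base i l σ) (E : Entries a b k l) :
    ∃ σ', Runs ω (seq (coin 4) (store ownBlock (.const 1) (rg 4))) (team k l) σ σ' ∧
      Holds M hi base l σ' ∧ (∀ p ∈ team k l, σ'.regs p 4 = (ω i p).toNat) ∧
      (∀ p j, j ≠ 4 → σ'.regs p j = σ.regs p j) ∧ (∀ p ∉ team k l, σ'.regs p = σ.regs p) ∧
      (∀ p ∈ team k l, σ'.draws p = i + 1) ∧ ∀ e ∈ l, Shown σ'.mem M (ω i) e := by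
  have hc := runs_coin (σ := σ) (A := team k l) (ω := ω) 4
  set σ₁ : State k := { σ.setReg (team k l) 4 (fun p => (ω (σ.draws p) p).toNat) with
    draws := fun p => if p ∈ team k l then σ.draws p + 1 else σ.draws p } with hσ₁
  have hm₁ : σ₁.mem = σ.mem := rfl
  have hr₁ : ∀ p j, σ₁.regs p j = if p ∈ team k l ∧ j = 4 then (ω (σ.draws p) p).toNat else σ.regs p j :=
    fun _ _ => rfl
  have hg₁ : ∀ p j, j ≠ 4 → σ₁.regs p j = σ.regs p j := fun p j hj => by simp [hr₁, hj]
  have h4 : ∀ p ∈ team k l, σ₁.regs p 4 = (ω i p).toNat := fun p hp => by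
    rw [hr₁, if_pos ⟨hp, rfl⟩, R.draws p hp]
  obtain ⟨σ₂, hr₂, ho⟩ := runs_of_wp (A := team k l) (σ := σ₁) ω (R := fun p => {M + p})
    (W := fun p => {M + p}) (c := store ownBlock (.const 1) (rg 4))
    (apart_self fun p q w hp hq => Fin.ext (Nat.add_left_cancel (hp.symm.trans hq))) (by simp [Simple])
    (Q := fun p s => s.2 = σ₁.regs p ∧
      ∀ f, s.1 (M + p) f = if f = 1 then (ω i p).toNat else σ.mem (M + p) f) fun p hp => by
      simp [hg₁ p 2 (by norm_num), R.holds.r2, h4 p hp, put, hm₁]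
  have hg₂ : ∀ p, σ₂.regs p = σ₁.regs p := fun p => by
    by_cases hp : p ∈ team k l
    · exact (ho.post p hp).choose_spec.2.1
    · exact ho.regs p hp
  have hm₂ : ∀ e ∈ l, ∀ f, σ₂.mem (M + e.1) f = if f = 1 then (ω i e.1).toNat else σ.mem (M + e.1) f :=
    fun e he f => by
      obtain ⟨μ, h1, -, h2⟩ := ho.post ⟨e.1, E.lt e he⟩ (by simpa [team] using ⟨e.2, he⟩)
      rw [h1 (M + e.1) rfl]
      exact h2 f
  refine ⟨σ₂, hc.seq hr₂, R.holds.frame (fun w hw => ?_) (fun e he f h1 _ => ?_)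
    (fun p => by rw [hg₂, hg₁ p 1 (by norm_num)]) (fun p => by rw [hg₂, hg₁ p 2 (by norm_num)]),
    fun p hp => by rw [hg₂, h4 p hp], fun p j hj => by rw [hg₂, hg₁ p j hj], fun p hp => ?_,
    fun p hp => ?_, fun e he => ⟨?_, ?_⟩⟩
  · rw [ho.mem w fun p _ h => by have := p.2; have h : w = M + p := h; omega, hm₁]
  · rw [hm₂ e he, if_neg h1]
  · rw [hg₂]; funext j; simp [hr₁, hp]
  · rw [ho.draws, hσ₁]; simp [hp, R.draws p hp]
  · obtain ⟨l₁, l₂, hl⟩ := List.append_of_mem he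
    have hc := R.holds.chain
    rw [hl, chain_append] at hc
    obtain ⟨⟨h, v, h1, h2⟩, -⟩ := hc.2
    rw [hm₂ e he, if_neg (by norm_num), h2.rank, h1, h2.ord.rank_eq]
  · rw [hm₂ e he, if_pos rfl]

theorem runs_bodyP (ha : 2 ≤ a) (hab : 2 * a ≤ b) (R : Ready M hi base i l σ) (E : Entries a b k l)
    (h2 : 2 ≤ l.length) : ∃ σ', Runs ω (bodyP a b) (team k l) σ σ' ∧
      Ready M hi (base + k) (i + 1) (iteration a b (ω i) l) σ' := by
  obtain ⟨σ₂, hr₂, H₂, h4, hg₂, hn₂, hd₂, hs⟩ := runs_publish (ω := ω) R E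
  obtain ⟨σ₃, hr₃, hm₃, hd₃, hn₃, hq₃⟩ := runs_of_wp_reads (A := team k l) (σ := σ₂) ω (c := lookP)
    (by simp [lookP, lookLeftP, lookRightP, decideP, Simple])
    (Q := fun p s => (∀ j < 7, s.2 j = σ₂.regs p j) ∧ ∀ t l₁ l₂, l = l₁ ++ ((p : ℕ), t) :: l₂ →
      s.2 24 = base + p ∧ (s.2 11 ≠ 0 ↔
        Joins (lastRank ⊤ l₁) (lastBit (ω i) l₁) t.rank (ω i p) (rankOf ⊤ l₂))) fun p hp => by
      obtain ⟨t, l₁, l₂, hl⟩ := mem_team.1 hp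
      obtain ⟨hk5, hk6⟩ := R.linked p t l₁ l₂ hl
      refine (wp_lookP (k := k) (p := p) (M := M) (base := base) (l₁ := l₁) (l₂ := l₂) (t := t)
        (fun e he => hs e (hl ▸ he)) (H₂.r2 p) ?_ (h4 p hp) ?_ ?_).mono fun s hs => ⟨hs.1,
          fun t' l₃ l₄ hl' => ?_⟩
      · rw [hg₂ p 3 (by norm_num), R.r3 p hp]
      · rw [hg₂ p 5 (by norm_num), hk5]
      · rw [hg₂ p 6 (by norm_num), hk6]
      · obtain ⟨rfl, h, rfl⟩ := E.split_unique hl hl' rfl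
        rw [Prod.mk.injEq] at h
        exact h.2 ▸ hs.2
  have hg₃ : ∀ p j, j < 7 → j ≠ 4 → σ₃.regs p j = σ.regs p j := fun p j hj h4 => by
    by_cases hp : p ∈ team k l
    · rw [← hg₂ p j h4]; exact (hq₃ p hp).1 j hj
    · rw [hn₃ p hp, hg₂ p j h4]
  have H₃ : Holds M hi base l σ₃ := H₂.frame (fun w _ => by rw [hm₃]) (fun e _ f _ _ => by rw [hm₃])
    (fun p => by rw [hg₃ p 1 (by norm_num) (by norm_num), hg₂ p 1 (by norm_num)])
    fun p => by rw [hg₃ p 2 (by norm_num) (by norm_num), hg₂ p 2 (by norm_num)]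
  have hL₃ : Linked l σ₃ := fun p t l₁ l₂ hl => by
    rw [hg₃ p 5 (by norm_num) (by norm_num), hg₃ p 6 (by norm_num) (by norm_num)]
    exact R.linked p t l₁ l₂ hl
  have hD₃ : Decided base (ω i) l σ₃ := fun p t l₁ l₂ hl =>
    (hq₃ p (mem_team.2 ⟨t, l₁, l₂, hl⟩)).2 t l₁ l₂ hl
  obtain ⟨σ₄, hr₄, H₄, hg₄, hd₄, hf₄⟩ := runs_leftPhase (ω := ω) ha hab H₃ E hL₃ hD₃
  have hfirst : ∃ σ₅, Runs ω (firstPhase a b) (team k l) σ₄ σ₅ ∧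
      Holds M hi (base + k) (iteration a b (ω i) l) σ₅ ∧
      (∀ p i, i < 12 → i ≠ 1 → σ₅.regs p i = σ₄.regs p i) ∧ σ₅.draws = σ₄.draws := by
      obtain ⟨u, v, rest, rfl⟩ : ∃ u v rest, l = u :: v :: rest := by
        match l, h2 with
        | u :: v :: rest, _ => exact ⟨u, v, rest, rfl⟩
      -- The first tree has no left neighbour, so its processor is idle in the left phase and its
      -- new record is still available.
      have hu : ∀ p : Fin k, (p : ℕ) = u.1 → ∀ x ∈ leftPairs (ω i) (u :: v :: rest), x.2.1 ≠ p :=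
        fun p hp x hx h => by
          obtain ⟨l₁, l₂, h1, -⟩ := mem_leftPairs.1 hx
          have := (E.split_unique (l₁ := []) (l₃ := l₁ ++ [x.1]) rfl (by simpa using h1)
            (hp.symm.trans h.symm)).1
          simp at this
      refine runs_firstPhase ha hab H₄ E H₃.le_base (fun p hp hpu => ?_) fun p hp => ?_
      · obtain ⟨t, l₁, l₂, hl⟩ := mem_team.1 hp
        rw [hg₄ p 5 (by norm_num) (by norm_num), (hL₃ p t l₁ l₂ hl).1, leftLink_ne_zero]
        rintro rfl
        rw [List.nil_append, List.cons.injEq] at hl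
        exact hpu (by rw [hl.1])
      · have hl : u :: v :: rest = [] ++ ((p : ℕ), u.2) :: v :: rest := by rw [hp]; rfl
        obtain ⟨d1, d2⟩ := hD₃ p _ _ _ hl
        obtain ⟨f1, f2⟩ := hf₄ p (hu p hp)
        rw [f1]
        refine ⟨(hL₃ p _ _ _ hl).1, (hL₃ p _ _ _ hl).2, ?_, d1, f2⟩
        rw [← hp]; exact d2
  obtain ⟨σ₅, hr₅, H₅, hg₅, hd₅⟩ := hfirst
  obtain ⟨σ₆, hr₆, hm₆, hd₆, hn₆, hq₆⟩ := runs_of_wp_reads (A := team k l) (σ := σ₅) ω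
    (c := assign 3 (rg 3 + .nprocs)) (by simp [Simple])
    (Q := fun p s => s.2 = Function.update (σ₅.regs p) 3 (σ₅.regs p 3 + k)) fun p _ => by simp
  have hg₆ : ∀ p j, j ≠ 3 → σ₆.regs p j = σ₅.regs p j := fun p j hj => by
    by_cases hp : p ∈ team k l
    · exact (congrFun (hq₆ p hp) j).trans (Function.update_of_ne hj _ _)
    · rw [hn₆ p hp]
  have H₆ : Holds M hi (base + k) (iteration a b (ω i) l) σ₆ :=
    H₅.frame (fun w _ => by rw [hm₆]) (fun e _ f _ _ => by rw [hm₆])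
      (fun p => hg₆ p 1 (by norm_num)) fun p => hg₆ p 2 (by norm_num)
  have hsub := team_iteration (c := ω i) ha hab E
  obtain ⟨σ₇, hr₇, H₇, hL₇, hf₇, hn₇, hg₇, hd₇⟩ := runs_relinkP (ω := ω) H₆ (E.iteration ha hab (ω i)) hsub
  refine ⟨σ₇, hr₂.seq (hr₃.seq (hr₄.seq (hr₅.seq (hr₆.seq hr₇)))),
    H₇, hL₇, fun p => ?_, fun p hp => ?_, fun p hp => ?_⟩
  · by_cases hp : p ∈ team k l
    · exact hf₇ p hp
    · refine iff_of_false (fun h => ?_) fun h => hp (hsub h.1)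
      rw [hn₇ p hp, hn₆ p hp, hg₅ p 0 (by norm_num) (by norm_num), hg₄ p 0 (by norm_num) (by norm_num),
        hg₃ p 0 (by norm_num) (by norm_num)] at h
      exact hp ((R.flag p).1 h).1
  · have h3 := hq₆ p (hsub hp)
    rw [hg₇ p 3 (by norm_num) (by norm_num) (by norm_num)]
    refine (congrFun h3 3).trans ?_
    rw [Function.update_self, hg₅ p 3 (by norm_num) (by norm_num), hg₄ p 3 (by norm_num) (by norm_num),
      hg₃ p 3 (by norm_num) (by norm_num), R.r3 p (hsub hp)]
  · rw [hd₇, hd₆, hd₅, hd₄, hd₃, hd₂ p (hsub hp)]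

theorem card_team_le (l : List Entry) : (team k l).card ≤ l.length := by
  have h : (team k l).image Fin.val ⊆ (l.map Prod.fst).toFinset := fun p hp => by
    obtain ⟨q, hq, rfl⟩ := Finset.mem_image.1 hp
    simpa [team] using hq
  calc (team k l).card = ((team k l).image Fin.val).card :=
        (Finset.card_image_of_injective _ Fin.val_injective).symm
    _ ≤ _ := Finset.card_le_card h
    _ ≤ (l.map Prod.fst).length := List.toFinset_card_le _
    _ = l.length := List.length_map _

/-- In each round exactly the processors with a tree are active, so the work is governed by the sum
of the numbers of trees. The bits drawn in round i are those of iteration i because each tree draws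
exactly one per round. -/
theorem exec_mainLoop (ha : 2 ≤ a) (hab : 2 * a ≤ b) {L : ℕ → List Entry}
    (hL : ∀ i, L (i + 1) = iteration a b (ω i) (L i)) {N : ℕ} (hA : team k (L i) ⊆ A)
    (R : Ready M hi base i (L i) σ) (E : Entries a b k (L i)) (hN : ∀ j < N, 2 ≤ (L (i + j)).length)
    (hend : (L (i + N)).length ≤ 1) :
    ∃ σ' t w base', Exec ω (loop (rg 0) (bodyP a b)) A σ σ' t w ∧
      Ready M hi base' (i + N) (L (i + N)) σ' ∧ t ≤ N * (cost (bodyP a b) + 1) + 1 + Nat.clog 2 k ∧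
      w ≤ A.card + (cost (bodyP a b) + 1) * ∑ j ∈ Finset.range N, (L (i + j)).length := by
  induction N generalizing i A base σ with
  | zero =>
    refine ⟨σ, _, _, base, .loopExit _ _ A σ fun p _ => ?_, R, by omega, by simp⟩
    by_contra h
    have := ((R.flag p).1 h).2
    rw [Nat.add_zero] at hend
    omega
  | succ N ih =>
    have h2 := hN 0 (by omega)
    rw [Nat.add_zero] at h2
    obtain ⟨σ₁, ⟨t₁, w₁, e₁, ht₁, hw₁⟩, R₁⟩ := runs_bodyP (ω := ω) ha hab R E h2
    have hfil : (A.filter fun p => (rg 0).eval σ p ≠ 0) = team k (L i) := by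
      ext p
      rw [Finset.mem_filter]
      exact ⟨fun h => ((R.flag p).1 h.2).1, fun h => ⟨hA h, (R.flag p).2 ⟨h, h2⟩⟩⟩
    have hi : ∀ j, L (i + 1 + j) = L (i + (j + 1)) := fun j => by congr 1; omega
    rw [← hL] at R₁
    obtain ⟨σ', t, w, base', e, R', ht, hw⟩ := ih (A := team k (L i)) (i := i + 1)
      (by rw [hL]; exact team_iteration ha hab E) R₁ (by rw [hL]; exact E.iteration ha hab _)
      (fun j hj => by rw [hi]; exact hN (j + 1) (by omega)) (by rw [hi]; exact hend)
    have hc := card_team_le (k := k) (L i)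
    have hne : ∃ p ∈ A, (rg 0).eval σ p ≠ 0 := by
      match hl : L i, h2 with
      | u :: r, _ =>
        have : (⟨u.1, E.lt u (by simp [hl])⟩ : Fin k) ∈ team k (L i) := by simp [team, hl]
        exact ⟨_, hA this, (R.flag _).2 ⟨this, h2⟩⟩
    refine ⟨σ', _, _, base', .loopStep _ _ A σ σ₁ σ' _ _ _ _ hne (hfil ▸ e₁) (hfil ▸ e), ?_, ?_, ?_⟩
    · rw [hi] at R'
      rwa [show i + 1 + N = i + (N + 1) by omega] at R'
    · rw [add_mul]; omega
    · rw [Finset.sum_range_succ']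
      simp only [hi] at hw
      simp only [Nat.add_zero]
      rw [mul_add]
      -- The next evaluation of the loop condition, made by the same processors, is charged to this
      -- round; hence the additional 1.
      have : w₁ + (team k (L i)).card ≤ (cost (bodyP a b) + 1) * (L i).length :=
        (by rw [add_mul, one_mul]; omega : _ ≤ (cost (bodyP a b) + 1) * (team k (L i)).card).trans
          (Nat.mul_le_mul_left _ hc)
      omega

end


/-! ### Input and output -/

-- Stored search trees and their description by height and records.

section

variable {a b : ℕ} {μ : ℕ → ℕ → ℕ} {r v lo hi : ℕ} {t : LTree} {fp : List ℕ}

theorem coe_flatten (L : List (List ℕ)) :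
    (L.flatten : Multiset ℕ) = (L.map Multiset.ofList).sum := by
  induction L with
  | nil => rfl
  | cons l L ih => rw [List.flatten_cons, ← Multiset.coe_add, ih, List.map_cons, List.sum_cons]

theorem coe_flatten_ofFn {n : ℕ} (f : Fin n → List ℕ) :
    ((List.ofFn f).flatten : Multiset ℕ) = ∑ j, (f j : Multiset ℕ) := by
  rw [coe_flatten, List.map_ofFn, List.sum_ofFn]; rfl

/-- What the memory contains if it holds a tree of height `r`. -/
structure InMemory (μ : ℕ → ℕ → ℕ) (r v : ℕ) (t : LTree) (fp : List ℕ) : Prop where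
  tree : t = treeAt μ r v
  recs : (fp : Multiset ℕ) = recsAt μ r v
  ord : ∀ lo hi, (∀ x ∈ t.leaves, lo ≤ x ∧ x ≤ hi) → Ordered μ r v lo hi

/-- The values below a child lie between the keys next to it, or between the outer bounds at the two
ends. The degree plays no role, so the argument serves both for inner subtrees and for the root. -/
theorem Stored.inMemory_node {cs : List LTree} (h : Stored μ v (LTree.node cs) fp)
    (hcs : ∀ c ∈ cs, ∀ v fp, Stored μ v c fp → InMemory μ r v c fp) :
    InMemory μ (r + 1) v (LTree.node cs) fp := by
  cases h with
  | node _ _ fps hpos hdeg hchild hkey =>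
    have ih := fun j => hcs _ (List.get_mem cs j) _ _ (hchild j)
    refine ⟨?_, ?_, fun lo hi hb => ⟨by omega, fun j hj => ?_⟩⟩
    · rw [treeAt, LTree.node.injEq]
      refine List.ext_getElem (by simp [hdeg]) fun j h1 h2 => ?_
      simpa using (ih ⟨j, h1⟩).tree
    · rw [recsAt, hdeg, Finset.sum_range, ← Multiset.cons_coe, coe_flatten_ofFn]
      congr 1
      exact Finset.sum_congr rfl fun j _ => (ih j).recs
    · rw [hdeg] at hj
      refine (ih ⟨j, hj⟩).ord _ _ fun x hx => ?_
      have hx' := hb x (by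
        rw [leaves, leavesList_eq_flatMap]
        exact List.mem_flatMap.2 ⟨_, List.get_mem cs ⟨j, hj⟩, hx⟩)
      simp only [bnd, hdeg]
      constructor
      · split_ifs with h0 h1
        · exact hx'.1
        · omega
        · obtain ⟨i, rfl⟩ := Nat.exists_eq_succ_of_ne_zero h0
          exact (hkey ⟨i, by omega⟩ ⟨i + 1, hj⟩ rfl).2 x hx
      · rw [if_neg (Nat.succ_ne_zero j)]
        split_ifs with h1
        · exact hx'.2
        · exact (hkey ⟨j, hj⟩ ⟨j + 1, by omega⟩ rfl).1 x hx

theorem IsSubtree.inMemory (ht : IsSubtree a b (r + 1) t) (h : Stored μ v t fp) :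
    InMemory μ r v t fp := by
  induction r generalizing v t fp with
  | zero =>
    cases ht with
    | leaf x =>
      cases h with
      | leaf _ hdeg => exact ⟨rfl, rfl, fun lo hi hb => ⟨hdeg, hb _ (by simp [leaves])⟩⟩
    | node _ cs hlo hhi hcs =>
      cases h with
      | node _ _ fps hpos => exact nomatch hcs _ (List.get_mem cs ⟨0, hpos⟩)
  | succ r ih =>
    cases ht with
    | node _ cs hlo hhi hcs => exact h.inMemory_node fun c hc v fp hs => ih (hcs c hc) hs

theorem IsABTree.inMemory (ha : 2 ≤ a) (ht : IsABTree a b t) (h : Stored μ v t fp) :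
    InMemory μ (t.rank - 1) v t fp := by
  obtain ⟨r, h0, h1, -⟩ := ht.inner
  rw [h1.rank_eq ha (by simp)]
  obtain ⟨cs, rfl, -, -, hcs⟩ := h1
  obtain ⟨r, rfl⟩ := Nat.exists_eq_succ_of_ne_zero h0.ne'
  exact h.inMemory_node fun c hc v fp hs => (hcs c hc).inMemory hs

theorem Ordered.le (h : Ordered μ r v lo hi) : lo ≤ hi := by
  induction r generalizing v lo hi with
  | zero => exact h.2.1.trans h.2.2
  | succ r ih =>
    have : ∀ j ≤ μ v 0, lo ≤ bnd (μ v 0) (μ v) lo hi j := fun j => by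
      induction j with
      | zero => exact fun _ => by simp [bnd]
      | succ j ihj => exact fun hj => (ihj (by omega)).trans (ih (h.2 j (by omega)))
    simpa [bnd, h.1.ne'] using this _ le_rfl

theorem Ordered.bnd_mem (h : Ordered μ (r + 1) v lo hi) {j : ℕ} (hj : j ≤ μ v 0) :
    lo ≤ bnd (μ v 0) (μ v) lo hi j ∧ bnd (μ v 0) (μ v) lo hi j ≤ hi := by
  have hm : ∀ i j, i ≤ j → j ≤ μ v 0 → bnd (μ v 0) (μ v) lo hi i ≤ bnd (μ v 0) (μ v) lo hi j :=
    fun i j hij => Nat.le_induction (fun _ => le_rfl)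
      (fun j _ ih hj => (ih (by omega)).trans (h.2 j (by omega)).le) j hij
  constructor
  · simpa [bnd] using hm 0 j (by omega) hj
  · simpa [bnd, h.1.ne'] using hm j _ hj le_rfl

/-- The way back to the output format. The bounds of the intervals are monotone from left to right,
so the values below each child stay within the bounds of the whole tree. -/
theorem Ordered.stored (h : Ordered μ r v lo hi) : ∃ fp, Stored μ v (treeAt μ r v) fp ∧
    (fp : Multiset ℕ) = recsAt μ r v ∧ ∀ x ∈ (treeAt μ r v).leaves, lo ≤ x ∧ x ≤ hi := by
  induction r generalizing v lo hi with
  | zero => exact ⟨[v], .leaf v h.1, rfl, fun x hx => by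
      simp only [treeAt, leaves, List.mem_singleton] at hx; exact hx ▸ h.2⟩
  | succ r ih =>
    choose! fps h1 h2 h3 using fun j hj => ih (h.2 j hj)
    have hlen : (kids μ r (μ v 0) (μ v)).length = μ v 0 := length_kids _ _
    have hget : ∀ j : Fin (kids μ r (μ v 0) (μ v)).length,
        (kids μ r (μ v 0) (μ v)).get j = treeAt μ r (μ v (2 * j + 1)) := fun j => by
      rw [List.get_eq_getElem]
      simp only [kids, List.getElem_map, List.getElem_range]
    have hlt : ∀ j : Fin (kids μ r (μ v 0) (μ v)).length, (j : ℕ) < μ v 0 := fun j =>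
      j.2.trans_eq hlen
    rw [treeAt_succ]
    refine ⟨_, .node v _ (fun j => fps j) (by rw [hlen]; exact h.1) hlen.symm
      (fun j => by rw [hget]; exact h1 j (hlt j)) fun i j hij => ?_, ?_, fun x hx => ?_⟩
    · have hj := hlt j
      rw [hget, hget, hij]
      refine ⟨fun x hx => ?_, fun y hy => ?_⟩
      · have := (h3 i (hlt i) x hx).2
        rwa [bnd, if_neg (by omega), if_neg (by omega)] at this
      · have := (h3 (i + 1) (by omega) y hy).1
        rwa [bnd, if_neg (by omega), if_neg (by omega)] at this
    · rw [← Multiset.cons_coe, coe_flatten_ofFn, recsAt, Finset.sum_range]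
      congr 1
      refine Fintype.sum_equiv (finCongr hlen) _ _ fun j => ?_
      exact h2 j (hlt j)
    · rw [leaves, leavesList_eq_flatMap] at hx
      obtain ⟨c, hc, hx⟩ := List.mem_flatMap.1 hx
      obtain ⟨j, hj, rfl⟩ := List.mem_map.1 hc
      have hj := List.mem_range.1 hj
      obtain ⟨h4, h5⟩ := h3 j hj x hx
      exact ⟨(h.bnd_mem hj.le).1.trans h4, h5.trans (h.bnd_mem hj).2⟩

theorem Ordered.lsp {d : ℕ} (h : Ordered μ (r + d) v lo hi) :
    ∃ lo' hi', Ordered μ r (lsp μ v d) lo' hi' := by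
  induction d generalizing v lo hi with
  | zero => exact ⟨lo, hi, h⟩
  | succ d ih =>
    rw [lsp_succ']
    exact ih (h.2 0 h.1)

/-- Degree 0 marks the leaves, and on the left spine a leaf is reached only at full depth; this ends
the walk that determines the rank. -/
theorem Ordered.degree_lsp {d : ℕ} (h : Ordered μ r v lo hi) (hd : d ≤ r) :
    μ (LightJoin.lsp μ v d) 0 = 0 ↔ d = r := by
  obtain ⟨s, rfl⟩ := Nat.exists_eq_add_of_le' hd
  obtain ⟨lo', hi', h⟩ := h.lsp
  cases s with
  | zero => simpa using h.1
  | succ s => exact iff_of_false h.1.ne' (by omega)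

theorem Ordered.leaves_eq (h : Ordered μ r v lo hi) :
    ∃ l, (treeAt μ r v).leaves = μ (LightJoin.lsp μ v r) 1 :: l := by
  induction r generalizing v lo hi with
  | zero => exact ⟨[], rfl⟩
  | succ r ih =>
    obtain ⟨l, hl⟩ := ih (h.2 0 h.1)
    obtain ⟨n, hn⟩ := Nat.exists_eq_succ_of_ne_zero h.1.ne'
    simp only [treeAt, hn, Nat.succ_eq_add_one, List.range_succ_eq_map, List.map_cons, leaves,
      leavesList]
    rw [hl, lsp_succ']
    exact ⟨_, rfl⟩

end


/-! ### Processors that write into their own blocks only -/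

/-- The memory below record `M` is that of `μ`, and `B` holds of the blocks and the registers of the
processors. -/
def Local {k : ℕ} (μ : ℕ → ℕ → ℕ) (M : ℕ) (B : Fin k → (ℕ → ℕ) → (ℕ → ℕ) → Prop) (σ : State k) : Prop :=
  (∀ w < M, σ.mem w = μ w) ∧ ∀ p, B p (σ.mem (M + p)) (σ.regs p)

/-- Preconditions of programs that write into the block of processor `p` only. -/
abbrev wpOwn (M k p : ℕ) (c : Cmd) (Q : (ℕ → ℕ) → (ℕ → ℕ) → Prop) (s : Loc) : Prop :=
  wp {w | w < M ∨ w = M + p} {M + p} k p c (fun s => Q (s.1 (M + p)) s.2) s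

section

variable {k M : ℕ} {μ : ℕ → ℕ → ℕ} {σ : State k} {ω : ℕ → ℕ → Bool} {e : Expr} {c : Cmd}
  {B B' : Fin k → (ℕ → ℕ) → (ℕ → ℕ) → Prop}

theorem apart_own : Apart (fun p : Fin k => {w | w < M ∨ w = M + p}) fun p => {M + (p : ℕ)} := by
  refine ⟨fun p w hw => .inr hw, fun p q hpq w hw hw' => ?_⟩
  have := Fin.val_ne_of_ne hpq
  simp only [Set.mem_ofPred_eq, Set.mem_singleton_iff] at hw hw'
  omega

theorem runs_local (hs : Simple c) (h : ∀ p μ' ρ, (∀ w < M, μ' w = μ w) → B p (μ' (M + p)) ρ →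
    wpOwn M k p c (B' p) (μ', ρ)) (hσ : Local μ M B σ) :
    ∃ σ', Runs ω c Finset.univ σ σ' ∧ Local μ M B' σ' ∧ σ'.draws = σ.draws := by
  obtain ⟨σ', hr, ho⟩ := runs_of_wp (A := Finset.univ) (σ := σ) ω apart_own hs
    (Q := fun p s => B' p (s.1 (M + p)) s.2) fun p _ => h p _ _ hσ.1 (hσ.2 p)
  refine ⟨σ', hr, ⟨fun w hw => ?_, fun p => ?_⟩, ho.draws⟩
  · rw [ho.mem w fun p _ h => by have h : w = M + p := h; omega, hσ.1 w hw]
  · obtain ⟨μ', h1, h2⟩ := ho.post p (Finset.mem_univ p)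
    rw [h1 (M + p) (.inr rfl)]
    exact h2

theorem exec_localLoop (hs : Simple c) (I : Fin k → ℕ → (ℕ → ℕ) → (ℕ → ℕ) → Prop)
    (hstep : ∀ p n μ' ρ, (∀ w < M, μ' w = μ w) → I p (n + 1) (μ' (M + p)) ρ →
      e.val k p ρ ≠ 0 ∧ wpOwn M k p c (I p n) (μ', ρ))
    (hzero : ∀ p bl ρ, I p 0 bl ρ → e.val k p ρ = 0) {n : Fin k → ℕ} {N : ℕ} (hN : ∀ p, n p ≤ N)
    (hσ : Local μ M (fun p => I p (n p)) σ) :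
    ∃ σ' t w, Exec ω (loop e c) Finset.univ σ σ' t w ∧ t ≤ N * (cost c + 1) + 1 + Nat.clog 2 k ∧
      w ≤ ∑ p, (n p + 1) * (cost c + 1) ∧ Local μ M (fun p => I p 0) σ' ∧ σ'.draws = σ.draws := by
  obtain ⟨σ', t, w, he, ht, hw, hv, -, hm, hd⟩ := exec_loop ω apart_own e c hs
    (fun p n s => (∀ w < M, s.1 w = μ w) ∧ I p n (s.1 (M + p)) s.2)
    (fun p n s hI => by
      obtain ⟨h1, h2⟩ := hstep p n s.1 s.2 hI.1 hI.2
      refine ⟨h1, (wp.frame h2).mono fun s' h => ⟨fun w hw => ?_, h.1⟩⟩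
      rw [h.2 w fun h => by have h : w = M + p := h; omega, hI.1 w hw])
    (fun p s hI => hzero p _ _ hI.2) N Finset.univ n σ (fun p _ => hN p)
    fun p _ => ⟨(σ.mem, σ.regs p), ⟨rfl, fun _ _ => rfl⟩, hσ.1, hσ.2 p⟩
  refine ⟨σ', t, w, he, ht, hw, ⟨fun w hw => ?_, fun p => ?_⟩, hd⟩
  · rw [hm w fun p _ h => by have h : w = M + p := h; omega, hσ.1 w hw]
  · obtain ⟨s, ⟨h1, h2⟩, h3, h4⟩ := hv p (Finset.mem_univ p)
    rw [h1, h2 (M + p) (.inr rfl)]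
    exact h4

end

/-! ### Preparations -/

/-- Find the root of the tree. -/
def rootP : Cmd :=
  seq (load 2 (.const 0) (.const 0)) <| seq (load 14 (.const 0) (.pid + .const 1)) <|
  seq (assign 15 (rg 14)) <| seq (assign 7 (.const 1)) (load 20 (rg 15) (.const 0))

/-- A step down the left spine. -/
def downP : Cmd :=
  seq (assign 7 (rg 7 + .const 1)) <| seq (load 15 (rg 15) (.const 1)) (load 20 (rg 15) (.const 0))

/-- Store the rank, the separator and the right link. -/
def showP : Cmd :=
  seq (load 16 (rg 15) (.const 1)) <| seq (store ownBlock (.const 0) (rg 7)) <|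
  seq (store ownBlock (.const 4) (rg 16)) <|
  seq (ite (.nprocs - (.pid + .const 1)) (store ownBlock (.const 3) (.pid + .const 2))
    (store ownBlock (.const 3) (.const 0))) <|
  seq (assign 15 (rg 14)) <| seq (assign 17 (rg 14)) <| seq (assign 20 (rg 7)) (assign 21 (rg 7 + rg 7))

/-- Store the nodes of some rank on the two spines. -/
def spineP : Cmd :=
  seq (store ownBlock (rg 21 + .const 5) (rg 15)) <| seq (store ownBlock (rg 21 + .const 6) (rg 17)) <|
  seq (load 15 (rg 15) (.const 1)) <| seq (load 22 (rg 17) (.const 0)) <|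
  seq (load 17 (rg 17) (rg 22 + rg 22 - .const 1)) <| seq (assign 20 (rg 20 - .const 1))
    (assign 21 (rg 21 - .const 2))

/-- All trees are prepared. -/
def prepareP : Cmd :=
  seq rootP <| seq (loop (rg 20) downP) <| seq showP <| seq (loop (rg 20) spineP) <|
    seq (assign 1 (.const 1)) (assign 3 (rg 2 + .nprocs))

/-- The trees of height `h p` with roots `v p` are in memory below record `M`. -/
structure Roots {k : ℕ} (μ : ℕ → ℕ → ℕ) (M : ℕ) (h v : Fin k → ℕ) : Prop where
  size : μ 0 0 = M
  pos : 0 < M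
  root : ∀ p : Fin k, μ 0 (p + 1) = v p
  ord : ∀ p, ∃ lo hi, Ordered μ (h p) (v p) lo hi
  lt : ∀ p, ∀ w ∈ recsAt μ (h p) (v p), w < M

/-- The link of processor `p` to its right neighbour, before the first iteration. -/
def nextLink (k p : ℕ) : ℕ := if p + 1 < k then p + 2 else 0

/-- The contents of the block of a processor, apart from nodes of rank up to `n`. -/
structure Block (μ : ℕ → ℕ → ℕ) (k p h v n : ℕ) (bl : ℕ → ℕ) : Prop where
  rank : bl 0 = h + 1
  link : bl 3 = nextLink k p
  sep : bl 4 = μ (lsp μ v h) 1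
  left : ∀ j, n < j → j ≤ h + 1 → bl (2 * j + 5) = lsp μ v (h + 1 - j)
  right : ∀ j, n < j → j ≤ h + 1 → bl (2 * j + 6) = rsp μ v (h + 1 - j)

-- Walking down the spines to fill the arrays.

section

variable {k M : ℕ} {μ : ℕ → ℕ → ℕ} {σ : State k} {ω : ℕ → ℕ → Bool} {h v : Fin k → ℕ}

theorem Roots.lsp_lt (H : Roots μ M h v) (p : Fin k) {d : ℕ} (hd : d ≤ h p) : lsp μ (v p) d < M := by
  obtain ⟨lo, hi, ho⟩ := H.ord p
  exact H.lt p _ (lsp_mem ho hd)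

theorem Roots.rsp_lt (H : Roots μ M h v) (p : Fin k) {d : ℕ} (hd : d ≤ h p) : rsp μ (v p) d < M := by
  obtain ⟨lo, hi, ho⟩ := H.ord p
  exact H.lt p _ (rsp_mem ho hd)

/-- The registers on the way down the left spine, `n` steps above the leaf. -/
def DownRegs (μ : ℕ → ℕ → ℕ) (M h v n : ℕ) (ρ : ℕ → ℕ) : Prop :=
  ρ 2 = M ∧ ρ 14 = v ∧ ∃ j, j + n = h ∧ ρ 7 = j + 1 ∧ ρ 15 = lsp μ v j ∧ ρ 20 = μ (lsp μ v j) 0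

/-- The registers while the spines are stored, with the nodes of rank `n` to be stored next. -/
def SpineRegs (μ : ℕ → ℕ → ℕ) (M h v n : ℕ) (ρ : ℕ → ℕ) : Prop :=
  ρ 2 = M ∧ ρ 20 = n ∧ ρ 21 = 2 * n ∧ n ≤ h + 1 ∧
    (0 < n → ρ 15 = lsp μ v (h + 1 - n) ∧ ρ 17 = rsp μ v (h + 1 - n))

theorem put_self (μ : ℕ → ℕ → ℕ) (w i x : ℕ) : put μ w i x w = Function.update (μ w) i x := by
  funext f
  simp [put, Function.update_apply]

theorem put_lt {M p w : ℕ} (μ : ℕ → ℕ → ℕ) (i x : ℕ) (hw : w < M) : put μ (M + p) i x w = μ w := by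
  funext f
  exact put_ne (.inl (by omega))

theorem wp_rootP (H : Roots μ M h v) (p : Fin k) {μ' ρ} (hμ : ∀ w < M, μ' w = μ w) :
    wpOwn M k p rootP (fun _ ρ => DownRegs μ M (h p) (v p) (h p) ρ) (μ', ρ) := by
  have h0 := hμ 0 H.pos
  have h1 := H.lsp_lt p (Nat.zero_le _)
  simp only [lsp] at h1
  have h2 := hμ _ h1
  simp [rootP, DownRegs, h0, h1, h2, H.size, H.root, H.pos, lsp]

theorem wp_downP (H : Roots μ M h v) (p : Fin k) {n : ℕ} {μ' ρ} (hμ : ∀ w < M, μ' w = μ w)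
    (hI : DownRegs μ M (h p) (v p) (n + 1) ρ) : (rg 20).val k p ρ ≠ 0 ∧
      wpOwn M k p downP (fun _ ρ => DownRegs μ M (h p) (v p) n ρ) (μ', ρ) := by
  obtain ⟨r2, r14, j, hj, r7, r15, r20⟩ := hI
  obtain ⟨lo, hi, ho⟩ := H.ord p
  have h1 := H.lsp_lt p (d := j) (by omega)
  have h2 := H.lsp_lt p (d := j + 1) (by omega)
  have h3 := hμ _ h2
  rw [lsp] at h2 h3
  refine ⟨?_, ?_⟩
  · rw [val_reg, r20, ne_eq, ho.degree_lsp (by omega)]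
    omega
  · simp only [downP, wp_seq, wp_assign, wp_load, val_add, val_reg, val_const]
    simp [DownRegs, r2, r14, r7, r15, hμ _ h1, h1, h2, h3]
    exact ⟨by omega, rfl, rfl⟩

theorem wp_showP (H : Roots μ M h v) (p : Fin k) {μ' ρ} (hμ : ∀ w < M, μ' w = μ w)
    (hI : DownRegs μ M (h p) (v p) 0 ρ) : wpOwn M k p showP (fun bl ρ =>
      SpineRegs μ M (h p) (v p) (h p + 1) ρ ∧ Block μ k p (h p) (v p) (h p + 1) bl) (μ', ρ) := by
  obtain ⟨r2, r14, j, rfl, r7, r15, r20⟩ := hI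
  have h1 := H.lsp_lt p (d := h p) le_rfl
  simp only [showP, wp_seq, wp_assign, wp_load, wp_store, wp_ite, val_add, val_sub, val_reg, val_const, val_pid, val_nprocs]
  simp only [ne_eq, not_false_eq_true, Function.update_of_ne, Function.update_self, r2, r14, r7, r15, hμ _ h1, h1,
    put_self, Set.mem_ofPred_eq, true_or, Set.mem_singleton_iff, true_and, Nat.reduceEqDiff]
  have key : ∀ x, x = nextLink k p → SpineRegs μ M (h p) (v p) (h p + 1) (Function.update
      (Function.update (Function.update (Function.update (Function.update ρ 16
        (μ (lsp μ (v p) (h p)) 1)) 15 (v p)) 17 (v p)) 20 (h p + 1)) 21 (h p + 1 + (h p + 1))) ∧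
      Block μ k p (h p) (v p) (h p + 1) (Function.update (Function.update (Function.update (μ' (M + p))
        0 (h p + 1)) 4 (μ (lsp μ (v p) (h p)) 1)) 3 x) := fun x hx =>
    ⟨⟨by simp [r2], by simp, by simp; omega, le_rfl, fun _ => by simp [lsp, rsp]⟩,
      by simp, by simp [hx], by simp, fun j h1 h2 => by omega, fun j h1 h2 => by omega⟩
  split_ifs with hk
  · exact key _ (by rw [nextLink, if_neg (by omega)])
  · exact key _ (by rw [nextLink, if_pos (by omega)])

theorem wp_spineP (H : Roots μ M h v) (p : Fin k) {n : ℕ} {μ' ρ} (hμ : ∀ w < M, μ' w = μ w)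
    (hI : SpineRegs μ M (h p) (v p) (n + 1) ρ ∧ Block μ k p (h p) (v p) (n + 1) (μ' (M + p))) :
    (rg 20).val k p ρ ≠ 0 ∧ wpOwn M k p spineP (fun bl ρ =>
      SpineRegs μ M (h p) (v p) n ρ ∧ Block μ k p (h p) (v p) n bl) (μ', ρ) := by
  obtain ⟨⟨r2, r20, r21, hn, r⟩, hB⟩ := hI
  obtain ⟨r15, r17⟩ := r (by omega)
  obtain ⟨d, hd⟩ : ∃ d, h p = d + n := ⟨h p - n, by omega⟩
  have h1 := H.lsp_lt p (d := d) (by omega)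
  have h2 := H.rsp_lt p (d := d) (by omega)
  rw [show h p + 1 - (n + 1) = d by omega] at r15 r17
  refine ⟨by simp [r20], ?_⟩
  simp only [spineP, wp_seq, wp_assign, wp_load, wp_store, val_add, val_sub, val_reg, val_const, val_pid]
  simp [r2, r20, r21, r15, r17, h1, h2, put_lt, hμ _ h1, hμ _ h2, put_self]
  refine ⟨⟨by simp [r2], by simp, by simp; omega, by omega, fun _ => ?_⟩, ?_, ?_, ?_, fun j h1 h2 => ?_,
    fun j h1 h2 => ?_⟩
  · rw [show h p + 1 - n = d + 1 by omega]
    simp [lsp, rsp, lastKid, two_mul]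
  · simpa using hB.rank
  · rw [Function.update_of_ne (by omega), Function.update_of_ne (by omega), hB.link]
  · rw [Function.update_of_ne (by omega), Function.update_of_ne (by omega), hB.sep]
  · rw [Function.update_of_ne (by omega)]
    by_cases hj : j = n + 1
    · rw [hj, Function.update_self, show h p + 1 - (n + 1) = d by omega]
    · rw [Function.update_of_ne (by omega), hB.left j (by omega) h2]
  · by_cases hj : j = n + 1
    · rw [hj, Function.update_self, show h p + 1 - (n + 1) = d by omega]
    · rw [Function.update_of_ne (by omega), Function.update_of_ne (by omega), hB.right j (by omega) h2]

/-- The execution of the preparations. -/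
theorem exec_prepareP (H : Roots μ M h v) {N : ℕ} (hN : ∀ p, h p ≤ N) :
    ∃ σ' t w, Exec ω prepareP Finset.univ (start k μ) σ' t w ∧ t ≤ 24 * N + 68 + 2 * Nat.clog 2 k ∧
      w ≤ 68 * k + ∑ p, 24 * h p ∧ Local μ M (fun p bl ρ => Block μ k p (h p) (v p) 0 bl ∧
        ρ 1 = 1 ∧ ρ 2 = M ∧ ρ 3 = M + k) σ' ∧ σ'.draws = fun _ => 0 := by
  obtain ⟨σ₁, ⟨t₁, w₁, e₁, ht₁, hw₁⟩, h₁, d₁⟩ := runs_local (μ := μ) (M := M) (σ := start k μ) (ω := ω)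
    (c := rootP) (B := fun _ _ _ => True) (by simp [rootP, Simple])
    (fun p μ' ρ hμ _ => wp_rootP H p hμ) ⟨fun _ _ => rfl, fun _ => trivial⟩
  obtain ⟨σ₂, t₂, w₂, e₂, ht₂, hw₂, h₂, d₂⟩ := exec_localLoop (ω := ω) (e := rg 20) (c := downP)
    (by simp [downP, Simple]) (fun p n _ ρ => DownRegs μ M (h p) (v p) n ρ)
    (fun p n μ' ρ hμ hI => wp_downP H p hμ hI) (fun p bl ρ hI => by
      obtain ⟨-, -, j, hj, -, -, r20⟩ := hI
      obtain ⟨lo, hi, ho⟩ := H.ord p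
      rw [val_reg, r20, ho.degree_lsp (by omega)]
      omega) hN h₁
  obtain ⟨σ₃, ⟨t₃, w₃, e₃, ht₃, hw₃⟩, h₃, d₃⟩ := runs_local (ω := ω) (c := showP)
    (by simp [showP, Simple]) (fun p μ' ρ hμ hI => wp_showP H p hμ hI) h₂
  obtain ⟨σ₄, t₄, w₄, e₄, ht₄, hw₄, h₄, d₄⟩ := exec_localLoop (ω := ω) (e := rg 20) (c := spineP)
    (by simp [spineP, Simple]) (fun p n bl ρ => SpineRegs μ M (h p) (v p) n ρ ∧ Block μ k p (h p) (v p) n bl)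
    (fun p n μ' ρ hμ hI => wp_spineP H p hμ hI) (fun p bl ρ hI => hI.1.2.1)
    -- One round for each rank, the leaf included, in contrast to the walk down, which makes one
    -- step for each edge.
    (N := N + 1) (n := fun p => h p + 1) (fun p => Nat.succ_le_succ (hN p)) h₃
  obtain ⟨σ₅, ⟨t₅, w₅, e₅, ht₅, hw₅⟩, h₅, d₅⟩ := runs_local (ω := ω)
    (c := seq (assign 1 (.const 1)) (assign 3 (rg 2 + .nprocs))) (by simp [Simple])
    (B' := fun p bl ρ => Block μ k p (h p) (v p) 0 bl ∧ ρ 1 = 1 ∧ ρ 2 = M ∧ ρ 3 = M + k)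
    (fun p μ' ρ hμ hI => by simp [hI.2, hI.1.1]) h₄
  refine ⟨σ₅, _, _, .seq _ _ _ _ _ _ _ _ _ _ e₁ (.seq _ _ _ _ _ _ _ _ _ _ e₂
    (.seq _ _ _ _ _ _ _ _ _ _ e₃ (.seq _ _ _ _ _ _ _ _ _ _ e₄ e₅))), ?_, ?_, h₅, by
      rw [d₅, d₄, d₃, d₂, d₁]; rfl⟩
  · simp only [cost, rootP, downP, showP, spineP] at *
    omega
  · simp only [cost, rootP, downP, showP, spineP, Finset.card_univ, Fintype.card_fin,
      ← Finset.sum_mul, ← Finset.mul_sum, Finset.sum_add_distrib, Finset.sum_const, smul_eq_mul, mul_one] at *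
    omega

end


/-! ### The whole program -/

-- From the input to the output.

section

variable {a b k M hi : ℕ} {μ : ℕ → ℕ → ℕ} {σ : State k} {ω : ℕ → ℕ → Bool} {T : Fin k → LTree}

theorem ofFn_split {l₁ l₂ : List Entry} {e : Entry}
    (h : (List.ofFn fun t : Fin k => ((t : ℕ), T t)) = l₁ ++ e :: l₂) :
    ∃ p : Fin k, e = ((p : ℕ), T p) ∧ (l₂ = [] ∧ (p : ℕ) + 1 = k ∨
      ∃ (q : Fin k) (l₃ : List Entry), l₂ = ((q : ℕ), T q) :: l₃ ∧ (q : ℕ) = p + 1) := by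
  have hlen := congrArg List.length h
  simp only [List.length_ofFn, List.length_append, List.length_cons] at hlen
  have hget : ∀ (i : ℕ) (hi : i < k), (l₁ ++ e :: l₂)[i]? = some (i, T ⟨i, hi⟩) := fun i hi => by
    rw [← h]; simp [hi]
  have h1 := hget l₁.length (by omega)
  rw [List.getElem?_append_right le_rfl, Nat.sub_self, List.getElem?_cons_zero, Option.some.injEq] at h1
  refine ⟨⟨l₁.length, by omega⟩, h1, ?_⟩
  cases l₂ with
  | nil => exact .inl ⟨rfl, by simpa using hlen.symm⟩
  | cons f l₂ =>
    rw [List.length_cons] at hlen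
    have h2 := hget (l₁.length + 1) (by omega)
    rw [List.getElem?_append_right (by omega), Nat.add_sub_cancel_left, List.getElem?_cons_succ,
      List.getElem?_cons_zero, Option.some.injEq] at h2
    exact .inr ⟨⟨l₁.length + 1, by omega⟩, l₂, by rw [h2], rfl⟩

/-- At the start both arrays are complete, so they are correct from rank 0 on, whatever the ranks of
the neighbours are. -/
theorem chain_of_split {l : List Entry} (h : ∀ l₁ e l₂, l = l₁ ++ e :: l₂ →
    Held μ M e 0 (sepOf μ M hi l₂) 0 (linkOf 0 l₂)) (pr : ℕ∞) : Chain μ M hi ⊤ 0 pr l := by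
  induction l generalizing pr with
  | nil => trivial
  | cons e l ih =>
    exact ⟨(h [] e l rfl).mono zero_le zero_le, ih (fun l₁ f l₂ hl => h (e :: l₁) f l₂ (by rw [hl]; rfl)) _⟩

/-- The memory holds the trees at the beginning. -/
structure Input (μ : ℕ → ℕ → ℕ) (T : Fin k → LTree) (fps : Fin k → List ℕ) : Prop where
  mem : ∀ p : Fin k, InMemory μ ((T p).rank - 1) (μ 0 (p + 1)) (T p) (fps p)
  nodup : (List.ofFn fps).flatten.Nodup
  range : ∀ v ∈ (List.ofFn fps).flatten, 0 < v ∧ v < μ 0 0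
  sorted : ∀ p, (T p).leaves.Pairwise (· ≤ ·)
  lt : ∀ p q : Fin k, p < q → ∀ x ∈ (T p).leaves, ∀ y ∈ (T q).leaves, x ≤ y

theorem IsInput.input (ha : 2 ≤ a) (hT : ∀ t, IsABTree a b (T t))
    (hs : (leavesList (List.ofFn T)).Pairwise (· ≤ ·)) (h : IsInput μ T) : ∃ fps, Input μ T fps := by
  obtain ⟨fps, h1, h2, h3⟩ := h
  rw [leavesList_eq_flatMap, List.pairwise_flatMap, List.pairwise_ofFn] at hs
  exact ⟨fps, fun p => (hT p).inMemory ha (h1 p), h2, h3, fun p => hs.1 _ (by simp [List.mem_ofFn]),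
    fun p q hpq => hs.2 hpq⟩

theorem Input.mem_range {fps : Fin k → List ℕ} (I : Input μ T fps) (p : Fin k) :
    ∀ w ∈ recsAt μ ((T p).rank - 1) (μ 0 (p + 1)), 0 < w ∧ w < μ 0 0 := fun w hw => by
  rw [← (I.mem p).recs] at hw
  exact I.range w (List.mem_flatten.2 ⟨fps p, by simp [List.mem_ofFn], hw⟩)

theorem Input.roots {fps : Fin k → List ℕ} (I : Input μ T fps) (hk : 0 < k) :
    Roots μ (μ 0 0) (fun p => (T p).rank - 1) fun p => μ 0 (p + 1) := by
  refine ⟨rfl, ?_, fun _ => rfl, fun p => ?_, fun p w hw => (I.mem_range p w hw).2⟩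
  · exact (Nat.zero_le _).trans_lt (I.mem_range ⟨0, hk⟩ _ (self_mem_recsAt _ _)).2
  · exact ⟨_, (T p).leaves.sum, (I.mem p).ord 0 _ fun x hx => ⟨Nat.zero_le x, List.le_sum_of_mem hx⟩⟩

/-- The values are sorted, so the left-most leaf carries the least one. It is the separator from the
left neighbour. -/
theorem Input.sep {fps : Fin k → List ℕ} (I : Input μ T fps) (p : Fin k) :
    μ (lsp μ (μ 0 (p + 1)) ((T p).rank - 1)) 1 ∈ (T p).leaves ∧
      ∀ x ∈ (T p).leaves, μ (lsp μ (μ 0 (p + 1)) ((T p).rank - 1)) 1 ≤ x := by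
  have ho := (I.mem p).ord 0 (T p).leaves.sum fun x hx => ⟨Nat.zero_le x, List.le_sum_of_mem hx⟩
  obtain ⟨l, hl⟩ := ho.leaves_eq
  rw [← (I.mem p).tree] at hl
  have hs := I.sorted p
  rw [hl] at hs ⊢
  refine ⟨by simp, fun x hx => ?_⟩
  rcases List.mem_cons.1 hx with rfl | hx
  · exact le_rfl
  · exact List.rel_of_pairwise_cons hs hx

/-- After the preparations, the trees are in the form that the iterations need. -/
theorem Input.holds {fps : Fin k → List ℕ} (I : Input μ T fps) (hk : 0 < k)
    (h : Local μ (μ 0 0) (fun p bl ρ =>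
      Block μ k p ((T p).rank - 1) (μ 0 (p + 1)) 0 bl ∧ ρ 1 = 1 ∧ ρ 2 = μ 0 0 ∧ ρ 3 = μ 0 0 + k) σ) :
    Holds (μ 0 0) (leavesList (List.ofFn T)).sum (μ 0 0 + k) (trees a b T ω 0) σ := by
  obtain ⟨hm, hB⟩ := h
  have hrec : ∀ p, ∀ w ∈ recsAt μ ((T p).rank - 1) (μ 0 (p + 1)), σ.mem w = μ w := fun p w hw =>
    hm w (I.mem_range p w hw).2
  have hheld : ∀ p hi link, (∀ x ∈ (T p).leaves, x ≤ hi) → nextLink k p = link →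
      HeldAt σ.mem (μ 0 0) p ((T p).rank - 1) (μ 0 (p + 1)) 0 (σ.mem (μ 0 0 + p) 4) hi 0 link :=
    fun p hi link hhi hlink => by
      have ho := (I.mem p).ord _ _ fun x hx => ⟨(I.sep p).2 x hx, hhi x hx⟩
      obtain ⟨h1, h2, h3, h4, h5⟩ := (hB p).1
      refine ⟨h1, ?_, ?_, (ordered_frame (hrec p)).2 (h3 ▸ ho), h2.trans hlink, fun j h0 _ hj => ?_,
        fun j h0 _ hj => ?_⟩
      · rw [h4 _ (by omega) le_rfl, Nat.sub_self]; rfl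
      · rw [h5 _ (by omega) le_rfl, Nat.sub_self]; rfl
      · rw [h4 j h0 hj, lsp_congr (μ' := σ.mem) ho (by omega) fun w hw => by rw [hrec p w hw]]
      · rw [h5 j h0 hj, rsp_congr (μ' := σ.mem) ho (by omega) fun w hw => by simp only [lastKid, hrec p w hw]]
  have hrecs : ∀ p : Fin k, recs σ.mem (μ 0 0) ((p : ℕ), T p) = (fps p : Multiset ℕ) := fun p => by
    rw [(hheld p _ _ (fun x hx => List.le_sum_of_mem hx) rfl).recs_eq, recsAt_frame (hrec p), (I.mem p).recs]
  have htot : total σ.mem (μ 0 0) (trees a b T ω 0) = ((List.ofFn fps).flatten : Multiset ℕ) := by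
    rw [total, trees, List.map_ofFn, List.sum_ofFn, coe_flatten_ofFn]
    exact Finset.sum_congr rfl fun p _ => hrecs p
  refine ⟨chain_of_split (fun l₁ e l₂ hl => ?_) ⊤, htot ▸ Multiset.coe_nodup.2 I.nodup,
    fun w hw => ?_, (I.roots hk).pos, le_rfl, fun p => ?_, fun p => (hB p).2.2.1⟩
  · obtain ⟨p, rfl, hl₂⟩ := ofFn_split hl
    refine ⟨_, _, by rw [treeAt_frame (hrec p)]; exact (I.mem p).tree, hheld p _ _ (fun x hx => ?_) ?_⟩
    · rcases hl₂ with ⟨rfl, -⟩ | ⟨q, l₃, rfl, hq⟩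
      · rw [sepOf, leavesList_eq_flatMap]
        exact List.le_sum_of_mem (List.mem_flatMap.2 ⟨T p, by simp [List.mem_ofFn], hx⟩)
      · simp only [sepOf, (hB q).1.sep]
        exact I.lt p q (Fin.lt_def.2 (by omega)) x hx _ (I.sep q).1
    · rcases hl₂ with ⟨rfl, hp⟩ | ⟨q, l₃, rfl, hq⟩
      · rw [nextLink, if_neg (by omega)]; rfl
      · rw [nextLink, if_pos (by omega), linkOf, hq]
  · rw [htot] at hw
    have := I.range w hw
    omega
  · rw [(hB p).2.1, if_pos]
    simp [trees, List.mem_ofFn]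

/-- The processor in charge of the only tree stores the root of this tree. -/
def outP : Cmd :=
  ite (rg 1) (seq (load 7 ownBlock (.const 0)) (seq (load 14 ownBlock (rg 7 + rg 7 + .const 6))
    (store (.const 0) (.const 1) (rg 14)))) skip

/-- The program of the theorem. -/
def joinP (a b : ℕ) : Cmd := seq prepareP (seq relinkP (seq (loop (rg 0) (bodyP a b)) outP))

theorem runs_outP {base : ℕ} {e : Entry} (H : Holds M hi base [e] σ) (he : e.1 < k) :
    ∃ σ', Runs ω outP Finset.univ σ σ' ∧ IsOutput σ'.mem e.2 := by
  obtain ⟨⟨h, v, htree, hheld⟩, -⟩ := H.chain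
  have hrecs := hheld.recs_eq e.2
  have htot : total σ.mem M [e] = recsAt σ.mem h v := by simpa [total] using hrecs
  let W : Fin k → Set ℕ := fun p => if (p : ℕ) = e.1 then {0} else ∅
  let R : Fin k → Set ℕ := fun p => if (p : ℕ) = e.1 then {0, M + e.1} else ∅
  have hRW : Apart R W := by
    refine ⟨fun p w hw => ?_, fun p q hpq w hw hw' => ?_⟩ <;> simp only [W, R] at *
    · split_ifs at hw ⊢
      exacts [.inl hw, hw]
    · split_ifs at hw hw' with h1 h2
      exacts [hpq (Fin.ext (h1.trans h2.symm)), hw', hw, hw]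
  obtain ⟨σ', hr, ho⟩ := runs_of_wp (A := Finset.univ) (σ := σ) ω hRW (c := outP)
    (by simp [outP, Simple]) (Q := fun p s => (p : ℕ) = e.1 → s.1 0 1 = v) fun p _ => by
      by_cases hp : (p : ℕ) = e.1
      · have h1 : σ.regs p 1 ≠ 0 := by rw [H.alive]; simp [hp]
        have h0 := hheld.rank
        have h3 := hheld.right
        rw [two_mul] at h3
        rw [outP, wp_ite_pos h1]
        simp [W, R, hp, H.r2, h0, h3, put]
      · have h1 : σ.regs p 1 = 0 := by rw [H.alive]; simp [hp]
        rw [outP, wp_ite_neg h1, wp_skip]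
        exact fun h => absurd h hp
  have hroot : σ'.mem 0 1 = v := by
    obtain ⟨μ, h1, h2⟩ := ho.post ⟨e.1, he⟩ (Finset.mem_univ _)
    rw [h1 0 (by simp [R])]
    exact h2 rfl
  -- The only write goes to record 0, and the records of the tree are positive.
  have hkeep : ∀ w ∈ recsAt σ.mem h v, σ'.mem w = σ.mem w := fun w hw => ho.mem w fun p _ hp => by
    have := (H.range w (htot ▸ hw)).1
    simp only [W] at hp
    split_ifs at hp
    · have hp : w = 0 := hp
      omega
    · exact hp
  obtain ⟨fp, h1, h2, -⟩ := ((ordered_frame hkeep).2 hheld.ord).stored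
  rw [treeAt_frame hkeep, ← htree] at h1
  rw [recsAt_frame hkeep, ← htot] at h2
  exact ⟨σ', hr, fp, hroot ▸ h1, Multiset.coe_nodup.1 (h2 ▸ H.nodup), fun w hw =>
    (H.range w (h2 ▸ Multiset.mem_coe.2 hw)).1⟩

theorem trees_eq_of_length_le {i j : ℕ} (h : (trees a b T ω i).length ≤ 1) (hij : i ≤ j) :
    trees a b T ω j = trees a b T ω i := by
  induction j, hij using Nat.le_induction with
  | base => rfl
  | succ j _ ih => rw [trees, iteration_of_length_le (ih ▸ h), ih]

/-- The three loops follow one another, so only three barriers are paid for. The number n of rounds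
is the first time at which a single tree is left. -/
theorem exec_joinP (ha : 2 ≤ a) (hab : 2 * a ≤ b) (hT : ∀ t, IsABTree a b (T t)) (hk : 0 < k)
    (hs : (leavesList (List.ofFn T)).Pairwise (· ≤ ·)) (hin : IsInput μ T) {N : ℕ}
    (hN : ∀ p, (T p).rank - 1 ≤ N) {n : ℕ} (hn : ∀ j < n, 2 ≤ (trees a b T ω j).length) {e : Entry}
    (he : trees a b T ω n = [e]) :
    ∃ σ' t w, Exec ω (joinP a b) Finset.univ (start k μ) σ' t w ∧ IsOutput σ'.mem e.2 ∧
      t ≤ 24 * N + 69 + 3 * Nat.clog 2 k + cost (seq relinkP outP) + (cost (bodyP a b) + 1) * n ∧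
      w ≤ (69 + cost (seq relinkP outP)) * k + ∑ p, 24 * ((T p).rank - 1) +
        (cost (bodyP a b) + 1) * ∑ j ∈ Finset.range n, (trees a b T ω j).length := by
  obtain ⟨fps, I⟩ := hin.input ha hT hs
  obtain ⟨σ₁, t₁, w₁, e₁, ht₁, hw₁, h₁, d₁⟩ := exec_prepareP (ω := ω) (I.roots hk) hN
  have H := I.holds (a := a) (b := b) (ω := ω) hk h₁
  have E : ∀ i, Entries a b k (trees a b T ω i) := fun i =>
    ⟨trees_isABTree ha hab hT ω i, (trees_pids ha hab hT ω i).1, (trees_pids ha hab hT ω i).2.1⟩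
  obtain ⟨σ₂, ⟨t₂, w₂, e₂, ht₂, hw₂⟩, H₂, hL, hf, -, hg, d₂⟩ := runs_relinkP (ω := ω) H (E 0)
    (Finset.subset_univ _)
  have R : Ready (μ 0 0) _ (μ 0 0 + k) 0 (trees a b T ω 0) σ₂ := ⟨H₂, hL, fun p => hf p (Finset.mem_univ p),
    fun p _ => by rw [hg p 3 (by norm_num) (by norm_num) (by norm_num), (h₁.2 p).2.2.2],
    fun p _ => by rw [d₂, d₁]⟩
  obtain ⟨σ₃, t₃, w₃, base, e₃, R₃, ht₃, hw₃⟩ := exec_mainLoop ha hab (ω := ω) (L := trees a b T ω)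
    (fun _ => rfl) (Finset.subset_univ _) R (E 0) (N := n) (by simpa using hn) (by simp [he])
  rw [Nat.zero_add, he] at R₃
  obtain ⟨σ₄, ⟨t₄, w₄, e₄, ht₄, hw₄⟩, hout⟩ := runs_outP (ω := ω) R₃.holds ((E n).lt e (by simp [he]))
  refine ⟨σ₄, _, _, .seq _ _ _ _ _ _ _ _ _ _ e₁ (.seq _ _ _ _ _ _ _ _ _ _ e₂
    (.seq _ _ _ _ _ _ _ _ _ _ e₃ e₄)), hout, ?_, ?_⟩
  · rw [mul_comm _ n]
    have : cost (seq relinkP outP) = cost relinkP + cost outP := rfl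
    omega
  · have : cost (seq relinkP outP) = cost relinkP + cost outP := rfl
    simp only [Finset.card_univ, Fintype.card_fin, Nat.zero_add] at hw₂ hw₃ hw₄
    rw [this, add_mul, add_mul]
    omega

end


/-! ### Time and work -/

-- Bounds on time and work, and their expectations.

section

variable {a b k m : ℕ} {μ : ℕ → ℕ → ℕ} {T : Fin k → LTree}

theorem rank_le_log (ha : 2 ≤ a) {t : LTree} (h : IsABTree a b t) :
    t.rank - 1 ≤ Nat.log 2 t.size + 1 := by
  have h1 := h.two_pow_rank_le ha
  have h2 := Nat.lt_pow_succ_log_self (b := 2) (by norm_num) t.size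
  have h3 : 2 ^ t.rank < 2 ^ (Nat.log 2 t.size + 3) := by
    calc 2 ^ t.rank ≤ 4 * t.size := h1
      _ < 4 * 2 ^ (Nat.log 2 t.size + 1) := by omega
      _ = 2 ^ (Nat.log 2 t.size + 3) := by ring
  have := (Nat.pow_lt_pow_iff_right (by norm_num : 1 < 2)).1 h3
  omega

/-- Jensen's inequality: ranks are logarithmic in the sizes, and the sum of the logarithms of k
sizes of mean m / k is at most k log(m/k). The remaining k, from rounding, is absorbed since the
logarithm is at least one. -/
theorem sum_rank_le (ha : 2 ≤ a) (hT : ∀ t, IsABTree a b (T t)) (hk : 0 < k)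
    (hm : m = ∑ t, (T t).size) : ((∑ t, ((T t).rank - 1) : ℕ) : ℝ) ≤ 2 * (k * lg (m / k)) := by
  have hk' : (0 : ℝ) < k := by exact_mod_cast hk
  have hkm : (k : ℝ) ≤ m := by exact_mod_cast card_le_sum_size hT hm
  have hy : (0 : ℝ) < m / k := div_pos (hk'.trans_le hkm) hk'
  have hlog : ∀ t, (((T t).rank - 1 : ℕ) : ℝ) ≤
      1 + Real.logb 2 (m / k) + (((T t).size : ℝ) / (m / k) - 1) / Real.log 2 := fun t => by
    have hs : (0 : ℝ) < (T t).size := by exact_mod_cast (hT t).size_pos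
    have h1 : (((T t).rank - 1 : ℕ) : ℝ) ≤ (Nat.log 2 (T t).size : ℝ) + 1 := by
      exact_mod_cast rank_le_log ha (hT t)
    have h2 := Real.natLog_le_logb (T t).size 2
    have h3 : Real.logb 2 (T t).size = Real.logb 2 (m / k) + Real.log ((T t).size / (m / k)) / Real.log 2 := by
      rw [Real.log_div hs.ne' hy.ne', Real.logb, Real.logb]
      ring
    have h4 : Real.log ((T t).size / (m / k)) / Real.log 2 ≤ (((T t).size : ℝ) / (m / k) - 1) / Real.log 2 :=
      div_le_div_of_nonneg_right (Real.log_le_sub_one_of_pos (by positivity)) (Real.log_nonneg (by norm_num))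
    push_cast at h2
    linarith
  -- The logarithm has been bounded by its tangent at the mean size, and the linear terms cancel in
  -- the sum.
  have hsum : ∑ t, (((T t).size : ℝ) / (m / k) - 1) / Real.log 2 = 0 := by
    rw [← Finset.sum_div, Finset.sum_sub_distrib, ← Finset.sum_div]
    have : ∑ t, ((T t).size : ℝ) = m := by rw [hm]; push_cast; rfl
    rw [this]
    simp only [Finset.sum_const, Finset.card_univ, Fintype.card_fin, nsmul_eq_mul, mul_one]
    have hm0 : (m : ℝ) ≠ 0 := (hk'.trans_le hkm).ne'
    rw [div_div_cancel₀ hm0, sub_self, zero_div]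
  have h := Finset.sum_le_sum fun t (_ : t ∈ Finset.univ) => hlog t
  rw [Finset.sum_add_distrib, hsum, add_zero] at h
  simp only [Finset.sum_const, Finset.card_univ, Fintype.card_fin, nsmul_eq_mul] at h
  push_cast
  have h1 := one_le_lg (m / k)
  have h2 : Real.logb 2 (m / k) ≤ lg (m / k) := le_max_right _ _
  nlinarith

theorem clog_le_lg (n : ℕ) : (Nat.clog 2 n : ℝ) ≤ 2 * lg n := by
  rw [← Real.natCeil_logb_natCast]
  have h1 := one_le_lg n
  have h2 : Real.logb 2 n ≤ lg n := le_max_right _ _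
  rcases le_total 0 (Real.logb 2 n) with h | h
  · have := Nat.ceil_lt_add_one h
    push_cast at *
    linarith
  · rw [Nat.cast_ofNat, Nat.ceil_eq_zero.2 h]
    simp
    linarith

theorem exists_least {ω : ℕ → ℕ → Bool} {i : ℕ} {e : Entry} (he : trees a b T ω i = [e]) :
    ∃ n, (∀ j < n, 2 ≤ (trees a b T ω j).length) ∧ trees a b T ω n = [e] := by
  classical
  have hi : (trees a b T ω i).length ≤ 1 := by simp [he]
  have h : ∃ n, (trees a b T ω n).length ≤ 1 := ⟨i, hi⟩
  refine ⟨Nat.find h, fun j hj => by have := Nat.find_min h hj; omega, ?_⟩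
  rw [← trees_eq_of_length_le (Nat.find_spec h) (Nat.find_min' h hi), he]

/-- The constant by which the loop contributes to time and work. -/
def loopCost (a b : ℕ) : ℕ := cost (bodyP a b) + 1

/-- The number of instructions outside of the loops. -/
def fixedCost : ℕ := cost (seq relinkP outP)

theorem runTime_le (ha : 2 ≤ a) (hab : 2 * a ≤ b) (hT : ∀ t, IsABTree a b (T t)) (hk : 0 < k)
    (hs : (leavesList (List.ofFn T)).Pairwise (· ≤ ·)) (hin : IsInput μ T) (hm : m = ∑ t, (T t).size)
    (ω : ℕ → ℕ → Bool) : (runTime (joinP a b) k μ ω : ℝ≥0∞) ≤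
      ((24 * (Nat.log 2 m + 1) + 69 + 3 * Nat.clog 2 k + fixedCost : ℕ) : ℝ≥0∞) +
        loopCost a b * openTime a b T ω := by
  -- If the join does not terminate, the right-hand side is infinite, as `loopCost` is positive;
  -- otherwise there is a complete execution.
  by_cases h : openTime a b T ω = ⊤
  · rw [h, ENNReal.mul_top (by simp [loopCost]), add_top]
    exact le_top
  obtain ⟨i, e, he⟩ := exists_trees_eq_singleton ha hab hT hk h
  obtain ⟨n, hn, he⟩ := exists_least he
  obtain ⟨σ', t, w, hx, -, ht, -⟩ := exec_joinP (N := Nat.log 2 m + 1) ha hab hT hk hs hin (fun p =>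
    (rank_le_log ha (hT p)).trans (Nat.succ_le_succ (Nat.log_mono_right
      (hm ▸ Finset.single_le_sum (f := fun p => (T p).size) (fun _ _ => Nat.zero_le _) (Finset.mem_univ p))))) hn he
  have h1 : runTime (joinP a b) k μ ω ≤ (t : ℕ∞) :=
    iInf₂_le (f := fun (t : ℕ) (_ : ∃ σ' w, Exec ω (joinP a b) Finset.univ (start k μ) σ' t w) => (t : ℕ∞))
      t ⟨σ', w, hx⟩
  have h2 : (runTime (joinP a b) k μ ω : ℝ≥0∞) ≤ (t : ℕ) := by simpa using ENat.toENNReal_le.2 h1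
  calc _ ≤ ((t : ℕ) : ℝ≥0∞) := h2
    _ ≤ ((24 * (Nat.log 2 m + 1) + 69 + 3 * Nat.clog 2 k + fixedCost + loopCost a b * n : ℕ) : ℝ≥0∞) := by
        exact_mod_cast ht
    _ ≤ _ := by
        rw [Nat.cast_add _ (loopCost a b * n), Nat.cast_mul]
        gcongr
        exact openTime_ge hn

theorem runWork_le (ha : 2 ≤ a) (hab : 2 * a ≤ b) (hT : ∀ t, IsABTree a b (T t)) (hk : 0 < k)
    (hs : (leavesList (List.ofFn T)).Pairwise (· ≤ ·)) (hin : IsInput μ T)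
    (ω : ℕ → ℕ → Bool) : (runWork (joinP a b) k μ ω : ℝ≥0∞) ≤
      (((69 + fixedCost) * k + ∑ p, 24 * ((T p).rank - 1) : ℕ) : ℝ≥0∞) +
        loopCost a b * openWork a b T ω := by
  by_cases h : openTime a b T ω = ⊤
  · have h' : openWork a b T ω = ⊤ := top_le_iff.1 (h.symm.le.trans (openTime_le_openWork ω))
    rw [h', ENNReal.mul_top (by simp [loopCost]), add_top]
    exact le_top
  obtain ⟨i, e, he⟩ := exists_trees_eq_singleton ha hab hT hk h
  obtain ⟨n, hn, he⟩ := exists_least he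
  obtain ⟨σ', t, w, hx, -, -, hw⟩ := exec_joinP (N := ∑ p, ((T p).rank - 1)) ha hab hT hk hs hin (fun p =>
    Finset.single_le_sum (f := fun p => (T p).rank - 1) (fun _ _ => Nat.zero_le _) (Finset.mem_univ p)) hn he
  have h1 : runWork (joinP a b) k μ ω ≤ (w : ℕ∞) :=
    iInf₂_le (f := fun (w : ℕ) (_ : ∃ σ' t, Exec ω (joinP a b) Finset.univ (start k μ) σ' t w) => (w : ℕ∞))
      w ⟨σ', t, hx⟩
  have h2 : (runWork (joinP a b) k μ ω : ℝ≥0∞) ≤ (w : ℕ) := by simpa using ENat.toENNReal_le.2 h1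
  calc _ ≤ ((w : ℕ) : ℝ≥0∞) := h2
    _ ≤ (((69 + fixedCost) * k + ∑ p, 24 * ((T p).rank - 1) +
          loopCost a b * ∑ j ∈ Finset.range n, (trees a b T ω j).length : ℕ) : ℝ≥0∞) := by
        exact_mod_cast hw
    _ ≤ _ := by
        rw [Nat.cast_add _ (loopCost a b * _), Nat.cast_mul]
        gcongr
        refine le_trans (le_of_eq ?_) (ENNReal.sum_le_tsum (Finset.range n))
        rw [Nat.cast_sum]
        exact Finset.sum_congr rfl fun j hj => by rw [openCount, if_pos (hn j (Finset.mem_range.1 hj))]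

theorem lintegral_const_add_mul_le {f : (ℕ → ℕ → Bool) → ℝ≥0∞} {x y B : ℝ} {n c : ℕ} (hx : n ≤ x)
    (hf : ∫⁻ ω, f ω ∂coins ≤ ENNReal.ofReal y) (hy : 0 ≤ y) (hB : x + c * y ≤ B) :
    ∫⁻ ω, ((n : ℝ≥0∞) + c * f ω) ∂coins ≤ ENNReal.ofReal B := by
  rw [lintegral_add_left measurable_const, lintegral_const, measure_univ, mul_one,
    lintegral_const_mul' _ _ (ENNReal.natCast_ne_top c)]
  refine le_trans ?_ (ENNReal.ofReal_le_ofReal hB)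
  have h0 : (0 : ℝ) ≤ x := (Nat.cast_nonneg n).trans hx
  rw [ENNReal.ofReal_add h0 (by positivity), ENNReal.ofReal_mul (Nat.cast_nonneg c), ENNReal.ofReal_natCast]
  gcongr
  rw [← ENNReal.ofReal_natCast]
  exact ENNReal.ofReal_le_ofReal hx

end

end LightJoin

theorem mainTheorem5 (a b : ℕ) (ha : 2 ≤ a) (hab : 2 * a ≤ b) :
    ∃ (P : Cmd) (C : ℝ), ∀ (k : ℕ) (T : Fin k → LTree) (m : ℕ), 0 < k →
      (∀ t, IsABTree a b (T t)) →
      (LTree.leavesList (List.ofFn T)).Pairwise (· ≤ ·) →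
      m = ∑ t, (T t).size →
      (∫⁻ ω, (numIterations a b T ω : ℝ≥0∞) ∂coins ≤ ENNReal.ofReal (C * (lg m + lg k))) ∧
      (∀ᵐ ω ∂coins, ∃ i e, trees a b T ω i = [e]) ∧
      (∀ ω i e, trees a b T ω i = [e] →
        IsABTree a b e.2 ∧ e.2.leaves = LTree.leavesList (List.ofFn T)) ∧
      ∀ μ : ℕ → ℕ → ℕ, IsInput μ T →
        (∀ ω i e, trees a b T ω i = [e] →
          ∃ σ' t w, Exec ω P Finset.univ (start k μ) σ' t w ∧ IsOutput σ'.mem e.2) ∧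
        (∫⁻ ω, (runTime P k μ ω : ℝ≥0∞) ∂coins ≤ ENNReal.ofReal (C * (lg m + lg k))) ∧
        (∫⁻ ω, (runWork P k μ ω : ℝ≥0∞) ∂coins ≤ ENNReal.ofReal (C * (k * lg (m / k)))) := by
  -- The constant covers 672 for the iterations, 672 rounds of the loop body for time and work, and
  -- 117 plus the fixed cost for everything outside of the main loop.
  refine ⟨joinP a b, 200 + fixedCost + 672 * loopCost a b, fun k T m hk hT hs hm => ?_⟩
  have hl1 : (1 : ℝ) ≤ loopCost a b := by simp [loopCost]
  have hf0 : (0 : ℝ) ≤ fixedCost := Nat.cast_nonneg _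
  have hmL := one_le_lg m
  have hkL := one_le_lg k
  have hyL := one_le_lg (m / k)
  have hk0 : (0 : ℝ) < k := by exact_mod_cast hk
  have hT0 := lintegral_openTime_le ha hab hT hk hm
  refine ⟨?_, ?_, fun ω i e he => ⟨?_, ?_⟩, fun μ hin => ⟨fun ω i e he => ?_, ?_, ?_⟩⟩
  · refine (lintegral_mono fun ω => numIterations_le ω).trans (hT0.trans (ENNReal.ofReal_le_ofReal ?_))
    nlinarith
  · have hms : Measurable fun ω => openTime a b T ω :=
      Measurable.tsum fun i =>
        measurable_trees ha hab hT i fun l => if 2 ≤ l.length then (1 : ℝ≥0∞) else 0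
    -- The number of unfinished iterations has finite expectation, hence is finite almost surely.
    filter_upwards [ae_lt_top hms (hT0.trans_lt ENNReal.ofReal_lt_top).ne] with ω hω
    exact exists_trees_eq_singleton ha hab hT hk hω.ne
  · exact trees_isABTree ha hab hT ω i e (by simp [he])
  · have := trees_values ha hab hT ω i
    rw [he] at this
    simpa [valuesOf] using this
  · obtain ⟨n, hn, he⟩ := exists_least he
    obtain ⟨σ', t, w, hx, ho, -⟩ := exec_joinP (N := ∑ p, ((T p).rank - 1)) ha hab hT hk hs hin (fun p =>
      Finset.single_le_sum (f := fun p => (T p).rank - 1) (fun _ _ => Nat.zero_le _) (Finset.mem_univ p)) hn he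
    exact ⟨σ', t, w, hx, ho⟩
  · refine (lintegral_mono fun ω => runTime_le ha hab hT hk hs hin hm ω).trans
      -- 24 (log m + 1) + 69 is at most 117 times the logarithm, and three barriers cost at most 6
      -- times the logarithm of k.
      (lintegral_const_add_mul_le (x := 117 * lg m + 6 * lg k + fixedCost * lg m) ?_ hT0 (by linarith) ?_)
    · have h1 := clog_le_lg k
      have h2 := Real.natLog_le_logb m 2
      have h3 : Real.logb 2 m ≤ lg m := le_max_right _ _
      push_cast at h2 ⊢
      nlinarith
    · nlinarith
  · refine (lintegral_mono fun ω => runWork_le ha hab hT hk hs hin ω).trans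
      -- Here 117 = 69 + 24 * 2, the 2 being the constant in the bound for the sum of the ranks.
      (lintegral_const_add_mul_le (x := (117 + fixedCost) * (k * lg (m / k))) ?_
        (lintegral_openWork_le ha hab hT hk hm) (by positivity) ?_)
    · have h1 := sum_rank_le ha hT hk hm
      rw [← Finset.mul_sum]
      push_cast at h1 ⊢
      have h2 := mul_le_mul_of_nonneg_left (le_mul_of_one_le_right hk0.le hyL)
        (by linarith : (0 : ℝ) ≤ 69 + fixedCost)
      linarith
    · nlinarith [mul_pos hk0 (zero_lt_one.trans_le hyL)]
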